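/- Let $q\in C^2(0,2\pi)\cap L_2(0,2\pi)$ be real, and denote its $2\pi$-periodic continuation to $\mathbb R$ also by $q$. For $w\in H^2(0,2\pi)$ put $$\Gamma_0w=\begin{pmatrix}w(0+)-w(2\pi-)\\ w'(0+)-w'(2\pi-)\end{pmatrix},\qquad \Gamma_1w=\frac12\begin{pmatrix}w'(0+)+w'(2\pi-)\\ -w(0+)-w(2\pi-)\end{pmatrix}.$$ For $T>0$ and $F=(f_1,f_2)^{\mathsf T}\in C_0^\infty(0,T;\mathbb R^2)$ (extended by $0$ to $\mathbb R$) the problem $$u_{tt}-u_{xx}+qu=0\ \ (0<x<2\pi,\ 0<t<T),\qquad (\Gamma_0u)(t)=\begin{pmatrix}f_1(t)\\ f_2'(t)\end{pmatrix},\qquad u(\cdot,0)=u_t(\cdot,0)=0$$ has exactly one solution $u^F$ that is $C^1$ on $[0,2\pi]\times[0,T)$ and $C^2$ on $(0,2\pi)\times(0,T)$, with $u^F(\cdot,t)\in H^2(0,2\pi)$ for every $t\in(0,T)$. The response operator $(R^TF)(t)=(\Gamma_1u^F)(t)$, $0<t<T$, has the following form. 1) There are kernels $w_i^0$ on $0\le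 x\le t<2\pi$ and $w_i^{2\pi}$ on $0\le 2\pi-x\le t<2\pi$ ($i=1,2$), continuous there, $C^1$ off the characteristics $t=x$, resp. $t=2\pi-x$, and $C^2$ inside, that solve the Goursat problems $$w_{tt}-w_{xx}+qw=0,\qquad \tfrac{d}{dx}w_i^0(x,x)=c_i\,q(x),\qquad \tfrac{d}{dx}w_i^{2\pi}(x,2\pi-x)=-\tfrac14q(x)\quad(0<x<2\pi),$$ $$w_i^0(0,0)=0,\qquad w_i^0(0,s)=w_i^{2\pi}(2\pi,s),\qquad (w_i^0)_x(0,s)=(w_i^{2\pi})_x(2\pi,s)\quad(0<s<2\pi),$$ where $c_1=-\frac14$ and $c_2=\frac14$. For any such kernels put $$R(t)=\begin{pmatrix}(w_1^0)_x(0,t)&(w_2^0)_x(0,t)\\ -w_1^0(0,t)&-w_2^0(0,t)\end{pmatrix}=\begin{pmatrix}(w_1^{2\pi})_x(2\pi,t)&(w_2^{2\pi})_x(2\pi,t)\\ -w_1^{2\pi}(2\pi,t)&-w_2^{2\pi}(2\pi,t)\end{pmatrix},\quad 0<t<2\pi .$$ The entries of $R$ are integrable on $(0,2\pi)$, and for $0<t<\min(T,2\pi)$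 $$(R^TF)(t)=-\frac12\begin{pmatrix}f_1'(t)\\-f_2(t)\end{pmatrix}+\int_0^tR(s)F(t-s)\,ds .$$ 2) Let $n\ge1$. There are kernels $w_1,w_2$, continuous on $|x|\le t<2n\pi$, that solve $w_{tt}-w_{xx}+qw=0$ in $|x|<t<2n\pi$ in the sense of distributions and satisfy $w_i(0,0)=0$, $\frac{d}{dx}w_i(x,x)=c_iq(x)$ for $0<x<2n\pi$ and $\frac{d}{dx}w_i(x,-x)=-\frac14q(x)$ for $-2n\pi<x<0$ (in both cases $x\notin2\pi\mathbb Z$). For any such kernels and every $k\in\mathbb Z$, the derivative $(w_i)_x(2k\pi,t)$ exists for all $t\in(2|k|\pi,2n\pi)$ with $t-2k\pi\notin4\pi\mathbb Z$, the entries of $$\widetilde R(t)=\sum_{|k|<n,\;2|k|\pi<t}\begin{pmatrix}(w_1)_x(2k\pi,t)&(w_2)_x(2k\pi,t)\\-w_1(2k\pi,t)&-w_2(2k\pi,t)\end{pmatrix}$$ are integrable on $(0,2n\pi)$, and for $0<t<\min(T,2n\pi)$ $$R^TF=\left(-\frac12\begin{pmatrix}\delta'(t)&0\\0&-\delta(t)\end{pmatrix}-\sum_{k=1}^{n-1}\begin{pmatrix}\delta'(t-2k\pi)&0\\0&-\delta(t-2k\pi)\end{pmatrix}+\sum_{k=1}^{n-1}\frac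 k2\int_0^{2\pi}q(x)\,dx\begin{pmatrix}\delta(t-2k\pi)&0\\0&0\end{pmatrix}+\widetilde R(t)\right)*\begin{pmatrix}f_1\\f_2\end{pmatrix}.$$ -/

import Mathlib

open Set MeasureTheory
open scoped ContDiff Matrix

noncomputable section

namespace PeriodicWave

/-! Boundary operators and the wave equation on the interval `(0, 2π)`. -/

/-- The first boundary operator, `Γ₀ w = (w(0+) - w(2π-), w'(0+) - w'(2π-))`. -/
def boundary0 (w : ℝ → ℝ) : Fin 2 → ℝ :=
  ![Function.rightLim w 0 - Function.leftLim w (2 * Real.pi),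
    Function.rightLim (deriv w) 0 - Function.leftLim (deriv w) (2 * Real.pi)]

/-- The second boundary operator,
`Γ₁ w = (1/2) (w'(0+) + w'(2π-), -w(0+) - w(2π-))`. -/
def boundary1 (w : ℝ → ℝ) : Fin 2 → ℝ :=
  (1 / 2 : ℝ) •
    ![Function.rightLim (deriv w) 0 + Function.leftLim (deriv w) (2 * Real.pi),
      -Function.rightLim w 0 - Function.leftLim w (2 * Real.pi)]

/-- The differential expression `-w'' + q w`. -/
def schrodinger (q w : ℝ → ℝ) (x : ℝ) : ℝ :=
  -iteratedDeriv 2 w x + q x * w x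

/-- Controls: the space `C₀^∞(0, T; ℝ²)`. -/
structure IsControl (T : ℝ) (F : ℝ → Fin 2 → ℝ) : Prop where
  smooth : ContDiff ℝ ∞ F
  compact : HasCompactSupport F
  support : tsupport F ⊆ Ioo 0 T

/-- `u = u(x, t)` is a classical solution, for `0 < x < 2π` and `0 < t < T`, of
`u_tt - u_xx + q u = 0`, `Γ₀ u(·, t) = (f₁(t), f₂'(t))`, `u(·, 0) = u_t(·, 0) = 0`.
For each `t` the function `u(·, t)` lies in `H²(0, 2π)`. -/
structure IsWaveSolution (q : ℝ → ℝ) (T : ℝ) (F : ℝ → Fin 2 → ℝ) (u : ℝ → ℝ → ℝ) : Prop where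
  smooth_closed : ContDiffOn ℝ 1 (Function.uncurry u) (Icc 0 (2 * Real.pi) ×ˢ Ico 0 T)
  smooth_open : ContDiffOn ℝ 2 (Function.uncurry u) (Ioo 0 (2 * Real.pi) ×ˢ Ioo 0 T)
  sobolev : ∀ t ∈ Ioo 0 T,
    MemLp (iteratedDeriv 2 (fun x => u x t)) 2 (volume.restrict (Ioo 0 (2 * Real.pi)))
  wave : ∀ x ∈ Ioo 0 (2 * Real.pi), ∀ t ∈ Ioo 0 T,
    iteratedDeriv 2 (fun s => u x s) t + schrodinger q (fun y => u y t) x = 0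
  boundary : ∀ t ∈ Ioo 0 T,
    boundary0 (fun x => u x t) = ![F t 0, deriv (fun s => F s 1) t]
  initial : ∀ x ∈ Icc 0 (2 * Real.pi), u x 0 = 0
  initial_deriv : ∀ x ∈ Icc 0 (2 * Real.pi), derivWithin (fun s => u x s) (Ici 0) 0 = 0

open Classical in
/-- The solution `u^F` (identically `0` if there were none). -/
def waveSolution (q : ℝ → ℝ) (T : ℝ) (F : ℝ → Fin 2 → ℝ) : ℝ → ℝ → ℝ :=
  if h : ∃ u, IsWaveSolution q T F u then h.choose else fun _ _ => 0

/-- The response operator `(R^T F)(t) = Γ₁ u^F(·, t)`. -/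
def response (q : ℝ → ℝ) (T : ℝ) (F : ℝ → Fin 2 → ℝ) (t : ℝ) : Fin 2 → ℝ :=
  boundary1 (fun x => waveSolution q T F x t)

/-- Convolution of a matrix kernel with a control, `∫₀ᵗ K(s) F(t - s) ds`. -/
def matConv (K : ℝ → Matrix (Fin 2) (Fin 2) ℝ) (F : ℝ → Fin 2 → ℝ) (t : ℝ) : Fin 2 → ℝ :=
  fun i => ∫ s in (0 : ℝ)..t, (K s *ᵥ F (t - s)) i

/-- Convolution with `δ(t - a)`. -/
def deltaConv (a : ℝ) (f : ℝ → ℝ) (t : ℝ) : ℝ := f (t - a)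

/-- Convolution with `δ'(t - a)`. -/
def deltaDerivConv (a : ℝ) (f : ℝ → ℝ) (t : ℝ) : ℝ := deriv f (t - a)

/-! Goursat kernels on the interval, for times below `2π`. -/

/-- The Goursat problem for a pair `w⁰`, `w^{2π}`. The two kernels live on the triangles
`0 < x < t < 2π` and `0 < 2π - x < t < 2π`, solve the wave equation there, satisfy
`d/dx w⁰(x, x) = c q(x)` and `d/dx w^{2π}(x, 2π - x) = -q(x)/4`, vanish at the corner, and are
matched together with their `x`-derivatives along `x = 0` and `x = 2π`. -/
structure IsGoursatPair (q : ℝ → ℝ) (c : ℝ) (w0 w2pi : ℝ → ℝ → ℝ) : Prop where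
  cont_left : ContinuousOn (Function.uncurry w0)
    {p | 0 ≤ p.1 ∧ p.1 ≤ p.2 ∧ p.2 < 2 * Real.pi}
  cont_right : ContinuousOn (Function.uncurry w2pi)
    {p | 0 ≤ 2 * Real.pi - p.1 ∧ 2 * Real.pi - p.1 ≤ p.2 ∧ p.2 < 2 * Real.pi}
  smooth_left : ContDiffOn ℝ 1 (Function.uncurry w0)
    {p | 0 ≤ p.1 ∧ p.1 < p.2 ∧ p.2 < 2 * Real.pi}
  smooth_right : ContDiffOn ℝ 1 (Function.uncurry w2pi)
    {p | 0 ≤ 2 * Real.pi - p.1 ∧ 2 * Real.pi - p.1 < p.2 ∧ p.2 < 2 * Real.pi}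
  smooth_left_open : ContDiffOn ℝ 2 (Function.uncurry w0)
    {p | 0 < p.1 ∧ p.1 < p.2 ∧ p.2 < 2 * Real.pi}
  smooth_right_open : ContDiffOn ℝ 2 (Function.uncurry w2pi)
    {p | 0 < 2 * Real.pi - p.1 ∧ 2 * Real.pi - p.1 < p.2 ∧ p.2 < 2 * Real.pi}
  wave_left : ∀ x t : ℝ, 0 < x → x < t → t < 2 * Real.pi →
    iteratedDeriv 2 (fun s => w0 x s) t - iteratedDeriv 2 (fun y => w0 y t) x
      + q x * w0 x t = 0
  wave_right : ∀ x t : ℝ, 0 < 2 * Real.pi - x → 2 * Real.pi - x < t → t < 2 * Real.pi →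
    iteratedDeriv 2 (fun s => w2pi x s) t - iteratedDeriv 2 (fun y => w2pi y t) x
      + q x * w2pi x t = 0
  char_left : ∀ x ∈ Ioo 0 (2 * Real.pi), HasDerivAt (fun y => w0 y y) (c * q x) x
  char_right : ∀ x ∈ Ioo 0 (2 * Real.pi),
    HasDerivAt (fun y => w2pi y (2 * Real.pi - y)) (-(1 / 4) * q x) x
  corner : w0 0 0 = 0
  compat : ∀ s ∈ Ioo 0 (2 * Real.pi), w0 0 s = w2pi (2 * Real.pi) s
  compat_deriv : ∀ s ∈ Ioo 0 (2 * Real.pi),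
    derivWithin (fun x => w0 x s) (Ici 0) 0
      = derivWithin (fun x => w2pi x s) (Iic (2 * Real.pi)) (2 * Real.pi)

/-- The response matrix, from the kernels `w₁⁰`, `w₂⁰` at the end point `x = 0`. -/
def responseMatrixLeft (w1 w2 : ℝ → ℝ → ℝ) (t : ℝ) : Matrix (Fin 2) (Fin 2) ℝ :=
  !![derivWithin (fun x => w1 x t) (Ici 0) 0, derivWithin (fun x => w2 x t) (Ici 0) 0;
     -w1 0 t, -w2 0 t]

/-- The response matrix, from the kernels `w₁^{2π}`, `w₂^{2π}` at the end point `x = 2π`. -/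
def responseMatrixRight (w1 w2 : ℝ → ℝ → ℝ) (t : ℝ) : Matrix (Fin 2) (Fin 2) ℝ :=
  !![derivWithin (fun x => w1 x t) (Iic (2 * Real.pi)) (2 * Real.pi),
     derivWithin (fun x => w2 x t) (Iic (2 * Real.pi)) (2 * Real.pi);
     -w1 (2 * Real.pi) t, -w2 (2 * Real.pi) t]

/-! Goursat kernels on the whole line, for the periodically continued potential. -/

/-- The `2π`-periodic continuation of the restriction of `q` to the period interval. -/
def periodize (q : ℝ → ℝ) (x : ℝ) : ℝ := q (toIcoMod Real.two_pi_pos 0 x)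

/-- The Goursat problem on `|x| < t < L` for the periodically continued potential: `w` is
continuous up to the characteristics, solves `w_tt - w_xx + q w = 0` in the sense of
distributions, and satisfies `d/dx w(x, x) = c q(x)` for `x > 0`,
`d/dx w(x, -x) = -q(x)/4` for `x < 0` (where the periodic continuation has no break), with
`w(0, 0) = 0`. The continuation of `q` and the data on the characteristics may be nonsmooth at
multiples of `2π`, so that in general no classical solution exists beyond `t = 2π`. -/
structure IsLineGoursatKernel (q : ℝ → ℝ) (L c : ℝ) (w : ℝ → ℝ → ℝ) : Prop where
  cont : ContinuousOn (Function.uncurry w) {p | |p.1| ≤ p.2 ∧ p.2 < L}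
  wave : ∀ φ : ℝ → ℝ → ℝ, ContDiff ℝ ∞ (Function.uncurry φ) →
    HasCompactSupport (Function.uncurry φ) →
    tsupport (Function.uncurry φ) ⊆ {p | |p.1| < p.2 ∧ p.2 < L} →
    ∫ p : ℝ × ℝ, w p.1 p.2 *
      (iteratedDeriv 2 (fun s => φ p.1 s) p.2 - iteratedDeriv 2 (fun y => φ y p.2) p.1
        + periodize q p.1 * φ p.1 p.2) = 0
  char_right : ∀ x ∈ Ioo 0 L, (∀ m : ℤ, x ≠ 2 * m * Real.pi) →
    HasDerivAt (fun y => w y y) (c * periodize q x) x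
  char_left : ∀ x ∈ Ioo (-L) 0, (∀ m : ℤ, x ≠ 2 * m * Real.pi) →
    HasDerivAt (fun y => w y (-y)) (-(1 / 4) * periodize q x) x
  corner : w 0 0 = 0

/-- The values `w(2kπ, t)`, `|k| < n`, summed over those `k` for which `(2kπ, t)` lies inside the
light cone. -/
def latticeSum (n : ℕ) (w : ℝ → ℝ → ℝ) (t : ℝ) : ℝ :=
  ∑ k ∈ Finset.Ioo (-(n : ℤ)) n,
    if |2 * (k : ℝ) * Real.pi| < t then w (2 * k * Real.pi) t else 0

/-- The regular part of the response kernel on `(0, 2nπ)`. -/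
def lineResponseMatrix (n : ℕ) (w1 w2 : ℝ → ℝ → ℝ) (t : ℝ) : Matrix (Fin 2) (Fin 2) ℝ :=
  !![latticeSum n (fun x s => deriv (fun y => w1 y s) x) t,
     latticeSum n (fun x s => deriv (fun y => w2 y s) x) t;
     -latticeSum n w1 t, -latticeSum n w2 t]

/-- The convolution of the singular part of the response kernel on `(0, 2nπ)` with `F`. -/
def singularPart (q : ℝ → ℝ) (n : ℕ) (F : ℝ → Fin 2 → ℝ) (t : ℝ) : Fin 2 → ℝ :=
  -(1 / 2 : ℝ) • ![deltaDerivConv 0 (fun s => F s 0) t, -deltaConv 0 (fun s => F s 1) t]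
    - ∑ k ∈ Finset.Ioo 0 n,
        ![deltaDerivConv (2 * k * Real.pi) (fun s => F s 0) t,
          -deltaConv (2 * k * Real.pi) (fun s => F s 1) t]
    + ∑ k ∈ Finset.Ioo 0 n,
        ![((k : ℝ) / 2 * ∫ x in (0 : ℝ)..(2 * Real.pi), q x)
            * deltaConv (2 * k * Real.pi) (fun s => F s 0) t,
          0]

end PeriodicWave

end

/-!
The problem on `(0, 2π)` is unfolded to the line. A signal `f` entering at `x = 0` generates on the
line, for the periodically continued potential `p`, the wave
`step a b x * f (t - |x|) + ∫ s in |x|..t, w x s * f (t - s)` (`causalWave`): a front of amplitude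
`a` to the right and `b` to the left, and a tail given by a Goursat kernel `w`. Summing the
translates of this wave by multiples of `2π` yields the solution on `(0, 2π)` (`foldedWave`). The
sums telescope in the boundary operator `Γ₀`, so that `a - b = 1`, `a + b = 0` produces the jump
`f` of the value, and `a = b = -1/2` the jump `f'` of the derivative. In `Γ₁` they add up instead:
the fronts that have come around `k` times produce the terms with `δ'(t - 2kπ)` and `δ(t - 2kπ)`,
and the tails produce the values and the `x`-derivatives of the kernels on the lines `x = 2kπ`.

The kernels are continuous solutions of an integral equation (`IsKernel`), which is Duhamel's
formula for the wave equation with source `-p w`: `w` is `-1/2` times the integral of `p`, against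
the front and `w` itself, over the backward light cone. It needs `p` only to be integrable, and is
solved by contraction in a weighted norm (`exists_isKernel`). From it follow
* the distributional equation, because the integral of `φ_tt - φ_xx` over the boundary of a light
  cone is `-2 φ_t` at its vertex (`integral_waveOp_cone`, `IsKernel.isLineGoursatKernel`);
* differentiability of `w` in the directions `x + t` and `x - t` where `p` is continuous at the
  respective feet of the characteristics, and classical smoothness for times below `2π`
  (`IsKernel.hasFDerivAt`, `IsKernel.classical`, `IsKernel.isGoursatPair`);
* the same integral equation, with `f` in place of the delta function, for the causal wave
  (`IsKernel.retConv_deriv`), hence its smoothness and the wave equation. The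
  singularities of `w` are smoothed by the convolution; those of `p` sit at the multiples of `2π`,
  that is, at the end points of the interval.

In the `x`-derivative of the causal wave at `x = 2kπ`, besides the convolution with `w_x`, the front
leaves a copy of `f (t - |x|)`, multiplied by the integral of `p` between source and observer
(`IsKernel.potIntSign_causalWave`). The integrals over `k` periods add up to the coefficients
`(k/2) ∫ q` of `δ(t - 2kπ)`.

Uniqueness rests throughout on characteristic parallelograms. For distributional solutions on the
line, testing with `α(x + t) β(t - x)`, where `α'` and `β'` are differences of bump functions, gives
the parallelogram identity and hence uniqueness for the free equation; subtracting the Duhamel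
integral reduces the general case to the homogeneous integral equation
(`IsLineGoursatKernel.unique`). For the classical problems the two kernels on the interval are glued,
or the solution is continued periodically, and the function `u_t - u_x` is integrated along
characteristics (`IsGoursatPair.unique`, `IsWaveSolution.unique`). Uniqueness carries the formulas
over from the kernels constructed here to arbitrary ones.
-/

noncomputable section

namespace PeriodicWave

open Filter Topology

/-! ### Retarded integrals -/

/-- Functions `G(y, τ)` that are measurable and bounded on each half space `τ ≤ R`. -/
structure LocBdd (G : ℝ → ℝ → ℝ) : Prop where
  meas : Measurable (Function.uncurry G)
  bdd : ∀ R, ∃ C, ∀ y τ, τ ≤ R → |G y τ| ≤ C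

/-- The sign of `x - y`, with the value `-1` at `x = y`. -/
def side (x y : ℝ) : ℝ := if y < x then 1 else -1

/-- The retarded integral `∫ p(y) G(y, t - |x - y|) dy`. -/
def potInt (p : ℝ → ℝ) (G : ℝ → ℝ → ℝ) (x t : ℝ) : ℝ := ∫ y, p y * G y (t - |x - y|)

/-- The signed retarded integral `∫ p(y) sgn(x - y) G(y, t - |x - y|) dy`. -/
def potIntSign (p : ℝ → ℝ) (G : ℝ → ℝ → ℝ) (x t : ℝ) : ℝ :=
  ∫ y, p y * (side x y * G y (t - |x - y|))

lemma abs_side (x y : ℝ) : |side x y| = 1 := by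
  unfold side; split_ifs <;> simp

lemma measurable_side (x : ℝ) : Measurable (side x) :=
  Measurable.ite measurableSet_Iio measurable_const measurable_const

lemma LocBdd.meas_ret {G : ℝ → ℝ → ℝ} (hG : LocBdd G) (x t : ℝ) :
    Measurable fun y => G y (t - |x - y|) :=
  hG.meas.comp (measurable_id.prodMk (by fun_prop))

lemma LocBdd.integrable_mul {G : ℝ → ℝ → ℝ} (hG : LocBdd G) {p : ℝ → ℝ} (hp : Integrable p)
    (x t : ℝ) : Integrable fun y => p y * G y (t - |x - y|) := by
  obtain ⟨C, hC⟩ := hG.bdd t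
  exact hp.mul_bdd (c := C) (hG.meas_ret x t).aestronglyMeasurable
    (ae_of_all _ fun y => by
      rw [Real.norm_eq_abs]; exact hC y _ (by linarith [abs_nonneg (x - y)]))

lemma LocBdd.integrable_sign_mul {G : ℝ → ℝ → ℝ} (hG : LocBdd G) {p : ℝ → ℝ} (hp : Integrable p)
    (x t : ℝ) : Integrable fun y => p y * (side x y * G y (t - |x - y|)) := by
  obtain ⟨C, hC⟩ := hG.bdd t
  refine hp.mul_bdd (c := C) ((measurable_side x).mul (hG.meas_ret x t)).aestronglyMeasurable
    (ae_of_all _ fun y => ?_)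
  rw [Real.norm_eq_abs, abs_mul, abs_side, one_mul]
  exact hC y _ (by linarith [abs_nonneg (x - y)])

lemma LocBdd.continuousAt_potInt {G : ℝ → ℝ → ℝ} (hG : LocBdd G) {p : ℝ → ℝ} (hp : Integrable p)
    {x₀ t₀ : ℝ} (h : ∀ᵐ y, ContinuousAt (G y) (t₀ - |x₀ - y|)) :
    ContinuousAt (Function.uncurry (potInt p G)) (x₀, t₀) := by
  obtain ⟨C, hC⟩ := hG.bdd (t₀ + 1)
  have hev : ∀ᶠ z : ℝ × ℝ in 𝓝 (x₀, t₀), z.2 < t₀ + 1 :=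
    (continuous_snd.tendsto (x₀, t₀)).eventually (gt_mem_nhds (by simp))
  refine continuousAt_of_dominated (bound := fun y => ‖p y‖ * C)
    (Eventually.of_forall fun z => (hG.integrable_mul hp z.1 z.2).aestronglyMeasurable) ?_
    (hp.norm.mul_const _) ?_
  · filter_upwards [hev] with z hz
    refine ae_of_all _ fun y => ?_
    rw [norm_mul]
    exact mul_le_mul_of_nonneg_left (hC _ _ (by linarith [abs_nonneg (z.1 - y)])) (norm_nonneg _)
  · filter_upwards [h] with y hy
    have h2 : ContinuousAt (fun z : ℝ × ℝ => z.2 - |z.1 - y|) (x₀, t₀) := by fun_prop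
    exact continuousAt_const.mul (ContinuousAt.comp (g := G y) hy h2)

lemma continuousAt_side {x₀ y : ℝ} (h : y ≠ x₀) : ContinuousAt (fun x => side x y) x₀ := by
  rcases lt_or_gt_of_ne h with h | h
  · refine (continuousAt_const (y := (1 : ℝ))).congr ?_
    filter_upwards [lt_mem_nhds h] with x hx
    simp [side, hx]
  · refine (continuousAt_const (y := (-1 : ℝ))).congr ?_
    filter_upwards [gt_mem_nhds h] with x hx
    simp [side, hx.le]

lemma LocBdd.continuousAt_potIntSign {G : ℝ → ℝ → ℝ} (hG : LocBdd G) {p : ℝ → ℝ}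
    (hp : Integrable p) {x₀ t₀ : ℝ} (h : ∀ᵐ y, ContinuousAt (G y) (t₀ - |x₀ - y|)) :
    ContinuousAt (Function.uncurry (potIntSign p G)) (x₀, t₀) := by
  obtain ⟨C, hC⟩ := hG.bdd (t₀ + 1)
  have hev : ∀ᶠ z : ℝ × ℝ in 𝓝 (x₀, t₀), z.2 < t₀ + 1 :=
    (continuous_snd.tendsto (x₀, t₀)).eventually (gt_mem_nhds (by simp))
  refine continuousAt_of_dominated (bound := fun y => ‖p y‖ * C)
    (Eventually.of_forall fun z => (hG.integrable_sign_mul hp z.1 z.2).aestronglyMeasurable) ?_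
    (hp.norm.mul_const _) ?_
  · filter_upwards [hev] with z hz
    refine ae_of_all _ fun y => ?_
    rw [norm_mul, norm_mul, Real.norm_eq_abs (side _ _), abs_side, one_mul]
    exact mul_le_mul_of_nonneg_left (hC _ _ (by linarith [abs_nonneg (z.1 - y)])) (norm_nonneg _)
  · filter_upwards [h, compl_mem_ae_iff.2 (measure_singleton x₀ : volume {x₀} = 0)] with y hy hne
    have h2 : ContinuousAt (fun z : ℝ × ℝ => z.2 - |z.1 - y|) (x₀, t₀) := by fun_prop
    have h3 : ContinuousAt (fun z : ℝ × ℝ => side z.1 y) (x₀, t₀) :=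
      ContinuousAt.comp (g := fun x => side x y) (continuousAt_side hne) continuousAt_fst
    exact continuousAt_const.mul (h3.mul (ContinuousAt.comp (g := G y) hy h2))

lemma hasDerivAt_abs_sub {x₀ y : ℝ} (h : y ≠ x₀) :
    HasDerivAt (fun x => |x - y|) (side x₀ y) x₀ := by
  have hx : x₀ - y ≠ 0 := sub_ne_zero.2 h.symm
  have h1 := HasDerivAt.comp (h₂ := fun u : ℝ => |u|) (h := fun x => x - y) x₀
    (hasDerivAt_abs hx) ((hasDerivAt_id' x₀).sub_const y)
  refine HasDerivAt.congr_deriv (f := fun x => |x - y|) h1 ?_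
  rcases lt_or_gt_of_ne h with h | h
  · simp [side, h, sign_pos (sub_pos.2 h)]
  · simp [side, h.le, sign_neg (sub_neg.2 h)]

/-- A retarded integral of a function that is Lipschitz in time is differentiable. -/
lemma LocBdd.hasFDerivAt_potInt {G g : ℝ → ℝ → ℝ} (hG : LocBdd G) (hg : LocBdd g) {p : ℝ → ℝ}
    (hp : Integrable p)
    (hL : ∀ R, ∃ C, ∀ y τ τ', τ ≤ R → τ' ≤ R → |G y τ - G y τ'| ≤ C * |τ - τ'|) {x₀ t₀ : ℝ}
    (h : ∀ᵐ y, HasDerivAt (G y) (g y (t₀ - |x₀ - y|)) (t₀ - |x₀ - y|)) :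
    HasFDerivAt (Function.uncurry (potInt p G))
      (potInt p g x₀ t₀ • ContinuousLinearMap.snd ℝ ℝ ℝ
        - potIntSign p g x₀ t₀ • ContinuousLinearMap.fst ℝ ℝ ℝ) (x₀, t₀) := by
  obtain ⟨C, hC⟩ := hL (t₀ + 1)
  have hev : {z : ℝ × ℝ | z.2 < t₀ + 1} ∈ 𝓝 (x₀, t₀) :=
    (continuous_snd.tendsto (x₀, t₀)).eventually (gt_mem_nhds (by simp))
  have hi1 := (hg.integrable_mul hp x₀ t₀).smul_const (ContinuousLinearMap.snd ℝ ℝ ℝ)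
  have hi2 := (hg.integrable_sign_mul hp x₀ t₀).smul_const (ContinuousLinearMap.fst ℝ ℝ ℝ)
  have key := hasFDerivAt_integral_of_dominated_loc_of_lip (𝕜 := ℝ) (μ := volume)
    (F := fun (z : ℝ × ℝ) y => p y * G y (z.2 - |z.1 - y|)) (x₀ := (x₀, t₀))
    (F' := fun y => (p y * g y (t₀ - |x₀ - y|)) • ContinuousLinearMap.snd ℝ ℝ ℝ
      - (p y * (side x₀ y * g y (t₀ - |x₀ - y|))) • ContinuousLinearMap.fst ℝ ℝ ℝ)
    (bound := fun y => ‖p y‖ * (|C| * 2)) hev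
    (Eventually.of_forall fun z => (hG.integrable_mul hp z.1 z.2).aestronglyMeasurable)
    (hG.integrable_mul hp x₀ t₀) (hi1.sub hi2).aestronglyMeasurable ?_ (hp.norm.mul_const _) ?_
  · have := key.2
    rw [integral_sub hi1 hi2, integral_smul_const, integral_smul_const] at this
    exact this
  · refine ae_of_all _ fun y => LipschitzOnWith.of_dist_le_mul fun z hz z' hz' => ?_
    simp only [Real.coe_nnabs, Real.dist_eq, mem_ofPred_eq] at *
    rw [← mul_sub, abs_mul, abs_mul, abs_norm, Real.norm_eq_abs, mul_assoc]
    refine mul_le_mul_of_nonneg_left ?_ (abs_nonneg _)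
    refine (hC y _ _ (by linarith [abs_nonneg (z.1 - y)])
      (by linarith [abs_nonneg (z'.1 - y)])).trans ?_
    rw [abs_of_nonneg (by positivity : (0 : ℝ) ≤ |C| * 2), mul_assoc]
    refine mul_le_mul (le_abs_self _) ?_ (abs_nonneg _) (abs_nonneg _)
    have h1 : |z.2 - z'.2| ≤ dist z z' := le_max_right _ _
    have h2 : |z.1 - z'.1| ≤ dist z z' := le_max_left _ _
    have h3 := abs_abs_sub_abs_le_abs_sub (z.1 - y) (z'.1 - y)
    have e : z.1 - y - (z'.1 - y) = z.1 - z'.1 := by ring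
    rw [e] at h3
    calc |z.2 - |z.1 - y| - (z'.2 - |z'.1 - y|)|
        = |(z.2 - z'.2) - (|z.1 - y| - |z'.1 - y|)| := by ring_nf
      _ ≤ |z.2 - z'.2| + |(|z.1 - y| - |z'.1 - y|)| := abs_sub _ _
      _ ≤ 2 * dist z z' := by linarith
  · filter_upwards [h, compl_mem_ae_iff.2 (measure_singleton x₀ : volume {x₀} = 0)] with y hy hne
    have hd := (hasDerivAt_abs_sub hne).comp_hasFDerivAt (f := fun z : ℝ × ℝ => z.1) (x₀, t₀)
      (hasFDerivAt_fst : HasFDerivAt _ (ContinuousLinearMap.fst ℝ ℝ ℝ) (x₀, t₀))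
    have h2 : HasFDerivAt (fun z : ℝ × ℝ => z.2 - |z.1 - y|) _ (x₀, t₀) :=
      hasFDerivAt_snd.sub hd
    have h3 := (HasDerivAt.comp_hasFDerivAt (h₂ := G y) (x₀, t₀) hy h2).const_mul (p y)
    refine HasFDerivAt.congr_fderiv (f := fun z : ℝ × ℝ => p y * G y (z.2 - |z.1 - y|)) h3 ?_
    ext
    · simp [mul_comm]
    · simp

lemma side_mul_self (x y : ℝ) : side x y * side x y = 1 := by
  unfold side; split_ifs <;> norm_num

lemma integral_mul_side {h : ℝ → ℝ} (hh : Integrable h) (x : ℝ) :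
    ∫ y, h y * side x y = 2 * (∫ y in Iic x, h y) - ∫ y, h y := by
  have e : ∀ y, h y * side x y = 2 * (Iio x).indicator h y - h y := by
    intro y
    by_cases hy : y < x
    · simp [side, hy]; ring
    · simp [side, hy]
  simp_rw [e]
  rw [integral_sub ((hh.indicator measurableSet_Iio).const_mul 2) hh, integral_const_mul,
    integral_indicator measurableSet_Iio, integral_Iic_eq_integral_Iio]

lemma integrable_mul_side {p : ℝ → ℝ} (hp : Integrable p) (x : ℝ) :
    Integrable fun y => p y * side x y :=
  hp.mul_bdd (c := 1) (measurable_side x).aestronglyMeasurable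
    (ae_of_all _ fun y => by rw [Real.norm_eq_abs, abs_side])

lemma hasFDerivAt_moving_integral {h : ℝ → ℝ → ℝ} {x₀ t₀ : ℝ}
    (hc : ContinuousAt (Function.uncurry h) (x₀, t₀))
    (hi : ∀ x t, IntervalIntegrable (fun y => h y (t - |x - y|)) volume x₀ x) :
    HasFDerivAt (fun z : ℝ × ℝ => ∫ y in x₀..z.1, h y (z.2 - |z.1 - y|))
      (h x₀ t₀ • ContinuousLinearMap.fst ℝ ℝ ℝ) (x₀, t₀) := by
  rw [hasFDerivAt_iff_isLittleO, Asymptotics.isLittleO_iff]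
  intro c hc0
  obtain ⟨δ, hδ, hδ'⟩ := Metric.continuousAt_iff.1 hc c hc0
  filter_upwards [Metric.ball_mem_nhds (x₀, t₀) (half_pos hδ)] with z hz
  have h1 : |z.1 - x₀| < δ / 2 := lt_of_le_of_lt (le_max_left _ _) hz
  have h2 : |z.2 - t₀| < δ / 2 := lt_of_le_of_lt (le_max_right _ _) hz
  have h3 : |z.1 - x₀| ≤ ‖z - (x₀, t₀)‖ := le_max_left _ _
  have e : (∫ y in x₀..z.1, h y (z.2 - |z.1 - y|)) - h x₀ t₀ * (z.1 - x₀)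
      = ∫ y in x₀..z.1, (h y (z.2 - |z.1 - y|) - h x₀ t₀) := by
    rw [intervalIntegral.integral_sub (hi _ _) intervalIntegrable_const]
    simp [mul_comm]
  simp only [intervalIntegral.integral_same, sub_zero, smul_apply,
    ContinuousLinearMap.coe_fst', Prod.fst_sub, smul_eq_mul]
  rw [e]
  refine (intervalIntegral.norm_integral_le_of_norm_le_const (C := c) fun y hy => ?_).trans
    (mul_le_mul_of_nonneg_left h3 hc0.le)
  have hy1 : |z.1 - y| ≤ |z.1 - x₀| := abs_sub_right_of_mem_uIcc (uIoc_subset_uIcc hy)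
  have hy2 : |y - x₀| ≤ |z.1 - x₀| := abs_sub_left_of_mem_uIcc (uIoc_subset_uIcc hy)
  have := hδ' (x := (y, z.2 - |z.1 - y|)) (by
    refine max_lt (by simpa [Real.dist_eq] using by linarith) ?_
    simp only [Real.dist_eq]
    have := abs_nonneg (z.1 - y)
    have h4 := hy1.trans_lt h1
    rw [abs_lt] at h2 ⊢
    constructor <;> linarith)
  exact this.le

/-- A signed retarded integral is differentiable where the potential and the integrand are
continuous: the jump of the sign at `y = x` contributes `2 p(x) G(x, t)` to the `x`-derivative. -/
lemma LocBdd.hasFDerivAt_potIntSign {G g : ℝ → ℝ → ℝ} (hG : LocBdd G) (hg : LocBdd g)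
    {p : ℝ → ℝ} (hp : Integrable p)
    (hL : ∀ R, ∃ C, ∀ y τ τ', τ ≤ R → τ' ≤ R → |G y τ - G y τ'| ≤ C * |τ - τ'|) {x₀ t₀ : ℝ}
    (h : ∀ᵐ y, HasDerivAt (G y) (g y (t₀ - |x₀ - y|)) (t₀ - |x₀ - y|))
    (hpc : ContinuousAt p x₀) (hGc : ContinuousAt (Function.uncurry G) (x₀, t₀)) :
    HasFDerivAt (Function.uncurry (potIntSign p G))
      (potIntSign p g x₀ t₀ • ContinuousLinearMap.snd ℝ ℝ ℝ
        + (2 * (p x₀ * G x₀ t₀) - potInt p g x₀ t₀) • ContinuousLinearMap.fst ℝ ℝ ℝ)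
      (x₀, t₀) := by
  have h1 := hG.hasFDerivAt_potInt hg (integrable_mul_side hp x₀) hL h
  have h2 := (hasFDerivAt_moving_integral (h := fun y τ => p y * G y τ) (x₀ := x₀) (t₀ := t₀)
    ((ContinuousAt.comp (f := fun z : ℝ × ℝ => z.1) (x := (x₀, t₀)) hpc continuousAt_fst).mul hGc)
    (fun x t => (hG.integrable_mul hp x t).intervalIntegrable)).const_mul 2
  have e1 : potInt (fun y => p y * side x₀ y) g x₀ t₀ = potIntSign p g x₀ t₀ := by
    simp only [potInt, potIntSign, mul_assoc]
  have e2 : potIntSign (fun y => p y * side x₀ y) g x₀ t₀ = potInt p g x₀ t₀ := by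
    simp only [potInt, potIntSign]
    congr 1; ext y
    linear_combination (p y * g y (t₀ - |x₀ - y|)) * side_mul_self x₀ y
  rw [e1, e2] at h1
  have e3 : Function.uncurry (potIntSign p G) = fun z : ℝ × ℝ =>
      Function.uncurry (potInt (fun y => p y * side x₀ y) G) z
        + 2 * ∫ y in x₀..z.1, p y * G y (z.2 - |z.1 - y|) := by
    ext z
    have hi := hG.integrable_mul hp z.1 z.2
    have a1 := integral_mul_side hi z.1
    have a2 := integral_mul_side hi x₀
    have a3 := intervalIntegral.integral_Iic_sub_Iic (hi.integrableOn (s := Iic x₀))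
      (hi.integrableOn (s := Iic z.1))
    have b1 : Function.uncurry (potIntSign p G) z
        = ∫ y, p y * G y (z.2 - |z.1 - y|) * side z.1 y := by
      simp only [Function.uncurry, potIntSign]
      congr 1; ext y; ring
    have b2 : Function.uncurry (potInt (fun y => p y * side x₀ y) G) z
        = ∫ y, p y * G y (z.2 - |z.1 - y|) * side x₀ y := by
      simp only [Function.uncurry, potInt]
      congr 1; ext y; ring
    rw [b1, b2, a1, a2, ← a3]; ring
  rw [e3]
  refine (h1.add h2).congr_fderiv ?_
  ext
  · simp; ring
  · simp

/-! ### Cone integrals of continuous functions -/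

/-- The integral `∫ w(y, s) ds` over `|y| ≤ s ≤ τ` (zero if `τ < |y|`). -/
def coneInt (w : ℝ → ℝ → ℝ) (y τ : ℝ) : ℝ := ∫ s in |y|..max |y| τ, w y s

/-- The restriction of `w` to the light cone `|y| ≤ τ`, continued by zero. -/
def coneRestr (w : ℝ → ℝ → ℝ) (y τ : ℝ) : ℝ := if |y| ≤ τ then w y τ else 0

lemma continuous_integral_param {X : Type*} [TopologicalSpace X] {F : X → ℝ → ℝ} {a b : X → ℝ}
    (hF : Continuous (Function.uncurry F)) (ha : Continuous a) (hb : Continuous b) :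
    Continuous fun x => ∫ s in a x..b x, F x s := by
  have h1 := intervalIntegral.continuous_parametric_intervalIntegral_of_continuous
    (μ := volume) (a₀ := 0) hF hb
  have h2 := intervalIntegral.continuous_parametric_intervalIntegral_of_continuous
    (μ := volume) (a₀ := 0) hF ha
  refine (h1.sub h2).congr fun x => ?_
  have hc : Continuous (F x) := hF.comp (Continuous.prodMk_right x)
  exact intervalIntegral.integral_interval_sub_left (hc.intervalIntegrable _ _)
    (hc.intervalIntegrable _ _)

lemma exists_bound_cone {w : ℝ → ℝ → ℝ} (hw : Continuous (Function.uncurry w)) (R : ℝ) :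
    ∃ C, 0 ≤ C ∧ ∀ y s, |y| ≤ s → s ≤ R → |w y s| ≤ C := by
  obtain ⟨C, hC⟩ := ((isCompact_Icc (a := -R) (b := R)).prod
    (isCompact_Icc (a := 0) (b := R))).exists_bound_of_continuousOn hw.continuousOn
  refine ⟨max C 0, le_max_right _ _, fun y s h1 h2 => le_max_of_le_left (hC (y, s) ?_)⟩
  have := abs_le.1 (h1.trans h2)
  exact ⟨⟨this.1, this.2⟩, (abs_nonneg y).trans h1, h2⟩

lemma coneInt_of_le {w : ℝ → ℝ → ℝ} {y τ : ℝ} (h : τ ≤ |y|) : coneInt w y τ = 0 := by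
  simp [coneInt, max_eq_left h]

lemma coneInt_of_ge {w : ℝ → ℝ → ℝ} {y τ : ℝ} (h : |y| ≤ τ) :
    coneInt w y τ = ∫ s in |y|..τ, w y s := by
  simp [coneInt, max_eq_right h]

lemma continuous_coneInt {w : ℝ → ℝ → ℝ} (hw : Continuous (Function.uncurry w)) :
    Continuous (Function.uncurry (coneInt w)) := by
  refine continuous_integral_param (F := fun z : ℝ × ℝ => w z.1) ?_ (by fun_prop) (by fun_prop)
  exact hw.comp (by fun_prop : Continuous fun z : (ℝ × ℝ) × ℝ => (z.1.1, z.2))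

lemma coneInt_lipschitz {w : ℝ → ℝ → ℝ} (hw : Continuous (Function.uncurry w)) (R : ℝ) :
    ∃ C, ∀ y τ τ', τ ≤ R → τ' ≤ R → |coneInt w y τ - coneInt w y τ'| ≤ C * |τ - τ'| := by
  obtain ⟨C, hC0, hC⟩ := exists_bound_cone hw R
  refine ⟨C, fun y τ τ' h1 h2 => ?_⟩
  have hc : Continuous (w y) := hw.comp (Continuous.prodMk_right y)
  rw [coneInt, coneInt, intervalIntegral.integral_interval_sub_left (hc.intervalIntegrable _ _)
    (hc.intervalIntegrable _ _)]
  refine (intervalIntegral.norm_integral_le_of_norm_le_const (f := w y) (C := C)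
    fun s hs => ?_).trans (mul_le_mul_of_nonneg_left ?_ hC0)
  · have h3 : |y| < s := lt_of_le_of_lt (le_min (le_max_left _ _) (le_max_left _ _)) hs.1
    refine hC y s h3.le ?_
    rcases le_max_iff.1 hs.2 with h | h <;> rcases le_max_iff.1 h with h | h <;> linarith
  · rw [max_comm |y| τ, max_comm |y| τ']; exact abs_max_sub_max_le_abs _ _ _

lemma coneRestr_bound {w : ℝ → ℝ → ℝ} (hw : Continuous (Function.uncurry w)) (R : ℝ) :
    ∃ C, ∀ y τ, τ ≤ R → |coneRestr w y τ| ≤ C := by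
  obtain ⟨C, hC0, hC⟩ := exists_bound_cone hw R
  refine ⟨C, fun y τ h => ?_⟩
  unfold coneRestr
  split_ifs with h1
  · exact hC _ _ h1 h
  · simpa

lemma locBdd_coneRestr {w : ℝ → ℝ → ℝ} (hw : Continuous (Function.uncurry w)) :
    LocBdd (coneRestr w) :=
  ⟨Measurable.ite (measurableSet_le (by fun_prop) (by fun_prop)) hw.measurable measurable_const,
    coneRestr_bound hw⟩

lemma locBdd_coneInt {w : ℝ → ℝ → ℝ} (hw : Continuous (Function.uncurry w)) :
    LocBdd (coneInt w) := by
  refine ⟨(continuous_coneInt hw).measurable, fun R => ?_⟩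
  obtain ⟨C, hC0, hC⟩ := exists_bound_cone (continuous_coneInt hw) R
  refine ⟨C, fun y τ h => ?_⟩
  rcases le_total τ |y| with h1 | h1
  · simpa [coneInt_of_le h1]
  · exact hC _ _ h1 h

lemma hasDerivAt_coneInt {w : ℝ → ℝ → ℝ} (hw : Continuous (Function.uncurry w)) {y τ : ℝ}
    (h : τ ≠ |y|) : HasDerivAt (coneInt w y) (coneRestr w y τ) τ := by
  have hc : Continuous (w y) := hw.comp (Continuous.prodMk_right y)
  rcases lt_or_gt_of_ne h with h | h
  · rw [coneRestr, if_neg (not_le.2 h)]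
    refine (hasDerivAt_const τ (0 : ℝ)).congr_of_eventuallyEq ?_
    filter_upwards [gt_mem_nhds h] with s hs using coneInt_of_le hs.le
  · rw [coneRestr, if_pos h.le]
    refine (intervalIntegral.integral_hasDerivAt_right (hc.intervalIntegrable |y| τ)
      (hc.stronglyMeasurableAtFilter _ _) hc.continuousAt).congr_of_eventuallyEq ?_
    filter_upwards [lt_mem_nhds h] with s hs using coneInt_of_ge hs.le

/-- The backward cone of `(x, t)` meets the forward cone of the origin over the interval between
the feet of the two characteristics. -/
lemma abs_le_sub_abs_iff {x t y : ℝ} :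
    |y| ≤ t - |x - y| ↔ |x| ≤ t ∧ (x - t) / 2 ≤ y ∧ y ≤ (x + t) / 2 := by
  constructor
  · intro h
    have h1 := neg_abs_le y
    have h2 := le_abs_self y
    have h3 := neg_abs_le (x - y)
    have h4 := le_abs_self (x - y)
    exact ⟨abs_le.2 ⟨by linarith, by linarith⟩, by linarith, by linarith⟩
  · rintro ⟨h1, h2, h3⟩
    obtain ⟨h4, h5⟩ := abs_le.1 h1
    rcases abs_cases y with h | h <;> rcases abs_cases (x - y) with h' | h' <;> linarith

lemma ae_ret_ne {x t : ℝ} (h : |x| ≠ t) : ∀ᵐ y : ℝ, t - |x - y| ≠ |y| := by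
  have hf : ({(x - t) / 2, (x + t) / 2} : Set ℝ).Finite := by simp
  filter_upwards [compl_mem_ae_iff.2 (hf.measure_zero volume)] with y hy he
  apply hy
  simp only [mem_insert_iff, mem_singleton_iff]
  by_contra hne
  push Not at hne
  apply h
  rcases abs_cases y with h1 | h1 <;> rcases abs_cases (x - y) with h' | h' <;>
    rcases abs_cases x with h2 | h2 <;> first
    | linarith
    | exact absurd (by linarith) hne.1
    | exact absurd (by linarith) hne.2

/-! ### The kernel of the Goursat problem as a solution of an integral equation -/

/-- The step function with value `a` on the right half line and `b` on the left one. -/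
def step (a b y : ℝ) : ℝ := if 0 < y then a else b

/-- `w` solves the integral equation equivalent to the Goursat problem in `|x| ≤ t` for the
potential `p` with data `w(x, x) = -(a/2) ∫₀ˣ p` and `w(-x, x) = -(b/2) ∫₋ₓ⁰ p`. Only the values
in the cone matter; `w` is continued to a continuous function on the plane. -/
structure IsKernel (p : ℝ → ℝ) (a b : ℝ) (w : ℝ → ℝ → ℝ) : Prop where
  cont : Continuous (Function.uncurry w)
  eq : ∀ x t, |x| ≤ t → w x t = -(1 / 2) * (∫ y in (x - t) / 2..(x + t) / 2, p y * step a b y)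
    - 1 / 2 * potInt p (coneInt w) x t

lemma abs_coneInt_le {w : ℝ → ℝ → ℝ} {l M y τ : ℝ} (hl : 0 < l)
    (hM : 0 ≤ M) (h : ∀ s, |y| ≤ s → s ≤ τ → |w y s| ≤ M * Real.exp (l * s)) :
    |coneInt w y τ| ≤ M / l * Real.exp (l * τ) := by
  rcases le_total τ |y| with h1 | h1
  · rw [coneInt_of_le h1, abs_zero]; positivity
  rw [coneInt_of_ge h1]
  have hd : ∀ s, HasDerivAt (fun s => M / l * Real.exp (l * s)) (M * Real.exp (l * s)) s := by
    intro s
    have := (((hasDerivAt_id' s).const_mul l).exp).const_mul (M / l)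
    refine this.congr_deriv ?_
    field_simp
  have e : ∫ s in |y|..τ, M * Real.exp (l * s)
      = M / l * Real.exp (l * τ) - M / l * Real.exp (l * |y|) :=
    intervalIntegral.integral_eq_sub_of_hasDerivAt (fun s _ => hd s)
      (Continuous.intervalIntegrable (by fun_prop) _ _)
  have h2 := intervalIntegral.norm_integral_le_of_norm_le h1 (f := w y)
    (g := fun s => M * Real.exp (l * s)) (μ := volume)
    (ae_of_all _ fun s hs => h s hs.1.le hs.2)
    (Continuous.intervalIntegrable (by fun_prop) _ _)
  rw [e] at h2
  have : 0 ≤ M / l * Real.exp (l * |y|) := by positivity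
  rw [Real.norm_eq_abs] at h2
  linarith

lemma abs_potInt_le {p : ℝ → ℝ} (hp : Integrable p) {G : ℝ → ℝ → ℝ} {x t M : ℝ}
    (h : ∀ y, |G y (t - |x - y|)| ≤ M) : |potInt p G x t| ≤ (∫ y, |p y|) * M := by
  rw [← integral_mul_const]
  refine norm_integral_le_of_norm_le (f := fun y => p y * G y (t - |x - y|))
    (hp.norm.mul_const M) (ae_of_all _ fun y => ?_)
  rw [norm_mul]
  exact mul_le_mul_of_nonneg_left (h y) (norm_nonneg _)

lemma coneInt_sub {w w' : ℝ → ℝ → ℝ} (hw : Continuous (Function.uncurry w))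
    (hw' : Continuous (Function.uncurry w')) (y τ : ℝ) :
    coneInt (fun x t => w x t - w' x t) y τ = coneInt w y τ - coneInt w' y τ :=
  intervalIntegral.integral_sub
    ((hw.comp (Continuous.prodMk_right y)).intervalIntegrable _ _)
    ((hw'.comp (Continuous.prodMk_right y)).intervalIntegrable _ _)

lemma potInt_sub {p : ℝ → ℝ} (hp : Integrable p) {G G' : ℝ → ℝ → ℝ} (hG : LocBdd G)
    (hG' : LocBdd G') (x t : ℝ) :
    potInt p (fun y τ => G y τ - G' y τ) x t = potInt p G x t - potInt p G' x t := by
  simp only [potInt, mul_sub]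
  exact integral_sub (hG.integrable_mul hp x t) (hG'.integrable_mul hp x t)

lemma integrable_mul_step {p : ℝ → ℝ} (hp : Integrable p) (a b : ℝ) :
    Integrable fun y => p y * step a b y :=
  hp.mul_bdd (c := max |a| |b|)
    (Measurable.ite measurableSet_Ioi measurable_const measurable_const).aestronglyMeasurable
    (ae_of_all _ fun y => by unfold step; split_ifs <;> simp)

lemma continuous_potInt_coneInt {p : ℝ → ℝ} (hp : Integrable p) {w : ℝ → ℝ → ℝ}
    (hw : Continuous (Function.uncurry w)) :
    Continuous (Function.uncurry (potInt p (coneInt w))) :=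
  continuous_iff_continuousAt.2 fun _ => (locBdd_coneInt hw).continuousAt_potInt hp
    (ae_of_all _ fun y => ((continuous_coneInt hw).comp (Continuous.prodMk_right y)).continuousAt)

lemma continuous_integral_endpoints {X : Type*} [TopologicalSpace X] {h : ℝ → ℝ}
    (hh : Integrable h) {u v : X → ℝ} (hu : Continuous u) (hv : Continuous v) :
    Continuous fun x => ∫ y in u x..v x, h y := by
  have hc : Continuous fun z => ∫ y in (0 : ℝ)..z, h y :=
    intervalIntegral.continuous_primitive (fun _ _ => hh.intervalIntegrable) 0
  refine ((hc.comp hv).sub (hc.comp hu)).congr fun x => ?_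
  exact intervalIntegral.integral_interval_sub_left hh.intervalIntegrable hh.intervalIntegrable

/-- The integral equation is solved by contraction in the bounded continuous functions on the plane,
after division by a sufficiently fast growing exponential of `|t|`. -/
theorem exists_isKernel {p : ℝ → ℝ} (hp : Integrable p) (a b : ℝ) : ∃ w, IsKernel p a b w := by
  set K := ∫ y, |p y| with hK
  have hK0 : 0 ≤ K := integral_nonneg fun _ => abs_nonneg _
  set l := K + 1 with hl
  have hl0 : 0 < l := by linarith
  let X := BoundedContinuousFunction (ℝ × ℝ) ℝ
  let ext : X → ℝ → ℝ → ℝ := fun o x t => Real.exp (l * |t|) * o (x, t)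
  have hext : ∀ o, Continuous (Function.uncurry (ext o)) := fun o => by
    have : Continuous o := o.continuous
    change Continuous fun z : ℝ × ℝ => Real.exp (l * |z.2|) * o (z.1, z.2)
    fun_prop
  -- the weighted norm of the Duhamel term is at most half of that of its argument
  have hbd : ∀ (w : ℝ → ℝ → ℝ) (M : ℝ), 0 ≤ M →
      (∀ y s, |w y s| ≤ M * Real.exp (l * |s|)) → ∀ x t,
      |potInt p (coneInt w) x t| ≤ M * Real.exp (l * |t|) := by
    intro w M hM hw x t
    have h1 : ∀ y, |coneInt w y (t - |x - y|)| ≤ M / l * Real.exp (l * |t|) := fun y => by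
      refine (abs_coneInt_le hl0 hM fun s hs _ => ?_).trans ?_
      · have := hw y s
        rwa [abs_of_nonneg ((abs_nonneg y).trans hs)] at this
      · refine mul_le_mul_of_nonneg_left (Real.exp_le_exp.2 ?_) (by positivity)
        refine mul_le_mul_of_nonneg_left ?_ hl0.le
        linarith [abs_nonneg (x - y), le_abs_self t]
    refine (abs_potInt_le hp h1).trans ?_
    rw [← hK]
    have : K * (M / l * Real.exp (l * |t|)) = (K / l) * (M * Real.exp (l * |t|)) := by ring
    rw [this]
    refine mul_le_of_le_one_left (by positivity) ?_
    rw [div_le_one hl0]; linarith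
  let w0 : ℝ × ℝ → ℝ := fun z =>
    -(1 / 2) * ∫ y in (z.1 - max z.2 |z.1|) / 2..(z.1 + max z.2 |z.1|) / 2, p y * step a b y
  have hw0 : Continuous w0 := continuous_const.mul
    (continuous_integral_endpoints (integrable_mul_step hp a b) (by fun_prop) (by fun_prop))
  have hw0b : ∀ z, |w0 z| ≤ ∫ y, |p y * step a b y| := by
    intro z
    have h1 := intervalIntegral.norm_integral_le_integral_norm_uIoc (f := fun y => p y * step a b y)
      (a := (z.1 - max z.2 |z.1|) / 2) (b := (z.1 + max z.2 |z.1|) / 2) (μ := volume)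
    have h2 := setIntegral_le_integral (integrable_mul_step hp a b).norm
      (s := uIoc ((z.1 - max z.2 |z.1|) / 2) ((z.1 + max z.2 |z.1|) / 2))
      (ae_of_all _ fun _ => norm_nonneg _)
    have h3 := h1.trans h2
    simp only [Real.norm_eq_abs] at h3
    simp only [w0, abs_mul]
    rw [show |(-(1 / 2) : ℝ)| = 1 / 2 by norm_num]
    have := abs_nonneg (∫ y in (z.1 - max z.2 |z.1|) / 2..(z.1 + max z.2 |z.1|) / 2,
      p y * step a b y)
    simp only [abs_mul] at h3 ⊢
    linarith
  have hexp : ∀ t : ℝ, Real.exp (-(l * |t|)) * Real.exp (l * |t|) = 1 := fun t => by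
    rw [← Real.exp_add]; simp
  have hexp1 : ∀ t : ℝ, Real.exp (-(l * |t|)) ≤ 1 := fun t => by
    rw [Real.exp_le_one_iff]; have := abs_nonneg t; nlinarith
  have hob : ∀ (o : X) y s, |ext o y s| ≤ ‖o‖ * Real.exp (l * |s|) := fun o y s => by
    simp only [ext, abs_mul, Real.abs_exp]
    rw [mul_comm]
    exact mul_le_mul_of_nonneg_right (o.norm_coe_le_norm _) (Real.exp_pos _).le
  let Phi : X → X := fun o => BoundedContinuousFunction.ofNormedAddCommGroup
    (fun z : ℝ × ℝ => Real.exp (-(l * |z.2|)) * (w0 z - 1 / 2 * potInt p (coneInt (ext o)) z.1 z.2))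
    (by
      have h1 : Continuous fun z : ℝ × ℝ => potInt p (coneInt (ext o)) z.1 z.2 :=
        continuous_potInt_coneInt hp (hext o)
      fun_prop)
    ((∫ y, |p y * step a b y|) + ‖o‖) (by
      intro z
      have h1 := hbd (ext o) ‖o‖ (norm_nonneg _) (hob o) z.1 z.2
      have h2 := hw0b z
      rw [Real.norm_eq_abs, abs_mul, Real.abs_exp]
      have h4 : |w0 z - 1 / 2 * potInt p (coneInt (ext o)) z.1 z.2|
          ≤ (∫ y, |p y * step a b y|) + ‖o‖ * Real.exp (l * |z.2|) := by
        refine (abs_sub _ _).trans (add_le_add h2 ?_)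
        rw [abs_mul, abs_of_pos (by norm_num : (0 : ℝ) < 1 / 2)]
        linarith [abs_nonneg (potInt p (coneInt (ext o)) z.1 z.2)]
      refine (mul_le_mul_of_nonneg_left h4 (Real.exp_pos _).le).trans ?_
      rw [mul_add]
      refine add_le_add (mul_le_of_le_one_left (integral_nonneg fun _ => abs_nonneg _)
        (hexp1 _)) (le_of_eq ?_)
      linear_combination ‖o‖ * hexp z.2)
  have hPhi' : ∀ o z, Phi o z
      = Real.exp (-(l * |z.2|)) * (w0 z - 1 / 2 * potInt p (coneInt (ext o)) z.1 z.2) :=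
    fun _ _ => rfl
  have hPhi : ContractingWith (1 / 2) Phi := by
    refine ⟨by norm_num, LipschitzWith.of_dist_le_mul fun o o' => ?_⟩
    rw [BoundedContinuousFunction.dist_le (by positivity)]
    intro z
    have e : Phi o z - Phi o' z = Real.exp (-(l * |z.2|)) *
        (-(1 / 2) * potInt p (coneInt fun x t => ext o x t - ext o' x t) z.1 z.2) := by
      have h1 : coneInt (fun x t => ext o x t - ext o' x t)
          = fun y τ => coneInt (ext o) y τ - coneInt (ext o') y τ := by
        ext y τ; exact coneInt_sub (hext o) (hext o') y τ
      rw [h1, potInt_sub hp (locBdd_coneInt (hext o)) (locBdd_coneInt (hext o'))]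
      rw [hPhi' o, hPhi' o']
      ring
    rw [Real.dist_eq, e, abs_mul, Real.abs_exp, abs_mul]
    have h2 := hbd (fun x t => ext o x t - ext o' x t) (dist o o') dist_nonneg (fun y s => by
      simp only [ext, ← mul_sub, abs_mul, Real.abs_exp]
      rw [mul_comm]
      exact mul_le_mul_of_nonneg_right (o.dist_coe_le_dist _) (Real.exp_pos _).le) z.1 z.2
    rw [show |(-(1 / 2) : ℝ)| = 1 / 2 by norm_num]
    calc _ ≤ Real.exp (-(l * |z.2|)) * (1 / 2 * (dist o o' * Real.exp (l * |z.2|))) := by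
          gcongr
      _ = 1 / 2 * dist o o' := by linear_combination (1 / 2 * dist o o') * hexp z.2
      _ = _ := by simp
  let o := hPhi.fixedPoint Phi
  have ho : Phi o = o := hPhi.fixedPoint_isFixedPt
  refine ⟨ext o, hext o, fun x t hxt => ?_⟩
  have h1 : ext o x t = Real.exp (l * |t|) * Phi o (x, t) := by rw [ho]
  rw [h1]
  rw [hPhi']
  simp only [w0, max_eq_left hxt]
  linear_combination (-(1 / 2) * (∫ y in (x - t) / 2..(x + t) / 2, p y * step a b y)
    - 1 / 2 * potInt p (coneInt (ext o)) x t) * hexp t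

/-- The homogeneous integral equation has only the zero solution. -/
theorem eq_zero_of_eq_potInt {p : ℝ → ℝ} (hp : Integrable p) {d : ℝ → ℝ → ℝ}
    (hd : Continuous (Function.uncurry d)) {L : ℝ}
    (h : ∀ x t, |x| ≤ t → t < L → d x t = -(1 / 2) * potInt p (coneInt d) x t) {x t : ℝ}
    (hx : |x| ≤ t) (ht : t < L) : d x t = 0 := by
  set K := ∫ y, |p y| with hK
  have hK0 : 0 ≤ K := integral_nonneg fun _ => abs_nonneg _
  set l := K + 1 with hl
  have hl0 : 0 < l := by linarith
  have hcl : IsClosed {z : ℝ × ℝ | |z.1| ≤ z.2 ∧ z.2 ≤ t} :=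
    (isClosed_le (by fun_prop) (by fun_prop)).and (isClosed_le (by fun_prop) (by fun_prop))
  have hc : IsCompact {z : ℝ × ℝ | |z.1| ≤ z.2 ∧ z.2 ≤ t} := by
    refine ((isCompact_Icc (a := -t) (b := t)).prod
      (isCompact_Icc (a := 0) (b := t))).of_isClosed_subset hcl fun z hz => ?_
    have := abs_le.1 (hz.1.trans hz.2)
    exact ⟨this, (abs_nonneg _).trans hz.1, hz.2⟩
  obtain ⟨z, hz, hmax⟩ := hc.exists_isMaxOn ⟨(x, t), hx, le_rfl⟩
    (f := fun z : ℝ × ℝ => |d z.1 z.2| * Real.exp (-(l * z.2)))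
    (Continuous.continuousOn (by
      have : Continuous fun z : ℝ × ℝ => d z.1 z.2 := hd
      fun_prop))
  set M := |d z.1 z.2| * Real.exp (-(l * z.2)) with hM
  have hM0 : 0 ≤ M := by positivity
  have hb : ∀ y s, |y| ≤ s → s ≤ t → |d y s| ≤ M * Real.exp (l * s) := fun y s h1 h2 => by
    have := hmax (show (y, s) ∈ {z : ℝ × ℝ | |z.1| ≤ z.2 ∧ z.2 ≤ t} from ⟨h1, h2⟩)
    simp only [mem_ofPred_eq] at this
    calc |d y s| = |d y s| * Real.exp (-(l * s)) * Real.exp (l * s) := by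
          rw [mul_assoc, ← Real.exp_add]; simp
      _ ≤ _ := mul_le_mul_of_nonneg_right this (Real.exp_pos _).le
  have h1 : |d z.1 z.2| ≤ 1 / 2 * (M * Real.exp (l * z.2)) := by
    rw [h z.1 z.2 hz.1 (hz.2.trans_lt ht), abs_mul, show |(-(1 / 2) : ℝ)| = 1 / 2 by norm_num]
    refine mul_le_mul_of_nonneg_left ?_ (by norm_num)
    refine (abs_potInt_le (M := M / l * Real.exp (l * z.2)) hp fun y => ?_).trans ?_
    · refine (abs_coneInt_le hl0 hM0 fun s hs h2 => hb y s hs ?_).trans ?_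
      · linarith [abs_nonneg (z.1 - y), hz.2]
      · gcongr
        linarith [abs_nonneg (z.1 - y)]
    · rw [← hK]
      have : K * (M / l * Real.exp (l * z.2)) = (K / l) * (M * Real.exp (l * z.2)) := by ring
      rw [this]
      refine mul_le_of_le_one_left (by positivity) ?_
      rw [div_le_one hl0]; linarith
  have h2 : M ≤ 1 / 2 * M := by
    have := mul_le_mul_of_nonneg_right h1 (Real.exp_pos (-(l * z.2))).le
    rw [mul_assoc, mul_assoc, ← Real.exp_add] at this
    simpa using this
  have h3 : M = 0 := by linarith
  have := hb x t hx le_rfl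
  rw [h3, zero_mul] at this
  exact abs_nonpos_iff.1 this

/-- Reflection in `x = 0` exchanges the two data. -/
lemma IsKernel.reflect {p : ℝ → ℝ} {a b : ℝ} {w : ℝ → ℝ → ℝ} (h : IsKernel p a b w) :
    IsKernel (fun y => p (-y)) b a fun x t => w (-x) t := by
  refine ⟨h.cont.comp (by fun_prop : Continuous fun z : ℝ × ℝ => (-z.1, z.2)), fun x t hx => ?_⟩
  rw [h.eq (-x) t (by rwa [abs_neg])]
  congr 2
  · have e : ∀ᵐ y : ℝ, p (-y) * step b a y = p (-y) * step a b (-y) := by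
      filter_upwards [compl_mem_ae_iff.2 (measure_singleton (0 : ℝ) : volume {(0 : ℝ)} = 0)] with y hy
      rcases lt_or_gt_of_ne hy with hy | hy
      · simp [step, hy, not_lt.2 hy.le]
      · simp [step, hy, not_lt.2 hy.le]
    rw [intervalIntegral.integral_congr_ae (e.mono fun y hy _ => hy),
      intervalIntegral.integral_comp_neg fun y => p y * step a b y]
    congr 1 <;> ring
  · simp only [potInt]
    rw [← integral_neg_eq_self]
    congr 1; ext y
    congr 1
    simp only [coneInt, abs_neg]
    rw [show |-x - -y| = |x - y| by rw [← abs_neg]; ring_nf]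

/-! ### Parametric integrals with an integrable weight -/

lemma continuous_weighted_integral {p : ℝ → ℝ} (hp : LocallyIntegrable p) {F : ℝ × ℝ → ℝ → ℝ}
    (hF : Continuous (Function.uncurry F)) {u v : ℝ × ℝ → ℝ} (hu : Continuous u)
    (hv : Continuous v) : Continuous fun z => ∫ y in u z..v z, p y * F z y := by
  refine continuous_iff_continuousAt.2 fun z₀ => ?_
  set R := max |u z₀| |v z₀| + 1 with hR
  have hR0 : 0 < R := by positivity
  have hu' : ∀ᶠ z in 𝓝 z₀, |u z| < R := by
    refine (hu.abs.tendsto z₀).eventually (gt_mem_nhds ?_)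
    linarith [le_max_left |u z₀| |v z₀|]
  have hv' : ∀ᶠ z in 𝓝 z₀, |v z| < R := by
    refine (hv.abs.tendsto z₀).eventually (gt_mem_nhds ?_)
    linarith [le_max_right |u z₀| |v z₀|]
  set q := (Icc (-R) R).indicator p with hq
  have hqi : Integrable q :=
    (hp.integrableOn_isCompact isCompact_Icc).integrable_indicator measurableSet_Icc
  set G : ℝ × ℝ → ℝ → ℝ := fun z y => F z (max (-R) (min R y)) with hG
  have hGc : Continuous (Function.uncurry G) :=
    hF.comp (by fun_prop : Continuous fun z : (ℝ × ℝ) × ℝ => (z.1, max (-R) (min R z.2)))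
  obtain ⟨C, hC⟩ := ((isCompact_closedBall z₀ 1).prod
    (isCompact_Icc (a := -R) (b := R))).exists_bound_of_continuousOn hF.continuousOn
  have hGb : ∀ z ∈ Metric.closedBall z₀ 1, ∀ y, |G z y| ≤ C := fun z hz y =>
    hC (z, _) ⟨hz, le_max_left _ _, max_le (by linarith) (min_le_left _ _)⟩
  have hGm : ∀ z, AEStronglyMeasurable (G z) volume := fun z =>
    (hGc.comp (Continuous.prodMk_right z)).aestronglyMeasurable
  have hGi : ∀ z ∈ Metric.closedBall z₀ 1, Integrable fun y => q y * G z y := fun z hz =>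
    hqi.mul_bdd (hGm z) (ae_of_all _ fun y => hGb z hz y)
  have key : ContinuousAt (fun z => ∫ y, q y * G z y * ((side (v z) y - side (u z) y) / 2)) z₀ := by
    refine continuousAt_of_dominated (bound := fun y => ‖q y‖ * C) ?_ ?_ (hqi.norm.mul_const _) ?_
    · refine Eventually.of_forall fun z => (hqi.aestronglyMeasurable.mul (hGm z)).mul ?_
      exact (((measurable_side _).sub (measurable_side _)).div_const 2).aestronglyMeasurable
    · filter_upwards [Metric.closedBall_mem_nhds z₀ one_pos] with z hz
      refine ae_of_all _ fun y => ?_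
      rw [norm_mul, norm_mul]
      have h1 : ‖(side (v z) y - side (u z) y) / 2‖ ≤ 1 := by
        rw [Real.norm_eq_abs, abs_div]
        have := abs_sub (side (v z) y) (side (u z) y)
        rw [abs_side, abs_side] at this
        rw [abs_two]; linarith
      have h2 := mul_le_mul_of_nonneg_left (hGb z hz y) (norm_nonneg (q y))
      exact (mul_le_of_le_one_right (by positivity) h1).trans h2
    · have hf : ({u z₀, v z₀} : Set ℝ).Finite := by simp
      filter_upwards [compl_mem_ae_iff.2 (hf.measure_zero volume)] with y hy
      simp only [mem_compl_iff, mem_insert_iff, mem_singleton_iff, not_or] at hy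
      have h1 : ContinuousAt (fun z => side (u z) y) z₀ :=
        ContinuousAt.comp (g := fun x => side x y) (continuousAt_side hy.1) hu.continuousAt
      have h2 : ContinuousAt (fun z => side (v z) y) z₀ :=
        ContinuousAt.comp (g := fun x => side x y) (continuousAt_side hy.2) hv.continuousAt
      have h3 : ContinuousAt (fun z => G z y) z₀ :=
        (hGc.comp (Continuous.prodMk_left y)).continuousAt
      exact (continuousAt_const.mul h3).mul ((h2.sub h1).div_const 2)
  refine key.congr ?_
  filter_upwards [hu', hv', Metric.closedBall_mem_nhds z₀ one_pos] with z h1 h2 hz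
  have hi := hGi z hz
  have e : ∫ y, q y * G z y * ((side (v z) y - side (u z) y) / 2)
      = ∫ y in u z..v z, q y * G z y := by
    have a3 := intervalIntegral.integral_Iic_sub_Iic (hi.integrableOn (s := Iic (u z)))
      (hi.integrableOn (s := Iic (v z)))
    rw [← a3]
    have : ∀ y, q y * G z y * ((side (v z) y - side (u z) y) / 2)
      = 1 / 2 * (q y * G z y * side (v z) y - q y * G z y * side (u z) y) := fun y => by ring
    simp_rw [this]
    rw [integral_const_mul, integral_sub (integrable_mul_side hi _) (integrable_mul_side hi _),
      integral_mul_side hi, integral_mul_side hi]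
    ring
  rw [e]
  refine intervalIntegral.integral_congr fun y hy => ?_
  have hy' : y ∈ Icc (-R) R := by
    have a1 := abs_lt.1 h1
    have a2 := abs_lt.1 h2
    exact ⟨(le_min a1.1.le a2.1.le).trans hy.1, hy.2.trans (max_le a1.2.le a2.2.le)⟩
  simp only [hq, hG, indicator_of_mem hy', min_eq_right hy'.2, max_eq_right hy'.1]

/-- The integral is continuously differentiable in its parameter and its upper limit together as
soon as the weight is continuous near that limit; elsewhere the weight need only be integrable. -/
lemma contDiffAt_param_integral {p : ℝ → ℝ} (hp : LocallyIntegrable p) {κ κ' : ℝ → ℝ → ℝ}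
    (hκ : Continuous (Function.uncurry κ)) (hκ' : Continuous (Function.uncurry κ'))
    {c d x₀ η₀ : ℝ} (hx : x₀ ∈ Ioo c d) {I : Set ℝ} (hI : I ∈ 𝓝 η₀)
    (hd : ∀ η ∈ I, ∀ y ∈ Ioo c d, HasDerivAt (fun s => κ s y) (κ' η y) η)
    (hpc : ∀ᶠ x in 𝓝 x₀, ContinuousAt p x) :
    ContDiffAt ℝ 1 (fun z : ℝ × ℝ => ∫ y in c..z.2, p y * κ z.1 y) (η₀, x₀) := by
  obtain ⟨ε, hε, hεI⟩ := Metric.mem_nhds_iff.1 hI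
  have hint : ∀ {k : ℝ → ℝ → ℝ}, Continuous (Function.uncurry k) → ∀ η a b,
      IntervalIntegrable (fun y => p y * k η y) volume a b := fun hk η a b =>
    (hp.integrableOn_isCompact isCompact_uIcc).intervalIntegrable (a := a) (b := b) |>.mul_continuousOn
      (hk.comp (Continuous.prodMk_right η)).continuousOn
  have h1 : ∀ v ∈ Metric.ball η₀ ε ×ˢ Ioo c d,
      HasDerivAt (fun η => ∫ y in c..v.2, p y * κ η y) (∫ y in c..v.2, p y * κ' v.1 y) v.1 := by
    rintro ⟨η, x⟩ ⟨h1, h2⟩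
    obtain ⟨C, hC⟩ := ((isCompact_closedBall η₀ ε).prod
      (isCompact_Icc (a := c) (b := d))).exists_bound_of_continuousOn hκ'.continuousOn
    refine (intervalIntegral.hasDerivAt_integral_of_dominated_loc_of_deriv_le
      (F := fun η y => p y * κ η y) (F' := fun η y => p y * κ' η y)
      (bound := fun y => ‖p y‖ * C) (Metric.isOpen_ball.mem_nhds h1)
      (Eventually.of_forall fun s => (hint hκ s c x).def'.aestronglyMeasurable)
      (hint hκ η c x) (hint hκ' η c x).def'.aestronglyMeasurable
      (ae_of_all _ fun y hy s hs => ?_) ((hp.integrableOn_isCompact isCompact_uIcc).intervalIntegrable.norm.mul_const C)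
      (ae_of_all _ fun y hy s hs => ?_)).2
    · rw [norm_mul]
      refine mul_le_mul_of_nonneg_left (hC (s, y) ⟨Metric.ball_subset_closedBall hs, ?_⟩)
        (norm_nonneg _)
      rw [uIoc_of_le h2.1.le] at hy
      exact ⟨hy.1.le, hy.2.trans h2.2.le⟩
    · rw [uIoc_of_le h2.1.le] at hy
      exact (hd s (hεI hs) y ⟨hy.1, hy.2.trans_lt h2.2⟩).const_mul (p y)
  have h2 : ∀ v : ℝ × ℝ, ContinuousAt p v.2 →
      HasDerivAt (fun x => ∫ y in c..x, p y * κ v.1 y) (p v.2 * κ v.1 v.2) v.2 := fun v hv =>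
    intervalIntegral.integral_hasDerivAt_right (hint hκ _ _ _)
      ((hp.aestronglyMeasurable.mul
        (hκ.comp (Continuous.prodMk_right v.1)).aestronglyMeasurable).stronglyMeasurableAtFilter)
      (hv.mul (hκ.comp (Continuous.prodMk_right v.1)).continuousAt)
  obtain ⟨V, hV, hVo, hxV⟩ := mem_nhds_iff.1 hpc
  set U := Metric.ball η₀ ε ×ˢ (Ioo c d ∩ V) with hU
  have hUo : IsOpen U := Metric.isOpen_ball.prod (isOpen_Ioo.inter hVo)
  set f₁ : ℝ → ℝ → ℝ →L[ℝ] ℝ := fun η x =>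
    ContinuousLinearMap.toSpanSingleton ℝ (∫ y in c..x, p y * κ' η y) with hf₁
  set f₂ : ℝ → ℝ → ℝ →L[ℝ] ℝ := fun η x =>
    ContinuousLinearMap.toSpanSingleton ℝ (p x * κ η x) with hf₂
  have c1 : Continuous (Function.uncurry f₁) := by
    refine (ContinuousLinearMap.toSpanSingletonCLE (𝕜 := ℝ) (E := ℝ)).continuous.comp ?_
    exact continuous_weighted_integral hp (F := fun z y => κ' z.1 y)
      (hκ'.comp (by fun_prop : Continuous fun z : (ℝ × ℝ) × ℝ => (z.1.1, z.2)))
      continuous_const continuous_snd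
  have c2 : ∀ v ∈ U, ContinuousAt (Function.uncurry f₂) v := fun v hv => by
    refine (ContinuousLinearMap.toSpanSingletonCLE (𝕜 := ℝ) (E := ℝ)).continuous.continuousAt.comp
      (f := fun v : ℝ × ℝ => p v.2 * κ v.1 v.2) (ContinuousAt.mul ?_ hκ.continuousAt)
    exact ContinuousAt.comp (g := p) (hV hv.2.2) continuousAt_snd
  rw [contDiffAt_one_iff]
  refine ⟨fun v => (f₁ v.1 v.2).coprod (f₂ v.1 v.2), U, hUo.mem_nhds
    ⟨Metric.mem_ball_self hε, hx, hxV⟩, ?_, fun v hv => ?_⟩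
  · intro v hv
    have := (ContinuousLinearMap.coprodEquivL (𝕜 := ℝ) (E := ℝ) (F := ℝ) (G := ℝ) ℝ).continuous.continuousAt.comp
      (f := fun v : ℝ × ℝ => (f₁ v.1 v.2, f₂ v.1 v.2))
      (ContinuousAt.prodMk c1.continuousAt (c2 v hv))
    exact this.continuousWithinAt
  · exact (hasStrictFDerivAt_uncurry_coprod (𝕜 := ℝ)
      (f := fun η x => ∫ y in c..x, p y * κ η y) (f₁ := f₁) (f₂ := f₂)
      (by filter_upwards [hUo.mem_nhds hv] with z hz using (h1 z ⟨hz.1, hz.2.1⟩).hasFDerivAt)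
      (by filter_upwards [hUo.mem_nhds hv] with z hz using (h2 z (hV hz.2.2)).hasFDerivAt)
      c1.continuousAt (c2 v hv)).hasFDerivAt

/-! ### Regularity of the Goursat kernel -/

/-- The integral of `p w` over the right-hand edge of the backward cone of a point with space
coordinate `x` and characteristic coordinate `ξ = x + t`. -/
def rightInt (p : ℝ → ℝ) (w : ℝ → ℝ → ℝ) (x ξ : ℝ) : ℝ := ∫ y in x..ξ / 2, p y * w y (ξ - y)

/-- The integral of `p w` over the left-hand edge of the backward cone of a point with space
coordinate `x` and characteristic coordinate `η = t - x`. -/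
def leftInt (p : ℝ → ℝ) (w : ℝ → ℝ → ℝ) (x η : ℝ) : ℝ := ∫ y in -η / 2..x, p y * w y (η + y)

lemma continuous_rightInt {p : ℝ → ℝ} (hp : Integrable p) {w : ℝ → ℝ → ℝ}
    (hw : Continuous (Function.uncurry w)) : Continuous (Function.uncurry (rightInt p w)) :=
  continuous_weighted_integral hp.locallyIntegrable (F := fun z y => w y (z.2 - y))
    (hw.comp (by fun_prop : Continuous fun z : (ℝ × ℝ) × ℝ => (z.2, z.1.2 - z.2)))
    continuous_fst (by fun_prop)

lemma continuous_leftInt {p : ℝ → ℝ} (hp : Integrable p) {w : ℝ → ℝ → ℝ}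
    (hw : Continuous (Function.uncurry w)) : Continuous (Function.uncurry (leftInt p w)) :=
  continuous_weighted_integral hp.locallyIntegrable (F := fun z y => w y (z.2 + y))
    (hw.comp (by fun_prop : Continuous fun z : (ℝ × ℝ) × ℝ => (z.2, z.1.2 + z.2)))
    (by fun_prop) continuous_fst

lemma leftInt_eq_rightInt (p : ℝ → ℝ) (w : ℝ → ℝ → ℝ) (x η : ℝ) :
    leftInt p w x η = rightInt (fun y => p (-y)) (fun y s => w (-y) s) (-x) η := by
  have := intervalIntegral.integral_comp_neg (fun y => p y * w y (η + y)) (a := -x) (b := η / 2)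
  simp only [rightInt, leftInt]
  rw [neg_neg] at this
  rw [neg_div, ← this]
  rfl

lemma integrable_mul_of_continuous {p : ℝ → ℝ} (hp : Integrable p) {h : ℝ → ℝ}
    (hh : Continuous h) (a b : ℝ) : IntervalIntegrable (fun y => p y * h y) volume a b :=
  hp.intervalIntegrable.mul_continuousOn hh.continuousOn

lemma potInt_coneRestr {p : ℝ → ℝ} (hp : Integrable p) {w : ℝ → ℝ → ℝ}
    (hw : Continuous (Function.uncurry w)) {x t : ℝ} (h : |x| ≤ t) :
    potInt p (coneRestr w) x t = leftInt p w x (t - x) + rightInt p w x (x + t) := by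
  obtain ⟨h1, h2⟩ := abs_le.1 h
  have e : ∀ y, p y * coneRestr w y (t - |x - y|)
      = (Icc ((x - t) / 2) ((x + t) / 2)).indicator (fun y => p y * w y (t - |x - y|)) y := by
    intro y
    by_cases hy : y ∈ Icc ((x - t) / 2) ((x + t) / 2)
    · rw [indicator_of_mem hy, coneRestr, if_pos (abs_le_sub_abs_iff.2 ⟨h, hy.1, hy.2⟩)]
    · rw [indicator_of_notMem hy, coneRestr, if_neg, mul_zero]
      exact fun h' => hy (abs_le_sub_abs_iff.1 h').2
  have hc : Continuous fun y => w y (t - |x - y|) :=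
    hw.comp (by fun_prop : Continuous fun y => (y, t - |x - y|))
  simp only [potInt, e]
  rw [integral_indicator measurableSet_Icc, integral_Icc_eq_integral_Ioc,
    ← intervalIntegral.integral_of_le (by linarith),
    ← intervalIntegral.integral_add_adjacent_intervals (b := x)
      (integrable_mul_of_continuous hp hc _ _) (integrable_mul_of_continuous hp hc _ _)]
  congr 1
  · rw [leftInt, show -(t - x) / 2 = (x - t) / 2 by ring]
    refine intervalIntegral.integral_congr fun y hy => ?_
    rw [uIcc_of_le (by linarith)] at hy
    simp only [abs_of_nonneg (sub_nonneg.2 hy.2)]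
    ring_nf
  · rw [rightInt]
    refine intervalIntegral.integral_congr fun y hy => ?_
    rw [uIcc_of_le (by linarith)] at hy
    simp only [abs_of_nonpos (sub_nonpos.2 hy.1)]
    ring_nf

lemma potIntSign_coneRestr {p : ℝ → ℝ} (hp : Integrable p) {w : ℝ → ℝ → ℝ}
    (hw : Continuous (Function.uncurry w)) {x t : ℝ} (h : |x| ≤ t) :
    potIntSign p (coneRestr w) x t = leftInt p w x (t - x) - rightInt p w x (x + t) := by
  obtain ⟨h1, h2⟩ := abs_le.1 h
  have e : potIntSign p (coneRestr w) x t
      = potInt (fun y => p y * side x y) (coneRestr w) x t := by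
    simp only [potInt, potIntSign, mul_assoc]
  rw [e, potInt_coneRestr (integrable_mul_side hp x) hw h, sub_eq_add_neg]
  congr 1
  · simp only [leftInt]
    refine intervalIntegral.integral_congr_ae ?_
    filter_upwards [compl_mem_ae_iff.2 (measure_singleton x : volume {x} = 0)] with y hne hy
    rw [uIoc_of_le (by linarith)] at hy
    have : y < x := lt_of_le_of_ne hy.2 hne
    simp [side, this]
  · simp only [rightInt]
    rw [← intervalIntegral.integral_neg]
    refine intervalIntegral.integral_congr fun y hy => ?_
    rw [uIcc_of_le (by linarith)] at hy
    simp [side, not_lt.2 hy.1]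

/-- The derivative of a Goursat kernel with respect to `ξ = t + x`, keeping `η = t - x`. -/
def kernelDxi (p : ℝ → ℝ) (a : ℝ) (w : ℝ → ℝ → ℝ) (x t : ℝ) : ℝ :=
  -(a / 4) * p ((x + t) / 2) - 1 / 2 * rightInt p w x (x + t)

/-- The derivative of a Goursat kernel with respect to `η = t - x`, keeping `ξ = t + x`. -/
def kernelDeta (p : ℝ → ℝ) (b : ℝ) (w : ℝ → ℝ → ℝ) (x t : ℝ) : ℝ :=
  -(b / 4) * p ((x - t) / 2) - 1 / 2 * leftInt p w x (t - x)

lemma continuousAt_step (a b : ℝ) {y : ℝ} (hy : y ≠ 0) : ContinuousAt (step a b) y := by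
  rcases lt_or_gt_of_ne hy with h | h
  · refine (continuousAt_const (y := b)).congr ?_
    filter_upwards [gt_mem_nhds h] with x hx
    simp [step, not_lt.2 hx.le]
  · refine (continuousAt_const (y := a)).congr ?_
    filter_upwards [lt_mem_nhds h] with x hx
    simp [step, hx]

/-- The kernel is differentiable inside the cone wherever the potential is continuous at the feet
of both characteristics through the point. -/
lemma IsKernel.hasFDerivAt {p : ℝ → ℝ} (hp : Integrable p) {a b : ℝ} {w : ℝ → ℝ → ℝ}
    (hw : IsKernel p a b w) {x t : ℝ} (hx : |x| < t) (hp1 : ContinuousAt p ((x + t) / 2))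
    (hp2 : ContinuousAt p ((x - t) / 2)) :
    HasFDerivAt (Function.uncurry w)
      (kernelDxi p a w x t • (ContinuousLinearMap.snd ℝ ℝ ℝ + ContinuousLinearMap.fst ℝ ℝ ℝ)
        + kernelDeta p b w x t •
          (ContinuousLinearMap.snd ℝ ℝ ℝ - ContinuousLinearMap.fst ℝ ℝ ℝ)) (x, t) := by
  obtain ⟨h1, h2⟩ := abs_lt.1 hx
  have hm : ∀ l : Filter ℝ, StronglyMeasurableAtFilter (fun y => p y * step a b y) l volume :=
    fun l => (integrable_mul_step hp a b).aestronglyMeasurable.stronglyMeasurableAtFilter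
  have f1 := intervalIntegral.integral_hasFDerivAt
    (integrable_mul_step hp a b).intervalIntegrable (hm _) (hm _)
    (hp2.mul (continuousAt_step a b (y := (x - t) / 2) (by linarith)))
    (hp1.mul (continuousAt_step a b (y := (x + t) / 2) (by linarith)))
  have f2 : HasFDerivAt (fun z : ℝ × ℝ => ((z.1 - z.2) / 2, (z.1 + z.2) / 2)) _ (x, t) :=
    (((hasFDerivAt_fst (𝕜 := ℝ)).sub hasFDerivAt_snd).mul_const (2⁻¹ : ℝ)).prodMk
      (((hasFDerivAt_fst (𝕜 := ℝ)).add hasFDerivAt_snd).mul_const (2⁻¹ : ℝ))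
  have f3 := (HasFDerivAt.comp (f := fun z : ℝ × ℝ => ((z.1 - z.2) / 2, (z.1 + z.2) / 2))
    (x, t) f1 f2).const_mul (-(1 / 2))
  have f4 := ((locBdd_coneInt hw.cont).hasFDerivAt_potInt (locBdd_coneRestr hw.cont) hp
    (coneInt_lipschitz hw.cont) (x₀ := x) (t₀ := t) ((ae_ret_ne hx.ne).mono fun y hy =>
      hasDerivAt_coneInt hw.cont hy)).const_mul (1 / 2)
  rw [potInt_coneRestr hp hw.cont hx.le, potIntSign_coneRestr hp hw.cont hx.le] at f4
  have hev : ∀ᶠ z : ℝ × ℝ in 𝓝 (x, t), |z.1| < z.2 :=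
    (isOpen_lt (by fun_prop) (by fun_prop)).mem_nhds hx
  refine ((f3.sub f4).congr_of_eventuallyEq ?_).congr_fderiv ?_
  · filter_upwards [hev] with z hz
    exact hw.eq z.1 z.2 hz.le
  · have s1 : step a b ((x - t) / 2) = b := by simp [step, show ¬ (0 < (x - t) / 2) by linarith]
    have s2 : step a b ((x + t) / 2) = a := by simp [step, show 0 < x + t by linarith]
    ext
    · simp [s1, s2, kernelDxi, kernelDeta]; ring
    · simp [s1, s2, kernelDxi, kernelDeta]; ring

lemma continuousAt_kernelDxi {p : ℝ → ℝ} (hp : Integrable p) {a : ℝ} {w : ℝ → ℝ → ℝ}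
    (hw : Continuous (Function.uncurry w)) {z : ℝ × ℝ} (h : ContinuousAt p ((z.1 + z.2) / 2)) :
    ContinuousAt (fun z : ℝ × ℝ => kernelDxi p a w z.1 z.2) z := by
  have h1 : ContinuousAt (fun z : ℝ × ℝ => p ((z.1 + z.2) / 2)) z :=
    ContinuousAt.comp (g := p) h (by fun_prop)
  have h2 : Continuous fun z : ℝ × ℝ => rightInt p w z.1 (z.1 + z.2) :=
    (continuous_rightInt hp hw).comp (by fun_prop : Continuous fun z : ℝ × ℝ => (z.1, z.1 + z.2))
  exact (continuousAt_const.mul h1).sub (continuousAt_const.mul h2.continuousAt)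

lemma continuousAt_kernelDeta {p : ℝ → ℝ} (hp : Integrable p) {b : ℝ} {w : ℝ → ℝ → ℝ}
    (hw : Continuous (Function.uncurry w)) {z : ℝ × ℝ} (h : ContinuousAt p ((z.1 - z.2) / 2)) :
    ContinuousAt (fun z : ℝ × ℝ => kernelDeta p b w z.1 z.2) z := by
  have h1 : ContinuousAt (fun z : ℝ × ℝ => p ((z.1 - z.2) / 2)) z :=
    ContinuousAt.comp (g := p) h (by fun_prop)
  have h2 : Continuous fun z : ℝ × ℝ => leftInt p w z.1 (z.2 - z.1) :=
    (continuous_leftInt hp hw).comp (by fun_prop : Continuous fun z : ℝ × ℝ => (z.1, z.2 - z.1))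
  exact (continuousAt_const.mul h1).sub (continuousAt_const.mul h2.continuousAt)

lemma IsKernel.contDiffOn_one {p : ℝ → ℝ} (hp : Integrable p) {a b : ℝ} {w : ℝ → ℝ → ℝ}
    (hw : IsKernel p a b w) {s : Set (ℝ × ℝ)} (hs : IsOpen s)
    (h : ∀ z ∈ s, |z.1| < z.2 ∧ ContinuousAt p ((z.1 + z.2) / 2) ∧
      ContinuousAt p ((z.1 - z.2) / 2)) :
    ContDiffOn ℝ 1 (Function.uncurry w) s := by
  intro z hz
  refine ContDiffAt.contDiffWithinAt ?_
  rw [contDiffAt_one_iff]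
  refine ⟨_, s, hs.mem_nhds hz, ?_, fun v hv => hw.hasFDerivAt hp (h v hv).1 (h v hv).2.1
    (h v hv).2.2⟩
  intro v hv
  refine ContinuousAt.continuousWithinAt (ContinuousAt.add ?_ ?_)
  · exact (continuousAt_kernelDxi hp hw.cont (h v hv).2.1).smul continuousAt_const
  · exact (continuousAt_kernelDeta hp hw.cont (h v hv).2.2).smul continuousAt_const

/-- The product of `p` with a bump function. -/
lemma exists_contDiff_eq_on_Icc {p : ℝ → ℝ} {A B α β : ℝ} (hp : ContDiffOn ℝ 1 p (Ioo A B))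
    (h1 : A < α) (h2 : α ≤ β) (h3 : β < B) :
    ∃ q : ℝ → ℝ, ContDiff ℝ 1 q ∧ ∀ y ∈ Icc α β, q y = p y := by
  set δ := min (α - A) (B - β) / 3 with hδ
  have hδ0 : 0 < δ := by
    have : 0 < min (α - A) (B - β) := lt_min (by linarith) (by linarith)
    positivity
  have hδ1 : 3 * δ ≤ α - A := by rw [hδ]; linarith [min_le_left (α - A) (B - β)]
  have hδ2 : 3 * δ ≤ B - β := by rw [hδ]; linarith [min_le_right (α - A) (B - β)]
  let χ : ContDiffBump ((α + β) / 2) := ⟨(β - α) / 2 + δ, (β - α) / 2 + 2 * δ, by linarith,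
    by linarith⟩
  refine ⟨fun y => χ y * p y, contDiff_iff_contDiffAt.2 fun y => ?_, fun y hy => ?_⟩
  · by_cases hy : y ∈ Ioo A B
    · exact χ.contDiff.contDiffAt.mul (hp.contDiffAt (isOpen_Ioo.mem_nhds hy))
    · have : y ∈ (tsupport χ)ᶜ := by
        rw [χ.tsupport_eq]
        intro hy'
        have hy'' := hy'
        rw [Metric.mem_closedBall, Real.dist_eq, abs_le] at hy''
        have h5 : χ.rOut = (β - α) / 2 + 2 * δ := rfl
        rw [h5] at hy''
        exact hy ⟨by linarith [hy''.1], by linarith [hy''.2]⟩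
      refine (contDiffAt_const (c := (0 : ℝ))).congr_of_eventuallyEq ?_
      filter_upwards [(isClosed_tsupport χ).isOpen_compl.mem_nhds this] with v hv
      simp [image_eq_zero_of_notMem_tsupport hv]
  · have : χ y = 1 := χ.one_of_mem_closedBall (by
      have h5 : χ.rIn = (β - α) / 2 + δ := rfl
      rw [Metric.mem_closedBall, Real.dist_eq, abs_le, h5]
      constructor <;> linarith [hy.1, hy.2])
    simp [this]

/-- The edge integral is continuously differentiable, although `w_η` need not be bounded along the
edge: in the coordinate `r = ξ/2 - y` the integrand is `p(ξ/2 - r) w(ξ/2 - r, ξ/2 + r)`, and its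
`ξ`-derivative involves only `p'` and `w_ξ` at points away from the break of the potential. -/
lemma IsKernel.contDiffAt_rightInt {p : ℝ → ℝ} (hp : Integrable p) {a b : ℝ} {w : ℝ → ℝ → ℝ}
    (hw : IsKernel p a b w) {l : ℝ} (h1 : ContDiffOn ℝ 1 p (Ioo 0 l))
    (h2 : ContinuousOn p (Ioo (-l) 0)) {x₀ t₀ : ℝ} (hx0 : 0 < x₀) (hxt : x₀ < t₀)
    (hl : x₀ + t₀ < 2 * l) :
    ContDiffAt ℝ 1 (fun z : ℝ × ℝ => rightInt p w z.1 (z.1 + z.2)) (x₀, t₀) := by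
  set ξ₀ := x₀ + t₀ with hξ₀
  obtain ⟨q, hq, hqp⟩ := exists_contDiff_eq_on_Icc h1 (α := x₀ / 2) (β := (ξ₀ / 2 + l) / 2)
    (by linarith) (by linarith) (by linarith)
  have hpc : ∀ y ∈ Ioo 0 l, ContinuousAt p y := fun y hy =>
    h1.continuousOn.continuousAt (isOpen_Ioo.mem_nhds hy)
  have hpc' : ∀ y ∈ Ioo (-l) 0, ContinuousAt p y := fun y hy =>
    h2.continuousAt (isOpen_Ioo.mem_nhds hy)
  set κ : ℝ → ℝ → ℝ := fun ξ r => q (ξ / 2 - r) * w (ξ / 2 - r) (ξ / 2 + r) with hκ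
  set κ' : ℝ → ℝ → ℝ := fun ξ r => (deriv q (ξ / 2 - r) * (1 / 2)) * w (ξ / 2 - r) (ξ / 2 + r)
    + q (ξ / 2 - r) * (-(a / 4) * q (ξ / 2) - 1 / 2 * rightInt p w (ξ / 2 - r) ξ) with hκ'
  have hqc := hq.continuous
  have hqd := hq.continuous_deriv le_rfl
  have hwc : Continuous fun z : ℝ × ℝ => w (z.1 / 2 - z.2) (z.1 / 2 + z.2) :=
    hw.cont.comp (by fun_prop : Continuous fun z : ℝ × ℝ => (z.1 / 2 - z.2, z.1 / 2 + z.2))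
  have hrc : Continuous fun z : ℝ × ℝ => rightInt p w (z.1 / 2 - z.2) z.1 :=
    (continuous_rightInt hp hw.cont).comp
      (by fun_prop : Continuous fun z : ℝ × ℝ => (z.1 / 2 - z.2, z.1))
  have hκc : Continuous (Function.uncurry κ) := by
    exact (hqc.comp (by fun_prop : Continuous fun z : ℝ × ℝ => z.1 / 2 - z.2)).mul hwc
  have hκc' : Continuous (Function.uncurry κ') := by
    have m1 : Continuous fun z : ℝ × ℝ => z.1 / 2 - z.2 := by fun_prop
    have m2 : Continuous fun z : ℝ × ℝ => z.1 / 2 := by fun_prop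
    exact (((hqd.comp m1).mul continuous_const).mul hwc).add ((hqc.comp m1).mul
      ((continuous_const.mul (hqc.comp m2)).sub (continuous_const.mul hrc)))
  have key := contDiffAt_param_integral (p := fun _ => 1)
    (continuous_const (y := (1 : ℝ))).locallyIntegrable hκc hκc'
    (c := 0) (d := ξ₀ / 2 - x₀ * (3 / 4)) (x₀ := (t₀ - x₀) / 2) (η₀ := ξ₀)
    ⟨by linarith, by linarith⟩ (I := Ioo (ξ₀ - x₀ / 2) (ξ₀ / 2 + l))
    (isOpen_Ioo.mem_nhds ⟨by linarith, by linarith⟩) (fun ξ hξ r hr => ?_)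
    (Eventually.of_forall fun _ => continuousAt_const)
  · have hcomp : ContDiffAt ℝ 1 (fun z : ℝ × ℝ => (z.1 + z.2, (z.2 - z.1) / 2)) (x₀, t₀) := by
      fun_prop
    have key2 := ContDiffAt.comp (x₀, t₀) (f := fun z : ℝ × ℝ => (z.1 + z.2, (z.2 - z.1) / 2))
      (g := fun z : ℝ × ℝ => ∫ y in (0 : ℝ)..z.2, 1 * κ z.1 y) key hcomp
    refine key2.congr_of_eventuallyEq ?_
    have hev : ∀ᶠ z : ℝ × ℝ in 𝓝 (x₀, t₀),
        x₀ / 2 < z.1 ∧ z.1 < z.2 ∧ (z.1 + z.2) / 2 < (ξ₀ / 2 + l) / 2 :=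
      ((isOpen_lt (by fun_prop) (by fun_prop)).and ((isOpen_lt (by fun_prop) (by fun_prop)).and
        (isOpen_lt (by fun_prop) (by fun_prop)))).mem_nhds
        ⟨by simp only; linarith, hxt, by simp only; linarith⟩
    filter_upwards [hev] with z ⟨hz1, hz2, hz3⟩
    have e := intervalIntegral.integral_comp_sub_left (fun y => p y * w y (z.1 + z.2 - y))
      ((z.1 + z.2) / 2) (a := 0) (b := (z.2 - z.1) / 2)
    rw [sub_zero, show (z.1 + z.2) / 2 - (z.2 - z.1) / 2 = z.1 by ring] at e
    rw [rightInt, ← e]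
    refine intervalIntegral.integral_congr fun r hr => ?_
    rw [uIcc_of_le (by linarith)] at hr
    simp only [hκ, one_mul]
    rw [hqp _ ⟨by linarith [hr.2], by linarith [hr.1]⟩,
      show z.1 + z.2 - ((z.1 + z.2) / 2 - r) = (z.1 + z.2) / 2 + r by ring]
  · have m1 : HasDerivAt (fun s : ℝ => s / 2 - r) (1 / 2) ξ :=
      ((hasDerivAt_id' ξ).div_const 2).sub_const r
    have m2 : HasDerivAt (fun s : ℝ => s / 2 + r) (1 / 2) ξ :=
      ((hasDerivAt_id' ξ).div_const 2).add_const r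
    have e1 : (ξ / 2 - r + (ξ / 2 + r)) / 2 = ξ / 2 := by ring
    have e2 : (ξ / 2 - r - (ξ / 2 + r)) / 2 = -r := by ring
    have d1 := hw.hasFDerivAt hp (x := ξ / 2 - r) (t := ξ / 2 + r)
      (abs_lt.2 ⟨by linarith [hξ.1, hr.1], by linarith [hr.1]⟩)
      (by rw [e1]; exact hpc _ ⟨by linarith [hξ.1], by linarith [hξ.2]⟩)
      (by rw [e2]; exact hpc' _ ⟨by linarith [hr.2], by linarith [hr.1]⟩)
    have d2 := HasFDerivAt.comp_hasDerivAt (f := fun s : ℝ => (s / 2 - r, s / 2 + r)) ξ d1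
      (m1.prodMk m2)
    have d3 := HasDerivAt.comp (h₂ := q) (h := fun s : ℝ => s / 2 - r) ξ
      ((hq.differentiable one_ne_zero).differentiableAt.hasDerivAt) m1
    refine (d3.mul d2).congr_deriv ?_
    simp only [hκ', hqp (ξ / 2) ⟨by linarith [hξ.1], by linarith [hξ.2]⟩, Function.comp,
      Function.uncurry]
    congr 2
    simp only [kernelDxi, e1, add_apply, smul_apply, sub_apply, ContinuousLinearMap.coe_fst',
      ContinuousLinearMap.coe_snd', smul_eq_mul, sub_self, mul_zero, add_zero]
    ring_nf

/-- The left-hand edge crosses the break of the potential at the origin. Below the point `-η/4` the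
integral is the reflection of a right-hand edge integral; above it the kernel is continuously
differentiable along the edge, and only `p` itself enters. -/
lemma IsKernel.contDiffAt_leftInt {p : ℝ → ℝ} (hp : Integrable p) {a b : ℝ} {w : ℝ → ℝ → ℝ}
    (hw : IsKernel p a b w) {l : ℝ} (h1 : ContDiffOn ℝ 1 p (Ioo 0 l))
    (h2 : ContDiffOn ℝ 1 p (Ioo (-l) 0)) {x₀ t₀ : ℝ} (hx0 : 0 < x₀) (hxt : x₀ < t₀)
    (hl : x₀ + t₀ < 2 * l) :
    ContDiffAt ℝ 1 (fun z : ℝ × ℝ => leftInt p w z.1 (z.2 - z.1)) (x₀, t₀) := by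
  set η₀ := t₀ - x₀ with hη₀
  set c := -η₀ / 4 with hc
  set δ := (l - (t₀ + x₀) / 2) / 4 with hδ
  have hδ0 : 0 < δ := by rw [hδ]; linarith
  have hneg : ContDiffOn ℝ 1 (fun y => p (-y)) (Ioo 0 l) :=
    h2.comp contDiff_neg.contDiffOn fun y hy => ⟨by linarith [hy.2], by linarith [hy.1]⟩
  have hneg' : ContinuousOn (fun y => p (-y)) (Ioo (-l) 0) :=
    h1.continuousOn.comp continuous_neg.continuousOn fun y hy =>
      ⟨by linarith [hy.2], by linarith [hy.1]⟩
  -- the part of the edge near the characteristic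
  have k1 : ContDiffAt ℝ 1 (fun z : ℝ × ℝ => leftInt p w c (z.2 - z.1)) (x₀, t₀) := by
    have e := hw.reflect.contDiffAt_rightInt hp.comp_neg hneg hneg' (x₀ := -c) (t₀ := η₀ + c)
      (by linarith) (by linarith) (by linarith)
    have e2 : ContDiffAt ℝ 1 (fun z : ℝ × ℝ => (-c, z.2 - z.1 + c)) (x₀, t₀) := by fun_prop
    have e3 := ContDiffAt.comp (x₀, t₀) (f := fun z : ℝ × ℝ => (-c, z.2 - z.1 + c)) e e2
    refine e3.congr_of_eventuallyEq (Eventually.of_forall fun z => ?_)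
    simp only [leftInt_eq_rightInt, Function.comp]
    congr 1; ring
  obtain ⟨q, hq, hqp⟩ := exists_contDiff_eq_on_Icc h1 (α := η₀ / 8) (β := l - δ)
    (by linarith) (by linarith) (by linarith)
  obtain ⟨q', hq', hqp'⟩ := exists_contDiff_eq_on_Icc h2 (α := -(η₀ / 2 + δ)) (β := -(3 * η₀ / 8))
    (by linarith) (by linarith) (by linarith)
  have hpc : ∀ y ∈ Ioo 0 l, ContinuousAt p y := fun y hy =>
    h1.continuousOn.continuousAt (isOpen_Ioo.mem_nhds hy)
  have hpc' : ∀ y ∈ Ioo (-l) 0, ContinuousAt p y := fun y hy =>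
    h2.continuousOn.continuousAt (isOpen_Ioo.mem_nhds hy)
  set κ : ℝ → ℝ → ℝ := fun η y => w y (η + y) with hκ
  set κ' : ℝ → ℝ → ℝ := fun η y =>
    (-(a / 4) * q (η / 2 + y) - 1 / 2 * rightInt p w y (y + (η + y)))
    + (-(b / 4) * q' (-(η / 2)) - 1 / 2 * leftInt p w y η) with hκ'
  have hκc : Continuous (Function.uncurry κ) :=
    hw.cont.comp (by fun_prop : Continuous fun z : ℝ × ℝ => (z.2, z.1 + z.2))
  have hκc' : Continuous (Function.uncurry κ') := by
    have m1 : Continuous fun z : ℝ × ℝ => z.1 / 2 + z.2 := by fun_prop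
    have m2 : Continuous fun z : ℝ × ℝ => -(z.1 / 2) := by fun_prop
    have m3 : Continuous fun z : ℝ × ℝ => (z.2, z.2 + (z.1 + z.2)) := by fun_prop
    have m4 : Continuous fun z : ℝ × ℝ => (z.2, z.1) := by fun_prop
    exact ((continuous_const.mul (hq.continuous.comp m1)).sub
        (continuous_const.mul ((continuous_rightInt hp hw.cont).comp m3))).add
      ((continuous_const.mul (hq'.continuous.comp m2)).sub
        (continuous_const.mul ((continuous_leftInt hp hw.cont).comp m4)))
  have key := contDiffAt_param_integral hp.locallyIntegrable hκc hκc'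
    (c := c) (d := x₀ + δ) (x₀ := x₀) (η₀ := η₀) ⟨by linarith, by linarith⟩
    (I := Ioo (3 * η₀ / 4) (η₀ + 2 * δ))
    (isOpen_Ioo.mem_nhds ⟨by linarith, by linarith⟩) (fun η hη y hy => ?_)
    (by filter_upwards [isOpen_Ioo.mem_nhds (⟨hx0, by linarith⟩ : x₀ ∈ Ioo 0 l)] with x hx
          using hpc x hx)
  · have hcomp : ContDiffAt ℝ 1 (fun z : ℝ × ℝ => (z.2 - z.1, z.1)) (x₀, t₀) := by fun_prop
    have key2 := ContDiffAt.comp (x₀, t₀) (f := fun z : ℝ × ℝ => (z.2 - z.1, z.1))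
      (g := fun z : ℝ × ℝ => ∫ y in c..z.2, p y * κ z.1 y) key hcomp
    refine (k1.add key2).congr_of_eventuallyEq (Eventually.of_forall fun z => ?_)
    have hcw : Continuous fun y => w y (z.2 - z.1 + y) :=
      hw.cont.comp (by fun_prop : Continuous fun y => (y, z.2 - z.1 + y))
    exact (intervalIntegral.integral_add_adjacent_intervals
      (integrable_mul_of_continuous hp hcw _ _) (integrable_mul_of_continuous hp hcw _ _)).symm
  · have e1 : (y + (η + y)) / 2 = η / 2 + y := by ring
    have e2 : (y - (η + y)) / 2 = -(η / 2) := by ring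
    have b1 : η / 2 + y ∈ Icc (η₀ / 8) (l - δ) :=
      ⟨by linarith [hη.1, hy.1], by linarith [hη.2, hy.2]⟩
    have b2 : -(η / 2) ∈ Icc (-(η₀ / 2 + δ)) (-(3 * η₀ / 8)) :=
      ⟨by linarith [hη.2], by linarith [hη.1]⟩
    have d1 := hw.hasFDerivAt hp (x := y) (t := η + y)
      (abs_lt.2 ⟨by linarith [hη.1, hy.1], by linarith [hη.1]⟩)
      (by rw [e1]; exact hpc _ ⟨by linarith [b1.1], by linarith [b1.2]⟩)
      (by rw [e2]; exact hpc' _ ⟨by linarith [b2.1], by linarith [b2.2]⟩)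
    have d2 := HasFDerivAt.comp_hasDerivAt (f := fun s : ℝ => (y, s + y)) η d1
      ((hasDerivAt_const η y).prodMk ((hasDerivAt_id' η).add_const y))
    refine d2.congr_deriv ?_
    rw [kernelDxi, kernelDeta, e1, e2]
    simp [hκ', hqp _ b1, hqp' _ b2]

lemma hasDerivAt_rightInt {p : ℝ → ℝ} (hp : Integrable p) {w : ℝ → ℝ → ℝ}
    (hw : Continuous (Function.uncurry w)) {x ξ : ℝ} (hx : ContinuousAt p x) :
    HasDerivAt (fun y => rightInt p w y ξ) (-(p x * w x (ξ - x))) x := by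
  have hc : Continuous fun y => w y (ξ - y) :=
    hw.comp (by fun_prop : Continuous fun y => (y, ξ - y))
  exact intervalIntegral.integral_hasDerivAt_left (integrable_mul_of_continuous hp hc _ _)
    (hp.aestronglyMeasurable.mul hc.aestronglyMeasurable).stronglyMeasurableAtFilter
    (hx.mul hc.continuousAt)

lemma hasDerivAt_leftInt {p : ℝ → ℝ} (hp : Integrable p) {w : ℝ → ℝ → ℝ}
    (hw : Continuous (Function.uncurry w)) {x η : ℝ} (hx : ContinuousAt p x) :
    HasDerivAt (fun y => leftInt p w y η) (p x * w x (η + x)) x := by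
  have hc : Continuous fun y => w y (η + y) :=
    hw.comp (by fun_prop : Continuous fun y => (y, η + y))
  exact intervalIntegral.integral_hasDerivAt_right (integrable_mul_of_continuous hp hc _ _)
    (hp.aestronglyMeasurable.mul hc.aestronglyMeasurable).stronglyMeasurableAtFilter
    (hx.mul hc.continuousAt)

lemma iteratedDeriv_two_eq {f f' : ℝ → ℝ} {f'' x : ℝ}
    (h1 : ∀ᶠ y in 𝓝 x, HasDerivAt f (f' y) y) (h2 : HasDerivAt f' f'' x) :
    iteratedDeriv 2 f x = f'' := by
  rw [iteratedDeriv_succ, iteratedDeriv_one]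
  have : deriv f =ᶠ[𝓝 x] f' := h1.mono fun y hy => hy.deriv
  rw [this.deriv_eq, h2.deriv]

/-- To the right of the origin a Goursat kernel is a classical solution. -/
theorem IsKernel.classical {p : ℝ → ℝ} (hp : Integrable p) {a b : ℝ} {w : ℝ → ℝ → ℝ}
    (hw : IsKernel p a b w) {l : ℝ} (h1 : ContDiffOn ℝ 1 p (Ioo 0 l))
    (h2 : ContDiffOn ℝ 1 p (Ioo (-l) 0)) :
    ContDiffOn ℝ 2 (Function.uncurry w) {z | 0 < z.1 ∧ z.1 < z.2 ∧ z.1 + z.2 < 2 * l} ∧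
    ∀ x t, 0 < x → x < t → x + t < 2 * l →
      iteratedDeriv 2 (fun s => w x s) t - iteratedDeriv 2 (fun y => w y t) x + p x * w x t
        = 0 := by
  set O : Set (ℝ × ℝ) := {z | 0 < z.1 ∧ z.1 < z.2 ∧ z.1 + z.2 < 2 * l} with hO
  have hOo : IsOpen O := (isOpen_lt (by fun_prop) (by fun_prop)).and
    ((isOpen_lt (by fun_prop) (by fun_prop)).and (isOpen_lt (by fun_prop) (by fun_prop)))
  have hm1 : ∀ z ∈ O, (z.1 + z.2) / 2 ∈ Ioo 0 l := fun z hz => by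
    obtain ⟨h1, h2, h3⟩ := hz
    constructor <;> linarith
  have hm2 : ∀ z ∈ O, (z.1 - z.2) / 2 ∈ Ioo (-l) 0 := fun z hz => by
    obtain ⟨h1, h2, h3⟩ := hz
    constructor <;> linarith
  have hpc : ∀ y ∈ Ioo 0 l, ContinuousAt p y := fun y hy =>
    h1.continuousOn.continuousAt (isOpen_Ioo.mem_nhds hy)
  have hpc' : ∀ y ∈ Ioo (-l) 0, ContinuousAt p y := fun y hy =>
    h2.continuousOn.continuousAt (isOpen_Ioo.mem_nhds hy)
  have hA : ∀ z ∈ O, ContDiffAt ℝ 1 (fun z : ℝ × ℝ => kernelDxi p a w z.1 z.2) z := by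
    intro z hz
    have e1 : ContDiffAt ℝ 1 (fun z : ℝ × ℝ => p ((z.1 + z.2) / 2)) z :=
      ContDiffAt.comp z (g := p) (f := fun z : ℝ × ℝ => (z.1 + z.2) / 2)
        (h1.contDiffAt (isOpen_Ioo.mem_nhds (hm1 z hz))) (by fun_prop)
    exact (contDiffAt_const.mul e1).sub (contDiffAt_const.mul
      (hw.contDiffAt_rightInt hp h1 h2.continuousOn hz.1 hz.2.1 hz.2.2))
  have hB : ∀ z ∈ O, ContDiffAt ℝ 1 (fun z : ℝ × ℝ => kernelDeta p b w z.1 z.2) z := by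
    intro z hz
    have e1 : ContDiffAt ℝ 1 (fun z : ℝ × ℝ => p ((z.1 - z.2) / 2)) z :=
      ContDiffAt.comp z (g := p) (f := fun z : ℝ × ℝ => (z.1 - z.2) / 2)
        (h2.contDiffAt (isOpen_Ioo.mem_nhds (hm2 z hz))) (by fun_prop)
    exact (contDiffAt_const.mul e1).sub (contDiffAt_const.mul
      (hw.contDiffAt_leftInt hp h1 h2 hz.1 hz.2.1 hz.2.2))
  have hF : ∀ z ∈ O, HasFDerivAt (Function.uncurry w) _ z := fun z hz =>
    hw.hasFDerivAt hp (x := z.1) (t := z.2)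
      (abs_lt.2 ⟨by linarith [hz.1, hz.2.1], hz.2.1⟩) (hpc _ (hm1 z hz)) (hpc' _ (hm2 z hz))
  refine ⟨?_, fun x t hx hxt hl => ?_⟩
  · rw [show (2 : WithTop ℕ∞) = 1 + 1 by norm_num, contDiffOn_succ_iff_fderiv_of_isOpen hOo]
    refine ⟨fun z hz => (hF z hz).differentiableAt.differentiableWithinAt, by simp, ?_⟩
    refine ContDiffOn.congr (f := fun z => kernelDxi p a w z.1 z.2 •
      (ContinuousLinearMap.snd ℝ ℝ ℝ + ContinuousLinearMap.fst ℝ ℝ ℝ)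
        + kernelDeta p b w z.1 z.2 • (ContinuousLinearMap.snd ℝ ℝ ℝ - ContinuousLinearMap.fst ℝ ℝ ℝ))
      (fun z hz => ?_) fun z hz => (hF z hz).fderiv
    exact (((hA z hz).smul contDiffAt_const).add
      ((hB z hz).smul contDiffAt_const)).contDiffWithinAt
  · have hz : (x, t) ∈ O := ⟨hx, hxt, hl⟩
    obtain ⟨A', hA'⟩ := (hA _ hz).differentiableAt one_ne_zero
    obtain ⟨B', hB'⟩ := (hB _ hz).differentiableAt one_ne_zero
    have w1 : ∀ᶠ s in 𝓝 t, HasDerivAt (fun s => w x s)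
        (kernelDxi p a w x s + kernelDeta p b w x s) s := by
      have : ∀ᶠ s in 𝓝 t, (x, s) ∈ O :=
        (Continuous.prodMk_right x).continuousAt.eventually (hOo.mem_nhds hz)
      filter_upwards [this] with s hs
      have := HasFDerivAt.comp_hasDerivAt (f := fun s : ℝ => (x, s)) s (hF _ hs)
        ((hasDerivAt_const s x).prodMk (hasDerivAt_id' s))
      refine this.congr_deriv ?_
      simp
    have w2 : ∀ᶠ y in 𝓝 x, HasDerivAt (fun y => w y t)
        (kernelDxi p a w y t - kernelDeta p b w y t) y := by
      have : ∀ᶠ y in 𝓝 x, (y, t) ∈ O :=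
        (Continuous.prodMk_left t).continuousAt.eventually (hOo.mem_nhds hz)
      filter_upwards [this] with y hy
      have := HasFDerivAt.comp_hasDerivAt (f := fun y : ℝ => (y, t)) y (hF _ hy)
        ((hasDerivAt_id' y).prodMk (hasDerivAt_const y t))
      refine this.congr_deriv ?_
      simp; ring
    have a1 := HasFDerivAt.comp_hasDerivAt (f := fun s : ℝ => (x, s)) t hA'
        ((hasDerivAt_const t x).prodMk (hasDerivAt_id' t))
    have b1 := HasFDerivAt.comp_hasDerivAt (f := fun s : ℝ => (x, s)) t hB'
        ((hasDerivAt_const t x).prodMk (hasDerivAt_id' t))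
    have a2 := HasFDerivAt.comp_hasDerivAt (f := fun y : ℝ => (y, t)) x hA'
        ((hasDerivAt_id' x).prodMk (hasDerivAt_const x t))
    have b2 := HasFDerivAt.comp_hasDerivAt (f := fun y : ℝ => (y, t)) x hB'
        ((hasDerivAt_id' x).prodMk (hasDerivAt_const x t))
    rw [iteratedDeriv_two_eq w1 (a1.add b1), iteratedDeriv_two_eq w2 (a2.sub b2)]
    -- the derivatives along the characteristics through `(x, t)`
    have hx0 : ContinuousAt p x := hpc x ⟨hx, by linarith⟩
    have a3 : A' (1, -1) = 1 / 2 * (p x * w x t) := by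
      have q1 := HasFDerivAt.comp_hasDerivAt_of_eq (f := fun y : ℝ => (y, x + t - y)) x hA'
        ((hasDerivAt_id' x).prodMk ((hasDerivAt_id' x).const_sub (x + t))) (by simp)
      have q2 := ((hasDerivAt_rightInt hp hw.cont (ξ := x + t) hx0).const_mul (1 / 2)).const_sub
        (-(a / 4) * p ((x + t) / 2))
      have q3 := q1.unique (q2.congr_of_eventuallyEq (Eventually.of_forall fun y => by
        simp [kernelDxi]))
      rw [q3, show x + t - x = t by ring]; ring
    have b3 : B' (1, 1) = -(1 / 2) * (p x * w x t) := by
      have q1 := HasFDerivAt.comp_hasDerivAt_of_eq (f := fun y : ℝ => (y, t - x + y)) x hB'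
        ((hasDerivAt_id' x).prodMk ((hasDerivAt_id' x).const_add (t - x))) (by simp)
      have q2 := ((hasDerivAt_leftInt hp hw.cont (η := t - x) hx0).const_mul (1 / 2)).const_sub
        (-(b / 4) * p ((x - t) / 2))
      have q3 := q1.unique (q2.congr_of_eventuallyEq (Eventually.of_forall fun y => by
        simp only [kernelDeta, Function.comp]
        rw [show (y - (t - x + y)) / 2 = (x - t) / 2 by ring,
          show t - x + y - y = t - x by ring]))
      rw [q3, show t - x + x = t by ring]; ring
    have a4 : A' (1, -1) = A' (1, 0) - A' (0, 1) := by rw [← map_sub]; simp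
    have b4 : B' (1, 1) = B' (1, 0) + B' (0, 1) := by rw [← map_add]; simp
    linarith

/-! ### The kernel equation in the sense of distributions -/

/-- The wave operator `φ_tt - φ_xx`. -/
def waveOp (φ : ℝ → ℝ → ℝ) (x t : ℝ) : ℝ :=
  iteratedDeriv 2 (fun s => φ x s) t - iteratedDeriv 2 (fun y => φ y t) x

section TestFunctions

variable {φ : ℝ → ℝ → ℝ}

lemma contDiff_fderiv_apply (hφ : ContDiff ℝ ∞ (Function.uncurry φ)) (v : ℝ × ℝ) :
    ContDiff ℝ ∞ fun z => fderiv ℝ (Function.uncurry φ) z v :=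
  (hφ.fderiv_right (m := ∞) (by simp)).clm_apply contDiff_const

lemma hasDerivAt_comp_line {Φ : ℝ × ℝ → ℝ} {u v : ℝ → ℝ} {u' v' s : ℝ}
    (hΦ : DifferentiableAt ℝ Φ (u s, v s)) (hu : HasDerivAt u u' s) (hv : HasDerivAt v v' s) :
    HasDerivAt (fun s => Φ (u s, v s)) (fderiv ℝ Φ (u s, v s) (u', v')) s :=
  HasFDerivAt.comp_hasDerivAt s hΦ.hasFDerivAt (hu.prodMk hv)

lemma waveOp_eq_fderiv_of_contDiffAt {x t : ℝ}
    (hφ : ContDiffAt ℝ 2 (Function.uncurry φ) (x, t)) :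
    waveOp φ x t = fderiv ℝ (fun z => fderiv ℝ (Function.uncurry φ) z (-1, 1)) (x, t) (1, 1) ∧
    waveOp φ x t = fderiv ℝ (fun z => fderiv ℝ (Function.uncurry φ) z (1, 1)) (x, t) (-1, 1) := by
  set Φ := Function.uncurry φ with hΦ
  have hd : ∀ᶠ z in 𝓝 (x, t), DifferentiableAt ℝ Φ z :=
    (hφ.eventually (by simp)).mono fun z hz => hz.differentiableAt (by simp)
  have hd2 : DifferentiableAt ℝ (fderiv ℝ Φ) (x, t) :=
    (hφ.fderiv_right (m := 1) (by norm_num)).differentiableAt (by simp)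
  set M := fderiv ℝ (fderiv ℝ Φ) (x, t) with hM
  have hsymm : ∀ u v, M u v = M v u :=
    second_derivative_symmetric_of_eventually (hd.mono fun y hy => hy.hasFDerivAt)
      hd2.hasFDerivAt
  have hMv : ∀ u v, fderiv ℝ (fun z => fderiv ℝ Φ z v) (x, t) u = M u v := by
    intro u v
    rw [fderiv_clm_apply hd2 (differentiableAt_const v)]
    simp [hM]
  have hd3 : ∀ v, DifferentiableAt ℝ (fun z => fderiv ℝ Φ z v) (x, t) := fun v =>
    hd2.clm_apply (differentiableAt_const v)
  have e1 : iteratedDeriv 2 (fun s => φ x s) t = M (0, 1) (0, 1) := by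
    rw [← hMv]
    refine iteratedDeriv_two_eq (f' := fun s => fderiv ℝ Φ (x, s) (0, 1))
      (((by fun_prop : Continuous fun s : ℝ => (x, s)).continuousAt.eventually hd).mono
        fun s hs => hasDerivAt_comp_line hs (hasDerivAt_const s x) (hasDerivAt_id' s)) ?_
    exact hasDerivAt_comp_line (hd3 _) (hasDerivAt_const t x) (hasDerivAt_id' t)
  have e2 : iteratedDeriv 2 (fun y => φ y t) x = M (1, 0) (1, 0) := by
    rw [← hMv]
    refine iteratedDeriv_two_eq (f' := fun y => fderiv ℝ Φ (y, t) (1, 0))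
      (((by fun_prop : Continuous fun y : ℝ => (y, t)).continuousAt.eventually hd).mono
        fun s hs => hasDerivAt_comp_line hs (hasDerivAt_id' s) (hasDerivAt_const s t)) ?_
    exact hasDerivAt_comp_line (hd3 _) (hasDerivAt_id' x) (hasDerivAt_const x t)
  have s1 : ((1, 1) : ℝ × ℝ) = (1, 0) + (0, 1) := by simp
  have s2 : ((-1, 1) : ℝ × ℝ) = -(1, 0) + (0, 1) := by simp
  have s3 := hsymm (1, 0) (0, 1)
  rw [hMv, hMv, waveOp, e1, e2, s1, s2]
  simp only [map_add, map_neg, add_apply, neg_apply]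
  constructor <;> linarith

lemma waveOp_eq_fderiv (hφ : ContDiff ℝ ∞ (Function.uncurry φ)) (x t : ℝ) :
    waveOp φ x t = fderiv ℝ (fun z => fderiv ℝ (Function.uncurry φ) z (-1, 1)) (x, t) (1, 1) ∧
    waveOp φ x t = fderiv ℝ (fun z => fderiv ℝ (Function.uncurry φ) z (1, 1)) (x, t) (-1, 1) :=
  waveOp_eq_fderiv_of_contDiffAt ((contDiff_infty.1 hφ 2).contDiffAt)

lemma continuous_waveOp (hφ : ContDiff ℝ ∞ (Function.uncurry φ)) :
    Continuous (Function.uncurry (waveOp φ)) := by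
  have : Function.uncurry (waveOp φ) =
      fun z => fderiv ℝ (fun z => fderiv ℝ (Function.uncurry φ) z (-1, 1)) z (1, 1) := by
    ext z; exact (waveOp_eq_fderiv hφ z.1 z.2).1
  rw [this]
  exact ((contDiff_fderiv_apply hφ (-1, 1)).continuous_fderiv (by simp)).clm_apply
    continuous_const

lemma hasCompactSupport_waveOp (hφ : ContDiff ℝ ∞ (Function.uncurry φ))
    (hc : HasCompactSupport (Function.uncurry φ)) :
    HasCompactSupport (Function.uncurry (waveOp φ)) := by
  have : Function.uncurry (waveOp φ) =
      fun z => fderiv ℝ (fun z => fderiv ℝ (Function.uncurry φ) z (-1, 1)) z (1, 1) := by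
    ext z; exact (waveOp_eq_fderiv hφ z.1 z.2).1
  rw [this]
  exact (hc.fderiv_apply (𝕜 := ℝ) (-1, 1)).fderiv_apply (𝕜 := ℝ) (1, 1)

lemma tsupport_waveOp_subset (hφ : ContDiff ℝ ∞ (Function.uncurry φ)) :
    tsupport (Function.uncurry (waveOp φ)) ⊆ tsupport (Function.uncurry φ) := by
  have : Function.uncurry (waveOp φ) =
      fun z => fderiv ℝ (fun z => fderiv ℝ (Function.uncurry φ) z (-1, 1)) z (1, 1) := by
    ext z; exact (waveOp_eq_fderiv hφ z.1 z.2).1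
  rw [this]
  exact (tsupport_fderiv_apply_subset ℝ _).trans (tsupport_fderiv_apply_subset ℝ _)

lemma isClosedEmbedding_graph {g : ℝ → ℝ} (hg : Continuous g) :
    IsClosedEmbedding fun x : ℝ => (x, g x) :=
  (Topology.IsClosedEmbedding.of_continuous_injective_isClosedMap
    (by fun_prop) (fun x y h => (Prod.ext_iff.1 h).1) (by
      intro s hs
      have : (fun x : ℝ => (x, g x)) '' s = {z : ℝ × ℝ | z.1 ∈ s ∧ z.2 = g z.1} := by
        ext z
        constructor
        · rintro ⟨x, hx, rfl⟩; exact ⟨hx, rfl⟩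
        · rintro ⟨h1, h2⟩; exact ⟨z.1, h1, Prod.ext rfl h2.symm⟩
      rw [this]
      exact (hs.preimage continuous_fst).and
        (isClosed_eq (by fun_prop) (by fun_prop))))

/-- Integrating `φ_tt - φ_xx` over the boundary of a forward light cone: on each of the two rays
the integrand is a total derivative. -/
lemma integral_waveOp_cone (hφ : ContDiff ℝ ∞ (Function.uncurry φ))
    (hc : HasCompactSupport (Function.uncurry φ)) (y τ : ℝ) :
    ∫ x, waveOp φ x (τ + |x - y|) = -2 * deriv (fun s => φ y s) τ := by
  set Φ := Function.uncurry φ with hΦ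
  have hd : ∀ v, ContDiff ℝ ∞ fun z => fderiv ℝ Φ z v := fun v => contDiff_fderiv_apply hφ v
  have hi : Integrable fun x => waveOp φ x (τ + |x - y|) :=
    ((continuous_waveOp hφ).comp (by fun_prop : Continuous fun x => (x, τ + |x - y|))
      ).integrable_of_hasCompactSupport ((hasCompactSupport_waveOp hφ hc).comp_isClosedEmbedding
        (isClosedEmbedding_graph (g := fun x => τ + |x - y|) (by fun_prop)))
  have r1 : ∫ x in Ioi y, waveOp φ x (τ + |x - y|) = -fderiv ℝ Φ (y, τ) (-1, 1) := by
    have h1 : ContDiff ℝ 1 fun x => fderiv ℝ Φ (x, τ + (x - y)) (-1, 1) :=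
      ((hd (-1, 1)).comp (g := fun z => fderiv ℝ Φ z (-1, 1))
        (by fun_prop : ContDiff ℝ ∞ fun x => (x, τ + (x - y)))).of_le (by simp)
    have h2 := HasCompactSupport.integral_Ioi_deriv_eq h1
      ((hc.fderiv_apply (𝕜 := ℝ) (-1, 1)).comp_isClosedEmbedding
        (isClosedEmbedding_graph (g := fun x => τ + (x - y)) (by fun_prop))) y
    rw [sub_self, add_zero] at h2
    rw [← h2]
    refine setIntegral_congr_fun measurableSet_Ioi fun x hx => ?_
    have h3 := hasDerivAt_comp_line ((hd (-1, 1)).differentiable (by simp) _) (hasDerivAt_id' x)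
      (((hasDerivAt_id' x).sub_const y).const_add τ)
    change _ = deriv (fun x => fderiv ℝ Φ (x, τ + (x - y)) (-1, 1)) x
    rw [h3.deriv, abs_of_pos (sub_pos.2 hx)]
    exact (waveOp_eq_fderiv hφ _ _).1
  have r2 : ∫ x in Iic y, waveOp φ x (τ + |x - y|) = -fderiv ℝ Φ (y, τ) (1, 1) := by
    have h1 : ContDiff ℝ 1 fun x => fderiv ℝ Φ (x, τ + (y - x)) (1, 1) :=
      ((hd (1, 1)).comp (g := fun z => fderiv ℝ Φ z (1, 1))
        (by fun_prop : ContDiff ℝ ∞ fun x => (x, τ + (y - x)))).of_le (by simp)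
    have h2 := HasCompactSupport.integral_Iic_deriv_eq h1
      ((hc.fderiv_apply (𝕜 := ℝ) (1, 1)).comp_isClosedEmbedding
        (isClosedEmbedding_graph (g := fun x => τ + (y - x)) (by fun_prop))) y
    rw [sub_self, add_zero] at h2
    rw [← h2, ← integral_neg]
    refine setIntegral_congr_fun measurableSet_Iic fun x hx => ?_
    have h3 := hasDerivAt_comp_line ((hd (1, 1)).differentiable (by simp) _) (hasDerivAt_id' x)
      (((hasDerivAt_id' x).const_sub y).const_add τ)
    change _ = -deriv (fun x => fderiv ℝ Φ (x, τ + (y - x)) (1, 1)) x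
    rw [h3.deriv, abs_of_nonpos (sub_nonpos.2 hx), neg_sub, (waveOp_eq_fderiv hφ _ _).2,
      ← map_neg]
    simp only [Prod.neg_mk, neg_neg]
    rfl
  have e := hasDerivAt_comp_line (hφ.differentiable (by simp) _) (hasDerivAt_const τ y)
    (hasDerivAt_id' τ)
  have e' : deriv (fun s => φ y s) τ = fderiv ℝ Φ (y, τ) (0, 1) := e.deriv
  have s : ((-1, 1) : ℝ × ℝ) + (1, 1) = (2 : ℝ) • (0, 1) := by ext <;> norm_num
  have s' := congrArg (fderiv ℝ Φ (y, τ)) s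
  rw [map_add, map_smul, smul_eq_mul] at s'
  rw [← intervalIntegral.integral_Iic_add_Ioi hi.integrableOn hi.integrableOn, r1, r2, e']
  linarith

end TestFunctions

/-- The cumulative distribution in time of the measure `step(y) δ_{|y|} + w(y, s) ds` on the light
cone. -/
def coneCum (a b : ℝ) (w : ℝ → ℝ → ℝ) (y τ : ℝ) : ℝ :=
  if |y| ≤ τ then step a b y + ∫ s in |y|..τ, w y s else 0

lemma measurable_step (a b : ℝ) : Measurable (step a b) :=
  Measurable.ite measurableSet_Ioi measurable_const measurable_const

lemma abs_step_le (a b y : ℝ) : |step a b y| ≤ max |a| |b| := by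
  unfold step; split_ifs <;> simp

lemma coneCum_eq (a b : ℝ) (w : ℝ → ℝ → ℝ) (y τ : ℝ) :
    coneCum a b w y τ = (if |y| ≤ τ then step a b y else 0) + coneInt w y τ := by
  unfold coneCum
  split_ifs with h
  · rw [coneInt_of_ge h]
  · rw [coneInt_of_le (not_le.1 h).le, add_zero]

lemma locBdd_coneStep (a b : ℝ) : LocBdd fun y τ => if |y| ≤ τ then step a b y else 0 := by
  refine ⟨Measurable.ite (measurableSet_le (by fun_prop) (by fun_prop))
    ((measurable_step a b).comp measurable_fst) measurable_const, fun R =>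
    ⟨max |a| |b|, fun y τ _ => ?_⟩⟩
  split_ifs
  · exact abs_step_le a b y
  · simp

lemma LocBdd.add {G G' : ℝ → ℝ → ℝ} (h : LocBdd G) (h' : LocBdd G') :
    LocBdd fun y τ => G y τ + G' y τ := by
  refine ⟨h.meas.add h'.meas, fun R => ?_⟩
  obtain ⟨C, hC⟩ := h.bdd R
  obtain ⟨C', hC'⟩ := h'.bdd R
  exact ⟨C + C', fun y τ hτ => (abs_add_le _ _).trans (add_le_add (hC y τ hτ) (hC' y τ hτ))⟩

lemma locBdd_coneCum (a b : ℝ) {w : ℝ → ℝ → ℝ} (hw : Continuous (Function.uncurry w)) :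
    LocBdd (coneCum a b w) := by
  have : coneCum a b w = fun y τ => (if |y| ≤ τ then step a b y else 0) + coneInt w y τ := by
    ext y τ; exact coneCum_eq a b w y τ
  rw [this]
  exact (locBdd_coneStep a b).add (locBdd_coneInt hw)

lemma potInt_coneCum {p : ℝ → ℝ} (hp : Integrable p) (a b : ℝ) {w : ℝ → ℝ → ℝ}
    (hw : Continuous (Function.uncurry w)) {x t : ℝ} (h : |x| ≤ t) :
    potInt p (coneCum a b w) x t
      = (∫ y in (x - t) / 2..(x + t) / 2, p y * step a b y) + potInt p (coneInt w) x t := by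
  obtain ⟨h1, h2⟩ := abs_le.1 h
  have e : ∀ y, p y * coneCum a b w y (t - |x - y|)
      = p y * (if |y| ≤ t - |x - y| then step a b y else 0)
        + p y * coneInt w y (t - |x - y|) := fun y => by rw [coneCum_eq, mul_add]
  simp only [potInt, e]
  rw [integral_add ((locBdd_coneStep a b).integrable_mul hp x t)
    ((locBdd_coneInt hw).integrable_mul hp x t)]
  congr 1
  have e : ∀ y, p y * (if |y| ≤ t - |x - y| then step a b y else 0)
      = (Icc ((x - t) / 2) ((x + t) / 2)).indicator (fun y => p y * step a b y) y := by
    intro y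
    by_cases hy : y ∈ Icc ((x - t) / 2) ((x + t) / 2)
    · rw [indicator_of_mem hy, if_pos (abs_le_sub_abs_iff.2 ⟨h, hy.1, hy.2⟩)]
    · rw [indicator_of_notMem hy, if_neg, mul_zero]
      exact fun h' => hy (abs_le_sub_abs_iff.1 h').2
  simp only [e]
  rw [integral_indicator measurableSet_Icc, integral_Icc_eq_integral_Ioc,
    ← intervalIntegral.integral_of_le (by linarith)]

lemma IsKernel.eq_coneCum {p : ℝ → ℝ} (hp : Integrable p) {a b : ℝ} {w : ℝ → ℝ → ℝ}
    (hw : IsKernel p a b w) {x t : ℝ} (h : |x| ≤ t) :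
    w x t = -(1 / 2) * potInt p (coneCum a b w) x t := by
  rw [potInt_coneCum hp a b hw.cont h, hw.eq x t h]; ring

lemma integrable_mul_of_hasCompactSupport {g h : ℝ × ℝ → ℝ} (hg : Measurable g)
    (hb : ∀ R, ∃ C, ∀ z, z.2 ≤ R → |g z| ≤ C) (hh : Continuous h) (hc : HasCompactSupport h) :
    Integrable fun z => g z * h z := by
  obtain ⟨R, hR⟩ := (hc.isCompact.image continuous_snd).bddAbove
  obtain ⟨C, hC⟩ := hb R
  refine ((hh.integrable_of_hasCompactSupport hc).norm.const_mul C).mono'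
    (hg.aestronglyMeasurable.mul hh.aestronglyMeasurable) (ae_of_all _ fun z => ?_)
  by_cases hz : z ∈ tsupport h
  · rw [norm_mul]
    exact mul_le_mul_of_nonneg_right (hC z (hR ⟨z, hz, rfl⟩)) (norm_nonneg _)
  · simp [image_eq_zero_of_notMem_tsupport hz]

/-- The shear `(x, τ) ↦ (x, τ + |x - y|)` flattening the forward cones with vertices over `y`. -/
def coneShear (y : ℝ) : ℝ × ℝ ≃ₜ ℝ × ℝ where
  toFun z := (z.1, z.2 + |z.1 - y|)
  invFun z := (z.1, z.2 - |z.1 - y|)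
  left_inv z := by simp
  right_inv z := by simp
  continuous_toFun := by fun_prop
  continuous_invFun := by fun_prop

lemma isClosedEmbedding_prodMk_right (y : ℝ) : IsClosedEmbedding fun s : ℝ => (y, s) :=
  Topology.IsClosedEmbedding.of_continuous_injective_isClosedMap (by fun_prop)
    (fun _ _ h => (Prod.ext_iff.1 h).2) (isClosedMap_prodMk_left y)

/-- Pairing the retarded potentials generated at `y` with the wave operator recovers the density
of their sources. -/
lemma integral_coneCum_mul_waveOp (a b : ℝ) {w : ℝ → ℝ → ℝ}
    (hw : Continuous (Function.uncurry w)) {φ : ℝ → ℝ → ℝ}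
    (hφ : ContDiff ℝ ∞ (Function.uncurry φ)) (hc : HasCompactSupport (Function.uncurry φ))
    (hs : tsupport (Function.uncurry φ) ⊆ {z | |z.1| < z.2}) (y : ℝ) :
    ∫ z : ℝ × ℝ, coneCum a b w y (z.2 - |z.1 - y|) * waveOp φ z.1 z.2
      = 2 * ∫ s, w y s * φ y s := by
  have hcw : Continuous (w y) := hw.comp (Continuous.prodMk_right y)
  have hφy : ContDiff ℝ ∞ (φ y) := hφ.comp (by fun_prop : ContDiff ℝ ∞ fun s : ℝ => (y, s))
  have hcy : HasCompactSupport (φ y) :=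
    hc.comp_isClosedEmbedding (isClosedEmbedding_prodMk_right y)
  have hV := locBdd_coneCum a b hw
  have hVm : Measurable (coneCum a b w y) := hV.meas.comp measurable_prodMk_left
  have hh := continuous_waveOp hφ
  have hhc := hasCompactSupport_waveOp hφ hc
  have i1 : Integrable fun z : ℝ × ℝ =>
      coneCum a b w y (z.2 - |z.1 - y|) * Function.uncurry (waveOp φ) z := by
    refine integrable_mul_of_hasCompactSupport (hVm.comp (by fun_prop)) (fun R => ?_) hh hhc
    obtain ⟨C, hC⟩ := hV.bdd R
    exact ⟨C, fun z hz => hC y _ (by linarith [abs_nonneg (z.1 - y)])⟩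
  have i2 : Integrable fun z : ℝ × ℝ =>
      coneCum a b w y z.2 * (Function.uncurry (waveOp φ) ∘ coneShear y) z := by
    refine integrable_mul_of_hasCompactSupport (hVm.comp measurable_snd) (fun R => ?_)
      (hh.comp (coneShear y).continuous)
      (hhc.comp_isClosedEmbedding (coneShear y).isClosedEmbedding)
    obtain ⟨C, hC⟩ := hV.bdd R
    exact ⟨C, fun z hz => hC y _ hz⟩
  have e1 : ∫ z : ℝ × ℝ, coneCum a b w y (z.2 - |z.1 - y|) * waveOp φ z.1 z.2
      = ∫ x, ∫ τ, coneCum a b w y τ * waveOp φ x (τ + |x - y|) := by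
    rw [Measure.volume_eq_prod] at i1 ⊢
    refine (integral_prod _ i1).trans ?_
    congr 1; ext x
    rw [← integral_add_right_eq_self _ (|x - y|)]
    simp
  have e2 : ∫ x, ∫ τ, coneCum a b w y τ * waveOp φ x (τ + |x - y|)
      = ∫ τ, ∫ x, coneCum a b w y τ * waveOp φ x (τ + |x - y|) :=
    integral_integral_swap i2
  rw [e1, e2]
  simp_rw [integral_const_mul, integral_waveOp_cone hφ hc]
  set U : ℝ → ℝ := fun τ => step a b y + ∫ s in |y|..τ, w y s with hU
  have hUd : ∀ τ, HasDerivAt U (w y τ) τ := fun τ =>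
    (intervalIntegral.integral_hasDerivAt_right (hcw.intervalIntegrable |y| τ)
      (hcw.stronglyMeasurableAtFilter _ _) hcw.continuousAt).const_add _
  have hUc : Continuous U := continuous_iff_continuousAt.2 fun τ => (hUd τ).continuousAt
  have hd := hφy.continuous_deriv (by simp)
  have e3 : ∀ τ, coneCum a b w y τ * (-2 * deriv (fun s => φ y s) τ)
      = -2 * (U τ * deriv (φ y) τ) := by
    intro τ
    by_cases h : |y| ≤ τ
    · rw [coneCum, if_pos h]; ring
    · have : deriv (φ y) τ = 0 := by
        have h0 : φ y =ᶠ[𝓝 τ] fun _ => 0 := by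
          filter_upwards [gt_mem_nhds (not_le.1 h)] with s hs'
          by_contra hne
          have h1 := hs (subset_tsupport _ (show (y, s) ∈ Function.support (Function.uncurry φ)
            from hne))
          exact absurd h1 (not_lt.2 hs'.le)
        rw [h0.deriv_eq, deriv_const]
      rw [coneCum, if_neg h, this]; ring
  simp_rw [e3]
  rw [integral_const_mul, integral_mul_deriv_eq_deriv_mul_of_integrable (u := U) (v := φ y)
    (u' := w y) (v' := deriv (φ y)) (fun x _ => hUd x)
    (fun x _ => (hφy.differentiable (by simp) x).hasDerivAt)
    ((hUc.mul hd).integrable_of_hasCompactSupport hcy.deriv.mul_left)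
    ((hcw.mul hφy.continuous).integrable_of_hasCompactSupport hcy.mul_left)
    ((hUc.mul hφy.continuous).integrable_of_hasCompactSupport hcy.mul_left)]
  ring

lemma integrable_mul_mul_of_hasCompactSupport {p : ℝ → ℝ} (hp : Integrable p) {w : ℝ → ℝ → ℝ}
    (hw : Continuous (Function.uncurry w)) {φ : ℝ → ℝ → ℝ}
    (hφ : Continuous (Function.uncurry φ)) (hc : HasCompactSupport (Function.uncurry φ)) :
    Integrable fun z : ℝ × ℝ => p z.1 * (w z.1 z.2 * φ z.1 z.2) := by
  rw [Measure.volume_eq_prod]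
  have hwφ : Continuous fun z : ℝ × ℝ => w z.1 z.2 * φ z.1 z.2 := hw.mul hφ
  have hwφc : HasCompactSupport fun z : ℝ × ℝ => w z.1 z.2 * φ z.1 z.2 :=
    hc.mul_left (f := Function.uncurry w)
  obtain ⟨C, hC⟩ := hwφ.bounded_above_of_compact_support hwφc
  obtain ⟨R, hR⟩ := (hc.isCompact.image continuous_snd).isBounded.subset_closedBall 0
  have hi := hp.mul_prod ((integrable_indicator_iff (measurableSet_Icc (a := -R) (b := R))).2
    (integrableOn_const (C := C) (by simp)) : Integrable ((Icc (-R) R).indicator fun _ => C))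
  refine hi.norm.mono' (hp.aestronglyMeasurable.comp_fst.mul hwφ.aestronglyMeasurable)
    (ae_of_all _ fun z => ?_)
  simp only [norm_mul]
  refine mul_le_mul_of_nonneg_left ?_ (norm_nonneg _)
  by_cases hz : z ∈ tsupport (Function.uncurry φ)
  · have h1 := hR ⟨z, hz, rfl⟩
    rw [Metric.mem_closedBall, Real.dist_eq, sub_zero, abs_le] at h1
    rw [indicator_of_mem (show z.2 ∈ Icc (-R) R from h1), ← norm_mul]
    exact (hC z).trans (le_abs_self C)
  · have := image_eq_zero_of_notMem_tsupport hz
    simp only [Function.uncurry] at this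
    simp [this]

/-- The retarded integral of `coneCum w` solves `W_tt - W_xx = 2 p w` in the light cone in the
sense of distributions. -/
theorem integral_potInt_coneCum_mul_waveOp {p : ℝ → ℝ} (hp : Integrable p) (a b : ℝ)
    {w : ℝ → ℝ → ℝ} (hw : Continuous (Function.uncurry w)) {φ : ℝ → ℝ → ℝ}
    (hφ : ContDiff ℝ ∞ (Function.uncurry φ)) (hc : HasCompactSupport (Function.uncurry φ))
    (hs : tsupport (Function.uncurry φ) ⊆ {z | |z.1| < z.2}) :
    ∫ z : ℝ × ℝ, potInt p (coneCum a b w) z.1 z.2 * waveOp φ z.1 z.2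
      = 2 * ∫ z : ℝ × ℝ, p z.1 * (w z.1 z.2 * φ z.1 z.2) := by
  have hV := locBdd_coneCum a b hw
  have hh := continuous_waveOp hφ
  have hhc := hasCompactSupport_waveOp hφ hc
  have hhi := hh.integrable_of_hasCompactSupport (μ := volume) hhc
  have i1 : Integrable (Function.uncurry fun (z : ℝ × ℝ) y =>
      p y * (coneCum a b w y (z.2 - |z.1 - y|) * waveOp φ z.1 z.2)) (volume.prod volume) := by
    obtain ⟨R, hR⟩ := (hhc.isCompact.image continuous_snd).bddAbove
    obtain ⟨C, hC⟩ := hV.bdd R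
    have hm : AEStronglyMeasurable (fun q : (ℝ × ℝ) × ℝ => p q.2)
        ((volume : Measure (ℝ × ℝ)).prod volume) := hp.aestronglyMeasurable.comp_snd
    refine ((hhi.norm.mul_prod hp.norm).const_mul C).mono' (hm.mul
      (Measurable.aestronglyMeasurable (Measurable.mul ?_ ?_))) (ae_of_all _ fun q => ?_)
    · exact hV.meas.comp (by fun_prop :
        Measurable fun q : (ℝ × ℝ) × ℝ => (q.2, q.1.2 - |q.1.1 - q.2|))
    · exact hh.measurable.comp measurable_fst
    · by_cases hz : q.1 ∈ tsupport (Function.uncurry (waveOp φ))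
      · have h1 := hC q.2 (q.1.2 - |q.1.1 - q.2|)
          (by linarith [abs_nonneg (q.1.1 - q.2), hR ⟨q.1, hz, rfl⟩])
        simp only [Function.uncurry, norm_mul, Real.norm_eq_abs]
        have := mul_le_mul_of_nonneg_right h1 (mul_nonneg (abs_nonneg (p q.2))
          (abs_nonneg (waveOp φ q.1.1 q.1.2)))
        linarith
      · have := image_eq_zero_of_notMem_tsupport hz
        simp only [Function.uncurry] at this
        simp [Function.uncurry, this]
  have e1 : ∀ z : ℝ × ℝ, potInt p (coneCum a b w) z.1 z.2 * waveOp φ z.1 z.2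
      = ∫ y, p y * (coneCum a b w y (z.2 - |z.1 - y|) * waveOp φ z.1 z.2) := by
    intro z
    rw [potInt, ← integral_mul_const]
    congr 1; ext y; ring
  simp_rw [e1]
  rw [integral_integral_swap i1]
  simp_rw [integral_const_mul, integral_coneCum_mul_waveOp a b hw hφ hc hs]
  have i2 := integrable_mul_mul_of_hasCompactSupport hp hw hφ.continuous hc
  rw [Measure.volume_eq_prod] at i2 ⊢
  rw [integral_prod _ i2, ← integral_const_mul]
  congr 1; ext y
  change _ = 2 * ∫ s, p y * (w y s * φ y s)
  rw [integral_const_mul]; ring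

/-! ### The periodic potential -/

/-- The periodic continuation of `q`, cut off outside `(-L, L)`. -/
def truncPot (q : ℝ → ℝ) (L : ℝ) : ℝ → ℝ := (Ioo (-L) L).indicator (periodize q)

/-- The multiples of `2π`, where the periodic potential may fail to be smooth. -/
def lattice : Set ℝ := range fun m : ℤ => 2 * (m : ℝ) * Real.pi

lemma countable_lattice : lattice.Countable := countable_range _

lemma notMem_lattice_iff {x : ℝ} : x ∉ lattice ↔ ∀ m : ℤ, x ≠ 2 * m * Real.pi := by
  simp only [lattice, mem_range, not_exists]
  exact forall_congr' fun m => ⟨fun h e => h e.symm, fun h e => h e.symm⟩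

lemma notMem_lattice_of_mem_Ioo {x : ℝ} (m : ℤ) (h : 2 * m * Real.pi < x)
    (h' : x < 2 * (m + 1) * Real.pi) : x ∉ lattice := by
  rw [notMem_lattice_iff]
  rintro k rfl
  have hp := Real.pi_pos
  have h1 : (m : ℝ) < k := by nlinarith
  have h2 : (k : ℝ) < m + 1 := by nlinarith
  have h3 : m < k := by exact_mod_cast h1
  have h4 : k < m + 1 := by exact_mod_cast h2
  omega

lemma periodize_periodic (q : ℝ → ℝ) : Function.Periodic (periodize q) (2 * Real.pi) :=
  fun x => by unfold periodize; rw [toIcoMod_add_right]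

lemma periodize_eq (q : ℝ → ℝ) {x : ℝ} (h : x ∈ Ico 0 (2 * Real.pi)) : periodize q x = q x := by
  unfold periodize
  rw [(toIcoMod_eq_self Real.two_pi_pos).2 (by simpa using h)]

lemma periodize_add (q : ℝ → ℝ) (x : ℝ) (k : ℤ) :
    periodize q (x + 2 * k * Real.pi) = periodize q x := by
  have := (periodize_periodic q).int_mul k x
  rwa [show (k : ℝ) * (2 * Real.pi) = 2 * k * Real.pi by ring] at this

variable {q : ℝ → ℝ}

lemma intervalIntegrable_periodize (hq2 : MemLp q 2 (volume.restrict (Ioo 0 (2 * Real.pi))))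
    (a b : ℝ) : IntervalIntegrable (periodize q) volume a b := by
  refine (periodize_periodic q).intervalIntegrable₀ Real.two_pi_pos.ne' ?_ a b
  rw [intervalIntegrable_iff_integrableOn_Ioo_of_le Real.two_pi_pos.le]
  have h : IntegrableOn q (Ioo 0 (2 * Real.pi)) := hq2.integrable (by norm_num)
  exact h.congr_fun (fun x hx => (periodize_eq q ⟨hx.1.le, hx.2⟩).symm) measurableSet_Ioo

lemma integral_periodize (hq2 : MemLp q 2 (volume.restrict (Ioo 0 (2 * Real.pi)))) (k : ℤ) :
    ∫ x in (0 : ℝ)..2 * k * Real.pi, periodize q x = k * ∫ x in (0 : ℝ)..2 * Real.pi, q x := by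
  have h := (periodize_periodic q).intervalIntegral_add_zsmul_eq k 0
    (intervalIntegrable_periodize hq2)
  rw [zero_add, zero_add, zsmul_eq_mul, zsmul_eq_mul,
    show (k : ℝ) * (2 * Real.pi) = 2 * k * Real.pi by ring] at h
  rw [h]
  congr 1
  refine intervalIntegral.integral_congr_ae ?_
  filter_upwards [compl_mem_ae_iff.2 (measure_singleton (2 * Real.pi) :
    volume {2 * Real.pi} = 0)] with x hx hx'
  rw [uIoc_of_le Real.two_pi_pos.le] at hx'
  exact periodize_eq q ⟨hx'.1.le, lt_of_le_of_ne hx'.2 hx⟩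

lemma exists_int_of_notMem_lattice {x : ℝ} (hx : x ∉ lattice) :
    ∃ k : ℤ, 2 * k * Real.pi < x ∧ x < 2 * (k + 1) * Real.pi := by
  obtain ⟨k, hk⟩ : ∃ k : ℤ, x - k • (2 * Real.pi) ∈ Ico 0 (0 + 2 * Real.pi) :=
    ⟨_, (existsUnique_sub_zsmul_mem_Ico Real.two_pi_pos x 0).choose_spec.1⟩
  rw [zsmul_eq_mul] at hk
  refine ⟨k, lt_of_le_of_ne (by linarith [hk.1]) fun e => hx ⟨k, e⟩, by linarith [hk.2]⟩

lemma contDiffAt_periodize (hq : ContDiffOn ℝ 2 q (Ioo 0 (2 * Real.pi))) {x : ℝ}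
    (hx : x ∉ lattice) : ContDiffAt ℝ 2 (periodize q) x := by
  obtain ⟨k, h1, h2⟩ := exists_int_of_notMem_lattice hx
  have hm : x - 2 * k * Real.pi ∈ Ioo 0 (2 * Real.pi) := ⟨by linarith, by linarith⟩
  have h3 : ContDiffAt ℝ 2 (fun y => q (y - 2 * k * Real.pi)) x :=
    (hq.contDiffAt (isOpen_Ioo.mem_nhds hm)).comp x (f := fun y => y - 2 * k * Real.pi)
      (by fun_prop)
  refine h3.congr_of_eventuallyEq ?_
  filter_upwards [(by fun_prop : Continuous fun y : ℝ => y - 2 * k * Real.pi).continuousAt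
    (isOpen_Ioo.mem_nhds hm)] with y hy
  have h4 := periodize_add q (y - 2 * k * Real.pi) k
  rw [sub_add_cancel] at h4
  rw [h4]
  exact periodize_eq q ⟨hy.1.le, hy.2⟩

lemma truncPot_eq {L x : ℝ} (h : |x| < L) : truncPot q L x = periodize q x :=
  indicator_of_mem (show x ∈ Ioo (-L) L from abs_lt.1 h) _

lemma integrable_truncPot (hq2 : MemLp q 2 (volume.restrict (Ioo 0 (2 * Real.pi)))) (L : ℝ) :
    Integrable (truncPot q L) := by
  refine (integrable_indicator_iff measurableSet_Ioo).2 ?_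
  rcases le_or_gt (-L) L with h | h
  · exact (intervalIntegrable_iff_integrableOn_Ioo_of_le h).1 (intervalIntegrable_periodize hq2 _ _)
  · rw [Ioo_eq_empty (by linarith)]; exact integrableOn_empty

lemma truncPot_eventuallyEq {L x : ℝ} (h : |x| < L) : truncPot q L =ᶠ[𝓝 x] periodize q := by
  filter_upwards [(isOpen_lt continuous_abs continuous_const).mem_nhds h] with y hy
  exact truncPot_eq hy

lemma contDiffAt_truncPot (hq : ContDiffOn ℝ 2 q (Ioo 0 (2 * Real.pi))) {L x : ℝ} (h : |x| < L)
    (hx : x ∉ lattice) : ContDiffAt ℝ 2 (truncPot q L) x :=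
  (contDiffAt_periodize hq hx).congr_of_eventuallyEq (truncPot_eventuallyEq h)

lemma integral_truncPot (hq2 : MemLp q 2 (volume.restrict (Ioo 0 (2 * Real.pi)))) {L : ℝ} (k : ℤ)
    (h : |2 * (k : ℝ) * Real.pi| ≤ L) :
    ∫ x in (0 : ℝ)..2 * k * Real.pi, truncPot q L x = k * ∫ x in (0 : ℝ)..2 * Real.pi, q x := by
  rw [← integral_periodize hq2]
  refine intervalIntegral.integral_congr_ae ?_
  filter_upwards [compl_mem_ae_iff.2 (measure_singleton (2 * k * Real.pi) :
      volume {2 * k * Real.pi} = 0),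
    compl_mem_ae_iff.2 (measure_singleton (0 : ℝ) : volume {(0 : ℝ)} = 0)] with x hx hx0 hx'
  refine truncPot_eq (lt_of_lt_of_le ?_ h)
  rcases le_total 0 (2 * k * Real.pi) with h0 | h0
  · rw [uIoc_of_le h0] at hx'
    rw [abs_of_pos hx'.1, abs_of_nonneg h0]; exact lt_of_le_of_ne hx'.2 hx
  · rw [uIoc_of_ge h0] at hx'
    have : x < 0 := lt_of_le_of_ne hx'.2 hx0
    rw [abs_of_neg this, abs_of_nonpos h0]; linarith [hx'.1]

/-! ### The line Goursat problem: existence -/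

lemma potInt_coneInt_char (p : ℝ → ℝ) (w : ℝ → ℝ → ℝ) {x t : ℝ} (h : |x| = t) :
    potInt p (coneInt w) x t = 0 := by
  unfold potInt
  rw [← integral_zero ℝ ℝ (μ := volume)]
  congr 1; ext y
  rw [coneInt_of_le, mul_zero]
  rw [← h]
  have := abs_sub_abs_le_abs_sub x y
  linarith

/-- The data on the characteristic, where the retarded integral vanishes. -/
lemma IsKernel.char_right {p : ℝ → ℝ} {a b : ℝ} {w : ℝ → ℝ → ℝ}
    (hw : IsKernel p a b w) {y : ℝ} (hy : 0 ≤ y) : w y y = -(a / 2) * ∫ s in (0 : ℝ)..y, p s := by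
  rw [hw.eq y y (abs_of_nonneg hy).le, potInt_coneInt_char p w (abs_of_nonneg hy), sub_self,
    zero_div, add_self_div_two]
  have : ∫ s in (0 : ℝ)..y, p s * step a b s = ∫ s in (0 : ℝ)..y, p s * a := by
    refine intervalIntegral.integral_congr_ae (ae_of_all _ fun s hs => ?_)
    rw [uIoc_of_le hy] at hs
    rw [step, if_pos hs.1]
  rw [this, intervalIntegral.integral_mul_const]
  ring

lemma IsKernel.char_left {p : ℝ → ℝ} {a b : ℝ} {w : ℝ → ℝ → ℝ}
    (hw : IsKernel p a b w) {y : ℝ} (hy : y ≤ 0) :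
    w y (-y) = -(b / 2) * ∫ s in y..0, p s := by
  have h := hw.reflect.char_right (y := -y) (by linarith)
  rw [neg_neg] at h
  rw [h, intervalIntegral.integral_comp_neg]
  simp

/-- The solution of the integral equation for the truncated potential solves the line Goursat
problem. -/
theorem IsKernel.isLineGoursatKernel (hq : ContDiffOn ℝ 2 q (Ioo 0 (2 * Real.pi)))
    (hq2 : MemLp q 2 (volume.restrict (Ioo 0 (2 * Real.pi)))) {L c : ℝ} {w : ℝ → ℝ → ℝ}
    (hw : IsKernel (truncPot q L) (-2 * c) (-(1 / 2)) w) : IsLineGoursatKernel q L c w := by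
  have hp := integrable_truncPot hq2 L
  refine ⟨hw.cont.continuousOn, fun φ hφ hc hs => ?_, fun x hx hm => ?_, fun x hx hm => ?_, ?_⟩
  · have h1 := integral_potInt_coneCum_mul_waveOp hp (-2 * c) (-(1 / 2)) hw.cont hφ hc
      fun z hz => (hs hz).1
    have hz0 : ∀ z : ℝ × ℝ, z ∉ tsupport (Function.uncurry φ) → φ z.1 z.2 = 0 :=
      fun z hz => image_eq_zero_of_notMem_tsupport (f := Function.uncurry φ) hz
    have hpw : ∀ z : ℝ × ℝ, periodize q z.1 * (w z.1 z.2 * φ z.1 z.2)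
        = truncPot q L z.1 * (w z.1 z.2 * φ z.1 z.2) := by
      intro z
      by_cases hz : z ∈ tsupport (Function.uncurry φ)
      · rw [truncPot_eq ((hs hz).1.trans (hs hz).2)]
      · rw [hz0 z hz]; simp
    have hww : ∀ z : ℝ × ℝ, w z.1 z.2 * waveOp φ z.1 z.2
        = -(1 / 2) * (potInt (truncPot q L) (coneCum (-2 * c) (-(1 / 2)) w) z.1 z.2
            * waveOp φ z.1 z.2) := by
      intro z
      by_cases hz : z ∈ tsupport (Function.uncurry φ)
      · rw [hw.eq_coneCum hp (hs hz).1.le]; ring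
      · have : waveOp φ z.1 z.2 = 0 := by
          by_contra hne
          exact hz (tsupport_waveOp_subset hφ (subset_tsupport _ hne))
        rw [this]; ring
    have i1 : Integrable fun z : ℝ × ℝ => w z.1 z.2 * waveOp φ z.1 z.2 :=
      (hw.cont.mul (continuous_waveOp hφ)).integrable_of_hasCompactSupport
        (hasCompactSupport_waveOp hφ hc).mul_left
    have i2 := integrable_mul_mul_of_hasCompactSupport hp hw.cont hφ.continuous hc
    calc _ = ∫ z : ℝ × ℝ, (w z.1 z.2 * waveOp φ z.1 z.2
          + truncPot q L z.1 * (w z.1 z.2 * φ z.1 z.2)) := by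
          congr 1; ext z
          rw [← hpw z]; simp only [waveOp]; ring
      _ = 0 := by
          rw [integral_add i1 i2]
          simp_rw [hww]
          rw [integral_const_mul, h1]; ring
  · have hxL : |x| < L := abs_lt.2 ⟨by linarith [hx.1, hx.2], hx.2⟩
    have h1 := intervalIntegral.integral_hasDerivAt_right (a := 0) (b := x)
      (hp.intervalIntegrable) (hp.aestronglyMeasurable.stronglyMeasurableAtFilter (l := 𝓝 x))
      (contDiffAt_truncPot hq hxL (notMem_lattice_iff.2 hm)).continuousAt
    rw [truncPot_eq hxL] at h1
    refine ((h1.const_mul (-(-2 * c / 2))).congr_deriv (by ring)).congr_of_eventuallyEq ?_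
    filter_upwards [Ioi_mem_nhds hx.1] with y hy
    exact hw.char_right (le_of_lt hy)
  · have hxL : |x| < L := abs_lt.2 ⟨hx.1, by linarith [hx.1, hx.2]⟩
    have h1 := intervalIntegral.integral_hasDerivAt_left (a := x) (b := 0)
      (hp.intervalIntegrable) (hp.aestronglyMeasurable.stronglyMeasurableAtFilter (l := 𝓝 x))
      (contDiffAt_truncPot hq hxL (notMem_lattice_iff.2 hm)).continuousAt
    rw [truncPot_eq hxL] at h1
    refine ((h1.const_mul (-(-(1 / 2) / 2))).congr_deriv (by ring)).congr_of_eventuallyEq ?_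
    filter_upwards [Iio_mem_nhds hx.2] with y hy
    exact hw.char_left (le_of_lt hy)
  · rw [hw.char_right le_rfl]; simp

/-! ### The line Goursat problem: uniqueness -/

lemma contDiff_primitive {a : ℝ → ℝ} (ha : ContDiff ℝ ∞ a) :
    ContDiff ℝ ∞ fun u => ∫ s in (0 : ℝ)..u, a s := by
  have hd : ∀ u, HasDerivAt (fun u => ∫ s in (0 : ℝ)..u, a s) (a u) u := fun u =>
    intervalIntegral.integral_hasDerivAt_right (ha.continuous.intervalIntegrable _ _)
      (ha.continuous.stronglyMeasurableAtFilter _ _) ha.continuous.continuousAt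
  refine contDiff_infty_iff_deriv.2 ⟨fun u => (hd u).differentiableAt, ?_⟩
  rwa [show deriv (fun u => ∫ s in (0 : ℝ)..u, a s) = a from funext fun u => (hd u).deriv]

lemma waveOp_mul_char {α β : ℝ → ℝ} (hα : ContDiff ℝ ∞ α) (hβ : ContDiff ℝ ∞ β) (x t : ℝ) :
    waveOp (fun x t => α (x + t) * β (t - x)) x t = 4 * (deriv α (x + t) * deriv β (t - x)) := by
  have hα' : ContDiff ℝ ∞ (deriv α) := (contDiff_infty_iff_deriv.1 hα).2
  have hβ' : ContDiff ℝ ∞ (deriv β) := (contDiff_infty_iff_deriv.1 hβ).2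
  have d1 : ∀ f : ℝ → ℝ, ContDiff ℝ ∞ f → ∀ x s, HasDerivAt (fun s => f (x + s))
      (deriv f (x + s)) s := fun f hf x s =>
    (((hf.differentiable (by simp) (x + s)).hasDerivAt).comp_const_add x s)
  have d2 : ∀ f : ℝ → ℝ, ContDiff ℝ ∞ f → ∀ x s, HasDerivAt (fun s => f (s - x))
      (deriv f (s - x)) s := fun f hf x s =>
    (((hf.differentiable (by simp) (s - x)).hasDerivAt).comp_sub_const s x)
  have d3 : ∀ f : ℝ → ℝ, ContDiff ℝ ∞ f → ∀ s x, HasDerivAt (fun y => f (y + s))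
      (deriv f (x + s)) x := fun f hf s x =>
    (((hf.differentiable (by simp) (x + s)).hasDerivAt).comp_add_const x s)
  have d4 : ∀ f : ℝ → ℝ, ContDiff ℝ ∞ f → ∀ s x, HasDerivAt (fun y => f (s - y))
      (-deriv f (s - x)) x := fun f hf s x =>
    (((hf.differentiable (by simp) (s - x)).hasDerivAt).comp_const_sub s x)
  unfold waveOp
  have e1 := iteratedDeriv_two_eq (f := fun s => α (x + s) * β (s - x))
    (f' := fun s => deriv α (x + s) * β (s - x) + α (x + s) * deriv β (s - x))
    (Eventually.of_forall fun s => (d1 α hα x s).mul (d2 β hβ x s))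
    (((d1 _ hα' x t).mul (d2 β hβ x t)).add ((d1 α hα x t).mul (d2 _ hβ' x t)))
  have e2 := iteratedDeriv_two_eq (f := fun y => α (y + t) * β (t - y))
    (f' := fun y => deriv α (y + t) * β (t - y) + α (y + t) * -deriv β (t - y))
    (Eventually.of_forall fun y => (d3 α hα t y).mul (d4 β hβ t y))
    (((d3 _ hα' t x).mul (d4 β hβ t x)).add ((d3 α hα t x).mul (d4 _ hβ' t x).neg))
  simp only [] at e1 e2 ⊢
  rw [e1, e2]
  ring

/-- For a bump function `a` supported in `[-δ, δ]`,
a compactly supported function with derivative `a(· - v) - a(· - u)`. -/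
lemma exists_primitive_bump {a : ℝ → ℝ} (ha : ContDiff ℝ ∞ a) {δ : ℝ}
    (h0 : ∀ s, δ ≤ |s| → a s = 0) {u v : ℝ} (huv : u ≤ v) :
    ∃ α : ℝ → ℝ, ContDiff ℝ ∞ α ∧ (∀ s, deriv α s = a (s - v) - a (s - u)) ∧
      ∀ s, s ∉ Icc (u - δ) (v + δ) → α s = 0 := by
  set P : ℝ → ℝ := fun u => ∫ s in (0 : ℝ)..u, a s with hP
  have hPs := contDiff_primitive ha
  have hd : ∀ u, HasDerivAt P (a u) u := fun u =>
    intervalIntegral.integral_hasDerivAt_right (ha.continuous.intervalIntegrable _ _)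
      (ha.continuous.stronglyMeasurableAtFilter _ _) ha.continuous.continuousAt
  refine ⟨fun s => P (s - v) - P (s - u), (hPs.comp (contDiff_id.sub contDiff_const)).sub
    (hPs.comp (contDiff_id.sub contDiff_const)), fun s =>
    (((hd (s - v)).comp_sub_const s v).sub ((hd (s - u)).comp_sub_const s u)).deriv, fun s hs => ?_⟩
  simp only [hP]
  rw [intervalIntegral.integral_interval_sub_left (ha.continuous.intervalIntegrable _ _)
    (ha.continuous.intervalIntegrable _ _)]
  rw [mem_Icc, not_and_or, not_le, not_le] at hs
  refine (intervalIntegral.integral_congr (g := fun _ => 0) fun r hr => ?_).trans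
    intervalIntegral.integral_zero
  rw [uIcc_of_ge (by linarith)] at hr
  refine h0 r ?_
  rcases hs with hs | hs
  · exact (by linarith [hr.2] : δ ≤ -r).trans (neg_le_abs r)
  · exact (by linarith [hr.1] : δ ≤ r).trans (le_abs_self r)

lemma integral_sub_sub_add {X : Type*} [MeasurableSpace X] {μ : Measure X} {f g h k : X → ℝ}
    (hf : Integrable f μ) (hg : Integrable g μ) (hh : Integrable h μ) (hk : Integrable k μ) :
    ∫ x, (f x - g x - h x + k x) ∂μ
      = ∫ x, f x ∂μ - ∫ x, g x ∂μ - ∫ x, h x ∂μ + ∫ x, k x ∂μ := by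
  rw [integral_add (f := fun x => f x - g x - h x) ((hf.sub hg).sub hh) hk,
    integral_sub (f := fun x => f x - g x) (hf.sub hg) hh, integral_sub hf hg]

/-- A continuous distributional solution of `E_tt = E_xx` satisfies the parallelogram identity. -/
lemma parallelogram_of_integral_waveOp {E : ℝ → ℝ → ℝ} (hE : Continuous (Function.uncurry E))
    {L : ℝ} (h : ∀ φ : ℝ → ℝ → ℝ, ContDiff ℝ ∞ (Function.uncurry φ) →
      HasCompactSupport (Function.uncurry φ) →
      tsupport (Function.uncurry φ) ⊆ {z | |z.1| < z.2 ∧ z.2 < L} →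
      ∫ z : ℝ × ℝ, E z.1 z.2 * waveOp φ z.1 z.2 = 0)
    {u v u' v' : ℝ} (hu : 0 < u) (huv : u ≤ v) (hu' : 0 < u') (huv' : u' ≤ v')
    (hL : v + v' < 2 * L) :
    E ((v - v') / 2) ((v + v') / 2) - E ((u - v') / 2) ((u + v') / 2)
      - E ((v - u') / 2) ((v + u') / 2) + E ((u - u') / 2) ((u + u') / 2) = 0 := by
  set Δ : ℝ × ℝ → ℝ := fun z =>
    E (z.1 + (v - v') / 2) (z.2 + (v + v') / 2) - E (z.1 + (u - v') / 2) (z.2 + (u + v') / 2)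
      - E (z.1 + (v - u') / 2) (z.2 + (v + u') / 2)
      + E (z.1 + (u - u') / 2) (z.2 + (u + u') / 2) with hΔ
  have hsh : ∀ k l : ℝ, Continuous fun z : ℝ × ℝ => E (z.1 + k) (z.2 + l) := fun k l =>
    hE.comp (by fun_prop : Continuous fun z : ℝ × ℝ => (z.1 + k, z.2 + l))
  have hΔc : Continuous Δ := by
    exact (((hsh _ _).sub (hsh _ _)).sub (hsh _ _)).add (hsh _ _)
  suffices hs : Δ 0 = 0 by simpa [hΔ] using hs
  by_contra hne
  -- near the origin `Δ` has a strict sign, which a product of two bump functions detects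
  have hev : ∀ᶠ z in 𝓝 (0 : ℝ × ℝ), 0 < Δ 0 * Δ z :=
    (continuous_const.mul hΔc).continuousAt.eventually (lt_mem_nhds (mul_self_pos.2 hne))
  obtain ⟨r, hr, hball⟩ := Metric.eventually_nhds_iff.1 hev
  set δ := min r (min (u / 2) (min (u' / 2) ((2 * L - (v + v')) / 4))) with hδ
  have hδ0 : 0 < δ := by
    refine lt_min hr (lt_min (by linarith) (lt_min (by linarith) (by linarith)))
  have hδr : δ ≤ r := min_le_left _ _
  have hδu : δ ≤ u / 2 := (min_le_right _ _).trans (min_le_left _ _)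
  have hδu' : δ ≤ u' / 2 := (min_le_right _ _).trans ((min_le_right _ _).trans (min_le_left _ _))
  have hδL : δ ≤ (2 * L - (v + v')) / 4 :=
    (min_le_right _ _).trans ((min_le_right _ _).trans (min_le_right _ _))
  let a : ContDiffBump (0 : ℝ) := ⟨δ / 2, δ, by linarith, by linarith⟩
  have ha : ContDiff ℝ ∞ a := a.contDiff
  have ha0 : ∀ s, δ ≤ |s| → a s = 0 := fun s hs => a.zero_of_le_dist (by simpa using hs)
  obtain ⟨α, hα, hα', hαs⟩ := exists_primitive_bump ha ha0 huv
  obtain ⟨β, hβ, hβ', hβs⟩ := exists_primitive_bump ha ha0 huv'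
  set φ : ℝ → ℝ → ℝ := fun x t => α (x + t) * β (t - x) with hφ
  have hφs : ContDiff ℝ ∞ (Function.uncurry φ) :=
    (hα.comp (by fun_prop : ContDiff ℝ ∞ fun z : ℝ × ℝ => z.1 + z.2)).mul
      (hβ.comp (by fun_prop : ContDiff ℝ ∞ fun z : ℝ × ℝ => z.2 - z.1))
  set S : Set (ℝ × ℝ) := {z | (z.1 + z.2 ∈ Icc (u - δ) (v + δ)) ∧
    z.2 - z.1 ∈ Icc (u' - δ) (v' + δ)} with hS
  have hScl : IsClosed S := (isClosed_Icc.preimage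
    (by fun_prop : Continuous fun z : ℝ × ℝ => z.1 + z.2)).inter (isClosed_Icc.preimage
    (by fun_prop : Continuous fun z : ℝ × ℝ => z.2 - z.1))
  have hSc : IsCompact S := by
    refine ((isCompact_Icc (a := ((u - δ) - (v' + δ)) / 2) (b := ((v + δ) - (u' - δ)) / 2)).prod
      (isCompact_Icc (a := ((u - δ) + (u' - δ)) / 2)
        (b := ((v + δ) + (v' + δ)) / 2))).of_isClosed_subset hScl fun z hz => ?_
    obtain ⟨⟨h1, h2⟩, h3, h4⟩ := hz
    exact ⟨⟨by linarith, by linarith⟩, by linarith, by linarith⟩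
  have hφ0 : ∀ z ∉ S, Function.uncurry φ z = 0 := by
    intro z hz
    simp only [hS, mem_ofPred_eq, not_and_or] at hz
    rcases hz with hz | hz
    · simp [hφ, Function.uncurry, hαs _ hz]
    · simp [hφ, Function.uncurry, hβs _ hz]
  have hφc : HasCompactSupport (Function.uncurry φ) := HasCompactSupport.intro hSc hφ0
  have hts : tsupport (Function.uncurry φ) ⊆ S :=
    closure_minimal (fun z hz => by by_contra hn; exact hz (hφ0 z hn)) hScl
  have h1 := h φ hφs hφc fun z hz => by
    obtain ⟨⟨h1, h2⟩, h3, h4⟩ := hts hz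
    exact ⟨abs_lt.2 ⟨by linarith, by linarith⟩, by linarith⟩
  set A : ℝ × ℝ → ℝ := fun z => a (z.1 + z.2) * a (z.2 - z.1) with hA
  have hAc : Continuous A := (ha.continuous.comp (by fun_prop)).mul (ha.continuous.comp (by fun_prop))
  have hAz : ∀ z, A z ≠ 0 → |z.1 + z.2| < δ ∧ |z.2 - z.1| < δ := by
    intro z hz
    by_contra hn
    rw [not_and_or, not_lt, not_lt] at hn
    rcases hn with hn | hn
    · exact hz (by simp [hA, ha0 _ hn])
    · exact hz (by simp [hA, ha0 _ hn])
  have hAd : ∀ z, A z ≠ 0 → dist z 0 < δ := by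
    intro z hz
    obtain ⟨h1, h2⟩ := hAz z hz
    rw [abs_lt] at h1 h2
    rw [Prod.dist_eq]
    simp only [Prod.fst_zero, Prod.snd_zero, Real.dist_eq, sub_zero]
    exact max_lt (abs_lt.2 ⟨by linarith, by linarith⟩) (abs_lt.2 ⟨by linarith, by linarith⟩)
  have hAcs : HasCompactSupport A := HasCompactSupport.intro (isCompact_closedBall (0 : ℝ × ℝ) δ)
    fun z hz => by by_contra hn; exact hz (Metric.mem_closedBall.2 (hAd z hn).le)
  have hsi : ∀ k l : ℝ, Integrable fun z : ℝ × ℝ => E (z.1 + k) (z.2 + l) * A z := fun k l =>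
    ((hsh k l).mul hAc).integrable_of_hasCompactSupport hAcs.mul_left
  have hsi' : ∀ k l : ℝ, Integrable fun z : ℝ × ℝ => E z.1 z.2 * A (z - (k, l)) := fun k l => by
    have := (hsi k l).comp_sub_right (k, l)
    simpa using this
  have hse : ∀ k l : ℝ, ∫ z : ℝ × ℝ, E z.1 z.2 * A (z - (k, l))
      = ∫ z : ℝ × ℝ, E (z.1 + k) (z.2 + l) * A z := fun k l => by
    rw [← integral_sub_right_eq_self (fun z : ℝ × ℝ => E (z.1 + k) (z.2 + l) * A z) (k, l)]
    simp
  have h2 : ∫ z, Δ z * A z = 0 := by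
    have e1 : ∀ z, Δ z * A z = E (z.1 + (v - v') / 2) (z.2 + (v + v') / 2) * A z
        - E (z.1 + (u - v') / 2) (z.2 + (u + v') / 2) * A z
        - E (z.1 + (v - u') / 2) (z.2 + (v + u') / 2) * A z
        + E (z.1 + (u - u') / 2) (z.2 + (u + u') / 2) * A z := fun z => by simp only [hΔ]; ring
    simp_rw [e1]
    rw [integral_sub_sub_add (hsi _ _) (hsi _ _) (hsi _ _) (hsi _ _),
      ← hse, ← hse, ← hse, ← hse,
      ← integral_sub_sub_add (hsi' _ _) (hsi' _ _) (hsi' _ _) (hsi' _ _)]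
    have e2 : ∀ z : ℝ × ℝ, E z.1 z.2 * A (z - ((v - v') / 2, (v + v') / 2))
        - E z.1 z.2 * A (z - ((u - v') / 2, (u + v') / 2))
        - E z.1 z.2 * A (z - ((v - u') / 2, (v + u') / 2))
        + E z.1 z.2 * A (z - ((u - u') / 2, (u + u') / 2))
        = 1 / 4 * (E z.1 z.2 * waveOp φ z.1 z.2) := by
      intro z
      rw [hφ, waveOp_mul_char hα hβ, hα', hβ']
      simp only [hA, Prod.fst_sub, Prod.snd_sub]
      ring_nf
    simp_rw [e2]
    rw [integral_const_mul, h1, mul_zero]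
  have hnn : ∀ z, 0 ≤ Δ 0 * Δ z * A z := by
    intro z
    by_cases hz : A z = 0
    · rw [hz, mul_zero]
    · exact mul_nonneg (hball ((hAd z hz).trans_le hδr)).le (mul_nonneg a.nonneg a.nonneg)
  have hpos := Continuous.integral_pos_of_hasCompactSupport_nonneg_nonzero (μ := volume)
    (f := fun z => Δ 0 * Δ z * A z) (x := 0)
    ((continuous_const.mul hΔc).mul hAc) (hAcs.mul_left (f := fun z => Δ 0 * Δ z)) hnn (by
      have : 0 < a 0 := a.pos_of_mem_ball (by simpa using hδ0)
      have h3 : A 0 = a 0 * a 0 := by simp [hA]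
      rw [h3]
      exact (mul_pos (mul_self_pos.2 hne) (mul_pos this this)).ne')
  have h3 : ∫ z, Δ 0 * Δ z * A z = 0 := by
    rw [← mul_zero (Δ 0), ← h2, ← integral_const_mul]
    congr 1; ext z; ring
  rw [h3] at hpos
  exact lt_irrefl _ hpos

/-- A continuous distributional solution of the homogeneous wave equation in the light cone that
vanishes on the characteristics is zero. -/
lemma eq_zero_of_integral_waveOp {E : ℝ → ℝ → ℝ} (hE : Continuous (Function.uncurry E))
    {L : ℝ} (h : ∀ φ : ℝ → ℝ → ℝ, ContDiff ℝ ∞ (Function.uncurry φ) →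
      HasCompactSupport (Function.uncurry φ) →
      tsupport (Function.uncurry φ) ⊆ {z | |z.1| < z.2 ∧ z.2 < L} →
      ∫ z : ℝ × ℝ, E z.1 z.2 * waveOp φ z.1 z.2 = 0)
    (h0 : ∀ x t, |x| = t → t < L → E x t = 0) {x t : ℝ} (hx : |x| < t) (ht : t < L) :
    E x t = 0 := by
  obtain ⟨hx1, hx2⟩ := abs_lt.1 hx
  set g : ℝ → ℝ := fun u => E ((x + t - (t - x)) / 2) ((x + t + (t - x)) / 2)
    - E ((u - (t - x)) / 2) ((u + (t - x)) / 2) - E ((x + t - u) / 2) ((x + t + u) / 2)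
    + E ((u - u) / 2) ((u + u) / 2) with hg
  have hEc : ∀ k l : ℝ → ℝ, Continuous k → Continuous l → Continuous fun u => E (k u) (l u) :=
    fun k l hk hl => hE.comp (hk.prodMk hl)
  have hgc : Continuous g := (((hEc _ _ (by fun_prop) (by fun_prop)).sub
    (hEc _ _ (by fun_prop) (by fun_prop))).sub (hEc _ _ (by fun_prop) (by fun_prop))).add
    (hEc _ _ (by fun_prop) (by fun_prop))
  have h1 : ∀ᶠ u in 𝓝[>] (0 : ℝ), g u = 0 := by
    filter_upwards [Ioo_mem_nhdsGT (show (0 : ℝ) < min (x + t) (t - x) from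
      lt_min (by linarith) (by linarith))] with u hu
    exact parallelogram_of_integral_waveOp hE h hu.1 (hu.2.le.trans (min_le_left _ _)) hu.1
      (hu.2.le.trans (min_le_right _ _)) (by linarith)
  have h2 : g 0 = 0 := tendsto_nhds_unique (hgc.continuousWithinAt.tendsto (s := Ioi 0))
    (tendsto_const_nhds.congr' (h1.mono fun _ h => h.symm))
  have e1 : E ((0 - (t - x)) / 2) ((0 + (t - x)) / 2) = 0 :=
    h0 _ _ (by rw [abs_of_neg (by linarith)]; ring) (by linarith)
  have e2 : E ((x + t - 0) / 2) ((x + t + 0) / 2) = 0 :=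
    h0 _ _ (by rw [abs_of_pos (by linarith)]; ring) (by linarith)
  have e3 : E ((0 - 0) / 2) ((0 + 0) / 2) = 0 := h0 _ _ (by simp) (by linarith)
  simp only [hg] at h2
  rw [e1, e2, e3, show (x + t - (t - x)) / 2 = x by ring,
    show (x + t + (t - x)) / 2 = t by ring] at h2
  linarith

/-- The retraction of the plane onto the cone `|x| ≤ t ≤ T`. -/
def coneRetract (T : ℝ) (z : ℝ × ℝ) : ℝ × ℝ :=
  (max (-(max 0 (min z.2 T))) (min z.1 (max 0 (min z.2 T))), max 0 (min z.2 T))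

lemma continuous_coneRetract (T : ℝ) : Continuous (coneRetract T) := by
  unfold coneRetract; fun_prop

lemma coneRetract_mem {T : ℝ} (hT : 0 ≤ T) (z : ℝ × ℝ) :
    |(coneRetract T z).1| ≤ (coneRetract T z).2 ∧ (coneRetract T z).2 ≤ T := by
  simp only [coneRetract]
  have h : 0 ≤ max 0 (min z.2 T) := le_max_left _ _
  exact ⟨abs_le.2 ⟨le_max_left _ _, max_le (by linarith) (min_le_right _ _)⟩,
    max_le hT (min_le_right _ _)⟩

lemma coneRetract_eq {T : ℝ} {z : ℝ × ℝ} (h : |z.1| ≤ z.2) (hT : z.2 ≤ T) :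
    coneRetract T z = z := by
  obtain ⟨h1, h2⟩ := abs_le.1 h
  have h0 : 0 ≤ z.2 := (abs_nonneg _).trans h
  simp only [coneRetract, min_eq_left hT, max_eq_right h0, min_eq_left h2, max_eq_right h1]

lemma coneCum_zero (w : ℝ → ℝ → ℝ) : coneCum 0 0 w = coneInt w := by
  ext y τ
  rw [coneCum_eq]
  simp [step]

/-- The line Goursat problem with zero data has only the zero solution. -/
theorem eq_zero_of_lineGoursat {q : ℝ → ℝ}
    (hq2 : MemLp q 2 (volume.restrict (Ioo 0 (2 * Real.pi)))) {L : ℝ} {d : ℝ → ℝ → ℝ}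
    (hd : ContinuousOn (Function.uncurry d) {z | |z.1| ≤ z.2 ∧ z.2 < L})
    (hw : ∀ φ : ℝ → ℝ → ℝ, ContDiff ℝ ∞ (Function.uncurry φ) →
      HasCompactSupport (Function.uncurry φ) →
      tsupport (Function.uncurry φ) ⊆ {z | |z.1| < z.2 ∧ z.2 < L} →
      ∫ z : ℝ × ℝ, d z.1 z.2 * (waveOp φ z.1 z.2 + periodize q z.1 * φ z.1 z.2) = 0)
    (h0 : ∀ x t, |x| = t → t < L → d x t = 0) {x t : ℝ} (hx : |x| ≤ t) (ht : t < L) :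
    d x t = 0 := by
  obtain ⟨T, htT, hTL⟩ := exists_between ht
  have hT0 : 0 ≤ T := ((abs_nonneg x).trans hx).trans htT.le
  set p := truncPot q L with hpdef
  have hp : Integrable p := integrable_truncPot hq2 L
  set D : ℝ → ℝ → ℝ := fun x t => Function.uncurry d (coneRetract T (x, t)) with hD
  have hDc : Continuous (Function.uncurry D) := by
    refine hd.comp_continuous (continuous_coneRetract T) fun z => ?_
    exact ⟨(coneRetract_mem hT0 z).1, (coneRetract_mem hT0 z).2.trans_lt hTL⟩
  have hDe : ∀ x t, |x| ≤ t → t ≤ T → D x t = d x t := fun x t h h' => by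
    simp only [hD]; rw [coneRetract_eq (z := (x, t)) h h']; rfl
  set E : ℝ → ℝ → ℝ := fun x t => D x t + 1 / 2 * potInt p (coneInt D) x t with hEd
  have hpc := continuous_potInt_coneInt hp hDc
  have hEc : Continuous (Function.uncurry E) := hDc.add (continuous_const.mul hpc)
  have hE0 : ∀ x t, |x| = t → t < T → E x t = 0 := fun x t h h' => by
    simp only [hEd]
    rw [potInt_coneInt_char p D h, hDe x t h.le h'.le, h0 x t h (h'.trans hTL)]; ring
  have hEw : ∀ φ : ℝ → ℝ → ℝ, ContDiff ℝ ∞ (Function.uncurry φ) →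
      HasCompactSupport (Function.uncurry φ) →
      tsupport (Function.uncurry φ) ⊆ {z | |z.1| < z.2 ∧ z.2 < T} →
      ∫ z : ℝ × ℝ, E z.1 z.2 * waveOp φ z.1 z.2 = 0 := by
    intro φ hφ hc hs
    have h1 := integral_potInt_coneCum_mul_waveOp hp 0 0 hDc hφ hc fun z hz => (hs hz).1
    have h2 := hw φ hφ hc fun z hz => ⟨(hs hz).1, (hs hz).2.trans hTL⟩
    rw [coneCum_zero] at h1
    have hcw := continuous_waveOp hφ
    have hccw := hasCompactSupport_waveOp hφ hc
    have i1 : Integrable fun z : ℝ × ℝ => D z.1 z.2 * waveOp φ z.1 z.2 :=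
      (hDc.mul hcw).integrable_of_hasCompactSupport hccw.mul_left
    have i2 : Integrable fun z : ℝ × ℝ => potInt p (coneInt D) z.1 z.2 * waveOp φ z.1 z.2 :=
      (hpc.mul hcw).integrable_of_hasCompactSupport hccw.mul_left
    have i3 := integrable_mul_mul_of_hasCompactSupport hp hDc hφ.continuous hc
    have e1 : ∀ z : ℝ × ℝ, d z.1 z.2 * (waveOp φ z.1 z.2 + periodize q z.1 * φ z.1 z.2)
        = D z.1 z.2 * waveOp φ z.1 z.2 + p z.1 * (D z.1 z.2 * φ z.1 z.2) := by
      intro z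
      by_cases hz : z ∈ tsupport (Function.uncurry φ)
      · rw [hDe _ _ (hs hz).1.le (hs hz).2.le, hpdef,
          truncPot_eq ((hs hz).1.trans ((hs hz).2.trans hTL))]
        ring
      · have h3 : φ z.1 z.2 = 0 := image_eq_zero_of_notMem_tsupport (f := Function.uncurry φ) hz
        have h4 : waveOp φ z.1 z.2 = 0 := image_eq_zero_of_notMem_tsupport
          (f := Function.uncurry (waveOp φ)) fun h => hz (tsupport_waveOp_subset hφ h)
        rw [h3, h4]; ring
    simp_rw [e1] at h2
    rw [integral_add i1 i3] at h2
    have e2 : ∀ z : ℝ × ℝ, E z.1 z.2 * waveOp φ z.1 z.2 = D z.1 z.2 * waveOp φ z.1 z.2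
        + 1 / 2 * (potInt p (coneInt D) z.1 z.2 * waveOp φ z.1 z.2) := fun z => by
      simp only [hEd]; ring
    simp_rw [e2]
    rw [integral_add i1 (i2.const_mul _), integral_const_mul, h1]
    linarith
  have hz : ∀ x t, |x| ≤ t → t < T → E x t = 0 := fun x t h h' =>
    h.lt_or_eq.elim (fun h => eq_zero_of_integral_waveOp hEc hEw hE0 h h') fun h => hE0 x t h h'
  rw [← hDe x t hx htT.le]
  refine eq_zero_of_eq_potInt hp hDc (L := T) (fun x t h h' => ?_) hx htT
  have := hz x t h h'
  simp only [hEd] at this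
  linarith

lemma IsLineGoursatKernel.eq_right {q : ℝ → ℝ} {L c : ℝ} {w w' : ℝ → ℝ → ℝ}
    (h : IsLineGoursatKernel q L c w) (h' : IsLineGoursatKernel q L c w') {y : ℝ} (hy : 0 ≤ y)
    (hyL : y < L) : w y y = w' y y := by
  have hm : MapsTo (fun s : ℝ => (s, s)) (Icc 0 y) {z : ℝ × ℝ | |z.1| ≤ z.2 ∧ z.2 < L} :=
    fun s hs => ⟨(abs_of_nonneg hs.1).le, hs.2.trans_lt hyL⟩
  have hc : ContinuousOn (fun s => w s s - w' s s) (Icc 0 y) :=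
    (h.cont.comp (f := fun s : ℝ => (s, s)) (by fun_prop) hm).sub
      (h'.cont.comp (f := fun s : ℝ => (s, s)) (by fun_prop) hm)
  have := integral_eq_of_hasDerivAt_off_countable (fun s => w s s - w' s s) (fun _ => 0)
    countable_lattice (a := 0) (b := y) (by rwa [uIcc_of_le hy]) (fun s hs => by
      rw [min_eq_left hy, max_eq_right hy] at hs
      have hs' : s ∈ Ioo 0 L := ⟨hs.1.1, hs.1.2.trans hyL⟩
      refine ((h.char_right s hs' (notMem_lattice_iff.1 hs.2)).sub
        (h'.char_right s hs' (notMem_lattice_iff.1 hs.2))).congr_deriv (sub_self _))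
    intervalIntegrable_const
  simp only [intervalIntegral.integral_zero, h.corner, h'.corner] at this
  linarith

lemma IsLineGoursatKernel.eq_left {q : ℝ → ℝ} {L c : ℝ} {w w' : ℝ → ℝ → ℝ}
    (h : IsLineGoursatKernel q L c w) (h' : IsLineGoursatKernel q L c w') {y : ℝ} (hy : y ≤ 0)
    (hyL : -L < y) : w y (-y) = w' y (-y) := by
  have hm : MapsTo (fun s : ℝ => (s, -s)) (Icc y 0) {z : ℝ × ℝ | |z.1| ≤ z.2 ∧ z.2 < L} :=
    fun s hs => ⟨(abs_of_nonpos hs.2).le, show -s < L by linarith [hs.1]⟩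
  have hc : ContinuousOn (fun s => w s (-s) - w' s (-s)) (Icc y 0) :=
    (h.cont.comp (f := fun s : ℝ => (s, -s)) (by fun_prop) hm).sub
      (h'.cont.comp (f := fun s : ℝ => (s, -s)) (by fun_prop) hm)
  have := integral_eq_of_hasDerivAt_off_countable (fun s => w s (-s) - w' s (-s)) (fun _ => 0)
    countable_lattice (a := y) (b := 0) (by rwa [uIcc_of_le hy]) (fun s hs => by
      rw [min_eq_left hy, max_eq_right hy] at hs
      have hs' : s ∈ Ioo (-L) 0 := ⟨hyL.trans hs.1.1, hs.1.2⟩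
      refine ((h.char_left s hs' (notMem_lattice_iff.1 hs.2)).sub
        (h'.char_left s hs' (notMem_lattice_iff.1 hs.2))).congr_deriv (sub_self _))
    intervalIntegrable_const
  simp only [intervalIntegral.integral_zero, neg_zero, h.corner, h'.corner] at this
  linarith

/-- The solution of the line Goursat problem is unique. -/
theorem IsLineGoursatKernel.unique {q : ℝ → ℝ}
    (hq2 : MemLp q 2 (volume.restrict (Ioo 0 (2 * Real.pi)))) {L c : ℝ} {w w' : ℝ → ℝ → ℝ}
    (h : IsLineGoursatKernel q L c w) (h' : IsLineGoursatKernel q L c w') {x t : ℝ}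
    (hx : |x| ≤ t) (ht : t < L) : w x t = w' x t := by
  have hint : ∀ w, IsLineGoursatKernel q L c w → ∀ φ : ℝ → ℝ → ℝ,
      ContDiff ℝ ∞ (Function.uncurry φ) → HasCompactSupport (Function.uncurry φ) →
      tsupport (Function.uncurry φ) ⊆ {z | |z.1| < z.2 ∧ z.2 < L} →
      Integrable fun z : ℝ × ℝ => w z.1 z.2 *
        (waveOp φ z.1 z.2 + periodize q z.1 * φ z.1 z.2) := by
    intro w h φ hφ hc hs
    -- the integrand only sees `w` on the support of `φ`, where `w` agrees with a continuous
    -- function on the whole plane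
    obtain ⟨R, hR⟩ : ∃ R, ∀ z ∈ tsupport (Function.uncurry φ), z.2 ≤ R ∧ R < L ∧ 0 ≤ R := by
      rcases (tsupport (Function.uncurry φ)).eq_empty_or_nonempty with he | hne
      · exact ⟨0, fun z hz => by simp [he] at hz⟩
      · obtain ⟨z, hz, hmax⟩ := hc.exists_isMaxOn hne continuous_snd.continuousOn
        refine ⟨z.2, fun y hy => ⟨hmax hy, (hs hz).2, (abs_nonneg _).trans (hs hz).1.le⟩⟩
    by_cases he : R < L ∧ 0 ≤ R
    swap
    · have hz : ∀ z, z ∉ tsupport (Function.uncurry φ) := fun z hz => he (hR z hz).2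
      refine (integrable_zero (ℝ × ℝ) ℝ volume).congr (ae_of_all _ fun z => ?_)
      have h3 : φ z.1 z.2 = 0 := image_eq_zero_of_notMem_tsupport (f := Function.uncurry φ) (hz z)
      have h4 : waveOp φ z.1 z.2 = 0 := image_eq_zero_of_notMem_tsupport
        (f := Function.uncurry (waveOp φ)) fun h => hz z (tsupport_waveOp_subset hφ h)
      simp [h3, h4]
    set D : ℝ → ℝ → ℝ := fun x t => Function.uncurry w (coneRetract R (x, t)) with hD
    have hDc : Continuous (Function.uncurry D) := by
      refine h.cont.comp_continuous (continuous_coneRetract R) fun z => ?_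
      exact ⟨(coneRetract_mem he.2 z).1, (coneRetract_mem he.2 z).2.trans_lt he.1⟩
    have i1 : Integrable fun z : ℝ × ℝ => D z.1 z.2 * waveOp φ z.1 z.2 :=
      (hDc.mul (continuous_waveOp hφ)).integrable_of_hasCompactSupport
        (hasCompactSupport_waveOp hφ hc).mul_left
    have i3 := integrable_mul_mul_of_hasCompactSupport (integrable_truncPot hq2 L) hDc
      hφ.continuous hc
    refine (i1.add i3).congr (ae_of_all _ fun z => ?_)
    by_cases hz : z ∈ tsupport (Function.uncurry φ)
    · have : D z.1 z.2 = w z.1 z.2 := by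
        simp only [hD]; rw [coneRetract_eq (z := (z.1, z.2)) (hs hz).1.le (hR z hz).1]; rfl
      simp only [Pi.add_apply, this]
      rw [truncPot_eq ((hs hz).1.trans (hs hz).2)]
      ring
    · have h3 : φ z.1 z.2 = 0 := image_eq_zero_of_notMem_tsupport (f := Function.uncurry φ) hz
      have h4 : waveOp φ z.1 z.2 = 0 := image_eq_zero_of_notMem_tsupport
        (f := Function.uncurry (waveOp φ)) fun h => hz (tsupport_waveOp_subset hφ h)
      simp [h3, h4]
  refine sub_eq_zero.1 (eq_zero_of_lineGoursat hq2 (d := fun x t => w x t - w' x t)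
    (h.cont.sub h'.cont) (fun φ hφ hc hs => ?_) (fun x t hxt htL => ?_) hx ht)
  · simp_rw [sub_mul]
    rw [integral_sub (hint w h φ hφ hc hs) (hint w' h' φ hφ hc hs)]
    have h1 := h.wave φ hφ hc hs
    have h2 := h'.wave φ hφ hc hs
    simp only [waveOp]
    rw [h1, h2, sub_zero]
  · rcases le_total 0 x with h0 | h0
    · rw [abs_of_nonneg h0] at hxt
      subst hxt
      exact sub_eq_zero.2 (h.eq_right h' h0 htL)
    · rw [abs_of_nonpos h0] at hxt
      subst hxt
      exact sub_eq_zero.2 (h.eq_left h' h0 (by linarith))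

/-! ### Derivatives along the characteristics -/

/-- The derivative `u_t - u_x` relative to `S`, as a function of the point `(x, t)`. -/
def charDeriv (u : ℝ → ℝ → ℝ) (S : Set (ℝ × ℝ)) (z : ℝ × ℝ) : ℝ :=
  fderivWithin ℝ (Function.uncurry u) S z (-1, 1)

lemma continuousOn_charDeriv {u : ℝ → ℝ → ℝ} {S : Set (ℝ × ℝ)} (hS : UniqueDiffOn ℝ S)
    (h : ContDiffOn ℝ 1 (Function.uncurry u) S) : ContinuousOn (charDeriv u S) S :=
  (h.continuousOn_fderivWithin hS (by simp)).clm_apply continuousOn_const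

lemma hasDerivAt_antidiagonal {u : ℝ → ℝ → ℝ} {S : Set (ℝ × ℝ)} {x t s : ℝ}
    (hS : S ∈ 𝓝 (x - s, t + s)) (h : DifferentiableAt ℝ (Function.uncurry u) (x - s, t + s)) :
    HasDerivAt (fun s => u (x - s) (t + s)) (charDeriv u S (x - s, t + s)) s := by
  rw [charDeriv, fderivWithin_of_mem_nhds hS]
  exact hasDerivAt_comp_line (Φ := Function.uncurry u) h ((hasDerivAt_id' s).const_sub x)
    ((hasDerivAt_id' s).const_add t)

/-- Along the other family of characteristics `u_t - u_x` has the derivative `u_tt - u_xx`. -/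
lemma hasDerivAt_charDeriv {u : ℝ → ℝ → ℝ} {S : Set (ℝ × ℝ)} {x t s : ℝ}
    (hS : S ∈ 𝓝 (x + s, t + s)) (h : ContDiffAt ℝ 2 (Function.uncurry u) (x + s, t + s)) :
    HasDerivAt (fun s => charDeriv u S (x + s, t + s)) (waveOp u (x + s) (t + s)) s := by
  rw [(waveOp_eq_fderiv_of_contDiffAt h).1]
  have h2 : DifferentiableAt ℝ (fun z => fderiv ℝ (Function.uncurry u) z (-1, 1))
      (x + s, t + s) :=
    ((h.fderiv_right (m := 1) (by norm_num)).differentiableAt (by simp)).clm_apply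
      (differentiableAt_const _)
  refine (hasDerivAt_comp_line h2 ((hasDerivAt_id' s).const_add x)
    ((hasDerivAt_id' s).const_add t)).congr_of_eventuallyEq ?_
  filter_upwards [(by fun_prop : Continuous fun s : ℝ => (x + s, t + s)).continuousAt.eventually
    (eventually_mem_nhds_iff.2 hS)] with r hr
  rw [charDeriv, fderivWithin_of_mem_nhds hr]

lemma charDeriv_eq {u : ℝ → ℝ → ℝ} {S : Set (ℝ × ℝ)} (z : ℝ × ℝ) :
    charDeriv u S z = fderivWithin ℝ (Function.uncurry u) S z (0, 1)
      - fderivWithin ℝ (Function.uncurry u) S z (1, 0) := by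
  rw [charDeriv, ← map_sub]; simp

lemma hasDerivWithinAt_fst {u : ℝ → ℝ → ℝ} {S : Set (ℝ × ℝ)} {x t : ℝ} {I : Set ℝ}
    (h : DifferentiableWithinAt ℝ (Function.uncurry u) S (x, t))
    (hI : ∀ᶠ y in 𝓝[I] x, (y, t) ∈ S) :
    HasDerivWithinAt (fun y => u y t) (fderivWithin ℝ (Function.uncurry u) S (x, t) (1, 0)) I x := by
  have := HasFDerivWithinAt.comp_hasDerivWithinAt (f := fun y => (y, t)) x h.hasFDerivWithinAt
    (((hasDerivAt_id' x).prodMk (hasDerivAt_const x t)).hasDerivWithinAt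
      (s := I ∩ {y | (y, t) ∈ S})) fun y hy => hy.2
  exact this.mono_of_mem_nhdsWithin (inter_mem self_mem_nhdsWithin hI)

lemma hasDerivWithinAt_snd {u : ℝ → ℝ → ℝ} {S : Set (ℝ × ℝ)} {x t : ℝ} {I : Set ℝ}
    (h : DifferentiableWithinAt ℝ (Function.uncurry u) S (x, t))
    (hI : ∀ᶠ s in 𝓝[I] t, (x, s) ∈ S) :
    HasDerivWithinAt (fun s => u x s) (fderivWithin ℝ (Function.uncurry u) S (x, t) (0, 1)) I t := by
  have := HasFDerivWithinAt.comp_hasDerivWithinAt (f := fun s => (x, s)) t h.hasFDerivWithinAt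
    (((hasDerivAt_const t x).prodMk (hasDerivAt_id' t)).hasDerivWithinAt
      (s := I ∩ {s | (x, s) ∈ S})) fun y hy => hy.2
  exact this.mono_of_mem_nhdsWithin (inter_mem self_mem_nhdsWithin hI)

/-- The increment of `V = D_t - D_x` along a characteristic, when `V_t + V_x = -p D` off the
lattice. -/
lemma abs_sub_le_of_charDeriv {p : ℝ → ℝ} {D V : ℝ → ℝ → ℝ} {x t l B K : ℝ} (hl : 0 ≤ l)
    (hB : 0 ≤ B)
    (hV : ContinuousOn (fun s => V (x + s) (t + s)) (Icc 0 l))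
    (hD : ContinuousOn (fun s => D (x + s) (t + s)) (Icc 0 l))
    (hd : ∀ s ∈ Ioo 0 l, x + s ∉ lattice →
      HasDerivAt (fun s => V (x + s) (t + s)) (-(p (x + s) * D (x + s) (t + s))) s)
    (hp : IntervalIntegrable p volume x (x + l)) (hK : ∫ y in x..x + l, |p y| ≤ K)
    (h : ∀ s ∈ Icc 0 l, |D (x + s) (t + s)| ≤ B) :
    |V (x + l) (t + l) - V x t| ≤ K * B := by
  have hp' : IntervalIntegrable (fun s => p (x + s)) volume 0 l := by
    have := hp.comp_add_left x
    simpa using this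
  have hc : ((fun s => x + s) ⁻¹' lattice).Countable :=
    countable_lattice.preimage (add_right_injective x)
  have e := integral_eq_of_hasDerivAt_off_countable (fun s => V (x + s) (t + s))
    (fun s => -(p (x + s) * D (x + s) (t + s))) hc (a := 0) (b := l) (by rwa [uIcc_of_le hl])
    (fun s hs => by
      rw [min_eq_left hl, max_eq_right hl] at hs
      exact hd s hs.1 hs.2)
    (hp'.mul_continuousOn (by rwa [uIcc_of_le hl])).neg
  simp only [add_zero] at e
  rw [← e]
  refine (intervalIntegral.norm_integral_le_of_norm_le
    (f := fun s => -(p (x + s) * D (x + s) (t + s)))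
    (g := fun s => |p (x + s)| * B) hl (ae_of_all _ fun s hs => ?_)
    (hp'.norm.mul_const B)).trans ?_
  · rw [norm_neg, norm_mul]
    exact mul_le_mul_of_nonneg_left (h s ⟨hs.1.le, hs.2⟩) (norm_nonneg _)
  · rw [intervalIntegral.integral_mul_const, intervalIntegral.integral_comp_add_left
      (fun y => |p y|), add_zero]
    exact mul_le_mul_of_nonneg_right hK hB

lemma integral_exp_le {c l r : ℝ} (hc : 0 < c) :
    ∫ s in (0 : ℝ)..l, Real.exp (c * (r + s)) ≤ Real.exp (c * (r + l)) / c := by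
  have hd : ∀ s, HasDerivAt (fun s => Real.exp (c * (r + s)) / c) (Real.exp (c * (r + s))) s := by
    intro s
    have := ((((hasDerivAt_id' s).const_add r).const_mul c).exp).div_const c
    refine this.congr_deriv ?_
    field_simp
  rw [intervalIntegral.integral_eq_sub_of_hasDerivAt (fun s _ => hd s)
    (Continuous.intervalIntegrable (by fun_prop) _ _)]
  have : 0 < Real.exp (c * (r + 0)) / c := by positivity
  linarith

/-! ### The Goursat problem on the interval: uniqueness -/

/-- The homogeneous Goursat problem in the cone, with `V = D_t - D_x`, has only the zero
solution: the increments of `D` over characteristic parallelograms are controlled by `p D`. -/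
theorem eq_zero_of_goursat {p : ℝ → ℝ} (hp : ∀ a b, IntervalIntegrable p volume a b)
    {D V : ℝ → ℝ → ℝ} {L : ℝ}
    (hD : ContinuousOn (Function.uncurry D) {z | |z.1| ≤ z.2 ∧ z.2 < L})
    (hV : ContinuousOn (Function.uncurry V) {z | |z.1| < z.2 ∧ z.2 < L})
    (hDd : ∀ x t s, |x - s| < t + s → t + s < L → x - s ∉ lattice →
      HasDerivAt (fun s => D (x - s) (t + s)) (V (x - s) (t + s)) s)
    (hVd : ∀ x t s, |x + s| < t + s → t + s < L → x + s ∉ lattice →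
      HasDerivAt (fun s => V (x + s) (t + s)) (-(p (x + s) * D (x + s) (t + s))) s)
    (h0 : ∀ x t, |x| = t → t < L → D x t = 0) {x t : ℝ} (hx : |x| ≤ t) (ht : t < L) :
    D x t = 0 := by
  set K := ∫ y in -t..t, |p y| with hK
  have ht0 : 0 ≤ t := (abs_nonneg x).trans hx
  have hK0 : 0 ≤ K := intervalIntegral.integral_nonneg (by linarith) fun _ _ => abs_nonneg _
  set c := 2 * K + 1 with hc
  have hc0 : 0 < c := by linarith
  have hcl : IsClosed {z : ℝ × ℝ | |z.1| ≤ z.2 ∧ z.2 ≤ t} :=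
    (isClosed_le (by fun_prop) (by fun_prop)).and (isClosed_le (by fun_prop) (by fun_prop))
  have hcomp : IsCompact {z : ℝ × ℝ | |z.1| ≤ z.2 ∧ z.2 ≤ t} := by
    refine ((isCompact_Icc (a := -t) (b := t)).prod
      (isCompact_Icc (a := 0) (b := t))).of_isClosed_subset hcl fun z hz => ?_
    have := abs_le.1 (hz.1.trans hz.2)
    exact ⟨this, (abs_nonneg _).trans hz.1, hz.2⟩
  have hDt : ContinuousOn (Function.uncurry D) {z | |z.1| ≤ z.2 ∧ z.2 ≤ t} :=
    hD.mono fun z hz => ⟨hz.1, hz.2.trans_lt ht⟩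
  obtain ⟨z, hz, hmax⟩ := hcomp.exists_isMaxOn ⟨(x, t), hx, le_rfl⟩
    (f := fun z : ℝ × ℝ => |Function.uncurry D z| * Real.exp (-(c * z.2)))
    (hDt.abs.mul (by fun_prop))
  set M := |Function.uncurry D z| * Real.exp (-(c * z.2)) with hM
  have hM0 : 0 ≤ M := by positivity
  have hb : ∀ y s, |y| ≤ s → s ≤ t → |D y s| ≤ M * Real.exp (c * s) := fun y s h1 h2 => by
    have := hmax (show (y, s) ∈ {z : ℝ × ℝ | |z.1| ≤ z.2 ∧ z.2 ≤ t} from ⟨h1, h2⟩)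
    simp only [mem_ofPred_eq] at this
    calc |D y s| = |D y s| * Real.exp (-(c * s)) * Real.exp (c * s) := by
          rw [mul_assoc, ← Real.exp_add]; simp
      _ ≤ _ := mul_le_mul_of_nonneg_right this (Real.exp_pos _).le
  -- the increment over a parallelogram inside the cone
  have key : ∀ y s e, |y| < s → s ≤ t → 0 < e → e < s - y → e < s + y →
      |D y s - D ((y + s - e) / 2 + 0) ((y + s + e) / 2)
        - D ((e + y - s) / 2) ((e + s - y) / 2) + D 0 e| ≤ K * M / c * Real.exp (c * s) := by
    intro y s e hy hs he he1 he2
    set l := (s - y - e) / 2 with hl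
    set m := (s + y - e) / 2 with hm
    have hl0 : 0 < l := by simp only [hl]; linarith
    have hm0 : 0 < m := by simp only [hm]; linarith
    have path : ∀ k, 0 ≤ k → k ≤ m → ∀ r ∈ Icc 0 l, |y + l - k - r| < s - l - k + r ∧
        s - l - k + r < L ∧ s - l - k + r ≤ t := fun k hk hkm r hr => by
      simp only [hl, hm] at hr hkm ⊢
      refine ⟨abs_lt.2 ⟨by linarith [hr.1], by linarith [hr.1]⟩, by linarith [hr.2],
        by linarith [hr.2]⟩
    have cV : ∀ k, 0 ≤ k → k ≤ m →
        ContinuousOn (fun r => V (y + l - k - r) (s - l - k + r)) (Icc 0 l) := fun k hk hkm =>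
      hV.comp (f := fun r => (y + l - k - r, s - l - k + r)) (by fun_prop)
        fun r hr => ⟨(path k hk hkm r hr).1, (path k hk hkm r hr).2.1⟩
    have FTC : ∀ k, 0 ≤ k → k ≤ m → ∫ r in (0 : ℝ)..l, V (y + l - k - r) (s - l - k + r)
        = D (y - k) (s - k) - D (y + l - k) (s - l - k) := fun k hk hkm => by
      have hcount : ((fun r => y + l - k - r) ⁻¹' lattice).Countable :=
        countable_lattice.preimage sub_right_injective
      have e := integral_eq_of_hasDerivAt_off_countable
        (fun r => D (y + l - k - r) (s - l - k + r))
        (fun r => V (y + l - k - r) (s - l - k + r)) hcount (a := 0) (b := l)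
        (by
          rw [uIcc_of_le hl0.le]
          exact hD.comp (f := fun r => (y + l - k - r, s - l - k + r)) (by fun_prop)
            fun r hr => ⟨(path k hk hkm r hr).1.le, (path k hk hkm r hr).2.1⟩)
        (fun r hr => by
          rw [min_eq_left hl0.le, max_eq_right hl0.le] at hr
          have := path k hk hkm r ⟨hr.1.1.le, hr.1.2.le⟩
          exact hDd _ _ r this.1 this.2.1 hr.2)
        (ContinuousOn.intervalIntegrable (by rw [uIcc_of_le hl0.le]; exact cV k hk hkm))
      rw [e]
      ring_nf
    have hdiff : ∀ r ∈ Icc 0 l, |V (y + l - 0 - r) (s - l - 0 + r)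
        - V (y + l - m - r) (s - l - m + r)| ≤ K * (M * Real.exp (c * (s - l + r))) := by
      intro r hr
      have hpath : ∀ k ∈ Icc 0 m, |y + l - m - r + k| < s - l - m + r + k ∧
          s - l - m + r + k < L ∧ s - l - m + r + k ≤ s - l + r ∧ s - l + r ≤ t := fun k hk => by
        have := path (m - k) (by linarith [hk.2]) (by linarith [hk.1]) r hr
        rw [show y + l - m - r + k = y + l - (m - k) - r by ring,
          show s - l - m + r + k = s - l - (m - k) + r by ring]
        exact ⟨this.1, this.2.1, by linarith [hk.2], by linarith [hr.2]⟩
      have hz0 := hpath 0 ⟨le_rfl, hm0.le⟩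
      have hzm := hpath m ⟨hm0.le, le_rfl⟩
      have := abs_sub_le_of_charDeriv (p := p) (D := D) (V := V) (x := y + l - m - r)
        (t := s - l - m + r) (l := m) (B := M * Real.exp (c * (s - l + r))) (K := K) hm0.le
        (by positivity)
        (hV.comp (f := fun k => (y + l - m - r + k, s - l - m + r + k)) (by fun_prop)
          fun k hk => ⟨(hpath k hk).1, (hpath k hk).2.1⟩)
        (hD.comp (f := fun k => (y + l - m - r + k, s - l - m + r + k)) (by fun_prop)
          fun k hk => ⟨(hpath k hk).1.le, (hpath k hk).2.1⟩)
        (fun k hk hkl => hVd _ _ k (hpath k ⟨hk.1.le, hk.2.le⟩).1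
          (hpath k ⟨hk.1.le, hk.2.le⟩).2.1 hkl)
        (hp _ _)
        (by
          refine intervalIntegral.integral_mono_interval ?_ (by linarith) ?_
            (ae_of_all _ fun _ => abs_nonneg _) (hp _ _).abs
          · linarith [(abs_lt.1 hz0.1).1, hz0.2.2.1, hz0.2.2.2]
          · linarith [(abs_lt.1 hzm.1).2, hzm.2.2.1, hzm.2.2.2])
        (fun k hk => by
          obtain ⟨h1, h2, h3, h4⟩ := hpath k hk
          refine (hb _ _ h1.le (h3.trans h4)).trans ?_
          gcongr)
      rw [show y + l - 0 - r = y + l - m - r + m by ring,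
        show s - l - 0 + r = s - l - m + r + m by ring]
      exact this
    have e0 := FTC 0 le_rfl hm0.le
    have em := FTC m hm0.le le_rfl
    have i0 : IntervalIntegrable (fun r => V (y + l - 0 - r) (s - l - 0 + r)) volume 0 l :=
      ContinuousOn.intervalIntegrable (by rw [uIcc_of_le hl0.le]; exact cV 0 le_rfl hm0.le)
    have im : IntervalIntegrable (fun r => V (y + l - m - r) (s - l - m + r)) volume 0 l :=
      ContinuousOn.intervalIntegrable (by rw [uIcc_of_le hl0.le]; exact cV m hm0.le le_rfl)
    have e : D y s - D ((y + s - e) / 2 + 0) ((y + s + e) / 2)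
        - D ((e + y - s) / 2) ((e + s - y) / 2) + D 0 e
        = ∫ r in (0 : ℝ)..l, (V (y + l - 0 - r) (s - l - 0 + r)
          - V (y + l - m - r) (s - l - m + r)) := by
      rw [intervalIntegral.integral_sub i0 im, e0, em]
      simp only [hl, hm]
      ring_nf
    rw [e]
    refine (intervalIntegral.norm_integral_le_of_norm_le
      (f := fun r => V (y + l - 0 - r) (s - l - 0 + r) - V (y + l - m - r) (s - l - m + r))
      (g := fun r => K * M * Real.exp (c * (s - l + r))) hl0.le
      (ae_of_all _ fun r hr => ?_) (Continuous.intervalIntegrable (by fun_prop) _ _)).trans ?_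
    · refine (hdiff r ⟨hr.1.le, hr.2⟩).trans_eq (by ring)
    · rw [intervalIntegral.integral_const_mul]
      have := mul_le_mul_of_nonneg_left (integral_exp_le (l := l) (r := s - l) hc0)
        (mul_nonneg hK0 hM0)
      refine this.trans_eq ?_
      rw [sub_add_cancel]; ring
  -- letting the parallelogram reach the boundary of the cone
  have bound : ∀ y s, |y| ≤ s → s ≤ t → |D y s| ≤ K * M / c * Real.exp (c * s) := by
    intro y s hy hs
    rcases hy.eq_or_lt with hy | hy
    · rw [h0 y s hy (by linarith), abs_zero]; positivity
    obtain ⟨hy1, hy2⟩ := abs_lt.1 hy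
    set S : Set ℝ := Ico 0 (min (s - y) (s + y)) with hS
    have hS0 : 0 < min (s - y) (s + y) := lt_min (by linarith) (by linarith)
    have hSl : ∀ e ∈ S, 0 ≤ e ∧ e < s - y ∧ e < s + y := fun e he =>
      ⟨he.1, he.2.trans_le (min_le_left _ _), he.2.trans_le (min_le_right _ _)⟩
    have c1 : ContinuousOn (fun e => D ((y + s - e) / 2 + 0) ((y + s + e) / 2)) S :=
      hD.comp (f := fun e => ((y + s - e) / 2 + 0, (y + s + e) / 2)) (by fun_prop) fun e he => by
        obtain ⟨h1, h2, h3⟩ := hSl e he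
        exact ⟨abs_le.2 ⟨by simp only; linarith, by simp only; linarith⟩, by simp only; linarith⟩
    have c2 : ContinuousOn (fun e => D ((e + y - s) / 2) ((e + s - y) / 2)) S :=
      hD.comp (f := fun e => ((e + y - s) / 2, (e + s - y) / 2)) (by fun_prop) fun e he => by
        obtain ⟨h1, h2, h3⟩ := hSl e he
        exact ⟨abs_le.2 ⟨by simp only; linarith, by simp only; linarith⟩, by simp only; linarith⟩
    have c3 : ContinuousOn (fun e => D 0 e) S :=
      hD.comp (f := fun e => ((0 : ℝ), e)) (by fun_prop) fun e he => by
        obtain ⟨h1, h2, h3⟩ := hSl e he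
        exact ⟨by simpa using h1, by simp only; linarith⟩
    have cc := (((continuousOn_const (c := D y s)).sub c1).sub c2).add c3
    have ht := (cc 0 ⟨le_rfl, hS0⟩).abs.tendsto
    have hle : ∀ᶠ e in 𝓝[Ioo 0 (min (s - y) (s + y))] (0 : ℝ),
        |D y s - D ((y + s - e) / 2 + 0) ((y + s + e) / 2)
        - D ((e + y - s) / 2) ((e + s - y) / 2) + D 0 e| ≤ K * M / c * Real.exp (c * s) := by
      filter_upwards [self_mem_nhdsWithin] with e he
      exact key y s e hy hs he.1 (hSl e ⟨he.1.le, he.2⟩).2.1 (hSl e ⟨he.1.le, he.2⟩).2.2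
    have : (𝓝[Ioo 0 (min (s - y) (s + y))] (0 : ℝ)).NeBot := by
      rw [nhdsWithin_Ioo_eq_nhdsGT hS0]; infer_instance
    have := le_of_tendsto (ht.mono_left (nhdsWithin_mono _ Ioo_subset_Ico_self)) hle
    simp only [Pi.add_apply, Pi.sub_apply] at this
    rw [h0 ((y + s - 0) / 2 + 0) ((y + s + 0) / 2)
        (by rw [abs_of_pos (by linarith)]; ring) (by linarith),
      h0 ((0 + y - s) / 2) ((0 + s - y) / 2) (by rw [abs_of_neg (by linarith)]; ring)
        (by linarith), h0 0 0 (by simp) (by linarith)] at this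
    simpa using this
  have h1 := bound z.1 z.2 hz.1 hz.2
  have h2 : M ≤ 1 / 2 * M := by
    have h3 := mul_le_mul_of_nonneg_right h1 (Real.exp_pos (-(c * z.2))).le
    rw [mul_assoc, ← Real.exp_add, add_neg_cancel, Real.exp_zero, mul_one] at h3
    refine (show M ≤ K * M / c from h3).trans ?_
    rw [div_le_iff₀ hc0]
    nlinarith
  have h3 : M = 0 := by linarith
  have := hb x t hx le_rfl
  rw [h3, zero_mul] at this
  exact abs_nonpos_iff.1 this

lemma periodize_of_mem_Ioo (q : ℝ → ℝ) {x : ℝ} (h1 : -(2 * Real.pi) < x) (h2 : x < 0) :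
    periodize q x = q (x + 2 * Real.pi) := by
  rw [← periodize_periodic q x, periodize_eq q ⟨by linarith, by linarith⟩]

/-- The triangle of the kernel `w⁰`, with its side `x = 0`. -/
def leftTriangle : Set (ℝ × ℝ) := {p | 0 ≤ p.1 ∧ p.1 < p.2 ∧ p.2 < 2 * Real.pi}

/-- The triangle of the kernel `w^{2π}`, with its side `x = 2π`. -/
def rightTriangle : Set (ℝ × ℝ) :=
  {p | 0 ≤ 2 * Real.pi - p.1 ∧ 2 * Real.pi - p.1 < p.2 ∧ p.2 < 2 * Real.pi}

lemma uniqueDiffOn_leftTriangle : UniqueDiffOn ℝ leftTriangle := by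
  have h : leftTriangle = (Ici 0 ×ˢ univ) ∩ {p : ℝ × ℝ | p.1 < p.2 ∧ p.2 < 2 * Real.pi} := by
    ext p; simp [leftTriangle]
  rw [h]
  exact ((uniqueDiffOn_Ici 0).prod uniqueDiffOn_univ).inter
    ((isOpen_lt (by fun_prop) (by fun_prop)).and (isOpen_lt (by fun_prop) (by fun_prop)))

lemma uniqueDiffOn_rightTriangle : UniqueDiffOn ℝ rightTriangle := by
  have h : rightTriangle = (Iic (2 * Real.pi) ×ˢ univ) ∩
      {p : ℝ × ℝ | 2 * Real.pi - p.1 < p.2 ∧ p.2 < 2 * Real.pi} := by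
    ext p; simp [rightTriangle]
  rw [h]
  exact ((uniqueDiffOn_Iic _).prod uniqueDiffOn_univ).inter
    ((isOpen_lt (by fun_prop) (by fun_prop)).and (isOpen_lt (by fun_prop) (by fun_prop)))

lemma leftTriangle_mem_nhds {x t : ℝ} (h0 : 0 < x) (h1 : x < t) (h2 : t < 2 * Real.pi) :
    leftTriangle ∈ 𝓝 (x, t) := by
  have ho : IsOpen {p : ℝ × ℝ | 0 < p.1 ∧ p.1 < p.2 ∧ p.2 < 2 * Real.pi} :=
    (isOpen_lt (by fun_prop) (by fun_prop)).and
      ((isOpen_lt (by fun_prop) (by fun_prop)).and (isOpen_lt (by fun_prop) (by fun_prop)))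
  exact mem_of_superset (ho.mem_nhds ⟨h0, h1, h2⟩) fun p hp => ⟨hp.1.le, hp.2⟩

lemma rightTriangle_mem_nhds {x t : ℝ} (h0 : x < 2 * Real.pi) (h1 : 2 * Real.pi - x < t)
    (h2 : t < 2 * Real.pi) : rightTriangle ∈ 𝓝 (x, t) := by
  have ho : IsOpen {p : ℝ × ℝ | 0 < 2 * Real.pi - p.1 ∧ 2 * Real.pi - p.1 < p.2 ∧
      p.2 < 2 * Real.pi} :=
    (isOpen_lt (by fun_prop) (by fun_prop)).and
      ((isOpen_lt (by fun_prop) (by fun_prop)).and (isOpen_lt (by fun_prop) (by fun_prop)))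
  exact mem_of_superset (ho.mem_nhds ⟨by simp only; linarith, h1, h2⟩) fun p hp => ⟨hp.1.le, hp.2⟩

/-- The function on the cone `|x| ≤ t` made of `f` for `x ≥ 0` and of `g`, translated by the
period, for `x < 0`. -/
def glue (f g : ℝ × ℝ → ℝ) (z : ℝ × ℝ) : ℝ := if 0 ≤ z.1 then f z else g (z.1 + 2 * Real.pi, z.2)

lemma continuousOn_glue {f g : ℝ × ℝ → ℝ} {s : Set (ℝ × ℝ)}
    (hf : ContinuousOn f (s ∩ {z | 0 ≤ z.1}))
    (hg : ContinuousOn (fun z => g (z.1 + 2 * Real.pi, z.2)) (s ∩ {z | z.1 ≤ 0}))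
    (h : ∀ t, (0, t) ∈ s → f (0, t) = g (2 * Real.pi, t)) : ContinuousOn (glue f g) s := by
  have c1 : IsClosed {z : ℝ × ℝ | 0 ≤ z.1} := isClosed_le (by fun_prop) (by fun_prop)
  have c2 : IsClosed {z : ℝ × ℝ | z.1 ≤ 0} := isClosed_le (by fun_prop) (by fun_prop)
  refine ContinuousOn.if (fun z hz => ?_) (hf.mono ?_) (hg.mono ?_)
  · have := frontier_le_subset_eq continuous_const continuous_fst hz.2
    obtain ⟨x, t⟩ := z
    have hx : 0 = x := this
    subst hx
    simpa using h t hz.1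
  · rw [c1.closure_eq]
  · refine inter_subset_inter_right _ (closure_minimal (fun z hz => ?_) c2)
    exact (not_le.1 (show ¬ 0 ≤ z.1 from hz)).le

section Pair

variable {q : ℝ → ℝ} {c : ℝ} {w0 w2 : ℝ → ℝ → ℝ}

lemma IsGoursatPair.continuousOn_glue (h : IsGoursatPair q c w0 w2)
    (hc : w2 (2 * Real.pi) 0 = w0 0 0) :
    ContinuousOn (glue (Function.uncurry w0) (Function.uncurry w2))
      {z | |z.1| ≤ z.2 ∧ z.2 < 2 * Real.pi} := by
  refine PeriodicWave.continuousOn_glue (h.cont_left.mono fun z hz => ?_)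
    (h.cont_right.comp (f := fun z : ℝ × ℝ => (z.1 + 2 * Real.pi, z.2)) (by fun_prop)
      fun z hz => ?_) fun t ht => ?_
  · obtain ⟨⟨h1, h2⟩, h3⟩ := hz
    exact ⟨h3, (le_abs_self _).trans h1, h2⟩
  · obtain ⟨⟨h1, h2⟩, h3⟩ := hz
    have h3' : z.1 ≤ 0 := h3
    have := (neg_le_abs z.1).trans h1
    exact ⟨by simp only; linarith, by simp only; linarith, h2⟩
  · obtain ⟨h1, h2⟩ := ht
    simp only [abs_zero] at h1
    rcases h1.eq_or_lt with h1 | h1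
    · subst h1; exact hc.symm
    · exact h.compat t ⟨h1, h2⟩

lemma IsGoursatPair.continuousOn_glue_charDeriv (h : IsGoursatPair q c w0 w2) :
    ContinuousOn (glue (charDeriv w0 leftTriangle) (charDeriv w2 rightTriangle))
      {z | |z.1| < z.2 ∧ z.2 < 2 * Real.pi} := by
  refine PeriodicWave.continuousOn_glue
    ((continuousOn_charDeriv uniqueDiffOn_leftTriangle h.smooth_left).mono fun z hz => ?_)
    ((continuousOn_charDeriv uniqueDiffOn_rightTriangle h.smooth_right).comp
      (f := fun z : ℝ × ℝ => (z.1 + 2 * Real.pi, z.2)) (by fun_prop) fun z hz => ?_) fun t ht => ?_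
  · obtain ⟨⟨h1, h2⟩, h3⟩ := hz
    exact ⟨h3, (le_abs_self _).trans_lt h1, h2⟩
  · obtain ⟨⟨h1, h2⟩, h3⟩ := hz
    have h3' : z.1 ≤ 0 := h3
    have := (neg_le_abs z.1).trans_lt h1
    exact ⟨by simp only; linarith, by simp only; linarith, h2⟩
  · obtain ⟨h1, h2⟩ := ht
    simp only [abs_zero] at h1 h2
    have d0 : DifferentiableWithinAt ℝ (Function.uncurry w0) leftTriangle (0, t) :=
      h.smooth_left.differentiableOn (by simp) (0, t) ⟨le_rfl, h1, h2⟩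
    have d2 : DifferentiableWithinAt ℝ (Function.uncurry w2) rightTriangle (2 * Real.pi, t) :=
      h.smooth_right.differentiableOn (by simp) (2 * Real.pi, t) ⟨by simp, by simpa using h1, h2⟩
    have hI : ∀ᶠ s in 𝓝 t, s ∈ Ioo 0 (2 * Real.pi) := isOpen_Ioo.mem_nhds ⟨h1, h2⟩
    have t0 := hasDerivWithinAt_snd (I := univ) d0 (by
      rw [nhdsWithin_univ]
      exact hI.mono fun s hs => ⟨le_rfl, hs.1, hs.2⟩)
    have t2 := hasDerivWithinAt_snd (I := univ) d2 (by
      rw [nhdsWithin_univ]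
      exact hI.mono fun s hs => ⟨by simp, by simpa using hs.1, hs.2⟩)
    rw [hasDerivWithinAt_univ] at t0 t2
    have et := t0.unique (t2.congr_of_eventuallyEq (hI.mono fun s hs => h.compat s hs))
    have x0 := hasDerivWithinAt_fst (I := Ici 0) d0 (by
      filter_upwards [self_mem_nhdsWithin, mem_nhdsWithin_of_mem_nhds (Iio_mem_nhds h1)]
        with y hy hy'
      exact ⟨hy, hy', h2⟩)
    have x2 := hasDerivWithinAt_fst (I := Iic (2 * Real.pi)) d2 (by
      filter_upwards [self_mem_nhdsWithin, mem_nhdsWithin_of_mem_nhds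
        (Ioi_mem_nhds (show 2 * Real.pi - t < 2 * Real.pi by linarith))] with y hy hy'
      have h1' : y ≤ 2 * Real.pi := hy
      have h2' : 2 * Real.pi - t < y := hy'
      exact ⟨by linarith, by linarith, h2⟩)
    rw [charDeriv_eq, charDeriv_eq, et, ← x0.derivWithin (uniqueDiffOn_Ici _ _ self_mem_Ici),
      ← x2.derivWithin (uniqueDiffOn_Iic _ _ self_mem_Iic), h.compat_deriv t ⟨h1, h2⟩]

lemma ne_zero_of_notMem_lattice {x : ℝ} (h : x ∉ lattice) : x ≠ 0 := by
  rintro rfl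
  exact h ⟨0, by simp⟩

lemma IsGoursatPair.hasDerivAt_glue (h : IsGoursatPair q c w0 w2) {x t s : ℝ}
    (hx : |x - s| < t + s) (ht : t + s < 2 * Real.pi) (hl : x - s ∉ lattice) :
    HasDerivAt (fun s => glue (Function.uncurry w0) (Function.uncurry w2) (x - s, t + s))
      (glue (charDeriv w0 leftTriangle) (charDeriv w2 rightTriangle) (x - s, t + s)) s := by
  obtain ⟨h1, h2⟩ := abs_lt.1 hx
  have hc : ContinuousAt (fun s => x - s) s := by fun_prop
  rcases lt_or_gt_of_ne (ne_zero_of_notMem_lattice hl) with h0 | h0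
  · have hm : rightTriangle ∈ 𝓝 (x + 2 * Real.pi - s, t + s) :=
      rightTriangle_mem_nhds (by linarith) (by linarith) ht
    have := hasDerivAt_antidiagonal hm ((h.smooth_right.contDiffAt hm).differentiableAt (by simp))
    rw [glue, if_neg (not_le.2 h0)]
    simp only [show x - s + 2 * Real.pi = x + 2 * Real.pi - s by ring]
    refine this.congr_of_eventuallyEq ?_
    filter_upwards [hc (Iio_mem_nhds h0)] with r hr
    simp only [mem_preimage, mem_Iio] at hr
    simp only [glue, if_neg (not_le.2 hr), show x - r + 2 * Real.pi = x + 2 * Real.pi - r by ring,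
      Function.uncurry]
  · have hm : leftTriangle ∈ 𝓝 (x - s, t + s) := leftTriangle_mem_nhds h0 (by linarith) ht
    have := hasDerivAt_antidiagonal hm ((h.smooth_left.contDiffAt hm).differentiableAt (by simp))
    rw [glue, if_pos (show 0 ≤ (x - s, t + s).1 from h0.le)]
    refine this.congr_of_eventuallyEq ?_
    filter_upwards [hc (Ioi_mem_nhds h0)] with r hr
    simp only [mem_preimage, mem_Ioi] at hr
    simp only [glue, if_pos hr.le, Function.uncurry]

lemma IsGoursatPair.hasDerivAt_glue_charDeriv (h : IsGoursatPair q c w0 w2) {x t s : ℝ}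
    (hx : |x + s| < t + s) (ht : t + s < 2 * Real.pi) (hl : x + s ∉ lattice) :
    HasDerivAt (fun s => glue (charDeriv w0 leftTriangle) (charDeriv w2 rightTriangle)
        (x + s, t + s))
      (-(periodize q (x + s) * glue (Function.uncurry w0) (Function.uncurry w2)
        (x + s, t + s))) s := by
  obtain ⟨h1, h2⟩ := abs_lt.1 hx
  have hc : ContinuousAt (fun s => x + s) s := by fun_prop
  rcases lt_or_gt_of_ne (ne_zero_of_notMem_lattice hl) with h0 | h0
  · have hm : rightTriangle ∈ 𝓝 (x + 2 * Real.pi + s, t + s) :=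
      rightTriangle_mem_nhds (by linarith) (by linarith) ht
    have ho : IsOpen {p : ℝ × ℝ | 0 < 2 * Real.pi - p.1 ∧ 2 * Real.pi - p.1 < p.2 ∧
        p.2 < 2 * Real.pi} :=
      (isOpen_lt (by fun_prop) (by fun_prop)).and
        ((isOpen_lt (by fun_prop) (by fun_prop)).and (isOpen_lt (by fun_prop) (by fun_prop)))
    have hw := h.wave_right (x + 2 * Real.pi + s) (t + s) (by linarith) (by linarith) ht
    have := hasDerivAt_charDeriv hm (h.smooth_right_open.contDiffAt (ho.mem_nhds
      ⟨by simp only; linarith, by simp only; linarith, ht⟩))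
    have e : waveOp w2 (x + 2 * Real.pi + s) (t + s)
        = -(q (x + 2 * Real.pi + s) * w2 (x + 2 * Real.pi + s) (t + s)) := by
      rw [waveOp]; linarith
    rw [e] at this
    rw [periodize_of_mem_Ioo q (by linarith) h0, glue, if_neg (not_le.2 h0)]
    simp only [show x + s + 2 * Real.pi = x + 2 * Real.pi + s by ring]
    refine this.congr_of_eventuallyEq ?_
    filter_upwards [hc (Iio_mem_nhds h0)] with r hr
    simp only [mem_preimage, mem_Iio] at hr
    simp only [glue, if_neg (not_le.2 hr), show x + r + 2 * Real.pi = x + 2 * Real.pi + r by ring]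
  · have hm : leftTriangle ∈ 𝓝 (x + s, t + s) := leftTriangle_mem_nhds h0 (by linarith) ht
    have ho : IsOpen {p : ℝ × ℝ | 0 < p.1 ∧ p.1 < p.2 ∧ p.2 < 2 * Real.pi} :=
      (isOpen_lt (by fun_prop) (by fun_prop)).and
        ((isOpen_lt (by fun_prop) (by fun_prop)).and (isOpen_lt (by fun_prop) (by fun_prop)))
    have hw := h.wave_left (x + s) (t + s) h0 h2 ht
    have := hasDerivAt_charDeriv hm (h.smooth_left_open.contDiffAt (ho.mem_nhds ⟨h0, h2, ht⟩))
    have e : waveOp w0 (x + s) (t + s) = -(q (x + s) * w0 (x + s) (t + s)) := by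
      rw [waveOp]; linarith
    rw [e] at this
    rw [periodize_eq q ⟨h0.le, by linarith⟩, glue,
      if_pos (show 0 ≤ (x + s, t + s).1 from h0.le)]
    refine this.congr_of_eventuallyEq ?_
    filter_upwards [hc (Ioi_mem_nhds h0)] with r hr
    simp only [mem_preimage, mem_Ioi] at hr
    simp only [glue, if_pos hr.le]

/-- The corner value of the second kernel, by continuity along `x = 2π`. -/
lemma IsGoursatPair.corner_right (h : IsGoursatPair q c w0 w2) :
    w2 (2 * Real.pi) 0 = 0 := by
  have hpi := Real.two_pi_pos
  have c0 : ContinuousOn (fun s => w0 0 s) (Ico 0 (2 * Real.pi)) :=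
    h.cont_left.comp (f := fun s : ℝ => ((0 : ℝ), s)) (by fun_prop)
      fun s hs => ⟨le_rfl, hs.1, hs.2⟩
  have c2 : ContinuousOn (fun s => w2 (2 * Real.pi) s) (Ico 0 (2 * Real.pi)) :=
    h.cont_right.comp (f := fun s : ℝ => (2 * Real.pi, s)) (by fun_prop)
      fun s hs => ⟨by simp, by simpa using hs.1, hs.2⟩
  have m0 : (0 : ℝ) ∈ Ico 0 (2 * Real.pi) := ⟨le_rfl, hpi⟩
  have t0 := ((c0 0 m0).mono Ioo_subset_Ico_self).tendsto
  have t2 := ((c2 0 m0).mono Ioo_subset_Ico_self).tendsto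
  have : (𝓝[Ioo 0 (2 * Real.pi)] (0 : ℝ)).NeBot := by
    rw [nhdsWithin_Ioo_eq_nhdsGT hpi]; infer_instance
  refine (tendsto_nhds_unique_of_eventuallyEq t2 t0 ?_).trans h.corner
  filter_upwards [self_mem_nhdsWithin] with s hs
  exact (h.compat s hs).symm

/-- The solution of the Goursat problem on the interval is unique. -/
theorem IsGoursatPair.unique (hq2 : MemLp q 2 (volume.restrict (Ioo 0 (2 * Real.pi))))
    {w0' w2' : ℝ → ℝ → ℝ} (h : IsGoursatPair q c w0 w2) (h' : IsGoursatPair q c w0' w2') {x t : ℝ}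
    (h0 : 0 ≤ x) (hx : x ≤ t) (ht : t < 2 * Real.pi) : w0 x t = w0' x t := by
  have hpi := Real.two_pi_pos
  have hright : ∀ y, 0 ≤ y → y < 2 * Real.pi → w0 y y = w0' y y := by
    intro y hy hyL
    have hm : MapsTo (fun s : ℝ => (s, s)) (Icc 0 y)
        {p : ℝ × ℝ | 0 ≤ p.1 ∧ p.1 ≤ p.2 ∧ p.2 < 2 * Real.pi} :=
      fun s hs => ⟨hs.1, le_rfl, hs.2.trans_lt hyL⟩
    have := integral_eq_of_hasDerivAt_off_countable (fun s => w0 s s - w0' s s) (fun _ => 0)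
      countable_empty (a := 0) (b := y) (by
        rw [uIcc_of_le hy]
        exact (h.cont_left.comp (f := fun s : ℝ => (s, s)) (by fun_prop) hm).sub
          (h'.cont_left.comp (f := fun s : ℝ => (s, s)) (by fun_prop) hm)) (fun s hs => by
        rw [min_eq_left hy, max_eq_right hy] at hs
        have hs' : s ∈ Ioo 0 (2 * Real.pi) := ⟨hs.1.1, hs.1.2.trans hyL⟩
        exact ((h.char_left s hs').sub (h'.char_left s hs')).congr_deriv (sub_self _))
      intervalIntegrable_const
    simp only [intervalIntegral.integral_zero, h.corner, h'.corner] at this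
    linarith
  have hleft : ∀ y, 0 < y → y ≤ 2 * Real.pi →
      w2 y (2 * Real.pi - y) = w2' y (2 * Real.pi - y) := by
    intro y hy hyL
    have hm : MapsTo (fun s : ℝ => (s, 2 * Real.pi - s)) (Icc y (2 * Real.pi))
        {p : ℝ × ℝ | 0 ≤ 2 * Real.pi - p.1 ∧ 2 * Real.pi - p.1 ≤ p.2 ∧ p.2 < 2 * Real.pi} :=
      fun s hs => ⟨sub_nonneg.2 hs.2, le_rfl, by simp only; linarith [hs.1]⟩
    have := integral_eq_of_hasDerivAt_off_countable
      (fun s => w2 s (2 * Real.pi - s) - w2' s (2 * Real.pi - s)) (fun _ => 0)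
      countable_empty (a := y) (b := 2 * Real.pi) (by
        rw [uIcc_of_le hyL]
        exact (h.cont_right.comp (f := fun s : ℝ => (s, 2 * Real.pi - s)) (by fun_prop) hm).sub
          (h'.cont_right.comp (f := fun s : ℝ => (s, 2 * Real.pi - s)) (by fun_prop) hm))
      (fun s hs => by
        rw [min_eq_left hyL, max_eq_right hyL] at hs
        have hs' : s ∈ Ioo 0 (2 * Real.pi) := ⟨hy.trans hs.1.1, hs.1.2⟩
        exact ((h.char_right s hs').sub (h'.char_right s hs')).congr_deriv (sub_self _))
      intervalIntegrable_const
    simp only [intervalIntegral.integral_zero, sub_self, h.corner_right, h'.corner_right] at this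
    linarith
  have key := eq_zero_of_goursat (p := periodize q) (L := 2 * Real.pi)
    (D := fun x t => glue (Function.uncurry w0) (Function.uncurry w2) (x, t)
      - glue (Function.uncurry w0') (Function.uncurry w2') (x, t))
    (V := fun x t => glue (charDeriv w0 leftTriangle) (charDeriv w2 rightTriangle) (x, t)
      - glue (charDeriv w0' leftTriangle) (charDeriv w2' rightTriangle) (x, t))
    (intervalIntegrable_periodize hq2)
    ((h.continuousOn_glue (by rw [h.corner, h.corner_right])).sub
      (h'.continuousOn_glue (by rw [h'.corner, h'.corner_right])))
    (h.continuousOn_glue_charDeriv.sub h'.continuousOn_glue_charDeriv)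
    (fun x t s hx ht hl => (h.hasDerivAt_glue hx ht hl).sub (h'.hasDerivAt_glue hx ht hl))
    (fun x t s hx ht hl => ((h.hasDerivAt_glue_charDeriv hx ht hl).sub
      (h'.hasDerivAt_glue_charDeriv hx ht hl)).congr_deriv (by ring))
    (fun x t hxt ht => by
      rcases le_or_gt 0 x with hx | hx
      · rw [abs_of_nonneg hx] at hxt
        subst hxt
        simp only [glue, if_pos hx, Function.uncurry]
        rw [hright x hx ht, sub_self]
      · rw [abs_of_neg hx] at hxt
        subst hxt
        simp only [glue, if_neg (not_le.2 hx), Function.uncurry]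
        have := hleft (x + 2 * Real.pi) (by linarith) (by linarith)
        rw [show 2 * Real.pi - (x + 2 * Real.pi) = -x by ring] at this
        rw [this, sub_self]) (x := x) (t := t) (by rwa [abs_of_nonneg h0]) ht
  simp only [glue, if_pos h0, Function.uncurry] at key
  linarith

lemma IsGoursatPair.derivWithin_unique
    (hq2 : MemLp q 2 (volume.restrict (Ioo 0 (2 * Real.pi))))
    {w0' w2' : ℝ → ℝ → ℝ} (h : IsGoursatPair q c w0 w2) (h' : IsGoursatPair q c w0' w2') {t : ℝ}
    (h0 : 0 < t) (ht : t < 2 * Real.pi) :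
    derivWithin (fun x => w0 x t) (Ici 0) 0 = derivWithin (fun x => w0' x t) (Ici 0) 0 := by
  refine Filter.EventuallyEq.derivWithin_eq ?_ (h.unique hq2 h' le_rfl h0.le ht)
  filter_upwards [self_mem_nhdsWithin, mem_nhdsWithin_of_mem_nhds (Iio_mem_nhds h0)] with y hy hy'
  exact h.unique hq2 h' hy (le_of_lt hy') ht

end Pair

/-! ### The Goursat problem on the interval: existence -/

/-- The two kernels on the interval are the restrictions of the kernel on the line. -/
theorem IsKernel.isGoursatPair {q : ℝ → ℝ} (hq : ContDiffOn ℝ 2 q (Ioo 0 (2 * Real.pi)))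
    (hq2 : MemLp q 2 (volume.restrict (Ioo 0 (2 * Real.pi)))) {c : ℝ} {w : ℝ → ℝ → ℝ}
    (hw : IsKernel (truncPot q (2 * Real.pi)) (-2 * c) (-(1 / 2)) w) :
    IsGoursatPair q c w fun x t => w (x - 2 * Real.pi) t := by
  have hpi := Real.two_pi_pos
  have hp := integrable_truncPot hq2 (2 * Real.pi)
  have hline := hw.isLineGoursatKernel hq hq2
  have hpc : ∀ y, y ≠ 0 → |y| < 2 * Real.pi → ContDiffAt ℝ 2 (truncPot q (2 * Real.pi)) y := by
    intro y hy hy'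
    refine contDiffAt_truncPot hq hy' ?_
    obtain ⟨h1, h2⟩ := abs_lt.1 hy'
    rcases lt_or_gt_of_ne hy with h | h
    · exact notMem_lattice_of_mem_Ioo (-1) (by push_cast; linarith) (by push_cast; linarith)
    · exact notMem_lattice_of_mem_Ioo 0 (by push_cast; linarith) (by push_cast; linarith)
  set O : Set (ℝ × ℝ) := {z | |z.1| < z.2 ∧ z.2 < 2 * Real.pi} with hO
  have hOo : IsOpen O :=
    (isOpen_lt (by fun_prop) (by fun_prop)).and (isOpen_lt (by fun_prop) (by fun_prop))
  have hC1 : ContDiffOn ℝ 1 (Function.uncurry w) O := hw.contDiffOn_one hp hOo fun z hz => by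
    obtain ⟨h1, h2⟩ := abs_lt.1 hz.1
    have h3 := hz.2
    refine ⟨hz.1, (hpc _ (by linarith) ?_).continuousAt, (hpc _ (by linarith) ?_).continuousAt⟩
    · exact abs_lt.2 ⟨by linarith, by linarith⟩
    · exact abs_lt.2 ⟨by linarith, by linarith⟩
  have hpr : ContDiffOn ℝ 1 (truncPot q (2 * Real.pi)) (Ioo 0 (2 * Real.pi)) := fun y hy =>
    ((hpc y hy.1.ne' (abs_lt.2 ⟨by linarith [hy.1], hy.2⟩)).of_le (by norm_num)).contDiffWithinAt
  have hpl : ContDiffOn ℝ 1 (truncPot q (2 * Real.pi)) (Ioo (-(2 * Real.pi)) 0) := fun y hy =>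
    ((hpc y hy.2.ne (abs_lt.2 ⟨hy.1, by linarith [hy.2]⟩)).of_le (by norm_num)).contDiffWithinAt
  obtain ⟨c2, cw⟩ := hw.classical hp hpr hpl
  have hrefl : ContDiffOn ℝ 1 (fun y => truncPot q (2 * Real.pi) (-y)) (Ioo 0 (2 * Real.pi)) :=
    hpl.comp contDiff_neg.contDiffOn fun y hy => ⟨neg_lt_neg hy.2, neg_lt_zero.2 hy.1⟩
  have hrefl' : ContDiffOn ℝ 1 (fun y => truncPot q (2 * Real.pi) (-y))
      (Ioo (-(2 * Real.pi)) 0) :=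
    hpr.comp contDiff_neg.contDiffOn fun y hy => ⟨neg_pos.2 hy.2, by linarith [hy.1]⟩
  obtain ⟨c2', cw'⟩ := hw.reflect.classical hp.comp_neg hrefl hrefl'
  have hdiff : ∀ s ∈ Ioo 0 (2 * Real.pi), DifferentiableAt ℝ (fun x => w x s) 0 := by
    intro s hs
    have h1 : DifferentiableAt ℝ (Function.uncurry w) (0, s) :=
      (hC1.contDiffAt (hOo.mem_nhds ⟨by simpa using hs.1, hs.2⟩)).differentiableAt (by simp)
    exact DifferentiableAt.comp (g := Function.uncurry w) (f := fun x : ℝ => (x, s)) 0 h1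
      (by fun_prop)
  refine ⟨hw.cont.continuousOn, ?_, hC1.mono ?_, ?_, c2.mono ?_, ?_, ?_, ?_, ?_, ?_,
    hline.corner, ?_, ?_⟩
  · exact (hw.cont.comp (by fun_prop : Continuous fun z : ℝ × ℝ =>
      (z.1 - 2 * Real.pi, z.2))).continuousOn
  · exact fun z hz => ⟨by rw [abs_of_nonneg hz.1]; exact hz.2.1, hz.2.2⟩
  · refine hC1.comp (g := Function.uncurry w) (f := fun z : ℝ × ℝ => (z.1 - 2 * Real.pi, z.2))
      (by fun_prop) fun z hz => ⟨?_, hz.2.2⟩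
    obtain ⟨h1, h2, h3⟩ := hz
    rw [abs_of_nonpos (by simp only; linarith)]
    simp only; linarith
  · exact fun z hz => ⟨hz.1, hz.2.1, by linarith [hz.2.1, hz.2.2]⟩
  · have := c2'.comp (f := fun z : ℝ × ℝ => (2 * Real.pi - z.1, z.2))
      (s := {p | 0 < 2 * Real.pi - p.1 ∧ 2 * Real.pi - p.1 < p.2 ∧ p.2 < 2 * Real.pi})
      (by fun_prop) fun z hz => ⟨hz.1, hz.2.1, by simp only; linarith [hz.2.1, hz.2.2]⟩
    refine this.congr fun z hz => ?_
    simp [Function.uncurry]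
  · intro x t h0 hx ht
    have := cw x t h0 hx (by linarith)
    rw [truncPot_eq (abs_lt.2 ⟨by linarith, by linarith⟩),
      periodize_eq q ⟨h0.le, by linarith⟩] at this
    exact this
  · intro x t h0 hx ht
    have h := cw' (2 * Real.pi - x) t h0 hx (by linarith)
    have e : iteratedDeriv 2 (fun y => w (y - 2 * Real.pi) t) x
        = iteratedDeriv 2 (fun y => w (-y) t) (2 * Real.pi - x) := by
      have := iteratedDeriv_comp_const_sub 2 (fun y => w (-y) t) (2 * Real.pi)
      have h2 := congrFun this x
      simp only [neg_sub] at h2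
      rw [h2]; simp
    simp only [neg_sub] at h
    rw [e]
    rw [truncPot_eq (abs_lt.2 ⟨by linarith, by linarith⟩),
      periodize_of_mem_Ioo q (by linarith) (by linarith), sub_add_cancel] at h
    exact h
  · intro x hx
    have := hline.char_right x hx fun m => notMem_lattice_iff.1
      (notMem_lattice_of_mem_Ioo 0 (by push_cast; linarith [hx.1]) (by push_cast; linarith [hx.2])) m
    rwa [periodize_eq q ⟨hx.1.le, hx.2⟩] at this
  · intro x hx
    have := hline.char_left (x - 2 * Real.pi) ⟨by linarith [hx.1], by linarith [hx.2]⟩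
      fun m => notMem_lattice_iff.1 (notMem_lattice_of_mem_Ioo (-1)
        (by push_cast; linarith [hx.1]) (by push_cast; linarith [hx.2])) m
    rw [periodize_of_mem_Ioo q (by linarith [hx.1]) (by linarith [hx.2]), sub_add_cancel] at this
    have h2 := this.comp_sub_const x (2 * Real.pi)
    simpa using h2
  · intro s _
    simp
  · intro s hs
    have h1 := hdiff s hs
    rw [(h1.hasDerivAt.hasDerivWithinAt).derivWithin (uniqueDiffOn_Ici _ _ self_mem_Ici)]
    have h2 : HasDerivAt (fun x => w (x - 2 * Real.pi) s) (deriv (fun x => w x s) 0)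
        (2 * Real.pi) := by
      have h3 : HasDerivAt (fun x => w x s) (deriv (fun x => w x s) 0)
          (2 * Real.pi - 2 * Real.pi) := by rw [sub_self]; exact h1.hasDerivAt
      exact h3.comp_sub_const (2 * Real.pi) (2 * Real.pi)
    rw [h2.hasDerivWithinAt.derivWithin (uniqueDiffOn_Iic _ _ self_mem_Iic)]

/-! ### The initial boundary value problem: uniqueness -/

/-- The `2π`-periodic continuation in the space variable of a function on `[0, 2π) × I`. -/
def perExt (f : ℝ × ℝ → ℝ) (z : ℝ × ℝ) : ℝ := f (toIcoMod Real.two_pi_pos 0 z.1, z.2)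

lemma perExt_eq {f : ℝ × ℝ → ℝ} {x t : ℝ} (k : ℤ) (h1 : 2 * k * Real.pi ≤ x)
    (h2 : x < 2 * (k + 1) * Real.pi) : perExt f (x, t) = f (x - 2 * k * Real.pi, t) := by
  have h : toIcoMod Real.two_pi_pos 0 x = x - 2 * k * Real.pi := by
    rw [toIcoMod_eq_iff]
    exact ⟨⟨by linarith, by linarith⟩, k, by rw [zsmul_eq_mul]; ring⟩
  rw [perExt, h]

lemma continuousOn_perExt {f : ℝ × ℝ → ℝ} {I : Set ℝ}
    (hf : ContinuousOn f (Icc 0 (2 * Real.pi) ×ˢ I))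
    (h : ∀ t ∈ I, f (0, t) = f (2 * Real.pi, t)) : ContinuousOn (perExt f) (univ ×ˢ I) := by
  have hpi := Real.two_pi_pos
  -- the continuation is continuous on each closed strip between lattice points
  have strip : ∀ k : ℤ, ContinuousOn (perExt f)
      (Icc (2 * (k : ℝ) * Real.pi) (2 * (k + 1) * Real.pi) ×ˢ I) := by
    intro k
    refine (hf.comp (f := fun z : ℝ × ℝ => (z.1 - 2 * k * Real.pi, z.2)) (by fun_prop)
      fun z hz => ⟨⟨by linarith [hz.1.1], by linarith [hz.1.2]⟩, hz.2⟩).congr fun z hz => ?_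
    obtain ⟨x, t⟩ := z
    obtain ⟨⟨h1, h2⟩, ht⟩ := hz
    simp only at h1 h2 ht
    rcases h2.eq_or_lt with h3 | h3
    · rw [perExt_eq (k + 1) (by push_cast; linarith) (by push_cast; linarith)]
      simp only [Function.comp, h3]
      push_cast
      rw [sub_self, h t ht]
      congr 2; ring
    · exact perExt_eq k h1 h3
  rintro ⟨x, t⟩ ⟨-, ht⟩
  obtain ⟨k, hk⟩ : ∃ k : ℤ, x - k • (2 * Real.pi) ∈ Ico 0 (0 + 2 * Real.pi) :=
    ⟨_, (existsUnique_sub_zsmul_mem_Ico Real.two_pi_pos x 0).choose_spec.1⟩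
  rw [zsmul_eq_mul] at hk
  have c1 := strip k (x, t) ⟨⟨by simp only; linarith [hk.1], by simp only; linarith [hk.2]⟩, ht⟩
  have c2 : ContinuousWithinAt (perExt f)
      (Icc (2 * ((k - 1 : ℤ) : ℝ) * Real.pi) (2 * ((k - 1 : ℤ) + 1) * Real.pi) ×ˢ I) (x, t) := by
    by_cases hx : x ≤ 2 * k * Real.pi
    · exact strip (k - 1) (x, t)
        ⟨⟨by push_cast; linarith [hk.1], by push_cast; linarith⟩, ht⟩
    · refine continuousWithinAt_of_notMem_closure fun hc => hx ?_
      rw [closure_prod_eq, isClosed_Icc.closure_eq] at hc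
      have := hc.1.2
      push_cast at this
      linarith
  refine (c1.union c2).mono_of_mem_nhdsWithin ?_
  have hn : Ioo (2 * (k - 1) * Real.pi) (2 * (k + 1) * Real.pi) ×ˢ univ ∈ 𝓝 (x, t) :=
    prod_mem_nhds (Ioo_mem_nhds (by linarith [hk.1]) (by linarith [hk.2])) univ_mem
  filter_upwards [mem_nhdsWithin_of_mem_nhds hn, self_mem_nhdsWithin] with z hz hz'
  rcases le_total (2 * k * Real.pi) z.1 with h1 | h1
  · exact Or.inl ⟨⟨h1, hz.1.2.le⟩, hz'.2⟩
  · exact Or.inr ⟨⟨by push_cast; exact hz.1.1.le, by push_cast; linarith⟩, hz'.2⟩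

/-- The wave equation on the line with zero initial data and a spatially bounded solution `D`,
with `V = D_t - D_x`, has only the zero solution. -/
theorem eq_zero_of_wave {p : ℝ → ℝ} (hp : ∀ a b, IntervalIntegrable p volume a b)
    {D V : ℝ → ℝ → ℝ} {T : ℝ}
    (hD : ContinuousOn (Function.uncurry D) (univ ×ˢ Ico 0 T))
    (hV : ContinuousOn (Function.uncurry V) (univ ×ˢ Ico 0 T))
    (hper : ∀ x t, ∃ y ∈ Icc 0 (2 * Real.pi), D x t = D y t)
    (hD0 : ∀ x, D x 0 = 0) (hV0 : ∀ x, V x 0 = 0)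
    (hDd : ∀ x t s, 0 < t + s → t + s < T → x - s ∉ lattice →
      HasDerivAt (fun s => D (x - s) (t + s)) (V (x - s) (t + s)) s)
    (hVd : ∀ x t s, 0 < t + s → t + s < T → x + s ∉ lattice →
      HasDerivAt (fun s => V (x + s) (t + s)) (-(p (x + s) * D (x + s) (t + s))) s)
    {x t : ℝ} (ht0 : 0 ≤ t) (ht : t < T) : D x t = 0 := by
  have hpi := Real.two_pi_pos
  set K := ∫ y in -t..2 * Real.pi + t, |p y| with hK
  have hK0 : 0 ≤ K := intervalIntegral.integral_nonneg (by linarith) fun _ _ => abs_nonneg _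
  set c := 2 * K + 1 with hc
  have hc0 : 0 < c := by linarith
  have hDt : ContinuousOn (Function.uncurry D) (Icc 0 (2 * Real.pi) ×ˢ Icc 0 t) :=
    hD.mono fun z hz => ⟨mem_univ _, hz.2.1, hz.2.2.trans_lt ht⟩
  obtain ⟨z, hz, hmax⟩ := (isCompact_Icc.prod isCompact_Icc).exists_isMaxOn
    (s := Icc 0 (2 * Real.pi) ×ˢ Icc 0 t) ⟨(0, 0), ⟨⟨le_rfl, hpi.le⟩, le_rfl, ht0⟩⟩
    (f := fun z : ℝ × ℝ => |Function.uncurry D z| * Real.exp (-(c * z.2)))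
    (hDt.abs.mul (by fun_prop))
  set M := |Function.uncurry D z| * Real.exp (-(c * z.2)) with hM
  have hM0 : 0 ≤ M := by positivity
  have hb : ∀ y s, 0 ≤ s → s ≤ t → |D y s| ≤ M * Real.exp (c * s) := fun y s h1 h2 => by
    obtain ⟨y', hy', e⟩ := hper y s
    have := hmax (show (y', s) ∈ Icc 0 (2 * Real.pi) ×ˢ Icc 0 t from ⟨hy', h1, h2⟩)
    simp only [mem_ofPred_eq] at this
    calc |D y s| = |D y' s| * Real.exp (-(c * s)) * Real.exp (c * s) := by
          rw [e, mul_assoc, ← Real.exp_add]; simp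
      _ ≤ _ := mul_le_mul_of_nonneg_right this (Real.exp_pos _).le
  have hVb : ∀ y s, 0 ≤ s → s ≤ t → 0 ≤ y → y ≤ 2 * Real.pi + t →
      |V y s| ≤ K * (M * Real.exp (c * s)) := by
    intro y s hs hst hy hy'
    have := abs_sub_le_of_charDeriv (p := p) (D := D) (V := V) (x := y - s) (t := 0) (l := s)
      (B := M * Real.exp (c * s)) (K := K) hs (by positivity)
      (hV.comp (f := fun r => (y - s + r, 0 + r)) (by fun_prop)
        fun r hr => ⟨mem_univ _, by simpa using hr.1, by simp only; linarith [hr.2]⟩)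
      (hD.comp (f := fun r => (y - s + r, 0 + r)) (by fun_prop)
        fun r hr => ⟨mem_univ _, by simpa using hr.1, by simp only; linarith [hr.2]⟩)
      (fun r hr hl => hVd _ _ r (by linarith [hr.1]) (by linarith [hr.2]) hl) (hp _ _)
      (by
        refine intervalIntegral.integral_mono_interval (by linarith) (by linarith) (by linarith)
          (ae_of_all _ fun _ => abs_nonneg _) (hp _ _).abs)
      (fun r hr => by
        refine (hb _ _ (by linarith [hr.1]) (by linarith [hr.2])).trans ?_
        have := hr.2
        gcongr
        linarith)
    simpa [hV0] using this
  obtain ⟨y, s⟩ := z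
  obtain ⟨⟨hy1, hy2⟩, hs1, hs2⟩ := hz
  simp only at hy1 hy2 hs1 hs2
  have hcount : ((fun r => y + s - r) ⁻¹' lattice).Countable :=
    countable_lattice.preimage sub_right_injective
  have hcV : ContinuousOn (fun r => V (y + s - r) (0 + r)) (Icc 0 s) :=
    hV.comp (f := fun r => (y + s - r, 0 + r)) (by fun_prop)
      fun r hr => ⟨mem_univ _, by simpa using hr.1, by simp only; linarith [hr.2]⟩
  have e := integral_eq_of_hasDerivAt_off_countable
    (fun r => D (y + s - r) (0 + r)) (fun r => V (y + s - r) (0 + r)) hcount (a := 0) (b := s)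
    (by
      rw [uIcc_of_le hs1]
      exact hD.comp (f := fun r => (y + s - r, 0 + r)) (by fun_prop)
        fun r hr => ⟨mem_univ _, by simpa using hr.1, by simp only; linarith [hr.2]⟩)
    (fun r hr => by
      rw [min_eq_left hs1, max_eq_right hs1] at hr
      exact hDd _ _ r (by linarith [hr.1.1]) (by linarith [hr.1.2]) hr.2)
    (ContinuousOn.intervalIntegrable (by rwa [uIcc_of_le hs1]))
  simp only [add_sub_cancel_right, zero_add, hD0, sub_zero] at e
  have h1 : |D y s| ≤ K * M / c * Real.exp (c * s) := by
    rw [← e]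
    refine (intervalIntegral.norm_integral_le_of_norm_le (f := fun r => V (y + s - r) r)
      (g := fun r => K * M * Real.exp (c * (0 + r))) hs1
      (ae_of_all _ fun r hr => ?_) (Continuous.intervalIntegrable (by fun_prop) _ _)).trans ?_
    · rw [zero_add, mul_assoc]
      exact hVb _ _ hr.1.le (hr.2.trans hs2) (by linarith [hr.2]) (by linarith [hr.1])
    · rw [intervalIntegral.integral_const_mul]
      have := mul_le_mul_of_nonneg_left (integral_exp_le (l := s) (r := 0) hc0)
        (mul_nonneg hK0 hM0)
      refine this.trans_eq ?_
      rw [zero_add]; ring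
  have h2 : M ≤ 1 / 2 * M := by
    have h3 := mul_le_mul_of_nonneg_right h1 (Real.exp_pos (-(c * s))).le
    rw [mul_assoc, ← Real.exp_add, add_neg_cancel, Real.exp_zero, mul_one] at h3
    refine (show M ≤ K * M / c from h3).trans ?_
    rw [div_le_iff₀ hc0]
    nlinarith
  have h3 : M = 0 := by linarith
  have := hb x t ht0 le_rfl
  rw [h3, zero_mul] at this
  exact abs_nonpos_iff.1 this

/-- The closed space-time rectangle of the initial boundary value problem. -/
def rect (T : ℝ) : Set (ℝ × ℝ) := Icc 0 (2 * Real.pi) ×ˢ Ico 0 T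

lemma uniqueDiffOn_rect (T : ℝ) : UniqueDiffOn ℝ (rect T) :=
  (uniqueDiffOn_Icc Real.two_pi_pos).prod (uniqueDiffOn_Ico 0 T)

section BoundaryValues

variable {u : ℝ → ℝ → ℝ} {T : ℝ}

lemma rect_mem_nhds {x t : ℝ} (hx : x ∈ Ioo 0 (2 * Real.pi)) (ht : t ∈ Ioo 0 T) :
    rect T ∈ 𝓝 (x, t) :=
  prod_mem_nhds (Icc_mem_nhds hx.1 hx.2) (Ico_mem_nhds ht.1 ht.2)

lemma hasDerivAt_fst_rect (hu : ContDiffOn ℝ 1 (Function.uncurry u) (rect T)) {x t : ℝ}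
    (hx : x ∈ Ioo 0 (2 * Real.pi)) (ht : t ∈ Ico 0 T) :
    HasDerivAt (fun y => u y t) (fderivWithin ℝ (Function.uncurry u) (rect T) (x, t) (1, 0)) x := by
  have := hasDerivWithinAt_fst (I := univ)
    (hu.differentiableOn (by simp) (x, t) ⟨⟨hx.1.le, hx.2.le⟩, ht⟩) (by
      rw [nhdsWithin_univ]
      filter_upwards [Icc_mem_nhds hx.1 hx.2] with y hy
      exact ⟨hy, ht⟩)
  rwa [hasDerivWithinAt_univ] at this

lemma tendsto_deriv_rect (hu : ContDiffOn ℝ 1 (Function.uncurry u) (rect T)) {x t : ℝ}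
    (hx : x ∈ Icc 0 (2 * Real.pi)) (ht : t ∈ Ico 0 T) :
    Tendsto (fun y => deriv (fun y => u y t) y) (𝓝[Ioo 0 (2 * Real.pi)] x)
      (𝓝 (fderivWithin ℝ (Function.uncurry u) (rect T) (x, t) (1, 0))) := by
  have h1 : ContinuousOn (fun z => fderivWithin ℝ (Function.uncurry u) (rect T) z (1, 0))
      (rect T) :=
    (hu.continuousOn_fderivWithin (uniqueDiffOn_rect T) (by simp)).clm_apply continuousOn_const
  have h2 : ContinuousOn (fun y => fderivWithin ℝ (Function.uncurry u) (rect T) (y, t) (1, 0))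
      (Icc 0 (2 * Real.pi)) :=
    h1.comp (f := fun y => (y, t)) (by fun_prop) fun y hy => ⟨hy, ht⟩
  refine ((h2 x hx).mono Ioo_subset_Icc_self).tendsto.congr' ?_
  filter_upwards [self_mem_nhdsWithin] with y hy
  exact (hasDerivAt_fst_rect hu hy ht).deriv.symm

lemma tendsto_rect (hu : ContDiffOn ℝ 1 (Function.uncurry u) (rect T)) {x t : ℝ}
    (hx : x ∈ Icc 0 (2 * Real.pi)) (ht : t ∈ Ico 0 T) :
    Tendsto (fun y => u y t) (𝓝[Ioo 0 (2 * Real.pi)] x) (𝓝 (u x t)) := by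
  have h2 : ContinuousOn (fun y => u y t) (Icc 0 (2 * Real.pi)) :=
    hu.continuousOn.comp (f := fun y => (y, t)) (by fun_prop) fun y hy => ⟨hy, ht⟩
  exact ((h2 x hx).mono Ioo_subset_Icc_self).tendsto

lemma boundary0_eq (hu : ContDiffOn ℝ 1 (Function.uncurry u) (rect T)) {t : ℝ}
    (ht : t ∈ Ico 0 T) :
    boundary0 (fun x => u x t) = ![u 0 t - u (2 * Real.pi) t,
      fderivWithin ℝ (Function.uncurry u) (rect T) (0, t) (1, 0)
        - fderivWithin ℝ (Function.uncurry u) (rect T) (2 * Real.pi, t) (1, 0)] := by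
  have hpi := Real.two_pi_pos
  have m0 : (0 : ℝ) ∈ Icc 0 (2 * Real.pi) := ⟨le_rfl, hpi.le⟩
  have m1 : 2 * Real.pi ∈ Icc 0 (2 * Real.pi) := ⟨hpi.le, le_rfl⟩
  have a1 := tendsto_rect hu m0 ht
  have a2 := tendsto_rect hu m1 ht
  have a3 := tendsto_deriv_rect hu m0 ht
  have a4 := tendsto_deriv_rect hu m1 ht
  rw [nhdsWithin_Ioo_eq_nhdsGT hpi] at a1 a3
  rw [nhdsWithin_Ioo_eq_nhdsLT hpi] at a2 a4
  rw [boundary0, rightLim_eq_of_tendsto a1,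
    leftLim_eq_of_tendsto a2, rightLim_eq_of_tendsto a3,
    leftLim_eq_of_tendsto a4]

lemma boundary1_eq (hu : ContDiffOn ℝ 1 (Function.uncurry u) (rect T)) {t : ℝ}
    (ht : t ∈ Ico 0 T) :
    boundary1 (fun x => u x t) = (1 / 2 : ℝ) •
      ![fderivWithin ℝ (Function.uncurry u) (rect T) (0, t) (1, 0)
        + fderivWithin ℝ (Function.uncurry u) (rect T) (2 * Real.pi, t) (1, 0),
        -u 0 t - u (2 * Real.pi) t] := by
  have hpi := Real.two_pi_pos
  have m0 : (0 : ℝ) ∈ Icc 0 (2 * Real.pi) := ⟨le_rfl, hpi.le⟩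
  have m1 : 2 * Real.pi ∈ Icc 0 (2 * Real.pi) := ⟨hpi.le, le_rfl⟩
  have a1 := tendsto_rect hu m0 ht
  have a2 := tendsto_rect hu m1 ht
  have a3 := tendsto_deriv_rect hu m0 ht
  have a4 := tendsto_deriv_rect hu m1 ht
  rw [nhdsWithin_Ioo_eq_nhdsGT hpi] at a1 a3
  rw [nhdsWithin_Ioo_eq_nhdsLT hpi] at a2 a4
  rw [boundary1, rightLim_eq_of_tendsto a1,
    leftLim_eq_of_tendsto a2, rightLim_eq_of_tendsto a3,
    leftLim_eq_of_tendsto a4]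

end BoundaryValues

section WaveUnique

variable {q : ℝ → ℝ} {T : ℝ} {F : ℝ → Fin 2 → ℝ} {u u' : ℝ → ℝ → ℝ}

lemma IsWaveSolution.charDeriv_zero (h : IsWaveSolution q T F u) (hT : 0 < T) {x : ℝ}
    (hx : x ∈ Icc 0 (2 * Real.pi)) : charDeriv u (rect T) (x, 0) = 0 := by
  have hd : DifferentiableWithinAt ℝ (Function.uncurry u) (rect T) (x, 0) :=
    h.smooth_closed.differentiableOn (by simp) (x, 0) ⟨hx, le_rfl, hT⟩
  have h1 := hasDerivWithinAt_fst (I := Icc 0 (2 * Real.pi)) hd (by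
    filter_upwards [self_mem_nhdsWithin] with y hy
    exact ⟨hy, le_rfl, hT⟩)
  have h2 := hasDerivWithinAt_snd (I := Ici 0) hd (by
    filter_upwards [self_mem_nhdsWithin, mem_nhdsWithin_of_mem_nhds (Iio_mem_nhds hT)] with s hs hs'
    exact ⟨hx, hs, hs'⟩)
  have h3 : HasDerivWithinAt (fun y => u y 0) 0 (Icc 0 (2 * Real.pi)) x :=
    (hasDerivWithinAt_const x _ (0 : ℝ)).congr (fun y hy => h.initial y hy) (h.initial x hx)
  rw [charDeriv_eq, ← h1.derivWithin (uniqueDiffOn_Icc Real.two_pi_pos x hx),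
    h3.derivWithin (uniqueDiffOn_Icc Real.two_pi_pos x hx),
    ← h2.derivWithin (uniqueDiffOn_Ici _ _ self_mem_Ici), h.initial_deriv x hx, sub_zero]

lemma IsWaveSolution.jump (h : IsWaveSolution q T F u) {t : ℝ} (ht : t ∈ Ioo 0 T) :
    u 0 t - u (2 * Real.pi) t = F t 0 ∧
    fderivWithin ℝ (Function.uncurry u) (rect T) (0, t) (1, 0)
      - fderivWithin ℝ (Function.uncurry u) (rect T) (2 * Real.pi, t) (1, 0)
      = deriv (fun s => F s 1) t := by
  have := h.boundary t ht
  rw [boundary0_eq (u := u) h.smooth_closed ⟨ht.1.le, ht.2⟩] at this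
  exact ⟨by simpa using congrFun this 0, by simpa using congrFun this 1⟩

lemma IsWaveSolution.hasDerivAt_perExt (h : IsWaveSolution q T F u) {x t s : ℝ}
    (h0 : 0 < t + s) (ht : t + s < T) (hl : x - s ∉ lattice) :
    HasDerivAt (fun s => perExt (Function.uncurry u) (x - s, t + s))
      (perExt (charDeriv u (rect T)) (x - s, t + s)) s := by
  obtain ⟨k, h1, h2⟩ := exists_int_of_notMem_lattice hl
  have hm : rect T ∈ 𝓝 (x - 2 * k * Real.pi - s, t + s) :=
    rect_mem_nhds ⟨by linarith, by linarith⟩ ⟨h0, ht⟩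
  have := hasDerivAt_antidiagonal hm ((h.smooth_closed.contDiffAt hm).differentiableAt (by simp))
  rw [perExt_eq k h1.le h2, show x - s - 2 * k * Real.pi = x - 2 * k * Real.pi - s by ring]
  refine this.congr_of_eventuallyEq ?_
  have hc : ContinuousAt (fun s => x - s) s := by fun_prop
  filter_upwards [hc (Ioo_mem_nhds h1 h2)] with r hr
  rw [perExt_eq k hr.1.le hr.2, show x - r - 2 * k * Real.pi = x - 2 * k * Real.pi - r by ring]
  rfl

lemma IsWaveSolution.hasDerivAt_perExt_charDeriv (h : IsWaveSolution q T F u) {x t s : ℝ}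
    (h0 : 0 < t + s) (ht : t + s < T) (hl : x + s ∉ lattice) :
    HasDerivAt (fun s => perExt (charDeriv u (rect T)) (x + s, t + s))
      (-(periodize q (x + s) * perExt (Function.uncurry u) (x + s, t + s))) s := by
  obtain ⟨k, h1, h2⟩ := exists_int_of_notMem_lattice hl
  have hmx : x - 2 * k * Real.pi + s ∈ Ioo 0 (2 * Real.pi) := ⟨by linarith, by linarith⟩
  have hm : rect T ∈ 𝓝 (x - 2 * k * Real.pi + s, t + s) := rect_mem_nhds hmx ⟨h0, ht⟩
  have := hasDerivAt_charDeriv hm (h.smooth_open.contDiffAt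
    (prod_mem_nhds (isOpen_Ioo.mem_nhds hmx) (isOpen_Ioo.mem_nhds ⟨h0, ht⟩)))
  have hw := h.wave _ hmx _ ⟨h0, ht⟩
  have e : waveOp u (x - 2 * k * Real.pi + s) (t + s)
      = -(q (x - 2 * k * Real.pi + s) * u (x - 2 * k * Real.pi + s) (t + s)) := by
    rw [schrodinger] at hw
    rw [waveOp]; linarith
  rw [e] at this
  have e2 : x + s - 2 * k * Real.pi = x - 2 * k * Real.pi + s := by ring
  have e3 : periodize q (x + s) = q (x - 2 * k * Real.pi + s) := by
    have := periodize_add q (x - 2 * k * Real.pi + s) k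
    rw [show x - 2 * k * Real.pi + s + 2 * k * Real.pi = x + s by ring] at this
    rw [this, periodize_eq q ⟨hmx.1.le, hmx.2⟩]
  rw [perExt_eq k h1.le h2, e2, e3]
  refine this.congr_of_eventuallyEq ?_
  have hc : ContinuousAt (fun s => x + s) s := by fun_prop
  filter_upwards [hc (Ioo_mem_nhds h1 h2)] with r hr
  rw [perExt_eq k hr.1.le hr.2, show x + r - 2 * k * Real.pi = x - 2 * k * Real.pi + r by ring]

/-- The initial boundary value problem has at most one solution. -/
theorem IsWaveSolution.unique (hq2 : MemLp q 2 (volume.restrict (Ioo 0 (2 * Real.pi))))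
    (hT : 0 < T) (h : IsWaveSolution q T F u) (h' : IsWaveSolution q T F u') {x t : ℝ}
    (hx : x ∈ Icc 0 (2 * Real.pi)) (ht : t ∈ Ico 0 T) : u x t = u' x t := by
  have hpi := Real.two_pi_pos
  have m0 : (0 : ℝ) ∈ Icc 0 (2 * Real.pi) := ⟨le_rfl, hpi.le⟩
  have m1 : 2 * Real.pi ∈ Icc 0 (2 * Real.pi) := ⟨hpi.le, le_rfl⟩
  set d : ℝ × ℝ → ℝ := fun z => Function.uncurry u z - Function.uncurry u' z with hd
  set v : ℝ × ℝ → ℝ := fun z => charDeriv u (rect T) z - charDeriv u' (rect T) z with hv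
  have hdc : ContinuousOn d (rect T) := h.smooth_closed.continuousOn.sub h'.smooth_closed.continuousOn
  have hvc : ContinuousOn v (rect T) :=
    (continuousOn_charDeriv (uniqueDiffOn_rect T) h.smooth_closed).sub
      (continuousOn_charDeriv (uniqueDiffOn_rect T) h'.smooth_closed)
  have hdp : ∀ s ∈ Ico 0 T, d (0, s) = d (2 * Real.pi, s) := by
    intro s hs
    rcases hs.1.eq_or_lt with h0 | h0
    · subst h0
      simp only [hd, Function.uncurry, h.initial _ m0, h.initial _ m1, h'.initial _ m0,
        h'.initial _ m1]
    · have e := (h.jump ⟨h0, hs.2⟩).1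
      have e' := (h'.jump ⟨h0, hs.2⟩).1
      simp only [hd, Function.uncurry]
      linarith
  have hvp : ∀ s ∈ Ico 0 T, v (0, s) = v (2 * Real.pi, s) := by
    intro s hs
    rcases hs.1.eq_or_lt with h0 | h0
    · subst h0
      simp only [hv, h.charDeriv_zero hT m0, h.charDeriv_zero hT m1, h'.charDeriv_zero hT m0,
        h'.charDeriv_zero hT m1]
    · have e := (h.jump ⟨h0, hs.2⟩).2
      have e' := (h'.jump ⟨h0, hs.2⟩).2
      have hev : ∀ᶠ r in 𝓝 s, r ∈ Ico 0 T := Ico_mem_nhds h0 hs.2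
      have dt : ∀ w, ContDiffOn ℝ 1 (Function.uncurry w) (rect T) → ∀ y ∈ Icc 0 (2 * Real.pi),
          HasDerivAt (fun r => w y r)
            (fderivWithin ℝ (Function.uncurry w) (rect T) (y, s) (0, 1)) s := fun w hw y hy => by
        have := hasDerivWithinAt_snd (I := univ) (hw.differentiableOn (by simp) (y, s) ⟨hy, hs⟩) (by
          rw [nhdsWithin_univ]
          exact hev.mono fun r hr => ⟨hy, hr⟩)
        rwa [hasDerivWithinAt_univ] at this
      have et := ((dt u h.smooth_closed 0 m0).sub (dt u' h'.smooth_closed 0 m0)).unique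
        (((dt u h.smooth_closed _ m1).sub (dt u' h'.smooth_closed _ m1)).congr_of_eventuallyEq
          (hev.mono fun r hr => hdp r hr))
      simp only [hv, charDeriv_eq]
      linarith
  have key := eq_zero_of_wave (p := periodize q) (T := T) (D := fun x t => perExt d (x, t))
    (V := fun x t => perExt v (x, t)) (intervalIntegrable_periodize hq2)
    (continuousOn_perExt hdc hdp) (continuousOn_perExt hvc hvp)
    (fun y s => ⟨toIcoMod Real.two_pi_pos 0 y, by
      have := toIcoMod_mem_Ico Real.two_pi_pos 0 y
      exact ⟨this.1, by linarith [this.2]⟩, by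
      simp only [perExt, toIcoMod_toIcoMod]⟩)
    (fun y => by
      have := toIcoMod_mem_Ico Real.two_pi_pos 0 y
      have hm : toIcoMod Real.two_pi_pos 0 y ∈ Icc 0 (2 * Real.pi) :=
        ⟨this.1, by linarith [this.2]⟩
      simp only [perExt, hd, Function.uncurry, h.initial _ hm, h'.initial _ hm, sub_zero])
    (fun y => by
      have := toIcoMod_mem_Ico Real.two_pi_pos 0 y
      have hm : toIcoMod Real.two_pi_pos 0 y ∈ Icc 0 (2 * Real.pi) :=
        ⟨this.1, by linarith [this.2]⟩
      simp only [perExt, hv, h.charDeriv_zero hT hm, h'.charDeriv_zero hT hm, sub_zero])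
    (fun x t s h0 ht hl => (h.hasDerivAt_perExt h0 ht hl).sub (h'.hasDerivAt_perExt h0 ht hl))
    (fun x t s h0 ht hl => ((h.hasDerivAt_perExt_charDeriv h0 ht hl).sub
      (h'.hasDerivAt_perExt_charDeriv h0 ht hl)).congr_deriv (by simp only [perExt, hd]; ring))
    (x := x) ht.1 ht.2
  rcases hx.2.eq_or_lt with h2 | h2
  · have e : perExt d (x, t) = d (0, t) := by
      rw [perExt_eq 1 (by push_cast; linarith) (by push_cast; linarith), h2]
      simp
    simp only [e, hdp t ht] at key
    rw [h2]
    exact sub_eq_zero.1 key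
  · simp only [perExt_eq (f := d) (t := t) 0 (show 2 * ((0 : ℤ) : ℝ) * Real.pi ≤ x by
      simpa using hx.1) (by push_cast; linarith)] at key
    simp only [Int.cast_zero, mul_zero, zero_mul, sub_zero] at key
    exact sub_eq_zero.1 key

end WaveUnique

/-! ### Waves generated by a causal signal -/

/-- Smooth signals that vanish for nonpositive times. -/
structure IsCausal (f : ℝ → ℝ) : Prop where
  smooth : ContDiff ℝ ∞ f
  zero : ∀ t, t ≤ 0 → f t = 0

namespace IsCausal

variable {f : ℝ → ℝ}

lemma continuous (hf : IsCausal f) : Continuous f := hf.smooth.continuous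

lemma hasDerivAt (hf : IsCausal f) (t : ℝ) : HasDerivAt f (deriv f t) t :=
  (hf.smooth.differentiable (by simp) t).hasDerivAt

lemma deriv (hf : IsCausal f) : IsCausal (deriv f) := by
  have hs : ContDiff ℝ ∞ (_root_.deriv f) := (contDiff_infty_iff_deriv.1 hf.smooth).2
  have h : EqOn (_root_.deriv f) (fun _ => 0) (Iio 0) := fun t ht => by
    have : f =ᶠ[𝓝 t] fun _ => 0 := by
      filter_upwards [Iio_mem_nhds ht] with s hs
      exact hf.zero s (le_of_lt hs)
    rw [this.deriv_eq, deriv_const]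
  refine ⟨hs, fun t ht => ?_⟩
  have := h.closure hs.continuous continuous_const
  rw [closure_Iio] at this
  exact this ht

lemma exists_primitive (hf : IsCausal f) : ∃ g, IsCausal g ∧ _root_.deriv g = f := by
  have hd : ∀ u, HasDerivAt (fun u => ∫ s in (0 : ℝ)..u, f s) (f u) u := fun u =>
    intervalIntegral.integral_hasDerivAt_right (hf.continuous.intervalIntegrable _ _)
      (hf.continuous.stronglyMeasurableAtFilter _ _) hf.continuous.continuousAt
  refine ⟨fun u => ∫ s in (0 : ℝ)..u, f s, ⟨contDiff_primitive hf.smooth, fun t ht => ?_⟩,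
    funext fun u => (hd u).deriv⟩
  refine (intervalIntegral.integral_congr (g := fun _ => 0) fun s hs => ?_).trans
    intervalIntegral.integral_zero
  rw [uIcc_of_ge ht] at hs
  exact hf.zero s hs.2

lemma bdd (hf : IsCausal f) (R : ℝ) : ∃ C, 0 ≤ C ∧ ∀ s ≤ R, |f s| ≤ C := by
  obtain ⟨C, hC⟩ := (isCompact_Icc (a := 0) (b := R)).exists_bound_of_continuousOn
    hf.continuous.continuousOn
  refine ⟨max C 0, le_max_right _ _, fun s hs => ?_⟩
  rcases le_total s 0 with h | h
  · rw [hf.zero s h, abs_zero]; exact le_max_right _ _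
  · exact (hC s ⟨h, hs⟩).trans (le_max_left _ _)

end IsCausal

/-- The part of the wave generated by the signal `f` at `x = 0` that travels behind the front. -/
def retConv (w : ℝ → ℝ → ℝ) (f : ℝ → ℝ) (x t : ℝ) : ℝ := ∫ s in |x|..t, w x s * f (t - s)

/-- The wave generated by the signal `f` at `x = 0`: the travelling front, of amplitude `a` to the
right and `b` to the left, and what follows behind it. -/
def causalWave (a b : ℝ) (w : ℝ → ℝ → ℝ) (f : ℝ → ℝ) (x t : ℝ) : ℝ :=
  step a b x * f (t - |x|) + retConv w f x t

section Causal

variable {w : ℝ → ℝ → ℝ} {f : ℝ → ℝ}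

lemma integral_mul_causal_of_le (hf : IsCausal f) (h : ℝ → ℝ) {r t : ℝ} (ht : t ≤ r) :
    ∫ s in r..t, h s * f (t - s) = 0 := by
  refine (intervalIntegral.integral_congr (g := fun _ => 0) fun s hs => ?_).trans
    intervalIntegral.integral_zero
  rw [uIcc_of_ge ht] at hs
  simp only [hf.zero (t - s) (by linarith [hs.1]), mul_zero]

lemma retConv_of_le (hf : IsCausal f) {x t : ℝ} (h : t ≤ |x|) : retConv w f x t = 0 :=
  integral_mul_causal_of_le hf _ h

/-- The upper limit of the convolution may be increased. -/
lemma retConv_eq (hw : Continuous (Function.uncurry w)) (hf : IsCausal f) {x t R : ℝ}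
    (ht : t ≤ R) (hx : |x| ≤ R) : retConv w f x t = ∫ s in |x|..R, w x s * f (t - s) := by
  have hc : Continuous fun s => w x s * f (t - s) :=
    (hw.comp (Continuous.prodMk_right x)).mul (hf.continuous.comp (by fun_prop))
  rcases le_total |x| t with h | h
  · rw [retConv, ← intervalIntegral.integral_add_adjacent_intervals (b := t)
      (hc.intervalIntegrable |x| t) (hc.intervalIntegrable t R), left_eq_add]
    refine (intervalIntegral.integral_congr (g := fun _ => 0) fun s hs => ?_).trans
      intervalIntegral.integral_zero
    rw [uIcc_of_le ht] at hs
    simp only [hf.zero (t - s) (by linarith [hs.1]), mul_zero]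
  · rw [retConv_of_le hf h]
    refine ((intervalIntegral.integral_congr (g := fun _ => 0) fun s hs => ?_).trans
      intervalIntegral.integral_zero).symm
    rw [uIcc_of_le hx] at hs
    simp only [hf.zero (t - s) (by linarith [hs.1]), mul_zero]

lemma continuous_retConv (hw : Continuous (Function.uncurry w)) (hf : IsCausal f) :
    Continuous (Function.uncurry (retConv w f)) := by
  refine continuous_integral_param (F := fun (z : ℝ × ℝ) s => w z.1 s * f (z.2 - s)) ?_
    (by fun_prop) (by fun_prop)
  exact (hw.comp (by fun_prop : Continuous fun z : (ℝ × ℝ) × ℝ => (z.1.1, z.2))).mul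
    (hf.continuous.comp (by fun_prop))

lemma locBdd_retConv (hw : Continuous (Function.uncurry w)) (hf : IsCausal f) :
    LocBdd (retConv w f) := by
  refine ⟨(continuous_retConv hw hf).measurable, fun R => ?_⟩
  obtain ⟨C, hC0, hC⟩ := exists_bound_cone hw R
  obtain ⟨C', hC0', hC'⟩ := hf.bdd R
  refine ⟨C * C' * |R|, fun y τ hτ => ?_⟩
  rcases le_total τ |y| with h | h
  · rw [retConv_of_le hf h, abs_zero]; positivity
  · refine (intervalIntegral.norm_integral_le_of_norm_le_const (f := fun s => w y s * f (τ - s))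
      (C := C * C') fun s hs => ?_).trans (mul_le_mul_of_nonneg_left ?_ (by positivity))
    · rw [uIoc_of_le h] at hs
      rw [norm_mul]
      exact mul_le_mul (hC y s hs.1.le (hs.2.trans hτ))
        (hC' _ (by linarith [(abs_nonneg y).trans hs.1.le])) (norm_nonneg _) hC0
    · rw [abs_of_nonneg (by linarith)]
      linarith [abs_nonneg y, le_abs_self R]

lemma hasDerivAt_retConv (hw : Continuous (Function.uncurry w)) (hf : IsCausal f) (x t : ℝ) :
    HasDerivAt (retConv w f x) (retConv w (deriv f) x t) t := by
  set R := max |x| (t + 1) with hR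
  obtain ⟨C, hC0, hC⟩ := exists_bound_cone hw R
  obtain ⟨C', hC0', hC'⟩ := hf.deriv.bdd (t + 1)
  have hcw : Continuous (w x) := hw.comp (Continuous.prodMk_right x)
  have h := (intervalIntegral.hasDerivAt_integral_of_dominated_loc_of_deriv_le (μ := volume)
    (F := fun t s => w x s * f (t - s)) (F' := fun t s => w x s * deriv f (t - s)) (a := |x|)
    (b := R) (x₀ := t) (s := Metric.ball t 1) (bound := fun _ => C * C')
    (Metric.ball_mem_nhds t one_pos)
    (Eventually.of_forall fun t =>
      (hcw.mul (hf.continuous.comp (by fun_prop))).aestronglyMeasurable)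
    ((hcw.mul (hf.continuous.comp (by fun_prop))).intervalIntegrable _ _)
    (hcw.mul (hf.deriv.continuous.comp (by fun_prop))).aestronglyMeasurable
    (ae_of_all _ fun s hs r hr => ?_) intervalIntegrable_const
    (ae_of_all _ fun s hs r hr => ?_)).2
  · rw [← retConv_eq hw hf.deriv (le_trans (by linarith) (le_max_right _ _))
      (le_max_left _ _)] at h
    refine h.congr_of_eventuallyEq ?_
    filter_upwards [Iio_mem_nhds (show t < t + 1 by linarith)] with r hr
    exact retConv_eq hw hf (le_trans (le_of_lt hr) (le_max_right _ _)) (le_max_left _ _)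
  · rw [uIoc_of_le (le_max_left _ _)] at hs
    rw [Metric.mem_ball, Real.dist_eq, abs_lt] at hr
    rw [norm_mul]
    exact mul_le_mul (hC x s hs.1.le hs.2)
      (hC' _ (by linarith [(abs_nonneg x).trans hs.1.le])) (norm_nonneg _) hC0
  · exact ((hf.hasDerivAt (r - s)).comp_sub_const r s).const_mul (w x s)

lemma locBdd_causalWave (a b : ℝ) (hw : Continuous (Function.uncurry w)) (hf : IsCausal f) :
    LocBdd (causalWave a b w f) := by
  refine LocBdd.add ⟨((measurable_step a b).comp measurable_fst).mul
    (hf.continuous.measurable.comp (by fun_prop)), fun R => ?_⟩ (locBdd_retConv hw hf)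
  obtain ⟨C', hC0', hC'⟩ := hf.bdd R
  refine ⟨max |a| |b| * C', fun y τ hτ => ?_⟩
  rw [abs_mul]
  exact mul_le_mul (abs_step_le a b y) (hC' _ (by linarith [abs_nonneg y])) (abs_nonneg _)
    ((abs_nonneg a).trans (le_max_left _ _))

lemma hasDerivAt_causalWave (a b : ℝ) (hw : Continuous (Function.uncurry w)) (hf : IsCausal f)
    (x t : ℝ) : HasDerivAt (causalWave a b w f x) (causalWave a b w (deriv f) x t) t :=
  (((hf.hasDerivAt (t - |x|)).comp_sub_const t |x|).const_mul _).add (hasDerivAt_retConv hw hf x t)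

lemma causalWave_lipschitz (a b : ℝ) (hw : Continuous (Function.uncurry w)) (hf : IsCausal f)
    (R : ℝ) : ∃ C, ∀ y τ τ', τ ≤ R → τ' ≤ R →
      |causalWave a b w f y τ - causalWave a b w f y τ'| ≤ C * |τ - τ'| := by
  obtain ⟨C, hC⟩ := (locBdd_causalWave a b hw hf.deriv).bdd R
  refine ⟨C, fun y τ τ' h h' => ?_⟩
  exact (convex_Iic R).norm_image_sub_le_of_norm_hasDerivWithin_le
    (fun s _ => (hasDerivAt_causalWave a b hw hf y s).hasDerivWithinAt) (fun s hs => hC y s hs) h' h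

lemma continuousAt_causalWave (a b : ℝ) (hw : Continuous (Function.uncurry w)) (hf : IsCausal f)
    {x t : ℝ} (hx : x ≠ 0) : ContinuousAt (Function.uncurry (causalWave a b w f)) (x, t) := by
  refine ContinuousAt.add (ContinuousAt.mul ?_ ?_) (continuous_retConv hw hf).continuousAt
  · exact ContinuousAt.comp (f := Prod.fst) (g := step a b) (x := (x, t)) (continuousAt_step a b hx) continuousAt_fst
  · exact (hf.continuous.comp (by fun_prop)).continuousAt

end Causal

/-! ### The integral equation of a causal wave -/

/-- Retarded integrals commute with convolution in time. -/
lemma potInt_convolution {p : ℝ → ℝ} (hp : Integrable p) {G : ℝ → ℝ → ℝ} (hG : LocBdd G)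
    (h0 : ∀ y τ, τ < |y| → G y τ = 0) {f : ℝ → ℝ} (hf : IsCausal f) {x t : ℝ} (hx : |x| ≤ t) :
    potInt p (fun y τ => ∫ σ in |y|..τ, G y σ * f (τ - σ)) x t
      = ∫ s in |x|..t, potInt p G x s * f (t - s) := by
  obtain ⟨C, hC⟩ := hG.bdd t
  obtain ⟨C', hC0', hC'⟩ := hf.bdd t
  have hC0 : 0 ≤ C := (abs_nonneg _).trans (hC 0 t le_rfl)
  have hGm : ∀ y, Measurable (G y) := fun y => hG.meas.comp measurable_prodMk_left
  have hint : ∀ y u v τ, v ≤ t → u ≤ v → 0 ≤ u + (t - τ) →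
      IntervalIntegrable (fun σ => G y σ * f (τ - σ)) volume u v := by
    intro y u v τ hv huv hu
    refine (intervalIntegrable_const (c := C * C')).mono_fun' (f := fun σ => G y σ * f (τ - σ))
      ((hGm y).mul (hf.continuous.measurable.comp (by fun_prop))).aestronglyMeasurable ?_
    rw [uIoc_of_le huv]
    filter_upwards [ae_restrict_mem measurableSet_Ioc] with σ hσ
    rw [norm_mul]
    exact mul_le_mul (hC y σ (hσ.2.trans hv)) (hC' _ (by linarith [hσ.1])) (norm_nonneg _) hC0
  -- the inner integral, in terms of the time of observation
  have inner : ∀ y, ∫ σ in |y|..t - |x - y|, G y σ * f (t - |x - y| - σ)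
      = ∫ s in |x|..t, G y (s - |x - y|) * f (t - s) := by
    intro y
    have hxy : |x| - |x - y| ≤ |y| := by
      have := abs_sub_abs_le_abs_sub x y
      linarith
    have e1 : ∫ s in |x|..t, G y (s - |x - y|) * f (t - s)
        = ∫ σ in |x| - |x - y|..t - |x - y|, G y σ * f (t - |x - y| - σ) := by
      rw [← intervalIntegral.integral_comp_sub_right
        (fun σ => G y σ * f (t - |x - y| - σ)) |x - y|]
      congr 1; ext s; congr 2; ring
    have ez : ∀ v, v ≤ |y| → |x| - |x - y| ≤ v →
        ∫ σ in |x| - |x - y|..v, G y σ * f (t - |x - y| - σ) = 0 := by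
      intro v hv hv'
      refine (intervalIntegral.integral_congr_ae (g := fun _ => 0) ?_).trans
        intervalIntegral.integral_zero
      filter_upwards [compl_mem_ae_iff.2 (measure_singleton |y| : volume {|y|} = 0)] with σ hσ hσ'
      rw [uIoc_of_le hv'] at hσ'
      rw [h0 y σ (lt_of_le_of_ne (hσ'.2.trans hv) hσ), zero_mul]
    rw [e1]
    rcases le_total |y| (t - |x - y|) with h | h
    · rw [← intervalIntegral.integral_add_adjacent_intervals (b := |y|)
        (hint y _ _ _ (by linarith [abs_nonneg (x - y)]) hxy (by linarith [abs_nonneg x]))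
        (hint y _ _ _ (by linarith [abs_nonneg (x - y)]) h (by linarith [abs_nonneg y, abs_nonneg (x - y)])),
        ez _ le_rfl hxy, zero_add]
    · rw [integral_mul_causal_of_le hf _ h, ez _ h (by linarith)]
  have hi : Integrable (Function.uncurry fun y s => p y * (G y (s - |x - y|) * f (t - s)))
      ((volume : Measure ℝ).prod (volume.restrict (Ioc |x| t))) := by
    have h1 : Integrable (Function.uncurry fun (y : ℝ) (_ : ℝ) => p y * (C * C'))
        ((volume : Measure ℝ).prod (volume.restrict (Ioc |x| t))) :=
      hp.mul_prod (ν := volume.restrict (Ioc |x| t)) (integrable_const (C * C'))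
    have hm : AEStronglyMeasurable (fun z : ℝ × ℝ => p z.1)
        ((volume : Measure ℝ).prod (volume.restrict (Ioc |x| t))) :=
      hp.aestronglyMeasurable.comp_fst
    refine h1.mono (hm.mul (Measurable.aestronglyMeasurable (Measurable.mul ?_ ?_))) ?_
    · exact hG.meas.comp (by fun_prop : Measurable fun z : ℝ × ℝ => (z.1, z.2 - |x - z.1|))
    · exact hf.continuous.measurable.comp (by fun_prop)
    · have hae : ∀ᵐ z ∂((volume : Measure ℝ).prod (volume.restrict (Ioc |x| t))),
          z.2 ∈ Ioc |x| t :=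
        Measure.quasiMeasurePreserving_snd.ae (ae_restrict_mem measurableSet_Ioc)
      filter_upwards [hae] with z hz
      simp only [Function.uncurry, norm_mul]
      refine mul_le_mul_of_nonneg_left ?_ (norm_nonneg _)
      rw [Real.norm_of_nonneg hC0, Real.norm_of_nonneg hC0']
      exact mul_le_mul (hC _ _ (by linarith [hz.2, abs_nonneg (x - z.1)]))
        (hC' _ (by linarith [(abs_nonneg x).trans hz.1.le])) (norm_nonneg _) hC0
  calc potInt p (fun y τ => ∫ σ in |y|..τ, G y σ * f (τ - σ)) x t
      = ∫ y, ∫ s in Ioc |x| t, p y * (G y (s - |x - y|) * f (t - s)) := by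
        simp only [potInt, inner]
        congr 1; ext y
        rw [integral_const_mul, intervalIntegral.integral_of_le hx]
    _ = ∫ s in Ioc |x| t, ∫ y, p y * (G y (s - |x - y|) * f (t - s)) := integral_integral_swap hi
    _ = _ := by
        rw [intervalIntegral.integral_of_le hx]
        congr 1; ext s
        rw [potInt, ← integral_mul_const]
        congr 1; ext y; ring

section Equation

variable {p : ℝ → ℝ} {a b : ℝ} {w : ℝ → ℝ → ℝ} {f : ℝ → ℝ}

lemma coneCum_of_lt {y τ : ℝ} (h : τ < |y|) : coneCum a b w y τ = 0 := if_neg (not_le.2 h)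

/-- Integration by parts in the convolution of the accumulated kernel with a derivative. -/
lemma integral_coneCum_mul_deriv (hw : Continuous (Function.uncurry w)) (hf : IsCausal f)
    (y τ : ℝ) :
    ∫ σ in |y|..τ, coneCum a b w y σ * deriv f (τ - σ) = causalWave a b w f y τ := by
  rcases le_total τ |y| with h | h
  · rw [integral_mul_causal_of_le hf.deriv _ h, causalWave, retConv_of_le hf h,
      hf.zero _ (by linarith)]
    ring
  have hcw : Continuous (w y) := hw.comp (Continuous.prodMk_right y)
  have hd1 : ∀ σ, HasDerivAt (fun σ => step a b y + ∫ s in |y|..σ, w y s) (w y σ) σ := fun σ =>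
    (intervalIntegral.integral_hasDerivAt_right (hcw.intervalIntegrable |y| σ)
      (hcw.stronglyMeasurableAtFilter _ _) hcw.continuousAt).const_add _
  have hd2 : ∀ σ, HasDerivAt (fun σ => -f (τ - σ)) (deriv f (τ - σ)) σ := fun σ =>
    (((hf.hasDerivAt (τ - σ)).comp_const_sub τ σ).neg).congr_deriv (neg_neg _)
  have e : ∫ σ in |y|..τ, coneCum a b w y σ * deriv f (τ - σ)
      = ∫ σ in |y|..τ, (step a b y + ∫ s in |y|..σ, w y s) * deriv f (τ - σ) := by
    refine intervalIntegral.integral_congr fun σ hσ => ?_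
    rw [uIcc_of_le h] at hσ
    simp only [coneCum, if_pos hσ.1]
  rw [e, intervalIntegral.integral_mul_deriv_eq_deriv_mul (fun σ _ => hd1 σ) (fun σ _ => hd2 σ)
    (hcw.intervalIntegrable _ _)
    ((hf.deriv.continuous.comp (by fun_prop)).intervalIntegrable _ _)]
  simp only [mul_neg, intervalIntegral.integral_neg, sub_self, hf.zero 0 le_rfl,
    intervalIntegral.integral_same, add_zero, causalWave, retConv]
  ring

/-- The integral equation for the kernel, convolved with the signal, is the integral equation of the
causal wave. -/
lemma IsKernel.retConv_deriv (hp : Integrable p) (hw : IsKernel p a b w) (hf : IsCausal f)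
    (x t : ℝ) :
    retConv w (deriv f) x t = -(1 / 2) * potInt p (causalWave a b w f) x t := by
  rcases le_total t |x| with h | h
  · rw [retConv_of_le hf.deriv h]
    have : ∀ y, causalWave a b w f y (t - |x - y|) = 0 := fun y => by
      have := abs_sub_abs_le_abs_sub x y
      rw [causalWave, retConv_of_le hf (by linarith), hf.zero _ (by linarith)]
      ring
    simp [potInt, this]
  · have e : causalWave a b w f
        = fun y τ => ∫ σ in |y|..τ, coneCum a b w y σ * deriv f (τ - σ) := by
      ext y τ; exact (integral_coneCum_mul_deriv hw.cont hf y τ).symm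
    rw [e, potInt_convolution hp (locBdd_coneCum a b hw.cont) (fun y τ => coneCum_of_lt) hf.deriv h,
      ← intervalIntegral.integral_const_mul, retConv]
    refine intervalIntegral.integral_congr fun s hs => ?_
    rw [uIcc_of_le h] at hs
    simp only [hw.eq_coneCum hp hs.1]
    ring

/-- The gradient of `retConv w f`. -/
lemma IsKernel.hasFDerivAt_retConv (hp : Integrable p) (hw : IsKernel p a b w) (hf : IsCausal f)
    (z : ℝ × ℝ) :
    HasFDerivAt (Function.uncurry (retConv w f))
      (retConv w (deriv f) z.1 z.2 • ContinuousLinearMap.snd ℝ ℝ ℝ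
        + (1 / 2 * potIntSign p (causalWave a b w f) z.1 z.2) • ContinuousLinearMap.fst ℝ ℝ ℝ)
      z := by
  obtain ⟨g, hg, rfl⟩ := hf.exists_primitive
  have h := ((locBdd_causalWave a b hw.cont hg).hasFDerivAt_potInt
    (locBdd_causalWave a b hw.cont hg.deriv) hp (causalWave_lipschitz a b hw.cont hg)
    (x₀ := z.1) (t₀ := z.2)
    (ae_of_all _ fun y => hasDerivAt_causalWave a b hw.cont hg y _)).const_mul (-(1 / 2))
  have e : Function.uncurry (retConv w (deriv g))
      = fun z => -(1 / 2) * Function.uncurry (potInt p (causalWave a b w g)) z := by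
    ext z; exact hw.retConv_deriv hp hg z.1 z.2
  rw [e, hw.retConv_deriv hp hg.deriv]
  refine h.congr_fderiv ?_
  ext
  · simp
  · simp

lemma continuous_potIntSign_causalWave (hp : Integrable p) (hw : Continuous (Function.uncurry w))
    (hf : IsCausal f) : Continuous (Function.uncurry (potIntSign p (causalWave a b w f))) :=
  continuous_iff_continuousAt.2 fun _ =>
    (locBdd_causalWave a b hw hf).continuousAt_potIntSign hp
      (ae_of_all _ fun y => (hasDerivAt_causalWave a b hw hf y _).continuousAt)

lemma IsKernel.contDiff_retConv (hp : Integrable p) (hw : IsKernel p a b w) (hf : IsCausal f) :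
    ContDiff ℝ 1 (Function.uncurry (retConv w f)) := by
  refine contDiff_iff_contDiffAt.2 fun z => contDiffAt_one_iff.2
    ⟨_, univ, univ_mem, Continuous.continuousOn ?_, fun v _ => hw.hasFDerivAt_retConv hp hf v⟩
  exact ((continuous_retConv hw.cont hf.deriv).smul continuous_const).add
    ((continuous_const.mul (continuous_potIntSign_causalWave hp hw.cont hf)).smul
      continuous_const)

lemma IsKernel.hasDerivAt_retConv_fst (hp : Integrable p) (hw : IsKernel p a b w)
    (hf : IsCausal f) (x t : ℝ) : HasDerivAt (fun y => retConv w f y t)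
      (1 / 2 * potIntSign p (causalWave a b w f) x t) x := by
  have := hasDerivAt_comp_line (Φ := Function.uncurry (retConv w f)) (u := fun y => y)
    (v := fun _ => t) (hw.hasFDerivAt_retConv hp hf (x, t)).differentiableAt (hasDerivAt_id' x)
    (hasDerivAt_const x t)
  rw [(hw.hasFDerivAt_retConv hp hf (x, t)).fderiv] at this
  simpa using this

/-- The gradient of the `x`-derivative of `retConv w f` where the potential is continuous. -/
lemma IsKernel.hasFDerivAt_potIntSign (hp : Integrable p) (hw : IsKernel p a b w)
    (hf : IsCausal f) {z : ℝ × ℝ} (hpc : ContinuousAt p z.1) (hz : z.1 ≠ 0) :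
    HasFDerivAt (fun z : ℝ × ℝ => 1 / 2 * potIntSign p (causalWave a b w f) z.1 z.2)
      ((1 / 2 * potIntSign p (causalWave a b w (deriv f)) z.1 z.2) • ContinuousLinearMap.snd ℝ ℝ ℝ
        + (p z.1 * causalWave a b w f z.1 z.2 + retConv w (deriv (deriv f)) z.1 z.2)
          • ContinuousLinearMap.fst ℝ ℝ ℝ) z := by
  have h := ((locBdd_causalWave a b hw.cont hf).hasFDerivAt_potIntSign
    (locBdd_causalWave a b hw.cont hf.deriv) hp (causalWave_lipschitz a b hw.cont hf)
    (x₀ := z.1) (t₀ := z.2)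
    (ae_of_all _ fun y => hasDerivAt_causalWave a b hw.cont hf y _) hpc
    (continuousAt_causalWave a b hw.cont hf hz)).const_mul (1 / 2)
  rw [hw.retConv_deriv hp hf.deriv]
  refine HasFDerivAt.congr_fderiv
    (f := fun z : ℝ × ℝ => 1 / 2 * potIntSign p (causalWave a b w f) z.1 z.2) h ?_
  ext
  · simp; ring
  · simp

lemma IsKernel.contDiffOn_retConv (hp : Integrable p) (hw : IsKernel p a b w) (hf : IsCausal f)
    {O : Set ℝ} (hO : IsOpen O) (hpc : ∀ x ∈ O, ContinuousAt p x) (h0 : (0 : ℝ) ∉ O) :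
    ContDiffOn ℝ 2 (Function.uncurry (retConv w f)) (O ×ˢ univ) := by
  have hOo : IsOpen (O ×ˢ (univ : Set ℝ)) := hO.prod isOpen_univ
  have h1 : ContDiffOn ℝ 1
      (fun z : ℝ × ℝ => 1 / 2 * potIntSign p (causalWave a b w f) z.1 z.2) (O ×ˢ univ) := by
    intro z hz
    have hne : ∀ z ∈ O ×ˢ (univ : Set ℝ), z.1 ≠ 0 := fun z hz h => h0 (h ▸ hz.1)
    refine ContDiffAt.contDiffWithinAt (contDiffAt_one_iff.2 ⟨_, _, hOo.mem_nhds hz, ?_,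
      fun v hv => hw.hasFDerivAt_potIntSign hp hf (hpc _ hv.1) (hne v hv)⟩)
    intro v hv
    refine ContinuousAt.continuousWithinAt (ContinuousAt.add ?_ ?_)
    · exact (continuous_const.mul (continuous_potIntSign_causalWave hp hw.cont
        hf.deriv)).continuousAt.smul continuousAt_const
    · refine ContinuousAt.smul (ContinuousAt.add (ContinuousAt.mul ?_ ?_)
        (continuous_retConv hw.cont hf.deriv.deriv).continuousAt) continuousAt_const
      · exact ContinuousAt.comp (g := p) (f := Prod.fst) (hpc _ hv.1) continuousAt_fst
      · exact continuousAt_causalWave a b hw.cont hf (hne v hv)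
  rw [show (2 : WithTop ℕ∞) = 1 + 1 by norm_num, contDiffOn_succ_iff_fderiv_of_isOpen hOo]
  refine ⟨fun z _ => (hw.hasFDerivAt_retConv hp hf z).differentiableAt.differentiableWithinAt,
    by simp, ContDiffOn.congr ?_ fun z _ => (hw.hasFDerivAt_retConv hp hf z).fderiv⟩
  exact ((hw.contDiff_retConv hp hf.deriv).contDiffOn.smul contDiffOn_const).add
    (h1.smul contDiffOn_const)

end Equation

/-! ### The initial boundary value problem: existence -/

/-- A function with continuous first derivatives that solves the wave equation classically in
`0 < x < 2π`, together with its second time derivative. -/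
structure IsClassicalWave (q : ℝ → ℝ) (u utt : ℝ → ℝ → ℝ) : Prop where
  smooth : ContDiff ℝ 1 (Function.uncurry u)
  smooth_open : ContDiffOn ℝ 2 (Function.uncurry u) (Ioo 0 (2 * Real.pi) ×ˢ univ)
  cont : Continuous (Function.uncurry utt)
  deriv_time : ∀ x ∈ Ioo 0 (2 * Real.pi), ∀ t, iteratedDeriv 2 (fun s => u x s) t = utt x t
  deriv_space : ∀ x ∈ Ioo 0 (2 * Real.pi), ∀ t,
    iteratedDeriv 2 (fun y => u y t) x = utt x t + q x * u x t

section ClassicalWave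

variable {q : ℝ → ℝ} {u utt u' utt' : ℝ → ℝ → ℝ}

lemma IsClassicalWave.contDiffAt (h : IsClassicalWave q u utt) {x : ℝ}
    (hx : x ∈ Ioo 0 (2 * Real.pi)) (t : ℝ) : ContDiffAt ℝ 2 (Function.uncurry u) (x, t) :=
  h.smooth_open.contDiffAt ((isOpen_Ioo.prod isOpen_univ).mem_nhds ⟨hx, mem_univ _⟩)

lemma IsClassicalWave.add (h : IsClassicalWave q u utt) (h' : IsClassicalWave q u' utt') :
    IsClassicalWave q (fun x t => u x t + u' x t) fun x t => utt x t + utt' x t := by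
  have ct : ∀ {u utt : ℝ → ℝ → ℝ}, IsClassicalWave q u utt → ∀ x ∈ Ioo 0 (2 * Real.pi), ∀ t,
      ContDiffAt ℝ (2 : ℕ) (fun s => u x s) t := fun h x hx t =>
    ContDiffAt.comp t (f := fun s : ℝ => (x, s)) (h.contDiffAt hx t) (by fun_prop)
  have cx : ∀ {u utt : ℝ → ℝ → ℝ}, IsClassicalWave q u utt → ∀ x ∈ Ioo 0 (2 * Real.pi), ∀ t,
      ContDiffAt ℝ (2 : ℕ) (fun y => u y t) x := fun h x hx t =>
    ContDiffAt.comp x (f := fun y : ℝ => (y, t)) (h.contDiffAt hx t) (by fun_prop)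
  refine ⟨h.smooth.add h'.smooth, h.smooth_open.add h'.smooth_open, h.cont.add h'.cont,
    fun x hx t => ?_, fun x hx t => ?_⟩
  · rw [iteratedDeriv_fun_add (ct h x hx t) (ct h' x hx t), h.deriv_time x hx, h'.deriv_time x hx]
  · rw [iteratedDeriv_fun_add (cx h x hx t) (cx h' x hx t), h.deriv_space x hx,
      h'.deriv_space x hx]
    ring

lemma isClassicalWave_zero (q : ℝ → ℝ) : IsClassicalWave q (fun _ _ => 0) fun _ _ => 0 :=
  ⟨contDiff_const, contDiffOn_const, continuous_const, fun x _ t => by simp, fun x _ t => by simp⟩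

lemma isClassicalWave_sum {U Utt : ℕ → ℝ → ℝ → ℝ} {N : ℕ}
    (h : ∀ k < N, IsClassicalWave q (U k) (Utt k)) :
    IsClassicalWave q (fun x t => ∑ k ∈ Finset.range N, U k x t)
      fun x t => ∑ k ∈ Finset.range N, Utt k x t := by
  induction N with
  | zero => simpa using isClassicalWave_zero q
  | succ N ih =>
    simp only [Finset.sum_range_succ]
    exact (ih fun k hk => h k (by omega)).add (h N (by omega))

/-- For a classical wave the Sobolev condition holds because `q` is square integrable and the wave
is bounded. -/
lemma IsClassicalWave.memLp (h : IsClassicalWave q u utt)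
    (hq2 : MemLp q 2 (volume.restrict (Ioo 0 (2 * Real.pi)))) (t : ℝ) :
    MemLp (iteratedDeriv 2 (fun x => u x t)) 2 (volume.restrict (Ioo 0 (2 * Real.pi))) := by
  have hbd : ∀ g : ℝ → ℝ, Continuous g → MemLp g ⊤ (volume.restrict (Ioo 0 (2 * Real.pi))) := by
    intro g hg
    obtain ⟨C, hC⟩ := (isCompact_Icc (a := 0) (b := 2 * Real.pi)).exists_bound_of_continuousOn
      hg.continuousOn
    refine memLp_top_of_bound hg.aestronglyMeasurable C ?_
    filter_upwards [ae_restrict_mem measurableSet_Ioo] with x hx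
    exact hC x ⟨hx.1.le, hx.2.le⟩
  have c1 : Continuous fun x => utt x t := h.cont.comp (Continuous.prodMk_left t)
  have c2 : Continuous fun x => u x t := h.smooth.continuous.comp (Continuous.prodMk_left t)
  have m1 : MemLp (fun x => utt x t) 2 (volume.restrict (Ioo 0 (2 * Real.pi))) :=
    (hbd _ c1).mono_exponent le_top
  have m2 : MemLp (fun x => q x * u x t) 2 (volume.restrict (Ioo 0 (2 * Real.pi))) :=
    (hbd _ c2).mul hq2
  refine (memLp_congr_ae ?_).1 (m1.add m2)
  filter_upwards [ae_restrict_mem measurableSet_Ioo] with x hx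
  exact (h.deriv_space x hx t).symm

end ClassicalWave

/-- The analytic expression of a causal wave on one side of the origin: the wave with front
`m f(t - e x)`, where `e = 1` to the right and `e = -1` to the left. -/
def frontWave (m e : ℝ) (w : ℝ → ℝ → ℝ) (f : ℝ → ℝ) (x t : ℝ) : ℝ :=
  m * f (t - e * x) + retConv w f x t

/-- The `x`-derivative of `frontWave m e w f`, where `w` is the kernel for `p`, `a`, `b`. -/
def frontWaveDx (p : ℝ → ℝ) (a b m e : ℝ) (w : ℝ → ℝ → ℝ) (f : ℝ → ℝ) (x t : ℝ) : ℝ :=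
  -(m * e) * deriv f (t - e * x) + 1 / 2 * potIntSign p (causalWave a b w f) x t

section FrontWave

variable {p : ℝ → ℝ} {a b m e : ℝ} {w : ℝ → ℝ → ℝ} {f : ℝ → ℝ}

lemma contDiff_front (hf : IsCausal f) (n : ℕ) :
    ContDiff ℝ n fun z : ℝ × ℝ => m * f (z.2 - e * z.1) :=
  contDiff_const.mul ((contDiff_infty.1 hf.smooth n).comp (by fun_prop))

lemma IsKernel.hasDerivAt_frontWave (hp : Integrable p) (hw : IsKernel p a b w) (hf : IsCausal f)
    (x t : ℝ) :
    HasDerivAt (fun y => frontWave m e w f y t) (frontWaveDx p a b m e w f x t) x := by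
  have h1 : HasDerivAt (fun y => m * f (t - e * y)) (m * (deriv f (t - e * x) * -(e * 1))) x :=
    (HasDerivAt.comp (h₂ := f) (h := fun y => t - e * y) x (hf.hasDerivAt (t - e * x))
      (((hasDerivAt_id' x).const_mul e).const_sub t)).const_mul m
  refine (h1.add (hw.hasDerivAt_retConv_fst hp hf x t)).congr_deriv ?_
  rw [frontWaveDx]; ring

lemma hasDerivAt_frontWave_time (hw : Continuous (Function.uncurry w)) (hf : IsCausal f)
    (x t : ℝ) : HasDerivAt (frontWave m e w f x) (frontWave m e w (deriv f) x t) t :=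
  (((hf.hasDerivAt (t - e * x)).comp_sub_const t (e * x)).const_mul m).add
    (hasDerivAt_retConv hw hf x t)

lemma frontWave_of_le (hf : IsCausal f) {x t : ℝ} (h : t ≤ |x|) (he : |x| = e * x) :
    frontWave m e w f x t = 0 := by
  rw [frontWave, retConv_of_le hf h, hf.zero _ (by linarith)]; ring

lemma frontWaveDx_of_le (hf : IsCausal f) {x t : ℝ} (h : t ≤ |x|) (he : |x| = e * x) :
    frontWaveDx p a b m e w f x t = 0 := by
  have : ∀ y, causalWave a b w f y (t - |x - y|) = 0 := fun y => by
    have := abs_sub_abs_le_abs_sub x y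
    rw [causalWave, retConv_of_le hf (by linarith), hf.zero _ (by linarith)]
    ring
  rw [frontWaveDx, hf.deriv.zero _ (by linarith)]
  simp [potIntSign, this]

lemma IsKernel.isClassicalWave_frontWave (hp : Integrable p) (hw : IsKernel p a b w)
    (hf : IsCausal f) {q : ℝ → ℝ} {c : ℝ} (he : e * e = 1)
    (h : ∀ x ∈ Ioo 0 (2 * Real.pi), ContinuousAt p (x + c) ∧ p (x + c) = q x ∧
      step a b (x + c) = m ∧ |x + c| = e * (x + c) ∧ x + c ≠ 0) :
    IsClassicalWave q (fun x t => frontWave m e w f (x + c) t)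
      fun x t => frontWave m e w (deriv (deriv f)) (x + c) t := by
  have hsh : ∀ n : WithTop ℕ∞, ContDiff ℝ n fun z : ℝ × ℝ => (z.1 + c, z.2) := fun n => by fun_prop
  refine ⟨?_, ?_, ?_, fun x hx t => ?_, fun x hx t => ?_⟩
  · exact ContDiff.comp (g := fun z : ℝ × ℝ => m * f (z.2 - e * z.1) + Function.uncurry (retConv w f) z)
      ((contDiff_front hf 1).add (hw.contDiff_retConv hp hf)) (hsh 1)
  · have h1 := hw.contDiffOn_retConv hp hf (O := Ioo c (2 * Real.pi + c)) isOpen_Ioo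
      (fun x hx => by
        have := (h (x - c) ⟨by linarith [hx.1], by linarith [hx.2]⟩).1
        rwa [sub_add_cancel] at this)
      (fun h0 => (h (0 - c) ⟨by linarith [h0.1], by linarith [h0.2]⟩).2.2.2.2 (by ring))
    exact ContDiffOn.comp
      (g := fun z : ℝ × ℝ => m * f (z.2 - e * z.1) + Function.uncurry (retConv w f) z)
      ((contDiff_front hf 2).contDiffOn.add h1) (hsh 2).contDiffOn
      fun z hz => ⟨⟨by linarith [hz.1.1], by linarith [hz.1.2]⟩, mem_univ _⟩
  · have h1 : Continuous fun z : ℝ × ℝ => m * deriv (deriv f) (z.2 - e * z.1)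
        + Function.uncurry (retConv w (deriv (deriv f))) z :=
      (contDiff_front hf.deriv.deriv 0).continuous.add (continuous_retConv hw.cont hf.deriv.deriv)
    exact h1.comp (hsh 0).continuous
  · exact iteratedDeriv_two_eq
      (Eventually.of_forall fun s => hasDerivAt_frontWave_time hw.cont hf (x + c) s)
      (hasDerivAt_frontWave_time hw.cont hf.deriv (x + c) t)
  · obtain ⟨h1, h2, h3, h4, h5⟩ := h x hx
    have d1 : HasDerivAt (fun y => -(m * e) * deriv f (t - e * (y + c)))
        (-(m * e) * (deriv (deriv f) (t - e * (x + c)) * -(e * 1))) x :=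
      (HasDerivAt.comp (h₂ := deriv f) (h := fun y => t - e * (y + c)) x
        (hf.deriv.hasDerivAt (t - e * (x + c)))
        ((((hasDerivAt_id' x).add_const c).const_mul e).const_sub t)).const_mul _
    have d2 := hasDerivAt_comp_line (u := fun y => y + c) (v := fun _ => t)
      (hw.hasFDerivAt_potIntSign hp hf (z := (x + c, t)) h1 h5).differentiableAt
      ((hasDerivAt_id' x).add_const c) (hasDerivAt_const x t)
    rw [(hw.hasFDerivAt_potIntSign hp hf (z := (x + c, t)) h1 h5).fderiv] at d2
    refine iteratedDeriv_two_eq (f' := fun y => frontWaveDx p a b m e w f (y + c) t)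
      (Eventually.of_forall fun y => (hw.hasDerivAt_frontWave hp hf (y + c) t).comp_add_const y c) ?_
    refine (d1.add d2).congr_deriv ?_
    simp only [add_apply, smul_apply, ContinuousLinearMap.coe_snd', ContinuousLinearMap.coe_fst',
      smul_eq_mul, causalWave, h2, h3, h4, frontWave]
    linear_combination m * deriv (deriv f) (t - e * (x + c)) * he

end FrontWave

/-- The wave on the period interval generated by the signal `f`: the wave on the line, folded. -/
def foldedWave (a b : ℝ) (N : ℕ) (w : ℝ → ℝ → ℝ) (f : ℝ → ℝ) (x t : ℝ) : ℝ :=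
  ∑ k ∈ Finset.range N, (frontWave a 1 w f (x + 2 * k * Real.pi) t
    + frontWave b (-1) w f (x + -(2 * (k + 1) * Real.pi)) t)

/-- The `x`-derivative of `foldedWave`. -/
def foldedWaveDx (p : ℝ → ℝ) (a b : ℝ) (N : ℕ) (w : ℝ → ℝ → ℝ) (f : ℝ → ℝ) (x t : ℝ) : ℝ :=
  ∑ k ∈ Finset.range N, (frontWaveDx p a b a 1 w f (x + 2 * k * Real.pi) t
    + frontWaveDx p a b b (-1) w f (x + -(2 * (k + 1) * Real.pi)) t)

section FoldedWave

variable {q : ℝ → ℝ} {a b : ℝ} {N : ℕ} {w : ℝ → ℝ → ℝ} {f : ℝ → ℝ}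

lemma IsKernel.isClassicalWave_foldedWave (hq : ContDiffOn ℝ 2 q (Ioo 0 (2 * Real.pi)))
    (hq2 : MemLp q 2 (volume.restrict (Ioo 0 (2 * Real.pi))))
    (hw : IsKernel (truncPot q (2 * N * Real.pi)) a b w) (hf : IsCausal f) :
    IsClassicalWave q (foldedWave a b N w f) (foldedWave a b N w (deriv (deriv f))) := by
  have hpi := Real.pi_pos
  have hp := integrable_truncPot hq2 (2 * N * Real.pi)
  refine isClassicalWave_sum fun k hk => ?_
  have hkN : (k : ℝ) + 1 ≤ N := by exact_mod_cast hk
  have hk0 : (0 : ℝ) ≤ k := Nat.cast_nonneg k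
  have hkpi : 0 ≤ k * Real.pi := by positivity
  have hNpi : (k + 1) * Real.pi ≤ N * Real.pi := by gcongr
  refine (hw.isClassicalWave_frontWave hp hf (by norm_num) fun x hx => ?_).add
    (hw.isClassicalWave_frontWave hp hf (by norm_num) fun x hx => ?_)
  · have h1 : |x + 2 * k * Real.pi| < 2 * N * Real.pi :=
      abs_lt.2 ⟨by linarith [hx.1], by linarith [hx.2]⟩
    have h2 : x + 2 * k * Real.pi ∉ lattice := notMem_lattice_of_mem_Ioo k
      (by push_cast; linarith [hx.1]) (by push_cast; linarith [hx.2])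
    have h3 : 0 < x + 2 * k * Real.pi := by linarith [hx.1]
    refine ⟨(contDiffAt_truncPot hq h1 h2).continuousAt, ?_, by simp [step, h3], ?_, h3.ne'⟩
    · have := periodize_add q x k
      push_cast at this
      rw [truncPot_eq h1, this, periodize_eq q ⟨hx.1.le, hx.2⟩]
    · rw [abs_of_pos h3]; ring
  · have h1 : |x + -(2 * (k + 1) * Real.pi)| < 2 * N * Real.pi :=
      abs_lt.2 ⟨by linarith [hx.1], by linarith [hx.2]⟩
    have h2 : x + -(2 * (k + 1) * Real.pi) ∉ lattice := notMem_lattice_of_mem_Ioo (-(k + 1))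
      (by push_cast; linarith [hx.1]) (by push_cast; linarith [hx.2])
    have h3 : x + -(2 * (k + 1) * Real.pi) < 0 := by linarith [hx.2]
    refine ⟨(contDiffAt_truncPot hq h1 h2).continuousAt, ?_, by simp [step, not_lt.2 h3.le], ?_,
      h3.ne⟩
    · have := periodize_add q x (-(k + 1))
      push_cast at this
      rw [truncPot_eq h1, ← periodize_eq q ⟨hx.1.le, hx.2⟩, ← this]
      congr 1; ring
    · rw [abs_of_neg h3]; ring

lemma IsKernel.hasDerivAt_foldedWave {p : ℝ → ℝ} (hp : Integrable p) (hw : IsKernel p a b w)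
    (hf : IsCausal f) (x t : ℝ) :
    HasDerivAt (fun y => foldedWave a b N w f y t) (foldedWaveDx p a b N w f x t) x :=
  HasDerivAt.fun_sum fun _ _ =>
    ((hw.hasDerivAt_frontWave hp hf _ t).comp_add_const x _).add
      ((hw.hasDerivAt_frontWave hp hf _ t).comp_add_const x _)

lemma hasDerivAt_foldedWave_time (hw : Continuous (Function.uncurry w)) (hf : IsCausal f)
    (x t : ℝ) : HasDerivAt (foldedWave a b N w f x) (foldedWave a b N w (deriv f) x t) t :=
  HasDerivAt.fun_sum fun _ _ =>
    (hasDerivAt_frontWave_time hw hf _ t).add (hasDerivAt_frontWave_time hw hf _ t)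

lemma foldedWave_zero (hf : IsCausal f) {x : ℝ} (hx : x ∈ Icc 0 (2 * Real.pi)) :
    foldedWave a b N w f x 0 = 0 := by
  have hpi := Real.pi_pos
  refine Finset.sum_eq_zero fun k _ => ?_
  have hkpi : 0 ≤ k * Real.pi := by positivity
  rw [frontWave_of_le hf (abs_nonneg _), frontWave_of_le hf (abs_nonneg _), add_zero]
  · rw [abs_of_nonpos (by linarith [hx.2])]; ring
  · rw [abs_of_nonneg (by linarith [hx.1])]; ring

/-- Folding turns differences of end point values into telescoping sums. -/
lemma sum_folded_sub (F G : ℝ → ℝ) (N : ℕ) :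
    (∑ k ∈ Finset.range N, (F (0 + 2 * k * Real.pi) + G (0 + -(2 * (k + 1) * Real.pi))))
      - ∑ k ∈ Finset.range N, (F (2 * Real.pi + 2 * k * Real.pi)
        + G (2 * Real.pi + -(2 * (k + 1) * Real.pi)))
      = F 0 - F (2 * N * Real.pi) + (G (-(2 * N * Real.pi)) - G 0) := by
  have h1 := Finset.sum_range_sub' (fun k : ℕ => F (2 * k * Real.pi)) N
  have h2 := Finset.sum_range_sub (fun k : ℕ => G (-(2 * k * Real.pi))) N
  push_cast at h1 h2
  simp only [mul_zero, zero_mul, neg_zero] at h1 h2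
  rw [← h1, ← h2, ← Finset.sum_sub_distrib, ← Finset.sum_add_distrib]
  refine Finset.sum_congr rfl fun k _ => ?_
  rw [show (0 : ℝ) + 2 * k * Real.pi = 2 * k * Real.pi by ring,
    show (0 : ℝ) + -(2 * (k + 1) * Real.pi) = -(2 * (k + 1) * Real.pi) by ring,
    show 2 * Real.pi + 2 * k * Real.pi = 2 * (k + 1) * Real.pi by ring,
    show 2 * Real.pi + -(2 * (k + 1) * Real.pi) = -(2 * k * Real.pi) by ring]
  ring

lemma sum_range_add_succ (h : ℕ → ℝ) {N : ℕ} (hN : 1 ≤ N) (h0 : h N = 0) :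
    ∑ k ∈ Finset.range N, (h k + h (k + 1)) = h 0 + 2 * ∑ k ∈ Finset.Ioo 0 N, h k := by
  have h1 : ∑ k ∈ Finset.range N, h k = h 0 + ∑ k ∈ Finset.Ioo 0 N, h k := by
    rw [Finset.range_eq_Ico, ← Finset.Ioo_insert_left (by omega), Finset.sum_insert (by simp)]
  have h2 : ∑ k ∈ Finset.range N, h (k + 1) = ∑ k ∈ Finset.Ioo 0 N, h k := by
    have := Finset.sum_range_succ' h N
    rw [Finset.sum_range_succ, h0, add_zero, h1] at this
    linarith
  rw [Finset.sum_add_distrib, h1, h2]; ring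

lemma sum_folded_add (F G : ℝ → ℝ) {N : ℕ} (hN : 1 ≤ N) (hF : F (2 * N * Real.pi) = 0)
    (hG : G (-(2 * N * Real.pi)) = 0) :
    (∑ k ∈ Finset.range N, (F (0 + 2 * k * Real.pi) + G (0 + -(2 * (k + 1) * Real.pi))))
      + ∑ k ∈ Finset.range N, (F (2 * Real.pi + 2 * k * Real.pi)
        + G (2 * Real.pi + -(2 * (k + 1) * Real.pi)))
      = F 0 + G 0 + 2 * ∑ k ∈ Finset.Ioo 0 N, (F (2 * k * Real.pi) + G (-(2 * k * Real.pi))) := by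
  have h1 := sum_range_add_succ (fun k : ℕ => F (2 * k * Real.pi) + G (-(2 * k * Real.pi))) hN
    (by simp only [hF, hG, add_zero])
  push_cast at h1
  simp only [mul_zero, zero_mul, neg_zero] at h1
  rw [← h1, ← Finset.sum_add_distrib]
  refine Finset.sum_congr rfl fun k _ => ?_
  rw [show (0 : ℝ) + 2 * k * Real.pi = 2 * k * Real.pi by ring,
    show (0 : ℝ) + -(2 * (k + 1) * Real.pi) = -(2 * (k + 1) * Real.pi) by ring,
    show 2 * Real.pi + 2 * k * Real.pi = 2 * (k + 1) * Real.pi by ring,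
    show 2 * Real.pi + -(2 * (k + 1) * Real.pi) = -(2 * k * Real.pi) by ring]
  ring

lemma abs_two_mul_pi (N : ℕ) : |2 * (N : ℝ) * Real.pi| = 2 * N * Real.pi :=
  abs_of_nonneg (by have := Real.pi_pos; positivity)

lemma foldedWave_jump (hf : IsCausal f) {t : ℝ} (ht : t < 2 * N * Real.pi) :
    foldedWave a b N w f 0 t - foldedWave a b N w f (2 * Real.pi) t = (a - b) * f t := by
  rw [foldedWave, foldedWave, sum_folded_sub (fun x => frontWave a 1 w f x t)
    (fun x => frontWave b (-1) w f x t),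
    frontWave_of_le hf (x := 2 * N * Real.pi) (by rw [abs_two_mul_pi]; exact ht.le)
      (by rw [abs_two_mul_pi]; ring),
    frontWave_of_le hf (x := -(2 * N * Real.pi)) (by rw [abs_neg, abs_two_mul_pi]; exact ht.le)
      (by rw [abs_neg, abs_two_mul_pi]; ring)]
  simp only [frontWave, mul_zero, sub_zero]
  ring

lemma foldedWaveDx_jump {p : ℝ → ℝ} (hf : IsCausal f) {t : ℝ} (ht : t < 2 * N * Real.pi) :
    foldedWaveDx p a b N w f 0 t - foldedWaveDx p a b N w f (2 * Real.pi) t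
      = -(a + b) * deriv f t := by
  rw [foldedWaveDx, foldedWaveDx, sum_folded_sub (fun x => frontWaveDx p a b a 1 w f x t)
    (fun x => frontWaveDx p a b b (-1) w f x t),
    frontWaveDx_of_le hf (x := 2 * N * Real.pi) (by rw [abs_two_mul_pi]; exact ht.le)
      (by rw [abs_two_mul_pi]; ring),
    frontWaveDx_of_le hf (x := -(2 * N * Real.pi)) (by rw [abs_neg, abs_two_mul_pi]; exact ht.le)
      (by rw [abs_neg, abs_two_mul_pi]; ring)]
  simp only [frontWaveDx, mul_zero, sub_zero]
  ring

lemma foldedWave_add (hf : IsCausal f) (hN : 1 ≤ N) {t : ℝ} (ht : t < 2 * N * Real.pi) :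
    foldedWave a b N w f 0 t + foldedWave a b N w f (2 * Real.pi) t
      = (a + b) * f t + 2 * retConv w f 0 t + 2 * ∑ k ∈ Finset.Ioo 0 N,
        ((a + b) * f (t - 2 * k * Real.pi)
          + (retConv w f (2 * k * Real.pi) t + retConv w f (-(2 * k * Real.pi)) t)) := by
  rw [foldedWave, foldedWave, sum_folded_add (fun x => frontWave a 1 w f x t)
    (fun x => frontWave b (-1) w f x t) hN
    (frontWave_of_le hf (x := 2 * N * Real.pi) (by rw [abs_two_mul_pi]; exact ht.le)
      (by rw [abs_two_mul_pi]; ring))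
    (frontWave_of_le hf (x := -(2 * N * Real.pi)) (by rw [abs_neg, abs_two_mul_pi]; exact ht.le)
      (by rw [abs_neg, abs_two_mul_pi]; ring))]
  congr 1
  · simp only [frontWave, mul_zero, sub_zero]; ring
  · congr 1
    refine Finset.sum_congr rfl fun k _ => ?_
    simp only [frontWave, one_mul, neg_mul_neg]; ring

lemma foldedWaveDx_add {p : ℝ → ℝ} (hf : IsCausal f) (hN : 1 ≤ N) {t : ℝ}
    (ht : t < 2 * N * Real.pi) :
    foldedWaveDx p a b N w f 0 t + foldedWaveDx p a b N w f (2 * Real.pi) t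
      = (b - a) * deriv f t + potIntSign p (causalWave a b w f) 0 t
        + ∑ k ∈ Finset.Ioo 0 N, (2 * ((b - a) * deriv f (t - 2 * k * Real.pi))
          + (potIntSign p (causalWave a b w f) (2 * k * Real.pi) t
            + potIntSign p (causalWave a b w f) (-(2 * k * Real.pi)) t)) := by
  rw [foldedWaveDx, foldedWaveDx, sum_folded_add (fun x => frontWaveDx p a b a 1 w f x t)
    (fun x => frontWaveDx p a b b (-1) w f x t) hN
    (frontWaveDx_of_le hf (x := 2 * N * Real.pi) (by rw [abs_two_mul_pi]; exact ht.le)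
      (by rw [abs_two_mul_pi]; ring))
    (frontWaveDx_of_le hf (x := -(2 * N * Real.pi)) (by rw [abs_neg, abs_two_mul_pi]; exact ht.le)
      (by rw [abs_neg, abs_two_mul_pi]; ring)), Finset.mul_sum]
  congr 1
  · simp only [frontWaveDx, mul_zero, sub_zero]; ring
  · refine Finset.sum_congr rfl fun k _ => ?_
    simp only [frontWaveDx, one_mul, neg_mul_neg]; ring

end FoldedWave

lemma fderivWithin_rect_eq_deriv {u : ℝ → ℝ → ℝ} (hu : ContDiff ℝ 1 (Function.uncurry u)) {T : ℝ}
    {x t : ℝ} (hx : x ∈ Icc 0 (2 * Real.pi)) (ht : t ∈ Ico 0 T) :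
    fderivWithin ℝ (Function.uncurry u) (rect T) (x, t) (1, 0) = deriv (fun y => u y t) x := by
  have hd := hu.differentiable (by simp) (x, t)
  rw [hd.fderivWithin (uniqueDiffOn_rect T (x, t) ⟨hx, ht⟩)]
  exact (hasDerivAt_comp_line (Φ := Function.uncurry u) (u := fun y => y) (v := fun _ => t) hd
    (hasDerivAt_id' x) (hasDerivAt_const x t)).deriv.symm

/-- The components of a control are causal signals. -/
lemma IsControl.isCausal {T : ℝ} {F : ℝ → Fin 2 → ℝ} (hF : IsControl T F) (i : Fin 2) :
    IsCausal fun s => F s i := by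
  refine ⟨contDiff_pi.1 hF.smooth i, fun t ht => ?_⟩
  have : t ∉ tsupport F := fun h => absurd (hF.support h).1 (not_lt.2 ht)
  rw [image_eq_zero_of_notMem_tsupport this]; rfl

/-- The explicit solution of the initial boundary value problem for times below `2Nπ`. -/
theorem isWaveSolution_foldedWave {q : ℝ → ℝ} (hq : ContDiffOn ℝ 2 q (Ioo 0 (2 * Real.pi)))
    (hq2 : MemLp q 2 (volume.restrict (Ioo 0 (2 * Real.pi)))) {N : ℕ} {w1 w2 : ℝ → ℝ → ℝ}
    (h1 : IsKernel (truncPot q (2 * N * Real.pi)) (1 / 2) (-(1 / 2)) w1)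
    (h2 : IsKernel (truncPot q (2 * N * Real.pi)) (-(1 / 2)) (-(1 / 2)) w2)
    {F : ℝ → Fin 2 → ℝ} (hF : ∀ i, IsCausal fun s => F s i) {T : ℝ} (hT : T ≤ 2 * N * Real.pi) :
    IsWaveSolution q T F fun x t =>
      foldedWave (1 / 2) (-(1 / 2)) N w1 (fun s => F s 0) x t
        + foldedWave (-(1 / 2)) (-(1 / 2)) N w2 (fun s => F s 1) x t := by
  have hpi := Real.two_pi_pos
  have hp := integrable_truncPot hq2 (2 * N * Real.pi)
  have hW := (h1.isClassicalWave_foldedWave hq hq2 (hF 0)).add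
    (h2.isClassicalWave_foldedWave hq hq2 (hF 1))
  refine ⟨hW.smooth.contDiffOn, hW.smooth_open.mono (prod_mono_right (subset_univ _)),
    fun t _ => hW.memLp hq2 t, fun x hx t _ => ?_, fun t ht => ?_, fun x hx => ?_, fun x hx => ?_⟩
  · rw [schrodinger, hW.deriv_time x hx, hW.deriv_space x hx]; ring
  · have ht' : t ∈ Ico 0 T := ⟨ht.1.le, ht.2⟩
    have htN : t < 2 * N * Real.pi := ht.2.trans_le hT
    have hd : ∀ x, deriv (fun y => foldedWave (1 / 2) (-(1 / 2)) N w1 (fun s => F s 0) y t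
        + foldedWave (-(1 / 2)) (-(1 / 2)) N w2 (fun s => F s 1) y t) x
        = foldedWaveDx (truncPot q (2 * N * Real.pi)) (1 / 2) (-(1 / 2)) N w1 (fun s => F s 0) x t
        + foldedWaveDx (truncPot q (2 * N * Real.pi)) (-(1 / 2)) (-(1 / 2)) N w2
          (fun s => F s 1) x t := fun x =>
      ((h1.hasDerivAt_foldedWave hp (hF 0) x t).add (h2.hasDerivAt_foldedWave hp (hF 1) x t)).deriv
    rw [boundary0_eq hW.smooth.contDiffOn ht',
      fderivWithin_rect_eq_deriv hW.smooth ⟨le_rfl, hpi.le⟩ ht',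
      fderivWithin_rect_eq_deriv hW.smooth ⟨hpi.le, le_rfl⟩ ht', hd, hd]
    have e1 := foldedWave_jump (a := 1 / 2) (b := -(1 / 2)) (w := w1) (hF 0) htN
    have e2 := foldedWave_jump (a := -(1 / 2)) (b := -(1 / 2)) (w := w2) (hF 1) htN
    have e3 := foldedWaveDx_jump (a := 1 / 2) (b := -(1 / 2)) (w := w1)
      (p := truncPot q (2 * N * Real.pi)) (hF 0) htN
    have e4 := foldedWaveDx_jump (a := -(1 / 2)) (b := -(1 / 2)) (w := w2)
      (p := truncPot q (2 * N * Real.pi)) (hF 1) htN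
    congr 1
    · linarith
    · congr 1; linarith
  · simp only [foldedWave_zero (hF 0) hx, foldedWave_zero (hF 1) hx, add_zero]
  · have := (hasDerivAt_foldedWave_time (a := 1 / 2) (b := -(1 / 2)) (N := N) h1.cont (hF 0) x 0).add
      (hasDerivAt_foldedWave_time (a := -(1 / 2)) (b := -(1 / 2)) (N := N) h2.cont (hF 1) x 0)
    rw [foldedWave_zero (hF 0).deriv hx, foldedWave_zero (hF 1).deriv hx, add_zero] at this
    exact this.hasDerivWithinAt.derivWithin (uniqueDiffOn_Ici _ _ self_mem_Ici)

theorem exists_isWaveSolution {q : ℝ → ℝ} (hq : ContDiffOn ℝ 2 q (Ioo 0 (2 * Real.pi)))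
    (hq2 : MemLp q 2 (volume.restrict (Ioo 0 (2 * Real.pi)))) {T : ℝ} {F : ℝ → Fin 2 → ℝ}
    (hF : IsControl T F) : ∃ u, IsWaveSolution q T F u := by
  obtain ⟨N, hN⟩ := exists_nat_gt (T / (2 * Real.pi))
  rw [div_lt_iff₀ Real.two_pi_pos] at hN
  have hp := integrable_truncPot hq2 (2 * N * Real.pi)
  obtain ⟨w1, h1⟩ := exists_isKernel hp (1 / 2) (-(1 / 2))
  obtain ⟨w2, h2⟩ := exists_isKernel hp (-(1 / 2)) (-(1 / 2))
  exact ⟨_, isWaveSolution_foldedWave hq hq2 h1 h2 hF.isCausal (by linarith)⟩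

/-! ### The trace of the causal wave at a fixed point -/

/-- The `x`-derivative of a Goursat kernel. -/
def kernelDx (p : ℝ → ℝ) (a b : ℝ) (w : ℝ → ℝ → ℝ) (x t : ℝ) : ℝ :=
  kernelDxi p a w x t - kernelDeta p b w x t

section Trace

variable {p : ℝ → ℝ} {a b : ℝ} {w : ℝ → ℝ → ℝ} {f : ℝ → ℝ}

lemma IsKernel.hasDerivAt_kernelDx (hp : Integrable p) (hw : IsKernel p a b w) {x t : ℝ}
    (hx : |x| < t) (hp1 : ContinuousAt p ((x + t) / 2)) (hp2 : ContinuousAt p ((x - t) / 2)) :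
    HasDerivAt (fun y => w y t) (kernelDx p a b w x t) x := by
  have h := hw.hasFDerivAt hp hx hp1 hp2
  have d := hasDerivAt_comp_line (u := fun y => y) (v := fun _ => t) h.differentiableAt
    (hasDerivAt_id' x) (hasDerivAt_const x t)
  rw [h.fderiv] at d
  refine d.congr_deriv ?_
  simp [kernelDx, sub_eq_add_neg]

lemma integrable_comp_half (hp : Integrable p) (x : ℝ) :
    Integrable (fun s => p ((x + s) / 2)) ∧ Integrable fun s => p ((x - s) / 2) :=
  ⟨(hp.comp_div two_ne_zero).comp_add_left x, (hp.comp_div two_ne_zero).comp_sub_left x⟩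

lemma intervalIntegrable_kernelDx (hp : Integrable p) (hw : Continuous (Function.uncurry w))
    (x u v : ℝ) : IntervalIntegrable (kernelDx p a b w x) volume u v := by
  obtain ⟨h1, h2⟩ := integrable_comp_half hp x
  have h3 : Continuous fun s => rightInt p w x (x + s) :=
    (continuous_rightInt hp hw).comp (by fun_prop : Continuous fun s : ℝ => (x, x + s))
  have h4 : Continuous fun s => leftInt p w x (s - x) :=
    (continuous_leftInt hp hw).comp (by fun_prop : Continuous fun s : ℝ => (x, s - x))
  exact ((h1.const_mul _).intervalIntegrable.sub ((h3.const_mul _).intervalIntegrable _ _)).sub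
    ((h2.const_mul _).intervalIntegrable.sub ((h4.const_mul _).intervalIntegrable _ _))

lemma locBdd_front (a b : ℝ) (hf : IsCausal f) : LocBdd fun y τ => step a b y * f (τ - |y|) := by
  have h := locBdd_causalWave a b (w := fun _ _ => 0) continuous_const hf
  have e : causalWave a b (fun _ _ => 0) f = fun y τ => step a b y * f (τ - |y|) := by
    ext y τ; simp [causalWave, retConv]
  rwa [e] at h

/-- The front contributes to the signed retarded integral through the potential between the source
and the point of observation, and through the reflections on both sides. -/
lemma potIntSign_front (hp : Integrable p) (hf : IsCausal f) {x t : ℝ} (h : |x| ≤ t) :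
    potIntSign p (fun y τ => step a b y * f (τ - |y|)) x t
      = step a b x * (∫ y in (0 : ℝ)..x, p y) * f (t - |x|)
        - a / 2 * (∫ s in |x|..t, p ((x + s) / 2) * f (t - s))
        + b / 2 * ∫ s in |x|..t, p ((x - s) / 2) * f (t - s) := by
  obtain ⟨h1, h2⟩ := abs_le.1 h
  set m := min 0 x with hm
  set M := max 0 x with hM
  set H : ℝ → ℝ := fun y => p y * (side x y * (step a b y * f (t - |x - y| - |y|))) with hH
  have hsupp : Function.support H ⊆ Ioc ((x - t) / 2) ((x + t) / 2) := by
    intro y hy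
    by_contra hn
    apply hy
    have : t - |x - y| - |y| ≤ 0 := by
      by_contra hpos
      have h3 := neg_abs_le y
      have h4 := le_abs_self y
      have h5 := neg_abs_le (x - y)
      have h6 := le_abs_self (x - y)
      exact hn ⟨by linarith, by linarith⟩
    simp only [hH, hf.zero _ this, mul_zero]
  have hint : Integrable H := (locBdd_front a b hf).integrable_sign_mul hp x t
  have hI : ∀ u v, IntervalIntegrable H volume u v := fun u v => hint.intervalIntegrable
  have e0 : potIntSign p (fun y τ => step a b y * f (τ - |y|)) x t
      = (∫ y in (x - t) / 2..m, H y) + (∫ y in m..M, H y) + ∫ y in M..(x + t) / 2, H y := by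
    rw [intervalIntegral.integral_add_adjacent_intervals (hI _ _) (hI _ _),
      intervalIntegral.integral_add_adjacent_intervals (hI _ _) (hI _ _),
      intervalIntegral.integral_eq_integral_of_support_subset hsupp]
    rfl
  have hmx : m ≤ x := min_le_right _ _
  have hm0 : m ≤ 0 := min_le_left _ _
  have hMx : x ≤ M := le_max_right _ _
  have hM0 : 0 ≤ M := le_max_left _ _
  have hmM : m + M = x := by rw [hm, hM, min_add_max, zero_add]
  have hMm : M - m = |x| := by rw [hm, hM, max_sub_min_eq_abs, sub_zero]
  have hne : ∀ z : ℝ, ∀ᵐ y : ℝ, y ≠ z := fun z =>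
    compl_mem_ae_iff.2 (measure_singleton z : volume {z} = 0)
  -- to the right of both points the wave comes back after the time `2 y - x`
  have e1 : ∫ y in M..(x + t) / 2, H y
      = -(a / 2) * ∫ s in |x|..t, p ((x + s) / 2) * f (t - s) := by
    have c1 : ∫ y in M..(x + t) / 2, H y
        = ∫ y in M..(x + t) / 2, -a * (p y * f (t - (2 * y - x))) := by
      refine intervalIntegral.integral_congr_ae ?_
      filter_upwards [hne M] with y hy hy'
      rw [uIoc_of_le (by linarith)] at hy'
      have y0 : 0 < y := by linarith [hy'.1]
      have yx : x < y := by linarith [hy'.1]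
      simp only [hH, side, step, if_neg yx.le.not_gt, if_pos y0, abs_of_pos y0,
        abs_of_neg (sub_neg.2 yx)]
      rw [show t - -(x - y) - y = t - (2 * y - x) by ring]; ring
    have c2 := intervalIntegral.integral_comp_div_add (a := |x|) (b := t)
      (fun y => p y * f (t - (2 * y - x))) two_ne_zero (x / 2)
    have c3 : |x| / 2 + x / 2 = M := by linarith
    have c4 : t / 2 + x / 2 = (x + t) / 2 := by ring
    rw [c3, c4, smul_eq_mul] at c2
    have c5 : ∫ s in |x|..t, p ((x + s) / 2) * f (t - s)
        = ∫ s in |x|..t, p (s / 2 + x / 2) * f (t - (2 * (s / 2 + x / 2) - x)) := by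
      refine intervalIntegral.integral_congr fun s _ => ?_
      rw [show (x + s) / 2 = s / 2 + x / 2 by ring, show 2 * (s / 2 + x / 2) - x = s by ring]
    rw [c1, intervalIntegral.integral_const_mul, c5, c2]; ring
  have e2 : ∫ y in (x - t) / 2..m, H y
      = b / 2 * ∫ s in |x|..t, p ((x - s) / 2) * f (t - s) := by
    have c1 : ∫ y in (x - t) / 2..m, H y
        = ∫ y in (x - t) / 2..m, b * (p y * f (t - (x - 2 * y))) := by
      refine intervalIntegral.integral_congr_ae ?_
      filter_upwards [hne m] with y hy hy'
      rw [uIoc_of_le (by linarith)] at hy'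
      have hym : y < m := lt_of_le_of_ne hy'.2 hy
      have y0 : y < 0 := by linarith
      have yx : y < x := by linarith
      simp only [hH, side, step, if_pos yx, if_neg y0.le.not_gt, abs_of_neg y0,
        abs_of_pos (sub_pos.2 yx)]
      rw [show t - (x - y) - -y = t - (x - 2 * y) by ring]; ring
    have c2 := intervalIntegral.integral_comp_sub_div (a := |x|) (b := t)
      (fun y => p y * f (t - (x - 2 * y))) two_ne_zero (x / 2)
    have c3 : x / 2 - |x| / 2 = m := by linarith
    have c4 : x / 2 - t / 2 = (x - t) / 2 := by ring
    rw [c3, c4, smul_eq_mul] at c2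
    have c5 : ∫ s in |x|..t, p ((x - s) / 2) * f (t - s)
        = ∫ s in |x|..t, p (x / 2 - s / 2) * f (t - (x - 2 * (x / 2 - s / 2))) := by
      refine intervalIntegral.integral_congr fun s _ => ?_
      rw [show (x - s) / 2 = x / 2 - s / 2 by ring, show x - 2 * (x / 2 - s / 2) = s by ring]
    rw [c1, intervalIntegral.integral_const_mul, c5, c2]; ring
  -- between the two points the path of the reflected wave has the constant length `|x|`
  have e3 : ∫ y in m..M, H y = step a b x * (∫ y in (0 : ℝ)..x, p y) * f (t - |x|) := by
    rcases lt_or_ge 0 x with hx | hx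
    · rw [hm, hM, min_eq_left hx.le, max_eq_right hx.le]
      have : ∫ y in (0 : ℝ)..x, H y = ∫ y in (0 : ℝ)..x, p y * (step a b x * f (t - |x|)) := by
        refine intervalIntegral.integral_congr_ae ?_
        filter_upwards [hne x] with y hy hy'
        rw [uIoc_of_le hx.le] at hy'
        have yx : y < x := lt_of_le_of_ne hy'.2 hy
        simp only [hH, side, step, if_pos yx, if_pos hy'.1, if_pos hx, abs_of_pos hy'.1,
          abs_of_pos (sub_pos.2 yx), abs_of_pos hx]
        rw [show t - (x - y) - y = t - x by ring]; ring
      rw [this, intervalIntegral.integral_mul_const]; ring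
    · rw [hm, hM, min_eq_right hx, max_eq_left hx]
      have : ∫ y in x..(0 : ℝ), H y = ∫ y in x..(0 : ℝ), p y * (-step a b x * f (t - |x|)) := by
        refine intervalIntegral.integral_congr fun y hy => ?_
        rw [uIcc_of_le hx] at hy
        simp only [hH, side, step, if_neg hy.1.not_gt, if_neg hy.2.not_gt, if_neg hx.not_gt,
          abs_of_nonpos hy.2, abs_of_nonpos (sub_nonpos.2 hy.1), abs_of_nonpos hx]
        rw [show t - -(x - y) - -y = t - -x by ring]; ring
      rw [this, intervalIntegral.integral_mul_const, intervalIntegral.integral_symm x 0]; ring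
  rw [e0, e1, e2, e3]; ring

/-- The `x`-derivative of the causal wave behind the front: a delayed copy of the signal, weighted
by the jump of the kernel at the characteristic, and the convolution with the `x`-derivative of the
kernel. -/
theorem IsKernel.potIntSign_causalWave (hp : Integrable p) (hw : IsKernel p a b w)
    (hf : IsCausal f) (x t : ℝ) :
    1 / 2 * potIntSign p (causalWave a b w f) x t
      = 1 / 2 * (step a b x * ∫ y in (0 : ℝ)..x, p y) * f (t - |x|)
        + ∫ s in |x|..t, kernelDx p a b w x s * f (t - s) := by
  rcases lt_or_ge t |x| with h | h
  · have e : ∀ y, causalWave a b w f y (t - |x - y|) = 0 := fun y => by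
      have := abs_sub_abs_le_abs_sub x y
      rw [causalWave, retConv_of_le hf (by linarith), hf.zero _ (by linarith)]
      ring
    rw [integral_mul_causal_of_le hf _ h.le, hf.zero _ (by linarith)]
    simp [potIntSign, e]
  have e1 : potIntSign p (causalWave a b w f) x t
      = potIntSign p (fun y τ => step a b y * f (τ - |y|)) x t
        + potIntSign p (retConv w f) x t := by
    simp only [potIntSign]
    rw [← integral_add ((locBdd_front a b hf).integrable_sign_mul hp x t)
      ((locBdd_retConv hw.cont hf).integrable_sign_mul hp x t)]
    congr 1; ext y
    rw [causalWave]; ring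
  have e2 : potIntSign p (retConv w f) x t
      = ∫ s in |x|..t, (leftInt p w x (s - x) - rightInt p w x (x + s)) * f (t - s) := by
    have c1 : potIntSign p (retConv w f) x t = potInt (fun y => p y * side x y)
        (fun y τ => ∫ σ in |y|..τ, coneRestr w y σ * f (τ - σ)) x t := by
      simp only [potIntSign, potInt, mul_assoc]
      congr 1; ext y
      congr 2
      rcases le_total (t - |x - y|) |y| with h | h
      · rw [retConv_of_le hf h, integral_mul_causal_of_le hf _ h]
      · refine intervalIntegral.integral_congr fun s hs => ?_
        rw [uIcc_of_le h] at hs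
        simp only [coneRestr, if_pos hs.1]
    rw [c1, potInt_convolution (integrable_mul_side hp x) (locBdd_coneRestr hw.cont)
      (fun y τ h => if_neg (not_le.2 h)) hf h]
    refine intervalIntegral.integral_congr fun s hs => ?_
    rw [uIcc_of_le h] at hs
    have c2 : potInt (fun y => p y * side x y) (coneRestr w) x s
        = potIntSign p (coneRestr w) x s := by
      simp only [potInt, potIntSign, mul_assoc]
    rw [c2, potIntSign_coneRestr hp hw.cont hs.1]
  obtain ⟨i1, i2⟩ := integrable_comp_half hp x
  have cf : Continuous fun s => f (t - s) := hf.continuous.comp (by fun_prop)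
  have j1 := integrable_mul_of_continuous i1 cf |x| t
  have j2 := integrable_mul_of_continuous i2 cf |x| t
  have c3 : Continuous fun s => rightInt p w x (x + s) :=
    (continuous_rightInt hp hw.cont).comp (by fun_prop : Continuous fun s : ℝ => (x, x + s))
  have c4 : Continuous fun s => leftInt p w x (s - x) :=
    (continuous_leftInt hp hw.cont).comp (by fun_prop : Continuous fun s : ℝ => (x, s - x))
  have j3 : IntervalIntegrable
      (fun s => (leftInt p w x (s - x) - rightInt p w x (x + s)) * f (t - s)) volume |x| t :=
    ((c4.sub c3).mul cf).intervalIntegrable _ _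
  have e3 : ∫ s in |x|..t, kernelDx p a b w x s * f (t - s)
      = -(a / 4) * (∫ s in |x|..t, p ((x + s) / 2) * f (t - s))
        + b / 4 * (∫ s in |x|..t, p ((x - s) / 2) * f (t - s))
        + 1 / 2 * ∫ s in |x|..t, (leftInt p w x (s - x) - rightInt p w x (x + s)) * f (t - s) := by
    rw [← intervalIntegral.integral_const_mul, ← intervalIntegral.integral_const_mul,
      ← intervalIntegral.integral_const_mul, ← intervalIntegral.integral_add (j1.const_mul _)
        (j2.const_mul _), ← intervalIntegral.integral_add ((j1.const_mul _).add (j2.const_mul _))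
        (j3.const_mul _)]
    refine intervalIntegral.integral_congr fun s _ => ?_
    simp only [kernelDx, kernelDxi, kernelDeta]; ring
  rw [e1, potIntSign_front hp hf h, e2, e3]; ring

end Trace

/-! ### Lattice sums of kernels -/

lemma ae_notMem_lattice : ∀ᵐ s : ℝ, s ∉ lattice :=
  compl_mem_ae_iff.2 (countable_lattice.measure_zero _)

lemma sum_Ioo_int (h : ℝ → ℝ) {n : ℕ} (hn : 1 ≤ n) :
    ∑ k ∈ Finset.Ioo (-(n : ℤ)) n, h (2 * k * Real.pi)
      = h 0 + ∑ k ∈ Finset.Ioo 0 n, (h (2 * k * Real.pi) + h (-(2 * k * Real.pi))) := by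
  induction n, hn using Nat.le_induction with
  | base =>
    rw [show Finset.Ioo (-((1 : ℕ) : ℤ)) (1 : ℕ) = {0} from rfl,
      show Finset.Ioo 0 1 = (∅ : Finset ℕ) from rfl]
    simp
  | succ n hn ih =>
    have e1 : Finset.Ioo (-((n + 1 : ℕ) : ℤ)) (n + 1 : ℕ)
        = insert (n : ℤ) (insert (-(n : ℤ)) (Finset.Ioo (-(n : ℤ)) n)) := by
      ext k; simp only [Finset.mem_Ioo, Finset.mem_insert]; omega
    have e2 : Finset.Ioo 0 (n + 1) = insert n (Finset.Ioo 0 n) := by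
      ext k; simp only [Finset.mem_Ioo, Finset.mem_insert]; omega
    rw [e1, e2, Finset.sum_insert (by simp only [Finset.mem_insert, Finset.mem_Ioo]; omega),
      Finset.sum_insert (by simp), Finset.sum_insert (by simp), ih]
    push_cast
    rw [show 2 * -(n : ℝ) * Real.pi = -(2 * n * Real.pi) by ring]; ring

lemma integrableOn_latticeSum {n : ℕ} {v : ℝ → ℝ → ℝ}
    (hv : ∀ k ∈ Finset.Ioo (-(n : ℤ)) n, ∃ g : ℝ → ℝ, IntegrableOn g (Ioo 0 (2 * n * Real.pi)) ∧
      ∀ᵐ s, |2 * (k : ℝ) * Real.pi| < s → s < 2 * n * Real.pi → v (2 * k * Real.pi) s = g s) :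
    IntegrableOn (latticeSum n v) (Ioo 0 (2 * n * Real.pi)) := by
  refine integrable_finsetSum _ fun k hk => ?_
  obtain ⟨g, hg, h⟩ := hv k hk
  refine (hg.indicator (measurableSet_Ioi (a := |2 * (k : ℝ) * Real.pi|))).congr ?_
  filter_upwards [ae_restrict_mem measurableSet_Ioo, ae_restrict_of_ae h] with s hs h
  by_cases hks : |2 * (k : ℝ) * Real.pi| < s
  · rw [indicator_of_mem (show s ∈ Ioi _ from hks), if_pos hks, h hks hs.2]
  · rw [indicator_of_notMem (show s ∉ Ioi _ from hks), if_neg hks]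

/-- The convolution of a lattice sum with a causal signal. -/
lemma integral_latticeSum_mul {n : ℕ} {v : ℝ → ℝ → ℝ} {f : ℝ → ℝ} (hf : IsCausal f) {t : ℝ}
    (hv : ∀ k ∈ Finset.Ioo (-(n : ℤ)) n,
      IntervalIntegrable (v (2 * k * Real.pi)) volume |2 * (k : ℝ) * Real.pi| t) :
    IntervalIntegrable (fun s => latticeSum n v s * f (t - s)) volume 0 t ∧
    ∫ s in (0 : ℝ)..t, latticeSum n v s * f (t - s)
      = ∑ k ∈ Finset.Ioo (-(n : ℤ)) n,
        ∫ s in |2 * (k : ℝ) * Real.pi|..t, v (2 * k * Real.pi) s * f (t - s) := by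
  have cf : Continuous fun s => f (t - s) := hf.continuous.comp (by fun_prop)
  have key : ∀ k ∈ Finset.Ioo (-(n : ℤ)) n,
      IntervalIntegrable (fun s => (if |2 * (k : ℝ) * Real.pi| < s then v (2 * k * Real.pi) s else 0)
        * f (t - s)) volume 0 t ∧
      ∫ s in (0 : ℝ)..t, (if |2 * (k : ℝ) * Real.pi| < s then v (2 * k * Real.pi) s else 0)
        * f (t - s) = ∫ s in |2 * (k : ℝ) * Real.pi|..t, v (2 * k * Real.pi) s * f (t - s) := by
    intro k hk
    set X := 2 * (k : ℝ) * Real.pi with hX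
    have hX0 := abs_nonneg X
    rcases le_or_gt t |X| with h | h
    · have e : ∀ s ∈ uIoc 0 t, (0 : ℝ) = (if |X| < s then v X s else 0) * f (t - s) := by
        intro s hs
        have : s ≤ |X| := by
          rcases le_total 0 t with h0 | h0
          · rw [uIoc_of_le h0] at hs; exact hs.2.trans h
          · rw [uIoc_of_ge h0] at hs; exact hs.2.trans hX0
        rw [if_neg (not_lt.2 this), zero_mul]
      refine ⟨(intervalIntegrable_const (c := (0 : ℝ))).congr e, ?_⟩
      rw [integral_mul_causal_of_le hf _ h, ← intervalIntegral.integral_congr_ae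
        (ae_of_all _ e)]
      simp
    · have e1 : ∀ s ∈ uIoc 0 |X|, (0 : ℝ) = (if |X| < s then v X s else 0) * f (t - s) := by
        intro s hs
        rw [uIoc_of_le hX0] at hs
        rw [if_neg (not_lt.2 hs.2), zero_mul]
      have e2 : ∀ s ∈ uIoc |X| t, v X s * f (t - s)
          = (if |X| < s then v X s else 0) * f (t - s) := by
        intro s hs
        rw [uIoc_of_le h.le] at hs
        rw [if_pos hs.1]
      have i1 := (intervalIntegrable_const (μ := volume) (c := (0 : ℝ))).congr e1
      have i2 := ((hv k hk).mul_continuousOn cf.continuousOn).congr e2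
      refine ⟨i1.trans i2, ?_⟩
      rw [← intervalIntegral.integral_add_adjacent_intervals i1 i2,
        ← intervalIntegral.integral_congr_ae (ae_of_all _ e1),
        ← intervalIntegral.integral_congr_ae (ae_of_all _ e2)]
      simp
  simp only [latticeSum, Finset.sum_mul]
  refine ⟨(IntervalIntegrable.sum _ fun k hk => (key k hk).1).congr fun s _ =>
    Finset.sum_apply _ _ _, ?_⟩
  rw [intervalIntegral.integral_finsetSum fun k hk => (key k hk).1]
  exact Finset.sum_congr rfl fun k hk => (key k hk).2

section LineKernel

variable {q : ℝ → ℝ} {n : ℕ} {a b : ℝ} {w : ℝ → ℝ → ℝ}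

/-- On a lattice line the kernel is differentiable except where the characteristics through the
point start at breaks of the potential. -/
lemma IsKernel.hasDerivAt_lattice (hq : ContDiffOn ℝ 2 q (Ioo 0 (2 * Real.pi)))
    (hq2 : MemLp q 2 (volume.restrict (Ioo 0 (2 * Real.pi))))
    (hw : IsKernel (truncPot q (2 * n * Real.pi)) a b w) {k : ℤ} {s : ℝ}
    (h1 : |2 * (k : ℝ) * Real.pi| < s) (h2 : s < 2 * n * Real.pi)
    (h3 : ∀ m : ℤ, s ≠ 2 * k * Real.pi + 4 * m * Real.pi) :
    HasDerivAt (fun x => w x s) (kernelDx (truncPot q (2 * n * Real.pi)) a b w (2 * k * Real.pi) s)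
      (2 * k * Real.pi) := by
  obtain ⟨h4, h5⟩ := abs_lt.1 h1
  refine hw.hasDerivAt_kernelDx (integrable_truncPot hq2 _) h1
    (contDiffAt_truncPot hq (abs_lt.2 ⟨by linarith, by linarith⟩)
      (notMem_lattice_iff.2 fun m hm => h3 (m - k) ?_)).continuousAt
    (contDiffAt_truncPot hq (abs_lt.2 ⟨by linarith, by linarith⟩)
      (notMem_lattice_iff.2 fun m hm => h3 (-m) ?_)).continuousAt
  · push_cast; linarith
  · push_cast; linarith

lemma IsKernel.ae_deriv_lattice (hq : ContDiffOn ℝ 2 q (Ioo 0 (2 * Real.pi)))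
    (hq2 : MemLp q 2 (volume.restrict (Ioo 0 (2 * Real.pi))))
    (hw : IsKernel (truncPot q (2 * n * Real.pi)) a b w) (k : ℤ) :
    ∀ᵐ s, |2 * (k : ℝ) * Real.pi| < s → s < 2 * n * Real.pi →
      deriv (fun x => w x s) (2 * k * Real.pi)
        = kernelDx (truncPot q (2 * n * Real.pi)) a b w (2 * k * Real.pi) s := by
  filter_upwards [ae_notMem_lattice] with s hs h1 h2
  refine (hw.hasDerivAt_lattice hq hq2 h1 h2 fun m e => notMem_lattice_iff.1 hs (k + 2 * m) ?_).deriv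
  rw [e]; push_cast; ring

lemma IsKernel.integrableOn_lineResponseMatrix (hq : ContDiffOn ℝ 2 q (Ioo 0 (2 * Real.pi)))
    (hq2 : MemLp q 2 (volume.restrict (Ioo 0 (2 * Real.pi)))) {a' b' : ℝ} {w' : ℝ → ℝ → ℝ}
    (hw : IsKernel (truncPot q (2 * n * Real.pi)) a b w)
    (hw' : IsKernel (truncPot q (2 * n * Real.pi)) a' b' w') (i j : Fin 2) :
    IntegrableOn (fun t => lineResponseMatrix n w w' t i j) (Ioo 0 (2 * n * Real.pi)) := by
  have hpi := Real.pi_pos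
  have hL : 0 ≤ 2 * (n : ℝ) * Real.pi := by positivity
  have d : ∀ {a b : ℝ} {w : ℝ → ℝ → ℝ}, IsKernel (truncPot q (2 * n * Real.pi)) a b w →
      IntegrableOn (latticeSum n fun x s => deriv (fun y => w y s) x) (Ioo 0 (2 * n * Real.pi)) :=
    fun {a b w} h => integrableOn_latticeSum fun k _ =>
      ⟨_, (intervalIntegrable_iff_integrableOn_Ioo_of_le hL).1
        (intervalIntegrable_kernelDx (a := a) (b := b) (integrable_truncPot hq2 _) h.cont _ _ _),
        h.ae_deriv_lattice hq hq2 k⟩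
  have v : ∀ {a b : ℝ} {w : ℝ → ℝ → ℝ}, IsKernel (truncPot q (2 * n * Real.pi)) a b w →
      IntegrableOn (fun s => -latticeSum n w s) (Ioo 0 (2 * n * Real.pi)) :=
    fun {a b w} h => (integrableOn_latticeSum fun k _ =>
      ⟨_, (intervalIntegrable_iff_integrableOn_Ioo_of_le hL).1
        ((h.cont.comp (Continuous.prodMk_right (2 * (k : ℝ) * Real.pi))).intervalIntegrable _ _),
        ae_of_all _ fun s _ _ => rfl⟩).neg
  fin_cases i <;> fin_cases j
  exacts [d hw, d hw', v hw, v hw']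

lemma IsKernel.retConv_lattice (hw : IsKernel (truncPot q (2 * n * Real.pi)) a b w) {f : ℝ → ℝ}
    (hf : IsCausal f) (hn : 1 ≤ n) (t : ℝ) :
    IntervalIntegrable (fun s => latticeSum n w s * f (t - s)) volume 0 t ∧
    ∫ s in (0 : ℝ)..t, latticeSum n w s * f (t - s)
      = retConv w f 0 t + ∑ k ∈ Finset.Ioo 0 n,
        (retConv w f (2 * k * Real.pi) t + retConv w f (-(2 * k * Real.pi)) t) := by
  obtain ⟨h1, h2⟩ := integral_latticeSum_mul (n := n) (v := w) hf (t := t) fun k _ =>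
    (hw.cont.comp (Continuous.prodMk_right (2 * (k : ℝ) * Real.pi))).intervalIntegrable _ _
  exact ⟨h1, h2.trans (sum_Ioo_int (fun x => retConv w f x t) hn)⟩

/-- The trace of the `x`-derivative of the causal wave, summed over the lattice: delayed copies of
the signal, whose weights count the periods between source and lattice point, and a convolution. -/
lemma IsKernel.potIntSign_lattice (hq : ContDiffOn ℝ 2 q (Ioo 0 (2 * Real.pi)))
    (hq2 : MemLp q 2 (volume.restrict (Ioo 0 (2 * Real.pi))))
    (hw : IsKernel (truncPot q (2 * n * Real.pi)) a b w) {f : ℝ → ℝ} (hf : IsCausal f)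
    (hn : 1 ≤ n) {t : ℝ} (ht : t < 2 * n * Real.pi) :
    IntervalIntegrable (fun s => latticeSum n (fun x s => deriv (fun y => w y s) x) s * f (t - s))
      volume 0 t ∧
    1 / 2 * (potIntSign (truncPot q (2 * n * Real.pi)) (causalWave a b w f) 0 t
        + ∑ k ∈ Finset.Ioo 0 n,
          (potIntSign (truncPot q (2 * n * Real.pi)) (causalWave a b w f) (2 * k * Real.pi) t
          + potIntSign (truncPot q (2 * n * Real.pi)) (causalWave a b w f) (-(2 * k * Real.pi)) t))
      = (∑ k ∈ Finset.Ioo 0 n, (a - b) * (k / 2 * ∫ x in (0 : ℝ)..2 * Real.pi, q x)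
          * f (t - 2 * k * Real.pi))
        + ∫ s in (0 : ℝ)..t, latticeSum n (fun x s => deriv (fun y => w y s) x) s * f (t - s) := by
  have hpi := Real.pi_pos
  set p := truncPot q (2 * n * Real.pi) with hp'
  have hp : Integrable p := integrable_truncPot hq2 _
  -- the derivative may be replaced by the integrable expression `kernelDx` almost everywhere
  have hae : ∀ k : ℤ, ∀ᵐ s, s ∈ uIoc |2 * (k : ℝ) * Real.pi| t → |2 * (k : ℝ) * Real.pi| < t →
      kernelDx p a b w (2 * k * Real.pi) s = deriv (fun x => w x s) (2 * k * Real.pi) := by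
    intro k
    filter_upwards [hw.ae_deriv_lattice hq hq2 k] with s hs hs' hk
    rw [uIoc_of_le hk.le] at hs'
    exact (hs hs'.1 (hs'.2.trans_lt ht)).symm
  set v : ℝ → ℝ → ℝ := fun x s => if |x| < t then deriv (fun y => w y s) x else 0 with hv
  have hvi : ∀ k ∈ Finset.Ioo (-(n : ℤ)) n,
      IntervalIntegrable (v (2 * k * Real.pi)) volume |2 * (k : ℝ) * Real.pi| t := by
    intro k _
    by_cases hk : |2 * (k : ℝ) * Real.pi| < t
    · refine (intervalIntegrable_kernelDx hp hw.cont (2 * k * Real.pi) _ _).congr_ae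
        (a := |2 * (k : ℝ) * Real.pi|) (b := t) (f := kernelDx p a b w (2 * k * Real.pi)) ?_
      rw [Filter.EventuallyEq, ae_restrict_iff' measurableSet_uIoc]
      filter_upwards [hae k] with s hs hs'
      simp only [hv, if_pos hk]
      exact hs hs' hk
    · simp only [hv, if_neg hk]
      exact intervalIntegrable_const
  obtain ⟨h1, h2⟩ := integral_latticeSum_mul (n := n) (v := v) hf (t := t) hvi
  have e1 : ∀ s ∈ uIoc 0 t, latticeSum n v s * f (t - s)
      = latticeSum n (fun x s => deriv (fun y => w y s) x) s * f (t - s) := by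
    intro s hs
    rcases le_total 0 t with h0 | h0
    · rw [uIoc_of_le h0] at hs
      congr 1
      refine Finset.sum_congr rfl fun k _ => ?_
      split_ifs with hk
      · simp only [hv, if_pos (hk.trans_le hs.2)]
      · rfl
    · rw [uIoc_of_ge h0] at hs
      have e : ∀ v : ℝ → ℝ → ℝ, latticeSum n v s = 0 := fun v =>
        Finset.sum_eq_zero fun k _ => if_neg (not_lt.2 (hs.2.trans (abs_nonneg _)))
      rw [e, e]
  refine ⟨h1.congr e1, ?_⟩
  have e2 : ∀ k ∈ Finset.Ioo (-(n : ℤ)) n,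
      ∫ s in |2 * (k : ℝ) * Real.pi|..t, v (2 * k * Real.pi) s * f (t - s)
        = ∫ s in |2 * (k : ℝ) * Real.pi|..t, kernelDx p a b w (2 * k * Real.pi) s * f (t - s) := by
    intro k _
    rcases le_or_gt t |2 * (k : ℝ) * Real.pi| with hk | hk
    · rw [integral_mul_causal_of_le hf _ hk, integral_mul_causal_of_le hf _ hk]
    · refine intervalIntegral.integral_congr_ae ?_
      filter_upwards [hae k] with s hs hs'
      simp only [hv, if_pos hk]
      rw [hs hs' hk]
  rw [← intervalIntegral.integral_congr_ae (ae_of_all _ e1), h2, Finset.sum_congr rfl e2,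
    sum_Ioo_int (fun x => ∫ s in |x|..t, kernelDx p a b w x s * f (t - s)) hn, mul_add,
    Finset.mul_sum, hw.potIntSign_causalWave hp hf 0 t, intervalIntegral.integral_same]
  have e3 : ∀ k ∈ Finset.Ioo 0 n,
      1 / 2 * (potIntSign p (causalWave a b w f) (2 * k * Real.pi) t
        + potIntSign p (causalWave a b w f) (-(2 * k * Real.pi)) t)
      = (a - b) * (k / 2 * ∫ x in (0 : ℝ)..2 * Real.pi, q x) * f (t - 2 * k * Real.pi)
        + ((∫ s in |2 * k * Real.pi|..t, kernelDx p a b w (2 * k * Real.pi) s * f (t - s))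
        + ∫ s in |-(2 * k * Real.pi)|..t, kernelDx p a b w (-(2 * k * Real.pi)) s * f (t - s)) := by
    intro k hk
    rw [Finset.mem_Ioo] at hk
    have k0 : (0 : ℝ) < k := by exact_mod_cast hk.1
    have kn : (k : ℝ) ≤ n := by exact_mod_cast hk.2.le
    have kpi : 0 < 2 * (k : ℝ) * Real.pi := by positivity
    have knpi : 2 * (k : ℝ) * Real.pi ≤ 2 * n * Real.pi := by gcongr
    have i1 := integral_truncPot (q := q) hq2 (L := 2 * n * Real.pi) k
      (by push_cast; rwa [abs_of_pos kpi])
    have i2 := integral_truncPot (q := q) hq2 (L := 2 * n * Real.pi) (-k)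
      (by push_cast; rwa [show 2 * -(k : ℝ) * Real.pi = -(2 * k * Real.pi) by ring, abs_neg,
        abs_of_pos kpi])
    push_cast at i1 i2
    rw [show 2 * -(k : ℝ) * Real.pi = -(2 * k * Real.pi) by ring] at i2
    rw [mul_add, hw.potIntSign_causalWave hp hf, hw.potIntSign_causalWave hp hf, hp', i1, i2, step,
      step, if_pos kpi, if_neg (by linarith), abs_neg, abs_of_pos kpi]
    ring
  rw [Finset.sum_congr rfl e3, Finset.sum_add_distrib]
  ring

end LineKernel

/-! ### The response operator -/

section Response

variable {q : ℝ → ℝ} {n : ℕ} {T : ℝ} {F : ℝ → Fin 2 → ℝ}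

lemma IsWaveSolution.mono {u : ℝ → ℝ → ℝ} (h : IsWaveSolution q T F u) {T' : ℝ} (hT : T' ≤ T) :
    IsWaveSolution q T' F u where
  smooth_closed := h.smooth_closed.mono (prod_mono_right (Ico_subset_Ico_right hT))
  smooth_open := h.smooth_open.mono (prod_mono_right (Ioo_subset_Ioo_right hT))
  sobolev t ht := h.sobolev t (Ioo_subset_Ioo_right hT ht)
  wave x hx t ht := h.wave x hx t (Ioo_subset_Ioo_right hT ht)
  boundary t ht := h.boundary t (Ioo_subset_Ioo_right hT ht)
  initial := h.initial
  initial_deriv := h.initial_deriv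

/-- The boundary values of a solution are determined by the data, on any shorter time interval. -/
lemma IsWaveSolution.boundary1_eq_of_le
    (hq2 : MemLp q 2 (volume.restrict (Ioo 0 (2 * Real.pi)))) {u v : ℝ → ℝ → ℝ}
    (hu : IsWaveSolution q T F u) {T' : ℝ} (hT : T' ≤ T) (hv : IsWaveSolution q T' F v) {t : ℝ}
    (ht : t ∈ Ioo 0 T') : boundary1 (fun x => u x t) = boundary1 (fun x => v x t) := by
  have hpi := Real.two_pi_pos
  have ht' : t ∈ Ico 0 T' := ⟨ht.1.le, ht.2⟩
  have hu' := hu.mono hT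
  have he : EqOn (Function.uncurry u) (Function.uncurry v) (rect T') := fun z hz =>
    hu'.unique hq2 (ht.1.trans ht.2) hv hz.1 hz.2
  have m0 : ((0 : ℝ), t) ∈ rect T' := ⟨⟨le_rfl, hpi.le⟩, ht'⟩
  have m1 : (2 * Real.pi, t) ∈ rect T' := ⟨⟨hpi.le, le_rfl⟩, ht'⟩
  rw [boundary1_eq hu'.smooth_closed ht', boundary1_eq hv.smooth_closed ht',
    fderivWithin_congr he (he m0), fderivWithin_congr he (he m1),
    show u 0 t = v 0 t from he m0, show u (2 * Real.pi) t = v (2 * Real.pi) t from he m1]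

lemma response_eq_boundary1 (hq2 : MemLp q 2 (volume.restrict (Ioo 0 (2 * Real.pi))))
    {v : ℝ → ℝ → ℝ} (hex : ∃ u, IsWaveSolution q T F u) {T' : ℝ} (hT : T' ≤ T)
    (hv : IsWaveSolution q T' F v) {t : ℝ} (ht : t ∈ Ioo 0 T') :
    response q T F t = boundary1 (fun x => v x t) := by
  have h : IsWaveSolution q T F (waveSolution q T F) := by
    rw [waveSolution, dif_pos hex]; exact hex.choose_spec
  exact h.boundary1_eq_of_le hq2 hT hv ht

lemma singularPart_zero (q : ℝ → ℝ) (n : ℕ) (F : ℝ → Fin 2 → ℝ) (t : ℝ) :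
    singularPart q n F t 0 = -(1 / 2) * deriv (fun s => F s 0) t
      - (∑ k ∈ Finset.Ioo 0 n, deriv (fun s => F s 0) (t - 2 * k * Real.pi))
      + ∑ k ∈ Finset.Ioo 0 n, (k / 2 * ∫ x in (0 : ℝ)..2 * Real.pi, q x)
        * F (t - 2 * k * Real.pi) 0 := by
  simp only [singularPart, Pi.add_apply, Pi.sub_apply, Pi.smul_apply, Finset.sum_apply, deltaConv,
    deltaDerivConv, Matrix.cons_val_zero, sub_zero, smul_eq_mul]

lemma singularPart_one (q : ℝ → ℝ) (n : ℕ) (F : ℝ → Fin 2 → ℝ) (t : ℝ) :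
    singularPart q n F t 1
      = 1 / 2 * F t 1 + ∑ k ∈ Finset.Ioo 0 n, F (t - 2 * k * Real.pi) 1 := by
  simp only [singularPart, Pi.add_apply, Pi.sub_apply, Pi.smul_apply, Finset.sum_apply, deltaConv,
    deltaDerivConv, Matrix.cons_val_one, Matrix.cons_val_fin_one, sub_zero, smul_eq_mul,
    Finset.sum_neg_distrib, Finset.sum_const_zero]
  ring

/-- The response operator in terms of the kernels for the periodic potential on the line. -/
theorem response_eq_of_isKernel (hq : ContDiffOn ℝ 2 q (Ioo 0 (2 * Real.pi)))
    (hq2 : MemLp q 2 (volume.restrict (Ioo 0 (2 * Real.pi)))) {w1 w2 : ℝ → ℝ → ℝ} (hn : 1 ≤ n)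
    (h1 : IsKernel (truncPot q (2 * n * Real.pi)) (1 / 2) (-(1 / 2)) w1)
    (h2 : IsKernel (truncPot q (2 * n * Real.pi)) (-(1 / 2)) (-(1 / 2)) w2)
    (hF : IsControl T F) {t : ℝ} (ht : t ∈ Ioo 0 T) (htn : t < 2 * n * Real.pi) :
    response q T F t = singularPart q n F t + matConv (lineResponseMatrix n w1 w2) F t := by
  have hpi := Real.two_pi_pos
  have hp := integrable_truncPot hq2 (2 * n * Real.pi)
  have htm : t ∈ Ioo 0 (min T (2 * n * Real.pi)) := ⟨ht.1, lt_min ht.2 htn⟩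
  have htm' : t ∈ Ico 0 (min T (2 * n * Real.pi)) := ⟨ht.1.le, htm.2⟩
  have hF0 := hF.isCausal 0
  have hF1 := hF.isCausal 1
  have hv := isWaveSolution_foldedWave hq hq2 h1 h2 hF.isCausal (min_le_right T (2 * n * Real.pi))
  have hW := ((h1.isClassicalWave_foldedWave hq hq2 hF0).add
    (h2.isClassicalWave_foldedWave hq hq2 hF1)).smooth
  have hd : ∀ x, deriv (fun y => foldedWave (1 / 2) (-(1 / 2)) n w1 (fun s => F s 0) y t
      + foldedWave (-(1 / 2)) (-(1 / 2)) n w2 (fun s => F s 1) y t) x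
      = foldedWaveDx (truncPot q (2 * n * Real.pi)) (1 / 2) (-(1 / 2)) n w1 (fun s => F s 0) x t
      + foldedWaveDx (truncPot q (2 * n * Real.pi)) (-(1 / 2)) (-(1 / 2)) n w2
        (fun s => F s 1) x t := fun x =>
    ((h1.hasDerivAt_foldedWave hp hF0 x t).add (h2.hasDerivAt_foldedWave hp hF1 x t)).deriv
  rw [response_eq_boundary1 hq2 (exists_isWaveSolution hq hq2 hF) (min_le_left _ _) hv htm,
    boundary1_eq hW.contDiffOn htm',
    fderivWithin_rect_eq_deriv hW ⟨le_rfl, hpi.le⟩ htm',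
    fderivWithin_rect_eq_deriv hW ⟨hpi.le, le_rfl⟩ htm', hd, hd]
  have a1 := foldedWave_add (a := 1 / 2) (b := -(1 / 2)) (w := w1) hF0 hn htn
  have a2 := foldedWave_add (a := -(1 / 2)) (b := -(1 / 2)) (w := w2) hF1 hn htn
  have b1 := foldedWaveDx_add (a := 1 / 2) (b := -(1 / 2)) (w := w1)
    (p := truncPot q (2 * n * Real.pi)) hF0 hn htn
  have b2 := foldedWaveDx_add (a := -(1 / 2)) (b := -(1 / 2)) (w := w2)
    (p := truncPot q (2 * n * Real.pi)) hF1 hn htn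
  obtain ⟨i1, c1⟩ := h1.retConv_lattice hF0 hn t
  obtain ⟨i2, c2⟩ := h2.retConv_lattice hF1 hn t
  obtain ⟨j1, d1⟩ := h1.potIntSign_lattice hq hq2 hF0 hn htn
  obtain ⟨j2, d2⟩ := h2.potIntSign_lattice hq hq2 hF1 hn htn
  simp only [Finset.sum_add_distrib, ← Finset.mul_sum] at a1 a2 b1 b2 c1 c2 d1 d2
  funext i
  fin_cases i
  · have e : matConv (lineResponseMatrix n w1 w2) F t 0
        = (∫ s in (0 : ℝ)..t, latticeSum n (fun x s => deriv (fun y => w1 y s) x) s * F (t - s) 0)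
        + ∫ s in (0 : ℝ)..t, latticeSum n (fun x s => deriv (fun y => w2 y s) x) s
          * F (t - s) 1 := by
      rw [← intervalIntegral.integral_add j1 j2]
      simp [matConv, lineResponseMatrix, Matrix.mulVec, dotProduct, Fin.sum_univ_two]
    rw [show (1 / 2 - -(1 / 2) : ℝ) = 1 by norm_num] at d1
    rw [show (-(1 / 2) - -(1 / 2) : ℝ) = 0 by norm_num] at d2
    simp only [one_mul, zero_mul, Finset.sum_const_zero, zero_add] at d1 d2
    change 1 / 2 * (_ + _) = singularPart q n F t 0 + matConv (lineResponseMatrix n w1 w2) F t 0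
    rw [e, singularPart_zero, ← d2]
    linarith
  · have e : matConv (lineResponseMatrix n w1 w2) F t 1
        = -(∫ s in (0 : ℝ)..t, latticeSum n w1 s * F (t - s) 0)
        - ∫ s in (0 : ℝ)..t, latticeSum n w2 s * F (t - s) 1 := by
      rw [sub_eq_add_neg, ← intervalIntegral.integral_neg, ← intervalIntegral.integral_neg,
        ← intervalIntegral.integral_add (f := fun s => -(latticeSum n w1 s * F (t - s) 0))
          (g := fun s => -(latticeSum n w2 s * F (t - s) 1)) i1.neg i2.neg]
      simp [matConv, lineResponseMatrix, Matrix.mulVec, dotProduct, Fin.sum_univ_two]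
    change 1 / 2 * (-_ - _) = singularPart q n F t 1 + matConv (lineResponseMatrix n w1 w2) F t 1
    rw [e, singularPart_one, c1, c2]
    linarith

end Response

/-! ### Arbitrary solutions of the Goursat problems -/

section Transfer

variable {q : ℝ → ℝ} {n : ℕ}

lemma exists_isKernel_truncPot (hq2 : MemLp q 2 (volume.restrict (Ioo 0 (2 * Real.pi)))) (n : ℕ)
    (c : ℝ) : ∃ w, IsKernel (truncPot q (2 * n * Real.pi)) (-2 * c) (-(1 / 2)) w :=
  exists_isKernel (integrable_truncPot hq2 _) _ _

lemma IsLineGoursatKernel.eventuallyEq (hq2 : MemLp q 2 (volume.restrict (Ioo 0 (2 * Real.pi))))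
    {L c : ℝ} {w w' : ℝ → ℝ → ℝ} (h : IsLineGoursatKernel q L c w)
    (h' : IsLineGoursatKernel q L c w') {x t : ℝ} (hx : |x| < t) (ht : t < L) :
    (fun y => w y t) =ᶠ[𝓝 x] fun y => w' y t := by
  filter_upwards [(isOpen_lt continuous_abs continuous_const).mem_nhds hx] with y hy
  exact h.unique hq2 h' (le_of_lt hy) ht

lemma lineResponseMatrix_congr (hq2 : MemLp q 2 (volume.restrict (Ioo 0 (2 * Real.pi))))
    {c c' : ℝ} {v v' w w' : ℝ → ℝ → ℝ} (h1 : IsLineGoursatKernel q (2 * n * Real.pi) c v)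
    (h1' : IsLineGoursatKernel q (2 * n * Real.pi) c v')
    (h2 : IsLineGoursatKernel q (2 * n * Real.pi) c' w)
    (h2' : IsLineGoursatKernel q (2 * n * Real.pi) c' w') {t : ℝ} (ht : t < 2 * n * Real.pi) :
    lineResponseMatrix n v w t = lineResponseMatrix n v' w' t := by
  have e : ∀ {c : ℝ} {w w' : ℝ → ℝ → ℝ}, IsLineGoursatKernel q (2 * n * Real.pi) c w →
      IsLineGoursatKernel q (2 * n * Real.pi) c w' → latticeSum n w t = latticeSum n w' t ∧
      latticeSum n (fun x s => deriv (fun y => w y s) x) t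
        = latticeSum n (fun x s => deriv (fun y => w' y s) x) t := by
    intro c w w' h h'
    constructor
    · refine Finset.sum_congr rfl fun k _ => ?_
      split_ifs with hk
      · exact h.unique hq2 h' hk.le ht
      · rfl
    · refine Finset.sum_congr rfl fun k _ => ?_
      split_ifs with hk
      · exact (h.eventuallyEq hq2 h' hk ht).deriv_eq
      · rfl
  rw [lineResponseMatrix, lineResponseMatrix, (e h1 h1').1, (e h1 h1').2, (e h2 h2').1,
    (e h2 h2').2]

lemma matConv_congr {K K' : ℝ → Matrix (Fin 2) (Fin 2) ℝ} (F : ℝ → Fin 2 → ℝ) {t : ℝ} (ht : 0 ≤ t)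
    (h : ∀ s ∈ Ioc 0 t, K s = K' s) : matConv K F t = matConv K' F t := by
  funext i
  refine intervalIntegral.integral_congr_ae (ae_of_all _ fun s hs => ?_)
  rw [uIoc_of_le ht] at hs
  rw [h s hs]

lemma lineResponseMatrix_one (w w' : ℝ → ℝ → ℝ) {t : ℝ} (ht : 0 < t) :
    lineResponseMatrix 1 w w' t
      = !![deriv (fun x => w x t) 0, deriv (fun x => w' x t) 0; -w 0 t, -w' 0 t] := by
  have e : ∀ v : ℝ → ℝ → ℝ, latticeSum 1 v t = v 0 t := fun v => by
    rw [latticeSum, show Finset.Ioo (-((1 : ℕ) : ℤ)) (1 : ℕ) = {0} from rfl]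
    simp [ht]
  simp only [lineResponseMatrix, e]

/-- For times below `2π` the response matrix of an arbitrary pair of solutions of the Goursat
problems on the interval is that of the kernels on the line. -/
lemma responseMatrixLeft_eq (hq : ContDiffOn ℝ 2 q (Ioo 0 (2 * Real.pi)))
    (hq2 : MemLp q 2 (volume.restrict (Ioo 0 (2 * Real.pi)))) {c c' : ℝ}
    {w w2 w' w2' v v' : ℝ → ℝ → ℝ} (h : IsGoursatPair q c w w2) (h' : IsGoursatPair q c' w' w2')
    (hv : IsKernel (truncPot q (2 * Real.pi)) (-2 * c) (-(1 / 2)) v)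
    (hv' : IsKernel (truncPot q (2 * Real.pi)) (-2 * c') (-(1 / 2)) v') {t : ℝ}
    (ht : t ∈ Ioo 0 (2 * Real.pi)) :
    responseMatrixLeft w w' t = lineResponseMatrix 1 v v' t := by
  have d : ∀ {c : ℝ} {v : ℝ → ℝ → ℝ},
      IsKernel (truncPot q (2 * Real.pi)) (-2 * c) (-(1 / 2)) v →
      derivWithin (fun x => v x t) (Ici 0) 0 = deriv (fun x => v x t) 0 := by
    intro c v hv
    have e : 2 * ((1 : ℕ) : ℝ) * Real.pi = 2 * Real.pi := by push_cast; ring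
    rw [← e] at hv
    have := hv.hasDerivAt_lattice hq hq2 (k := 0) (s := t) (by simpa using ht.1)
      (by rw [e]; exact ht.2) fun m hm => ?_
    · simp only [Int.cast_zero, mul_zero, zero_mul] at this
      exact this.differentiableAt.derivWithin (uniqueDiffOn_Ici _ _ self_mem_Ici)
    · refine notMem_lattice_iff.1 (notMem_lattice_of_mem_Ioo (x := t) 0 (by simpa using ht.1)
        (by simpa using ht.2)) (2 * m) ?_
      rw [hm]; push_cast; ring
  have g := hv.isGoursatPair hq hq2
  have g' := hv'.isGoursatPair hq hq2
  rw [responseMatrixLeft, lineResponseMatrix_one _ _ ht.1,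
    h.derivWithin_unique hq2 g ht.1 ht.2, h'.derivWithin_unique hq2 g' ht.1 ht.2,
    h.unique hq2 g le_rfl ht.1.le ht.2, h'.unique hq2 g' le_rfl ht.1.le ht.2, d hv, d hv']

lemma responseMatrixLeft_eq_right {c c' : ℝ} {w w2 w' w2' : ℝ → ℝ → ℝ}
    (h : IsGoursatPair q c w w2) (h' : IsGoursatPair q c' w' w2') {t : ℝ}
    (ht : t ∈ Ioo 0 (2 * Real.pi)) : responseMatrixLeft w w' t = responseMatrixRight w2 w2' t := by
  rw [responseMatrixLeft, responseMatrixRight, h.compat t ht, h'.compat t ht, h.compat_deriv t ht,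
    h'.compat_deriv t ht]

lemma singularPart_of_one (q : ℝ → ℝ) (F : ℝ → Fin 2 → ℝ) (t : ℝ) :
    singularPart q 1 F t = -(1 / 2 : ℝ) • ![deriv (fun s => F s 0) t, -F t 1] := by
  simp [singularPart, deltaConv, deltaDerivConv, show Finset.Ioo 0 1 = (∅ : Finset ℕ) from rfl]

end Transfer

end PeriodicWave

end

theorem corollary1 (q : ℝ → ℝ) (hq : ContDiffOn ℝ 2 q (Set.Ioo 0 (2 * Real.pi)))
    (hq2 : MemLp q 2 (volume.restrict (Set.Ioo 0 (2 * Real.pi)))) :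
    -- the initial boundary value problem has exactly one solution
    (∀ T : ℝ, 0 < T → ∀ F : ℝ → Fin 2 → ℝ, PeriodicWave.IsControl T F →
      (∃ u, PeriodicWave.IsWaveSolution q T F u) ∧
      ∀ u u' : ℝ → ℝ → ℝ, PeriodicWave.IsWaveSolution q T F u →
        PeriodicWave.IsWaveSolution q T F u' →
        Set.EqOn (Function.uncurry u) (Function.uncurry u')
          (Set.Icc 0 (2 * Real.pi) ×ˢ Set.Ico 0 T)) ∧
    -- the response operator on `(0, 2π)`
    ((∃ w0 w2pi, PeriodicWave.IsGoursatPair q (-(1 / 4)) w0 w2pi) ∧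
      (∃ w0 w2pi, PeriodicWave.IsGoursatPair q (1 / 4) w0 w2pi) ∧
      ∀ w10 w12pi w20 w22pi : ℝ → ℝ → ℝ,
        PeriodicWave.IsGoursatPair q (-(1 / 4)) w10 w12pi →
        PeriodicWave.IsGoursatPair q (1 / 4) w20 w22pi →
        (∀ t ∈ Set.Ioo 0 (2 * Real.pi),
          PeriodicWave.responseMatrixLeft w10 w20 t
            = PeriodicWave.responseMatrixRight w12pi w22pi t) ∧
        (∀ i j, IntegrableOn (fun t => PeriodicWave.responseMatrixLeft w10 w20 t i j)
          (Set.Ioo 0 (2 * Real.pi))) ∧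
        ∀ T : ℝ, 0 < T → ∀ F : ℝ → Fin 2 → ℝ, PeriodicWave.IsControl T F →
          ∀ t ∈ Set.Ioo 0 T, t < 2 * Real.pi →
            PeriodicWave.response q T F t
              = -(1 / 2 : ℝ) • ![deriv (fun s => F s 0) t, -F t 1]
                + PeriodicWave.matConv (PeriodicWave.responseMatrixLeft w10 w20) F t) ∧
    -- the response operator on `(0, 2nπ)`
    (∀ n : ℕ, 1 ≤ n →
      (∃ w, PeriodicWave.IsLineGoursatKernel q (2 * n * Real.pi) (-(1 / 4)) w) ∧
      (∃ w, PeriodicWave.IsLineGoursatKernel q (2 * n * Real.pi) (1 / 4) w) ∧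
      ∀ w1 w2 : ℝ → ℝ → ℝ,
        PeriodicWave.IsLineGoursatKernel q (2 * n * Real.pi) (-(1 / 4)) w1 →
        PeriodicWave.IsLineGoursatKernel q (2 * n * Real.pi) (1 / 4) w2 →
        (∀ k : ℤ, ∀ s : ℝ, |2 * (k : ℝ) * Real.pi| < s → s < 2 * n * Real.pi →
          (∀ m : ℤ, s ≠ 2 * k * Real.pi + 4 * m * Real.pi) →
          DifferentiableAt ℝ (fun x => w1 x s) (2 * k * Real.pi) ∧
          DifferentiableAt ℝ (fun x => w2 x s) (2 * k * Real.pi)) ∧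
        (∀ i j, IntegrableOn (fun t => PeriodicWave.lineResponseMatrix n w1 w2 t i j)
          (Set.Ioo 0 (2 * n * Real.pi))) ∧
        ∀ T : ℝ, 0 < T → ∀ F : ℝ → Fin 2 → ℝ, PeriodicWave.IsControl T F →
          ∀ t ∈ Set.Ioo 0 T, t < 2 * n * Real.pi →
            PeriodicWave.response q T F t
              = PeriodicWave.singularPart q n F t
                + PeriodicWave.matConv (PeriodicWave.lineResponseMatrix n w1 w2) F t) := by
  have ea : -2 * (-(1 / 4)) = (1 / 2 : ℝ) := by norm_num
  have eb : -2 * (1 / 4) = (-(1 / 2) : ℝ) := by norm_num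
  have e1 : 2 * ((1 : ℕ) : ℝ) * Real.pi = 2 * Real.pi := by push_cast; ring
  refine ⟨fun T hT F hF => ⟨PeriodicWave.exists_isWaveSolution hq hq2 hF, fun u u' hu hu' z hz =>
    hu.unique hq2 hT hu' hz.1 hz.2⟩, ?_, fun n hn => ?_⟩
  · obtain ⟨v1, hv1⟩ := PeriodicWave.exists_isKernel_truncPot hq2 1 (-(1 / 4))
    obtain ⟨v2, hv2⟩ := PeriodicWave.exists_isKernel_truncPot hq2 1 (1 / 4)
    have k1 := hv1
    have k2 := hv2
    rw [ea] at k1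
    rw [eb] at k2
    have g1 := hv1
    have g2 := hv2
    rw [e1] at g1 g2
    refine ⟨⟨_, _, g1.isGoursatPair hq hq2⟩, ⟨_, _, g2.isGoursatPair hq hq2⟩,
      fun w10 w12 w20 w22 h1 h2 => ?_⟩
    have hR : ∀ t ∈ Set.Ioo 0 (2 * Real.pi),
        PeriodicWave.responseMatrixLeft w10 w20 t = PeriodicWave.lineResponseMatrix 1 v1 v2 t := fun t ht =>
      PeriodicWave.responseMatrixLeft_eq hq hq2 h1 h2 g1 g2 ht
    refine ⟨fun t ht => PeriodicWave.responseMatrixLeft_eq_right h1 h2 ht, fun i j => ?_,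
      fun T _ F hF t ht ht' => ?_⟩
    · have := k1.integrableOn_lineResponseMatrix hq hq2 k2 i j
      rw [e1] at this
      exact this.congr_fun (fun t ht => by simp only [hR t ht]) measurableSet_Ioo
    · rw [PeriodicWave.response_eq_of_isKernel hq hq2 le_rfl k1 k2 hF ht (by rwa [e1]), PeriodicWave.singularPart_of_one,
        PeriodicWave.matConv_congr F ht.1.le fun s hs => hR s ⟨hs.1, hs.2.trans_lt ht'⟩]
  · obtain ⟨v1, hv1⟩ := PeriodicWave.exists_isKernel_truncPot hq2 n (-(1 / 4))
    obtain ⟨v2, hv2⟩ := PeriodicWave.exists_isKernel_truncPot hq2 n (1 / 4)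
    have g1 := hv1.isLineGoursatKernel hq hq2
    have g2 := hv2.isLineGoursatKernel hq hq2
    rw [ea] at hv1
    rw [eb] at hv2
    refine ⟨⟨_, g1⟩, ⟨_, g2⟩, fun w1 w2 h1 h2 => ?_⟩
    refine ⟨fun k s hk hs hm => ⟨?_, ?_⟩, fun i j => ?_, fun T _ F hF t ht ht' => ?_⟩
    · exact (hv1.hasDerivAt_lattice hq hq2 hk hs hm).differentiableAt.congr_of_eventuallyEq
        (h1.eventuallyEq hq2 g1 hk hs)
    · exact (hv2.hasDerivAt_lattice hq hq2 hk hs hm).differentiableAt.congr_of_eventuallyEq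
        (h2.eventuallyEq hq2 g2 hk hs)
    · exact (hv1.integrableOn_lineResponseMatrix hq hq2 hv2 i j).congr_fun (fun t ht => by
        simp only [PeriodicWave.lineResponseMatrix_congr hq2 h1 g1 h2 g2 ht.2]) measurableSet_Ioo
    · rw [PeriodicWave.response_eq_of_isKernel hq hq2 hn hv1 hv2 hF ht ht',
        PeriodicWave.matConv_congr F ht.1.le fun s hs =>
          PeriodicWave.lineResponseMatrix_congr hq2 h1 g1 h2 g2 (hs.2.trans_lt ht')]
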